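/- **Setting.** Let $\mathcal G$ be the algebra of generalized power series $\varphi=\sum_k c_kx^{\lambda_k}$ with $\lambda_k\in\mathbb C$, $0<\operatorname{Re}\lambda_1\le\operatorname{Re}\lambda_2\le\dots\to+\infty$ (finite sums allowed). For $\nu\in\mathbb C$, "$Ax^\nu+o(x^\nu)$" means a series all of whose terms other than $Ax^\nu$ have exponents with real part $>\operatorname{Re}\nu$ (a constant term, $\nu=0$, is allowed here). Let $F(x,y_0,\dots,y_n)$ be holomorphic near $0\in\mathbb C^{n+2}$ and let $f$ be holomorphic near $0$, $f(x)=ax^{\ell}+o(x^\ell)$, $a\ne0$, $\ell\ge1$. Fix any value of $\ln a$; then $\varphi\in\mathcal G$ can be composed formally with $f$ by $f(x)^\lambda=e^{\lambda\ln a}x^{\ell\lambda}(1+g(x))^\lambda$, where $f=ax^\ell(1+g)$, $g(0)=0$, and $(1+g)^\lambda$ is expanded by the binomial series. Put $\Phi=(\varphi,\varphi\circ f,\dots,\varphi\circ f^{[n]})$, where $f^{[j]}$ is the $j$-th iterate. Suppose that $\varphi\in\mathcal G$ satisfies $F(x,\Phi)=0$ formally. An *admissible semigroup* is an additive semigroup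 $\Gamma=\{\sum m_i\rho_i:\ m\in\mathbb Z_{\ge0}^\tau\setminus\{0\}\}$ with $\rho_1,\dots,\rho_\tau\in\mathbb C$ linearly independent over $\mathbb Z$ and $\operatorname{Re}\rho_i>0$. Write $\varphi\in\mathbb C[[x^\Gamma]]$ if all exponents of $\varphi$ lie in $\Gamma$. "$\varphi$ converges in sectors" means: for every sector with vertex $0$ and opening less than $2\pi$ (and every branch of $\arg x$ on it), the series $\sum c_kx^{\lambda_k}$ converges uniformly (for every order of summation) in the part $|x|<r$ of the sector if $r>0$ is small enough. **(I) Univalent case.** Let $\ell=1$, $q=a=f'(0)$, and if $|q|=1$ assume Siegel's condition: there are $c,\gamma>0$ with $|q^k-1|\ge c\,k^{-\gamma}$ for all $k\ge1$. Assume that $F'_{y_j}(x,\Phi)=A_jx^\nu+o(x^\nu)$ for $j=0,\dots,n$ with one common $\nu$, and that not all $A_j$ vanish. Say that an admissible semigroup $\Gamma$ *carries* $\varphi$ and the equation linearized along it if $1\in\Gamma$, $\varphi\in\mathbb C[[x^\Gamma]]$, all but finitely many exponents of $\varphi$ lie in $\nu+\Gamma$, and all exponents of each $F'_{y_j}(x,\Phi)$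 other than $\nu$ lie in $\nu+\Gamma$ (if $\nu=0$, this just means $1\in\Gamma$ and $\varphi\in\mathbb C[[x^\Gamma]]$). Then: 1. There is an admissible semigroup $\Gamma$ carrying $\varphi$ and the equation linearized along it; in particular $\varphi\in\mathbb C[[x^\Gamma]]$. 2. Let $\Gamma$ be any such semigroup, with generators $\rho_1,\dots,\rho_\tau$. Put $L(z)=A_nz^n+\dots+A_1z+A_0$ and $q^{\rho}=e^{\rho\ln q}$. For a set $R$ of nonzero numbers let $D(R)$ be the condition that, for some $c,\gamma>0$, $$\bigl|(m_1\rho_1+\dots+m_\tau\rho_\tau)\ln q-\ln b-2\pi k\mathrm i\bigr|>c\,(m_1+\dots+m_\tau)^{-\gamma}$$ for all $b\in R$, $m\in\mathbb Z_{\ge0}^\tau\setminus\{0\}$, $k\in\mathbb Z$. Let $R_L$ be the set of roots of $(z-1)L(z)$. Then $\varphi$ converges in sectors if one of the following holds: - $A_0\ne0$, $A_n\ne0$ and $D(R_L)$; - (a) $A_0\ne0$ and all $|q^{\rho_i}|<1$; - (b) $A_n\ne0$ and all $|q^{\rho_i}|>1$; - (c) all $|q^{\rho_i}|=1$, and $D(\{b\in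 R_L:|b|=1\})$; - (d) $A_0\ne0$, all $|q^{\rho_i}|\le1$, and $D(\{b\in R_L:|b|\le1\})$; - (e) $A_n\ne0$, all $|q^{\rho_i}|\ge1$, and $D(\{b\in R_L:|b|\ge1\})$. **(II) $\ell$-valent case.** Let $\ell\ge2$ and assume $F'_{y_0}(x,\Phi)=A_0x^\nu+o(x^\nu)$ with $A_0\ne0$. Then $\varphi\in\mathbb C[[x^\Gamma]]$ for some admissible semigroup $\Gamma$, and $\varphi$ converges in sectors. -/

import Mathlib

open Filter Topology

noncomputable section

namespace GenPower

/-- Complex exponents, ordered by their real parts (`z < w` iff `Re z < Re w`; distinct exponents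
with equal real parts are incomparable). -/
def ReExp : Type := ℂ

namespace ReExp

instance : AddCommGroup ReExp := inferInstanceAs (AddCommGroup ℂ)

/-- A complex number seen as an exponent. -/
def of (z : ℂ) : ReExp := z

/-- The complex number underlying an exponent. -/
def val (z : ReExp) : ℂ := z

instance : PartialOrder ReExp where
  le z w := z = w ∨ z.val.re < w.val.re
  le_refl _ := Or.inl rfl
  le_trans a b c h₁ h₂ := by
    rcases h₁ with rfl | h₁
    · exact h₂
    · rcases h₂ with rfl | h₂
      · exact Or.inr h₁
      · exact Or.inr (h₁.trans h₂)
  le_antisymm a b h₁ h₂ := by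
    rcases h₁ with h₁ | h₁
    · exact h₁
    · rcases h₂ with h₂ | h₂
      · exact h₂.symm
      · exact absurd (h₁.trans h₂) (lt_irrefl _)

theorem le_def (z w : ReExp) : z ≤ w ↔ (z = w ∨ z.val.re < w.val.re) := Iff.rfl

theorem val_add (z w : ReExp) : (z + w).val = z.val + w.val := rfl

instance : IsOrderedCancelAddMonoid ReExp where
  add_le_add_left a b h c := by
    rcases h with rfl | h
    · exact Or.inl rfl
    · refine Or.inr ?_
      simp only [val_add, Complex.add_re]
      linarith
  le_of_add_le_add_left a b c h := by
    rcases h with h | h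
    · exact Or.inl (add_left_cancel h)
    · refine Or.inr ?_
      simp only [val_add, Complex.add_re] at h
      linarith

end ReExp

/-- Generalized power series `∑ c_k x ^ λ_k` with `0 < Re λ_1 ≤ Re λ_2 ≤ … → ∞`, encoded by the
coefficient function `λ ↦ c_λ`. -/
@[ext]
structure GenSeries where
  coeff : ℂ → ℂ
  re_pos : ∀ l, coeff l ≠ 0 → 0 < l.re
  finite_le : ∀ N : ℝ, {l | coeff l ≠ 0 ∧ l.re ≤ N}.Finite

theorem GenSeries.isPWO (φ : GenSeries) :
    (Function.support fun z : ReExp => φ.coeff z.val).IsPWO := by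
  intro u
  by_contra hcon
  push Not at hcon
  have hle : ∀ a b : ℕ, a < b → ¬ ((u a : ReExp) ≤ (u b : ReExp)) := fun a b hab => hcon a b hab
  have hmem : ∀ n, (u n : ReExp).val ∈ {l | φ.coeff l ≠ 0 ∧ l.re ≤ (u 0 : ReExp).val.re} := by
    intro n
    refine ⟨(u n).2, ?_⟩
    rcases Nat.eq_zero_or_pos n with rfl | hn
    · exact le_rfl
    · by_contra hlt
      exact hle 0 n hn (Or.inr (not_le.mp hlt))
  obtain ⟨a, -, b, -, hab, he'⟩ := Set.infinite_univ.exists_ne_map_eq_of_mapsTo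
    (f := fun n : ℕ => (u n : ReExp).val) (fun n _ => hmem n)
    (φ.finite_le (u 0 : ReExp).val.re)
  rcases lt_or_gt_of_ne hab with h | h
  · exact hle a b h (Or.inl he')
  · exact hle b a h (Or.inl he'.symm)

/-- A generalized power series as an element of the ring of Hahn series with complex exponents
ordered by real part (the product is the usual product of generalized power series). -/
def GenSeries.toHahn (φ : GenSeries) : HahnSeries ReExp ℂ where
  coeff z := φ.coeff z.val
  isPWO_support' := φ.isPWO

/-- The coefficient of `x ^ i` in `(1 + g) ^ l = ∑ j, binom l j * g ^ j`, for a power series `g`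
without constant term and `l : ℂ`. -/
def onePowCoeff (g : PowerSeries ℂ) (l : ℂ) (i : ℕ) : ℂ :=
  ∑ j ∈ Finset.range (i + 1), Ring.choose l j * PowerSeries.coeff i (g ^ j)

/-- For `f = a x ^ d + …` with `a ≠ 0`, the series `g` without constant term such that
`f = a x ^ d (1 + g)`. -/
def unitTail (f : PowerSeries ℂ) (d : ℕ) : PowerSeries ℂ :=
  PowerSeries.mk fun i =>
    if i = 0 then 0 else PowerSeries.coeff (d + i) f / PowerSeries.coeff d f

/-- The coefficient of `x ^ μ` in
`φ (f x) = ∑ c_l a ^ l x ^ (d l) (1 + g x) ^ l`, where `f = a x ^ d (1 + g)` and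
`a ^ l = exp (l * la)`, `la` being a fixed value of `log a`. -/
def compCoeff (f : PowerSeries ℂ) (d : ℕ) (la : ℂ) (φ : GenSeries) (μ : ℂ) : ℂ :=
  ∑ᶠ i : ℕ, φ.coeff ((μ - i) / d) * Complex.exp ((μ - i) / d * la) *
    onePowCoeff (unitTail f d) ((μ - i) / d) i

theorem exists_of_compCoeff_ne_zero {f : PowerSeries ℂ} {d : ℕ} {la : ℂ} {φ : GenSeries} {μ : ℂ}
    (h : compCoeff f d la φ μ ≠ 0) :
    1 ≤ d ∧ ∃ (i : ℕ) (l : ℂ), φ.coeff l ≠ 0 ∧ μ = d * l + i := by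
  obtain ⟨i, hi⟩ : ∃ i : ℕ, φ.coeff ((μ - i) / d) * Complex.exp ((μ - i) / d * la) *
      onePowCoeff (unitTail f d) ((μ - i) / d) i ≠ 0 := by
    by_contra hcon
    push Not at hcon
    exact h (finsum_eq_zero_of_forall_eq_zero hcon)
  have hc : φ.coeff ((μ - i) / d) ≠ 0 := left_ne_zero_of_mul (left_ne_zero_of_mul hi)
  have hd : d ≠ 0 := by
    rintro rfl
    have := φ.re_pos _ hc
    simp at this
  have hd' : (d : ℂ) ≠ 0 := Nat.cast_ne_zero.mpr hd
  refine ⟨Nat.one_le_iff_ne_zero.mpr hd, i, _, hc, ?_⟩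
  field_simp
  ring

/-- The formal composition `φ ∘ f` of a generalized power series with `f = a x ^ d + …`, for a
fixed value `la` of `log a`. -/
def GenSeries.comp (f : PowerSeries ℂ) (d : ℕ) (la : ℂ) (φ : GenSeries) : GenSeries where
  coeff := compCoeff f d la φ
  re_pos μ hμ := by
    obtain ⟨hd, i, l, hl, rfl⟩ := exists_of_compCoeff_ne_zero hμ
    have h1 := φ.re_pos l hl
    have h2 : (1 : ℝ) ≤ d := by exact_mod_cast hd
    have h3 : (0 : ℝ) ≤ i := Nat.cast_nonneg i
    simp only [Complex.add_re, Complex.mul_re, Complex.natCast_re, Complex.natCast_im]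
    nlinarith
  finite_le N := by
    refine Set.Finite.subset (((φ.finite_le N).prod (Set.finite_Iic ⌊N⌋₊)).image
      fun p : ℂ × ℕ => (d : ℂ) * p.1 + p.2) ?_
    rintro μ ⟨hμ, hN⟩
    obtain ⟨hd, i, l, hl, rfl⟩ := exists_of_compCoeff_ne_zero hμ
    have h1 := φ.re_pos l hl
    have h2 : (1 : ℝ) ≤ d := by exact_mod_cast hd
    have h3 : (0 : ℝ) ≤ i := Nat.cast_nonneg i
    simp only [Complex.add_re, Complex.mul_re, Complex.natCast_re, Complex.natCast_im] at hN
    refine ⟨(l, i), ⟨⟨hl, ?_⟩, ?_⟩, rfl⟩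
    · nlinarith
    · exact Nat.le_floor (by nlinarith)

/-- The tuple `(x, φ(x), φ(f(x)), …, φ(f^[n](x)))` of series substituted for the variables
`(x, y_0, …, y_n)`; `φ(f^[j](x))` is the `j`-fold composition with `f`. -/
def args (n : ℕ) (f : PowerSeries ℂ) (d : ℕ) (la : ℂ) (φ : GenSeries) :
    Fin (n + 2) → HahnSeries ReExp ℂ :=
  Fin.cons (HahnSeries.single (ReExp.of 1) 1)
    fun j : Fin (n + 1) => ((GenSeries.comp f d la)^[(j : ℕ)] φ).toHahn

/-- The coefficient of `x ^ μ` in the result `∑ m, G_m v ^ m` of substituting the series `v i`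
(with exponents of positive real part) for the variables of a power series `G`. Only finitely many
multi-indices `m` contribute. -/
def substCoeff {N : ℕ} (G : MvPowerSeries (Fin N) ℂ) (v : Fin N → HahnSeries ReExp ℂ) (μ : ℂ) : ℂ :=
  ∑ᶠ m : Fin N →₀ ℕ, MvPowerSeries.coeff m G * (∏ i, v i ^ m i).coeff (ReExp.of μ)

/-- `φ` formally satisfies `F(x, y(x), y(f(x)), …, y(f^[n](x))) = 0`. -/
def IsFormalSolution (n : ℕ) (F : MvPowerSeries (Fin (n + 2)) ℂ) (f : PowerSeries ℂ) (d : ℕ)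
    (la : ℂ) (φ : GenSeries) : Prop :=
  ∀ μ, substCoeff F (args n f d la φ) μ = 0

/-- The coefficient function of `F'_{y_j}(x, φ(x), φ(f(x)), …, φ(f^[n](x)))`. -/
def partialAlong (n : ℕ) (F : MvPowerSeries (Fin (n + 2)) ℂ) (f : PowerSeries ℂ) (d : ℕ)
    (la : ℂ) (φ : GenSeries) (j : Fin (n + 1)) : ℂ → ℂ :=
  substCoeff (MvPowerSeries.pderiv ℂ j.succ F) (args n f d la φ)

/-- The series with coefficient function `s` is `A x ^ ν + o(x ^ ν)`: all its terms other than
`A x ^ ν` have exponents with real part greater than `Re ν`. -/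
def HasLeadingTerm (s : ℂ → ℂ) (A ν : ℂ) : Prop :=
  s ν = A ∧ ∀ μ, μ ≠ ν → s μ ≠ 0 → ν.re < μ.re

/-- `F` is holomorphic near `0`, with Taylor series `Fs` at `0`. -/
def HasTaylorSeries {N : ℕ} (F : (Fin N → ℂ) → ℂ) (Fs : MvPowerSeries (Fin N) ℂ) : Prop :=
  ∀ᶠ z in 𝓝 (0 : Fin N → ℂ),
    HasSum (fun m : Fin N →₀ ℕ => MvPowerSeries.coeff m Fs * ∏ i, z i ^ m i) (F z)

/-- `f` is holomorphic near `0`, with Taylor series `fs` at `0`. -/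
def HasTaylorSeries₁ (f : ℂ → ℂ) (fs : PowerSeries ℂ) : Prop :=
  ∀ᶠ z in 𝓝 (0 : ℂ), HasSum (fun k : ℕ => PowerSeries.coeff k fs * z ^ k) (f z)

/-- Siegel's condition on a multiplier `q`. -/
def SiegelCondition (q : ℂ) : Prop :=
  ∃ c > (0 : ℝ), ∃ γ > (0 : ℝ), ∀ k : ℕ, 1 ≤ k → c * (k : ℝ) ^ (-γ) ≤ ‖q ^ k - 1‖

/-- The additive semigroup generated by `ρ_1, …, ρ_τ`. -/
def semigroup {τ : ℕ} (ρ : Fin τ → ℂ) : AddSubsemigroup ℂ :=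
  AddSubsemigroup.closure (Set.range ρ)

/-- The numbers `ρ_i` are linearly independent over `ℤ` and have positive real parts. -/
def AdmissibleGenerators {τ : ℕ} (ρ : Fin τ → ℂ) : Prop :=
  LinearIndependent ℤ ρ ∧ ∀ i, 0 < (ρ i).re

/-- All exponents of `φ` lie in the semigroup `Γ`, i.e. `φ ∈ ℂ[[x ^ Γ]]`. -/
def GenSeries.ExponentsIn (φ : GenSeries) (Γ : AddSubsemigroup ℂ) : Prop :=
  ∀ l, φ.coeff l ≠ 0 → l ∈ Γ

/-- The semigroup `Γ` carries `φ` together with the equation linearized along `φ`, whose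
coefficients have coefficient functions `s j` and common leading exponent `ν`: it contains `1` and
the exponents of `φ`, all but finitely many of these exponents lie in `ν + Γ`, and each coefficient
of the linearized equation is of the form `A_j x ^ ν + x ^ ν (series with exponents in Γ)`. -/
def Carries (Γ : AddSubsemigroup ℂ) (φ : GenSeries) {n : ℕ} (s : Fin (n + 1) → ℂ → ℂ) (ν : ℂ) :
    Prop :=
  1 ∈ Γ ∧ φ.ExponentsIn Γ ∧ {l | φ.coeff l ≠ 0 ∧ l - ν ∉ Γ}.Finite ∧
    ∀ j μ, μ ≠ ν → s j μ ≠ 0 → μ - ν ∈ Γ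

/-- The polynomial `L(z) = A_n z ^ n + … + A_1 z + A_0`. -/
def charPoly {n : ℕ} (A : Fin (n + 1) → ℂ) : Polynomial ℂ :=
  ∑ j : Fin (n + 1), Polynomial.C (A j) * Polynomial.X ^ (j : ℕ)

/-- The roots of `(z - 1) L(z)`. -/
def resonantRoots {n : ℕ} (A : Fin (n + 1) → ℂ) : Set ℂ :=
  {a | ((Polynomial.X - 1) * charPoly A).IsRoot a}

/-- The Diophantine condition on `ρ_1, …, ρ_τ` (with a fixed value `lq` of `log q`) at each
`a ∈ R`. As `k` runs over all integers, the choice of the value of `log a` is immaterial. -/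
def Diophantine {τ : ℕ} (lq : ℂ) (ρ : Fin τ → ℂ) (R : Set ℂ) : Prop :=
  ∃ c > (0 : ℝ), ∃ γ > (0 : ℝ), ∀ a ∈ R, ∀ m : Fin τ → ℕ, m ≠ 0 → ∀ k : ℤ,
    c * (∑ i, (m i : ℝ)) ^ (-γ) <
      ‖(∑ i, (m i : ℂ) * ρ i) * lq - Complex.log a - 2 * Real.pi * k * Complex.I‖

/-- `|q ^ ρ_i|`, for a fixed value `lq` of `log q`. -/
def modPow (lq r : ℂ) : ℝ := ‖Complex.exp (r * lq)‖

/-- The sufficient conditions for convergence in the univalent case: the general condition, and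
its five variants for special positions of the numbers `q ^ ρ_i` relative to the unit circle. -/
def ConvergenceCondition {n τ : ℕ} (lq : ℂ) (A : Fin (n + 1) → ℂ) (ρ : Fin τ → ℂ) : Prop :=
  (A (Fin.last n) ≠ 0 ∧ A 0 ≠ 0 ∧ Diophantine lq ρ (resonantRoots A)) ∨
  (A 0 ≠ 0 ∧ ∀ i, modPow lq (ρ i) < 1) ∨
  (A (Fin.last n) ≠ 0 ∧ ∀ i, 1 < modPow lq (ρ i)) ∨
  ((∀ i, modPow lq (ρ i) = 1) ∧ Diophantine lq ρ {a ∈ resonantRoots A | ‖a‖ = 1}) ∨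
  (A 0 ≠ 0 ∧ (∀ i, modPow lq (ρ i) ≤ 1) ∧ Diophantine lq ρ {a ∈ resonantRoots A | ‖a‖ ≤ 1}) ∨
  (A (Fin.last n) ≠ 0 ∧ (∀ i, 1 ≤ modPow lq (ρ i)) ∧
    Diophantine lq ρ {a ∈ resonantRoots A | 1 ≤ ‖a‖})

/-- The open sector with vertex `0`, radius `r`, bisecting direction `θ` and opening `2 η`. -/
def sector (θ η r : ℝ) : Set ℂ :=
  {x | x ≠ 0 ∧ ‖x‖ < r ∧ |Complex.arg (x * Complex.exp (-(θ * Complex.I)))| < η}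

/-- The branch of `x ^ l` with `arg x ∈ (θ - π, θ + π]`. -/
def branchPow (θ : ℝ) (x l : ℂ) : ℂ :=
  Complex.exp (l * (Complex.log (x * Complex.exp (-(θ * Complex.I))) + θ * Complex.I))

/-- The series `φ` converges uniformly in every sector with vertex `0`, of opening less than `2π`
and sufficiently small radius (for every order of summation of its terms). -/
def ConvergesInSectors (φ : GenSeries) : Prop :=
  ∀ θ η : ℝ, 0 < η → η < Real.pi → ∃ r > (0 : ℝ), ∃ g : ℂ → ℂ,
    TendstoUniformlyOn (fun (s : Finset ℂ) (x : ℂ) => ∑ l ∈ s, φ.coeff l * branchPow θ x l)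
      g atTop (sector θ η r)

end GenPower

end

open scoped ENNReal

noncomputable section

namespace GenPower

/-! Convergence is reduced to finiteness of a weighted ℓ¹ norm ∑ |c_λ| r^{Re λ} for some r > 0. On a
finitely generated semigroup |λ| ≤ κ Re λ, so that arg x only rescales r and the norm dominates the
series on every sector (`convergesInSectors_of_nm`).

Write φ = φ₀ + χ, where φ₀ is a finite sum and χ has high order, and expand F to first order about
the tuple of φ₀. The coefficient of x^{λ+ν} then expresses L(q^λ) c_λ (for ℓ ≥ 2: A₀ c_λ) through F
along φ₀, linear terms of higher order and a quadratic remainder. Let S(r) be the weighted sum over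
the coefficients of χ with Re λ ≤ M. The norm estimates (`dampedSum_le`) bound S(r) by a constant
that is small with r, a small multiple of S(r), and a multiple of S(r)². As S is continuous in r and
S(0) = 0, it cannot cross a fixed small value b, so S < b on an interval that does not depend on M.
Letting M grow gives convergence (`summable_of_equation`).

Division by L(q^λ) brings in small divisors. Each root b of L contributes q^λ - b. If two exponents
differing by an element μ of Γ both have q^λ close to b, then q^μ is close to 1, and the Diophantine
condition at the root 1 of (z - 1) L(z) makes Re μ large. This separation limits how often small
divisors accumulate, by a counting argument in the manner of Siegel and Bryuno (`badCount_pair`).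
The result is a damping factor g(κ) ≥ exp(-k Re κ) that absorbs all divisors when put into the
weights (`exists_isDamping`); it costs only a smaller radius.

A univalent f is first conjugated to x ↦ q x. The conjugation h solves f(h(x)) = h(q x), which is an
equation of the same kind with n = 1, so the same convergence result yields h and then its inverse
(`exists_linearization`). Substituting h for x turns the equation into one with a linear
substitution, with the same leading coefficients A_j. For ℓ ≥ 2, composition with f replaces the
radius r by about r², so the terms with j ≥ 1 are a perturbation of A₀ y₀ and no divisors occur
(`exists_nm_lt_top_of_order`).

For the semigroup, adjoin finitely many exponents to 1 and the low exponents of φ, and consider an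
exponent λ of least real part that is not accounted for. Its equation reads L(q^λ) = 0 if ℓ = 1, and
is contradictory if ℓ ≥ 2. The λ with q^λ = b form a finite set or lie in an arithmetic progression,
hence finitely many more generators suffice (`exists_semigroup_of_equation`). Any finite set of
exponents with positive real parts lies in a semigroup with independent generators
(`exists_admissibleGenerators`). -/

/-- Hahn series with complex exponents, ordered by real part. -/
abbrev HS : Type := HahnSeries ReExp ℂ

/-- The coefficient of `x ^ μ`. -/
def cf (H : HS) (μ : ℂ) : ℂ := H.coeff (ReExp.of μ)

/-! ### Coefficients, products and weighted ℓ¹ norms. -/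

theorem cf_ext {H K : HS} (h : ∀ μ, cf H μ = cf K μ) : H = K :=
  HahnSeries.ext (funext h)

@[simp] theorem cf_zero (μ : ℂ) : cf 0 μ = 0 := rfl

@[simp] theorem cf_add (H K : HS) (μ : ℂ) : cf (H + K) μ = cf H μ + cf K μ := rfl

@[simp] theorem cf_sub (H K : HS) (μ : ℂ) : cf (H - K) μ = cf H μ - cf K μ := rfl

@[simp] theorem cf_neg (H : HS) (μ : ℂ) : cf (-H) μ = - cf H μ := rfl

theorem cf_sum {ι : Type*} (s : Finset ι) (H : ι → HS) (μ : ℂ) :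
    cf (∑ i ∈ s, H i) μ = ∑ i ∈ s, cf (H i) μ := by
  classical
  induction s using Finset.induction_on with
  | empty => simp
  | insert a s ha ih => rw [Finset.sum_insert ha, Finset.sum_insert ha, cf_add, ih]

theorem cf_single (a c μ : ℂ) :
    cf (HahnSeries.single (ReExp.of a) c) μ = if μ = a then c else 0 := by
  classical
  exact HahnSeries.coeff_single

theorem cf_single_mul (a c : ℂ) (H : HS) (μ : ℂ) :
    cf (HahnSeries.single (ReExp.of a) c * H) μ = c * cf H (μ - a) :=
  HahnSeries.coeff_single_mul

theorem cf_C_mul (c : ℂ) (H : HS) (μ : ℂ) : cf (HahnSeries.C c * H) μ = c * cf H μ :=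
  HahnSeries.coeff_single_zero_mul

theorem cf_C (c μ : ℂ) : cf (HahnSeries.C c) μ = if μ = 0 then c else 0 :=
  cf_single 0 c μ

theorem cf_one (μ : ℂ) : cf 1 μ = if μ = 0 then 1 else 0 :=
  cf_single 0 1 μ

theorem cf_mul (H K : HS) (μ : ℂ) :
    cf (H * K) μ = ∑ ij ∈ Finset.antidiagonal H.isPWO_support K.isPWO_support (ReExp.of μ),
      cf H ij.1.val * cf K ij.2.val :=
  HahnSeries.coeff_mul

theorem exists_of_cf_mul_ne_zero {H K : HS} {μ : ℂ} (h : cf (H * K) μ ≠ 0) :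
    ∃ a b, a + b = μ ∧ cf H a ≠ 0 ∧ cf K b ≠ 0 := by
  rw [cf_mul] at h
  obtain ⟨ij, hij, hne⟩ := Finset.exists_ne_zero_of_sum_ne_zero h
  rw [Finset.mem_antidiagonal] at hij
  exact ⟨ij.1.val, ij.2.val, hij.2.2, left_ne_zero_of_mul hne, right_ne_zero_of_mul hne⟩

/-- A pair of exponents with sum μ is determined by its first member, so the finite convolution sum
is part of a sum over all of ℂ. Values in `ℝ≥0∞` remove every summability question. -/
theorem enorm_cf_mul_le (H K : HS) (μ : ℂ) :
    ‖cf (H * K) μ‖ₑ ≤ ∑' a, ‖cf H a‖ₑ * ‖cf K (μ - a)‖ₑ := by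
  classical
  rw [cf_mul]
  set s := Finset.antidiagonal H.isPWO_support K.isPWO_support (ReExp.of μ) with hs
  have hsum : ∀ ij ∈ s, ij.1.val + ij.2.val = μ := fun ij hij => by
    rw [hs, Finset.mem_antidiagonal] at hij
    exact hij.2.2
  have hinj : Set.InjOn (fun ij : ReExp × ReExp => ij.1.val) s := by
    intro x hx y hy hxy
    have h1 := hsum x hx
    have h2 := hsum y hy
    have h3 : x.1.val = y.1.val := hxy
    have h4 : x.2.val = y.2.val := by
      rw [h3] at h1
      exact add_left_cancel (h1.trans h2.symm)
    exact Prod.ext h3 h4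
  calc ‖∑ ij ∈ s, cf H ij.1.val * cf K ij.2.val‖ₑ
      ≤ ∑ ij ∈ s, ‖cf H ij.1.val * cf K ij.2.val‖ₑ := enorm_sum_le _ _
    _ = ∑ ij ∈ s, ‖cf H ij.1.val‖ₑ * ‖cf K (μ - ij.1.val)‖ₑ := by
        refine Finset.sum_congr rfl fun ij hij => ?_
        rw [enorm_mul, ← hsum ij hij, add_sub_cancel_left]
    _ = ∑ a ∈ s.image (fun ij : ReExp × ReExp => ij.1.val), ‖cf H a‖ₑ * ‖cf K (μ - a)‖ₑ := by
        rw [Finset.sum_image hinj]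
    _ ≤ _ := ENNReal.sum_le_tsum _

/-- The weighted sum `∑ |c_μ| W μ` of the moduli of the coefficients. -/
def nm (W : ℂ → ℝ≥0∞) (H : HS) : ℝ≥0∞ := ∑' μ, ‖cf H μ‖ₑ * W μ

theorem nm_zero (W : ℂ → ℝ≥0∞) : nm W 0 = 0 := by simp [nm]

theorem nm_add_le (W : ℂ → ℝ≥0∞) (H K : HS) : nm W (H + K) ≤ nm W H + nm W K := by
  unfold nm
  rw [← ENNReal.tsum_add]
  refine ENNReal.tsum_le_tsum fun μ => ?_
  rw [← add_mul, cf_add]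
  gcongr
  exact enorm_add_le _ _

theorem nm_C (W : ℂ → ℝ≥0∞) (c : ℂ) : nm W (HahnSeries.C c) = ‖c‖ₑ * W 0 := by
  unfold nm
  rw [tsum_eq_single 0]
  · rw [cf_C, if_pos rfl]
  · intro b hb
    rw [cf_C, if_neg hb, enorm_zero, zero_mul]

/-- Young's inequality. Three weights are allowed because terms of order 0, 1 and 2 in the unknown
are weighted differently, and the weights need to be compared only on exponents that occur. -/
theorem nm_mul_le {W₁ W₂ W₃ : ℂ → ℝ≥0∞} {H K : HS}
    (h : ∀ a b, cf H a ≠ 0 → cf K b ≠ 0 → W₃ (a + b) ≤ W₁ a * W₂ b) :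
    nm W₃ (H * K) ≤ nm W₁ H * nm W₂ K := by
  unfold nm
  calc ∑' μ, ‖cf (H * K) μ‖ₑ * W₃ μ
      ≤ ∑' μ, ∑' a, ‖cf H a‖ₑ * ‖cf K (μ - a)‖ₑ * W₃ μ := by
        refine ENNReal.tsum_le_tsum fun μ => ?_
        rw [ENNReal.tsum_mul_right]
        gcongr
        exact enorm_cf_mul_le H K μ
    _ = ∑' a, ∑' μ, ‖cf H a‖ₑ * ‖cf K (μ - a)‖ₑ * W₃ μ := ENNReal.tsum_comm
    _ = ∑' a, ∑' b, ‖cf H a‖ₑ * ‖cf K b‖ₑ * W₃ (a + b) := by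
        refine tsum_congr fun a => ?_
        rw [← (Equiv.addLeft a).tsum_eq]
        simp
    _ ≤ ∑' a, ∑' b, (‖cf H a‖ₑ * W₁ a) * (‖cf K b‖ₑ * W₂ b) := by
        refine ENNReal.tsum_le_tsum fun a => ENNReal.tsum_le_tsum fun b => ?_
        by_cases ha : cf H a = 0
        · simp [ha]
        by_cases hb : cf K b = 0
        · simp [hb]
        calc ‖cf H a‖ₑ * ‖cf K b‖ₑ * W₃ (a + b)
            ≤ ‖cf H a‖ₑ * ‖cf K b‖ₑ * (W₁ a * W₂ b) := by
              gcongr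
              exact h a b ha hb
          _ = _ := by ring
    _ = _ := by
        simp_rw [ENNReal.tsum_mul_left, ENNReal.tsum_mul_right]

/-- Pairs of a series with exponents in `S` and a bound for its weighted norm. -/
def normClass (S : Set ℂ) (W : ℂ → ℝ≥0∞) : AddSubmonoid (HS × ℝ) where
  carrier := {p | (∀ μ, cf p.1 μ ≠ 0 → μ ∈ S) ∧ 0 ≤ p.2 ∧ nm W p.1 ≤ ENNReal.ofReal p.2}
  zero_mem' := ⟨fun μ h => absurd rfl h, le_rfl, by simp [nm_zero]⟩
  add_mem' := by
    rintro p q ⟨h1, h2, h3⟩ ⟨k1, k2, k3⟩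
    refine ⟨fun μ h => ?_, add_nonneg h2 k2, ?_⟩
    · by_contra hS
      have e1 : cf p.1 μ = 0 := by_contra fun h' => hS (h1 μ h')
      have e2 : cf q.1 μ = 0 := by_contra fun h' => hS (k1 μ h')
      exact h (by simp [e1, e2])
    · refine (nm_add_le W p.1 q.1).trans ?_
      rw [Prod.snd_add, ENNReal.ofReal_add h2 k2]
      exact add_le_add h3 k3

theorem mul_mem_normClass {S₁ S₂ S₃ : Set ℂ} {W₁ W₂ W₃ : ℂ → ℝ≥0∞}
    (h : ∀ a ∈ S₁, ∀ b ∈ S₂, a + b ∈ S₃ ∧ W₃ (a + b) ≤ W₁ a * W₂ b) {p q : HS × ℝ}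
    (hp : p ∈ normClass S₁ W₁) (hq : q ∈ normClass S₂ W₂) : p * q ∈ normClass S₃ W₃ := by
  obtain ⟨h1, h2, h3⟩ := hp
  obtain ⟨k1, k2, k3⟩ := hq
  refine ⟨fun μ hμ => ?_, mul_nonneg h2 k2, ?_⟩
  · obtain ⟨a, b, rfl, ha, hb⟩ := exists_of_cf_mul_ne_zero hμ
    exact (h a (h1 a ha) b (k1 b hb)).1
  · refine (nm_mul_le fun a b ha hb => (h a (h1 a ha) b (k1 b hb)).2).trans ?_
    rw [Prod.snd_mul, ENNReal.ofReal_mul h2]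
    exact mul_le_mul' h3 k3

theorem mem_normClass_mono {S S' : Set ℂ} {W W' : ℂ → ℝ≥0∞} {H : HS} {y : ℝ}
    (hS : ∀ a ∈ S, a ∈ S' ∧ W' a ≤ W a) (h : (H, y) ∈ normClass S W) :
    (H, y) ∈ normClass S' W' := by
  obtain ⟨h1, h2, h3⟩ := h
  refine ⟨fun μ hμ => (hS μ (h1 μ hμ)).1, h2, le_trans (ENNReal.tsum_le_tsum fun μ => ?_) h3⟩
  by_cases h0 : cf H μ = 0
  · simp [h0]
  · gcongr
    exact (hS μ (h1 μ h0)).2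

/-! ### First-order Taylor expansion of polynomials, with supports and norms. -/

section Remainder

variable {σ : Type*}

@[elab_as_elim]
-- The coefficients range over an additive submonoid only, because neither nonnegative reals nor
-- bounded pairs form a subring.
theorem mvPolynomial_induction_coeff {B : Type*} [CommSemiring B] {T : AddSubmonoid B}
    {P : MvPolynomial σ B → Prop} (h0 : P 0) (hadd : ∀ p q, P p → P q → P (p + q))
    (hC : ∀ c ∈ T, P (MvPolynomial.C c)) (hX : ∀ p i, P p → P (p * MvPolynomial.X i))
    (p : MvPolynomial σ B) (hp : ∀ m, p.coeff m ∈ T) : P p := by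
  classical
  have hpow : ∀ (p : MvPolynomial σ B) i (k : ℕ), P p → P (p * MvPolynomial.X i ^ k) := by
    intro p i k h
    induction k with
    | zero => simpa using h
    | succ k ih =>
      rw [pow_succ, ← mul_assoc]
      exact hX _ _ ih
  have hmon : ∀ (m : σ →₀ ℕ) (c : B), c ∈ T → P (MvPolynomial.monomial m c) := by
    intro m
    induction m using Finsupp.induction₂ with
    | zero => exact fun c hc => hC c hc
    | add_single a b f _ _ ih =>
      intro c hc
      rw [MvPolynomial.monomial_add_single]
      exact hpow _ _ _ (ih c hc)
  rw [p.as_sum]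
  exact Finset.sum_induction _ P hadd h0 fun m _ => hmon m _ (hp m)

theorem map_mvPolynomial_eval {A B : Type*} [CommSemiring A] [CommSemiring B] (φ : A →+* B)
    (x : σ → A) (p : MvPolynomial σ A) :
    φ (MvPolynomial.eval x p) = MvPolynomial.eval (fun i => φ (x i)) (MvPolynomial.map φ p) := by
  induction p using MvPolynomial.induction_on with
  | C a => simp
  | add p q hp hq => simp [hp, hq]
  | mul_X p i hp => simp [hp]

/-- The polynomial whose coefficients are the moduli of those of `p`. -/
def absPoly (p : MvPolynomial σ ℂ) : MvPolynomial σ ℝ :=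
  ∑ m ∈ p.support, MvPolynomial.monomial m ‖p.coeff m‖

theorem coeff_absPoly (p : MvPolynomial σ ℂ) (m : σ →₀ ℕ) :
    (absPoly p).coeff m = ‖p.coeff m‖ := by
  classical
  simp only [absPoly, MvPolynomial.coeff_sum, MvPolynomial.coeff_monomial]
  simp only [Finset.sum_ite_eq', MvPolynomial.mem_support_iff, ite_eq_left_iff, not_not]
  intro h
  rw [h, norm_zero]

variable [Fintype σ]

/-- `T₀`, `T₁`, `T₂` are the classes of order 0, 1 and 2 in `w`. Multiplying p by X_i changes its
remainder Q into v_i Q + w_i Q + L w_i, where L is the linear part, and the closure rules keep this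
in `T₂`. -/
theorem remainder_mem {B : Type*} [CommRing B] {T₀ T₁ T₂ : AddSubmonoid B}
    (h00 : ∀ a ∈ T₀, ∀ b ∈ T₀, a * b ∈ T₀) (h01 : ∀ a ∈ T₀, ∀ b ∈ T₁, a * b ∈ T₁)
    (h02 : ∀ a ∈ T₀, ∀ b ∈ T₂, a * b ∈ T₂) (h11 : ∀ a ∈ T₁, ∀ b ∈ T₁, a * b ∈ T₂)
    (h12 : ∀ a ∈ T₁, ∀ b ∈ T₂, a * b ∈ T₂) {v w : σ → B} (hv : ∀ i, v i ∈ T₀)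
    (hw : ∀ i, w i ∈ T₁) (p : MvPolynomial σ B) (hp : ∀ m, p.coeff m ∈ T₀) :
    MvPolynomial.eval v p ∈ T₀ ∧
      ∑ j, MvPolynomial.eval v (MvPolynomial.pderiv j p) * w j ∈ T₁ ∧
      MvPolynomial.eval (v + w) p - MvPolynomial.eval v p -
        ∑ j, MvPolynomial.eval v (MvPolynomial.pderiv j p) * w j ∈ T₂ := by
  classical
  refine mvPolynomial_induction_coeff (T := T₀) ?_ ?_ ?_ ?_ p hp
  · simp [zero_mem]
  · rintro p q ⟨a1, a2, a3⟩ ⟨b1, b2, b3⟩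
    simp only [map_add, add_mul, Finset.sum_add_distrib]
    refine ⟨add_mem a1 b1, add_mem a2 b2, ?_⟩
    convert add_mem a3 b3 using 1
    ring
  · intro c hc
    simp [zero_mem, hc]
  · rintro p i ⟨a1, a2, a3⟩
    have hL : ∑ j, MvPolynomial.eval v (MvPolynomial.pderiv j (p * MvPolynomial.X i)) * w j =
        v i * (∑ j, MvPolynomial.eval v (MvPolynomial.pderiv j p) * w j) +
          MvPolynomial.eval v p * w i := by
      have : ∀ j, MvPolynomial.eval v (MvPolynomial.pderiv j (p * MvPolynomial.X i)) * w j =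
          v i * (MvPolynomial.eval v (MvPolynomial.pderiv j p) * w j) +
          (if i = j then MvPolynomial.eval v p * w j else 0) := by
        intro j
        rw [Derivation.leibniz, MvPolynomial.pderiv_X]
        by_cases hij : i = j
        · subst hij
          simp
          ring
        · simp [hij]
          ring
      simp_rw [this, Finset.sum_add_distrib, ← Finset.mul_sum]
      simp
    rw [hL]
    set L := ∑ j, MvPolynomial.eval v (MvPolynomial.pderiv j p) * w j
    set V := MvPolynomial.eval v p
    simp only [map_mul, MvPolynomial.eval_X, Pi.add_apply]
    refine ⟨h00 _ a1 _ (hv i), add_mem (h01 _ (hv i) _ a2) (h01 _ a1 _ (hw i)), ?_⟩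
    have : MvPolynomial.eval (v + w) p * (v i + w i) - V * v i - (v i * L + V * w i) =
        v i * (MvPolynomial.eval (v + w) p - V - L) +
          w i * (MvPolynomial.eval (v + w) p - V - L) + L * w i := by ring
    rw [this]
    exact add_mem (add_mem (h02 _ (hv i) _ a3) (h12 _ (hw i) _ a3)) (h11 _ a2 _ (hw i))

/-- With nonnegative coefficients every monomial of degree at least two in the increment gains (s /
s₀)² on passing from s₀ to s. The induction on p also has to carry the bounds of orders zero and
one. -/
theorem remainder_le {a : σ → ℝ} (ha : ∀ i, 0 ≤ a i) {s s₀ : ℝ} (hs : 0 ≤ s) (hs₀ : 0 < s₀)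
    (hss : s ≤ s₀) (p : MvPolynomial σ ℝ) (hp : ∀ m, 0 ≤ p.coeff m) :
    MvPolynomial.eval (fun i => a i + s) p - MvPolynomial.eval a p -
        ∑ j, MvPolynomial.eval a (MvPolynomial.pderiv j p) * s ≤
      (s / s₀) ^ 2 * MvPolynomial.eval (fun i => a i + s₀) p := by
  classical
  suffices h : 0 ≤ MvPolynomial.eval a p ∧ 0 ≤ MvPolynomial.eval (fun i => a i + s₀) p ∧
      MvPolynomial.eval (fun i => a i + s) p ≤ MvPolynomial.eval (fun i => a i + s₀) p ∧
      MvPolynomial.eval (fun i => a i + s) p - MvPolynomial.eval a p ≤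
        (s / s₀) * MvPolynomial.eval (fun i => a i + s₀) p ∧
      MvPolynomial.eval (fun i => a i + s) p - MvPolynomial.eval a p -
        ∑ j, MvPolynomial.eval a (MvPolynomial.pderiv j p) * s ≤
      (s / s₀) ^ 2 * MvPolynomial.eval (fun i => a i + s₀) p from h.2.2.2.2
  have hq : 0 ≤ s / s₀ := by positivity
  have hqs : (s / s₀) * s₀ = s := by field_simp
  refine mvPolynomial_induction_coeff (T := AddSubmonoid.nonneg ℝ) ?_ ?_ ?_ ?_ p hp
  · simp
  · rintro p q ⟨a1, hM, a2, a3, a4⟩ ⟨b1, hM', b2, b3, b4⟩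
    simp only [map_add, add_mul, Finset.sum_add_distrib]
    refine ⟨add_nonneg a1 b1, add_nonneg hM hM', add_le_add a2 b2, ?_, ?_⟩ <;> linarith
  · intro c hc
    have hc' : 0 ≤ c := hc
    simp only [MvPolynomial.eval_C, sub_self, MvPolynomial.pderiv_C, map_zero, zero_mul,
      Finset.sum_const_zero, le_refl, true_and]
    exact ⟨hc', hc', by positivity, by positivity⟩
  · rintro p i ⟨a1, hM, a2, a3, a4⟩
    have hL : ∑ j, MvPolynomial.eval a (MvPolynomial.pderiv j (p * MvPolynomial.X i)) * s =
        a i * (∑ j, MvPolynomial.eval a (MvPolynomial.pderiv j p) * s) +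
          MvPolynomial.eval a p * s := by
      have : ∀ j, MvPolynomial.eval a (MvPolynomial.pderiv j (p * MvPolynomial.X i)) * s =
          a i * (MvPolynomial.eval a (MvPolynomial.pderiv j p) * s) +
          (if i = j then MvPolynomial.eval a p * s else 0) := by
        intro j
        rw [Derivation.leibniz, MvPolynomial.pderiv_X]
        by_cases hij : i = j
        · subst hij
          simp
          ring
        · simp [hij]
          ring
      simp_rw [this, Finset.sum_add_distrib, ← Finset.mul_sum]
      simp
    rw [hL]
    set L := ∑ j, MvPolynomial.eval a (MvPolynomial.pderiv j p) * s
    set V := MvPolynomial.eval a p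
    set E := MvPolynomial.eval (fun i => a i + s) p
    set M := MvPolynomial.eval (fun i => a i + s₀) p
    simp only [map_mul, MvPolynomial.eval_X]
    have hi := ha i
    refine ⟨mul_nonneg a1 hi, mul_nonneg hM (by linarith), ?_, ?_, ?_⟩
    · have h1 : E * (a i + s) ≤ M * (a i + s) := mul_le_mul_of_nonneg_right a2 (by linarith)
      have h2 : M * (a i + s) ≤ M * (a i + s₀) := mul_le_mul_of_nonneg_left (by linarith) hM
      exact h1.trans h2
    · have e1 : (E - V) * a i ≤ ((s / s₀) * M) * a i := mul_le_mul_of_nonneg_right a3 hi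
      have e2 : E * s ≤ M * s := mul_le_mul_of_nonneg_right a2 hs
      have e3 : (s / s₀) * (M * (a i + s₀)) =
          ((s / s₀) * M) * a i + M * ((s / s₀) * s₀) := by ring
      rw [hqs] at e3
      linarith
    · have e1 : (E - V - L) * a i ≤ ((s / s₀) ^ 2 * M) * a i := mul_le_mul_of_nonneg_right a4 hi
      have e2 : (E - V) * s ≤ ((s / s₀) * M) * s := mul_le_mul_of_nonneg_right a3 hs
      have e3 : (s / s₀) ^ 2 * (M * (a i + s₀)) =
          ((s / s₀) ^ 2 * M) * a i + ((s / s₀) * M) * ((s / s₀) * s₀) := by ring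
      rw [hqs] at e3
      linarith

theorem remainder_mem_normClass {S₀ S₁ S₂ : Set ℂ} {W₀ W₁ W₂ : ℂ → ℝ≥0∞}
    (h0 : (0 : ℂ) ∈ S₀) (hW0 : W₀ 0 ≤ 1)
    (h00 : ∀ a ∈ S₀, ∀ b ∈ S₀, a + b ∈ S₀ ∧ W₀ (a + b) ≤ W₀ a * W₀ b)
    (h01 : ∀ a ∈ S₀, ∀ b ∈ S₁, a + b ∈ S₁ ∧ W₁ (a + b) ≤ W₀ a * W₁ b)
    (h02 : ∀ a ∈ S₀, ∀ b ∈ S₂, a + b ∈ S₂ ∧ W₂ (a + b) ≤ W₀ a * W₂ b)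
    (h11 : ∀ a ∈ S₁, ∀ b ∈ S₁, a + b ∈ S₂ ∧ W₂ (a + b) ≤ W₁ a * W₁ b)
    (h12 : ∀ a ∈ S₁, ∀ b ∈ S₂, a + b ∈ S₂ ∧ W₂ (a + b) ≤ W₁ a * W₂ b)
    {v w : σ → HS} {a : σ → ℝ} {s : ℝ} (hv : ∀ i, (v i, a i) ∈ normClass S₀ W₀)
    (hw : ∀ i, (w i, s) ∈ normClass S₁ W₁) (p : MvPolynomial σ ℂ) :
    (MvPolynomial.aeval v p, MvPolynomial.eval a (absPoly p)) ∈ normClass S₀ W₀ ∧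
    (∀ j, (MvPolynomial.aeval v (MvPolynomial.pderiv j p),
      MvPolynomial.eval a (MvPolynomial.pderiv j (absPoly p))) ∈ normClass S₀ W₀) ∧
    (∀ μ, cf (∑ j, MvPolynomial.aeval v (MvPolynomial.pderiv j p) * w j) μ ≠ 0 → μ ∈ S₁) ∧
    (MvPolynomial.aeval (v + w) p - MvPolynomial.aeval v p -
        ∑ j, MvPolynomial.aeval v (MvPolynomial.pderiv j p) * w j,
      MvPolynomial.eval (fun i => a i + s) (absPoly p) - MvPolynomial.eval a (absPoly p) -
        ∑ j, MvPolynomial.eval a (MvPolynomial.pderiv j (absPoly p)) * s) ∈ normClass S₂ W₂ := by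
  classical
  -- Over the product ring this polynomial projects to p and to `absPoly p`. One application of the
  -- algebraic lemma thus yields the remainder of p together with its numerical bound, which is the
  -- remainder of `absPoly p`.
  let pB : MvPolynomial σ (HS × ℝ) :=
    ∑ m ∈ p.support, MvPolynomial.monomial m (HahnSeries.C (p.coeff m), ‖p.coeff m‖)
  have hpB : ∀ m, pB.coeff m ∈ normClass S₀ W₀ := by
    intro m
    simp only [pB, MvPolynomial.coeff_sum, MvPolynomial.coeff_monomial]
    refine sum_mem fun i _ => ?_
    split_ifs
    · refine ⟨fun μ hμ => ?_, norm_nonneg _, ?_⟩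
      · by_contra hcon
        have : μ ≠ 0 := by rintro rfl; exact hcon h0
        exact hμ ((cf_C _ _).trans (if_neg this))
      · rw [nm_C, ofReal_norm]
        exact mul_le_of_le_one_right' hW0
    · exact zero_mem _
  have hfst : MvPolynomial.map (RingHom.fst HS ℝ) pB = MvPolynomial.map (algebraMap ℂ HS) p := by
    ext1 m
    simp only [pB, map_sum, MvPolynomial.map_monomial, MvPolynomial.coeff_sum,
      MvPolynomial.coeff_monomial, MvPolynomial.coeff_map]
    simp only [Finset.sum_ite_eq', MvPolynomial.mem_support_iff, RingHom.coe_fst]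
    split_ifs with h
    · rfl
    · rw [not_not.mp h, map_zero]
  have hsnd : MvPolynomial.map (RingHom.snd HS ℝ) pB = absPoly p := by
    simp [pB, absPoly]
  have e1 : ∀ (x : σ → HS × ℝ) , MvPolynomial.eval x pB =
      (MvPolynomial.aeval (fun i => (x i).1) p, MvPolynomial.eval (fun i => (x i).2) (absPoly p)) := by
    intro x
    refine Prod.ext ?_ ?_
    · have := map_mvPolynomial_eval (RingHom.fst HS ℝ) x pB
      rw [hfst, MvPolynomial.eval_map] at this
      exact this
    · have := map_mvPolynomial_eval (RingHom.snd HS ℝ) x pB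
      rw [hsnd] at this
      exact this
  have e2 : ∀ (x : σ → HS × ℝ) j, MvPolynomial.eval x (MvPolynomial.pderiv j pB) =
      (MvPolynomial.aeval (fun i => (x i).1) (MvPolynomial.pderiv j p),
        MvPolynomial.eval (fun i => (x i).2) (MvPolynomial.pderiv j (absPoly p))) := by
    intro x j
    refine Prod.ext ?_ ?_
    · have := map_mvPolynomial_eval (RingHom.fst HS ℝ) x (MvPolynomial.pderiv j pB)
      rw [← MvPolynomial.pderiv_map, hfst, MvPolynomial.pderiv_map, MvPolynomial.eval_map] at this
      exact this
    · have := map_mvPolynomial_eval (RingHom.snd HS ℝ) x (MvPolynomial.pderiv j pB)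
      rw [← MvPolynomial.pderiv_map, hsnd] at this
      exact this
  have key := fun (p : MvPolynomial σ (HS × ℝ)) hp => remainder_mem
    (T₀ := normClass S₀ W₀) (T₁ := normClass S₁ W₁) (T₂ := normClass S₂ W₂)
    (fun _ ha _ hb => mul_mem_normClass h00 ha hb) (fun _ ha _ hb => mul_mem_normClass h01 ha hb)
    (fun _ ha _ hb => mul_mem_normClass h02 ha hb) (fun _ ha _ hb => mul_mem_normClass h11 ha hb)
    (fun _ ha _ hb => mul_mem_normClass h12 ha hb) (v := fun i => (v i, a i))
    (w := fun i => (w i, s)) hv hw p hp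
  obtain ⟨k1, k2, k3⟩ := key pB hpB
  refine ⟨?_, fun j => ?_, ?_, ?_⟩
  · rw [e1] at k1
    exact k1
  · have := (key (MvPolynomial.pderiv j pB) fun m => ?_).1
    · rw [e2] at this
      exact this
    · rw [MvPolynomial.coeff_pderiv]
      have := nsmul_mem (hpB (m + Finsupp.single j 1)) (m j + 1)
      rw [nsmul_eq_mul, mul_comm] at this
      exact_mod_cast this
  · intro μ hμ
    have := k2.1 μ
    simp only [e2] at this
    rw [Prod.fst_sum] at this
    exact this hμ
  · simp only [e2] at k3
    rw [e1, e1] at k3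
    convert k3 using 1
    refine Prod.ext ?_ ?_
    · simp only [Prod.fst_sub, Prod.fst_sum, Prod.fst_mul]
      rfl
    · simp only [Prod.snd_sub, Prod.snd_sum, Prod.snd_mul]
      rfl

end Remainder


/-! ### Substitution into power series by truncation, and Cauchy estimates. -/

/-- All exponents of `H` have real part at least `c`. -/
def ReGe (c : ℝ) (H : HS) : Prop := ∀ μ, cf H μ ≠ 0 → c ≤ μ.re

theorem ReGe.mul {c d : ℝ} {H K : HS} (hH : ReGe c H) (hK : ReGe d K) : ReGe (c + d) (H * K) := by
  intro μ hμ
  obtain ⟨a, b, rfl, ha, hb⟩ := exists_of_cf_mul_ne_zero hμ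
  rw [Complex.add_re]
  exact add_le_add (hH a ha) (hK b hb)

theorem reGe_one : ReGe 0 (1 : HS) := by
  intro μ hμ
  by_cases h : μ = 0
  · simp [h]
  · exact absurd (by rw [cf_one, if_neg h]) hμ

theorem ReGe.pow {c : ℝ} {H : HS} (hH : ReGe c H) (k : ℕ) : ReGe (k * c) (H ^ k) := by
  induction k with
  | zero => simpa using reGe_one
  | succ k ih =>
    rw [pow_succ]
    convert ih.mul hH using 1
    push_cast
    ring

theorem ReGe.prod {ι : Type*} {c : ι → ℝ} {H : ι → HS} (s : Finset ι)
    (hH : ∀ i, ReGe (c i) (H i)) : ReGe (∑ i ∈ s, c i) (∏ i ∈ s, H i) := by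
  classical
  induction s using Finset.induction_on with
  | empty => simpa using reGe_one
  | insert a s ha ih =>
    rw [Finset.sum_insert ha, Finset.prod_insert ha]
    exact (hH a).mul ih

theorem ReGe.prod_pow {N : ℕ} {ε : ℝ} {v : Fin N → HS} (hv : ∀ i, ReGe ε (v i))
    (m : Fin N →₀ ℕ) : ReGe (m.degree * ε) (∏ i, v i ^ m i) := by
  have := ReGe.prod Finset.univ fun i => (hv i).pow (m i)
  rw [← Finset.sum_mul, ← Nat.cast_sum] at this
  rwa [Finsupp.degree_eq_sum]

/-- Each factor `v i` adds at least ε to the real part, so multi-indices of degree D or more cannot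
reach μ. A coefficient of the substituted series is thus one of a polynomial expression, to which
the algebra above applies. -/
theorem substCoeff_eq {N : ℕ} (G : MvPowerSeries (Fin N) ℂ) {v : Fin N → HS} {ε : ℝ}
    (hε : 0 ≤ ε) (hv : ∀ i, ReGe ε (v i)) {μ : ℂ} {D : ℕ} (hD : μ.re < D * ε) :
    substCoeff G v μ = cf (MvPolynomial.aeval v (MvPowerSeries.truncTotal D G)) μ := by
  have h1 : MvPolynomial.aeval v (MvPowerSeries.truncTotal D G) =
      ∑ m ∈ (MvPowerSeries.truncTotal D G).support,
        HahnSeries.C ((MvPowerSeries.truncTotal D G).coeff m) * ∏ i, v i ^ m i := by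
    rw [MvPolynomial.aeval_def, MvPolynomial.eval₂_eq']
    rfl
  rw [h1, cf_sum]
  unfold substCoeff
  rw [finsum_eq_sum_of_support_subset (s := (MvPowerSeries.truncTotal D G).support)]
  · refine Finset.sum_congr rfl fun m hm => ?_
    rw [cf_C_mul]
    rw [MvPolynomial.mem_support_iff, MvPowerSeries.coeff_truncTotal_eq_ite] at hm
    rw [MvPowerSeries.coeff_truncTotal_eq_ite]
    split_ifs at hm ⊢ with h
    · rfl
    · exact absurd rfl hm
  · intro m hm
    have hm1 := left_ne_zero_of_mul hm
    have hm2 : cf (∏ i, v i ^ m i) μ ≠ 0 := right_ne_zero_of_mul hm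
    have hdeg : m.degree < D := by
      by_contra hcon
      push Not at hcon
      have h2 := ReGe.prod_pow hv m μ hm2
      have h3 : (D : ℝ) * ε ≤ m.degree * ε :=
        mul_le_mul_of_nonneg_right (by exact_mod_cast hcon) hε
      linarith
    rw [Finset.mem_coe, MvPolynomial.mem_support_iff, MvPowerSeries.coeff_truncTotal_eq_ite,
      if_pos hdeg]
    exact hm1

theorem pderiv_truncTotal {N : ℕ} (G : MvPowerSeries (Fin N) ℂ) (j : Fin N) (D : ℕ) :
    MvPolynomial.pderiv j (MvPowerSeries.truncTotal (D + 1) G) =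
      MvPowerSeries.truncTotal D (MvPowerSeries.pderiv ℂ j G) := by
  ext m
  rw [MvPolynomial.coeff_pderiv, MvPowerSeries.coeff_truncTotal_eq_ite,
    MvPowerSeries.coeff_truncTotal_eq_ite, MvPowerSeries.coeff_pderiv, map_add,
    Finsupp.degree_single]
  simp only [Nat.add_lt_add_iff_right]
  split_ifs <;> simp

theorem eval_mono_of_nonneg {σ : Type*} {p : MvPolynomial σ ℝ} (hp : ∀ m, 0 ≤ p.coeff m)
    {a b : σ → ℝ} (ha : ∀ i, 0 ≤ a i) (hab : ∀ i, a i ≤ b i) :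
    0 ≤ MvPolynomial.eval a p ∧ MvPolynomial.eval a p ≤ MvPolynomial.eval b p := by
  rw [MvPolynomial.eval_eq, MvPolynomial.eval_eq]
  constructor
  · exact Finset.sum_nonneg fun m _ =>
      mul_nonneg (hp m) (Finset.prod_nonneg fun i _ => pow_nonneg (ha i) _)
  · refine Finset.sum_le_sum fun m _ => mul_le_mul_of_nonneg_left ?_ (hp m)
    exact Finset.prod_le_prod (fun i _ => pow_nonneg (ha i) _)
      fun i _ => pow_le_pow_left₀ (ha i) (hab i) _

/-- A convergent power series in several variables: the moduli of the terms have bounded partial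
sums at some point with equal positive coordinates. -/
def ConvergentAt {N : ℕ} (F : MvPowerSeries (Fin N) ℂ) (R C : ℝ) : Prop :=
  ∀ D, MvPolynomial.eval (fun _ => R) (absPoly (MvPowerSeries.truncTotal D F)) ≤ C

theorem HasTaylorSeries.convergentAt {N : ℕ} {F : (Fin N → ℂ) → ℂ}
    {Fs : MvPowerSeries (Fin N) ℂ} (h : HasTaylorSeries F Fs) :
    ∃ R > 0, ∃ C, ConvergentAt Fs R C := by
  obtain ⟨δ, hδ, hball⟩ := Metric.eventually_nhds_iff.mp h
  have hδ2 : 0 < δ / 2 := by positivity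
  have hz : dist (fun _ : Fin N => ((δ / 2 : ℝ) : ℂ)) 0 < δ := by
    rw [dist_pi_lt_iff hδ]
    intro i
    rw [Pi.zero_apply, dist_zero_right, Complex.norm_real, Real.norm_of_nonneg hδ2.le]
    linarith
  have hs := (hball hz).summable.norm
  refine ⟨δ / 2, hδ2, ∑' m : Fin N →₀ ℕ, ‖MvPowerSeries.coeff m Fs *
    ∏ i, ((fun _ : Fin N => ((δ / 2 : ℝ) : ℂ)) i) ^ m i‖, fun D => ?_⟩
  rw [MvPolynomial.eval_eq']
  refine le_trans (Finset.sum_le_sum fun m hm => ?_) (hs.sum_le_tsum (absPoly _).support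
    fun _ _ => norm_nonneg _)
  rw [coeff_absPoly, norm_mul, norm_prod]
  simp only [norm_pow, Complex.norm_real, Real.norm_of_nonneg hδ2.le]
  refine mul_le_mul_of_nonneg_right ?_ (by positivity)
  rw [MvPowerSeries.coeff_truncTotal_eq_ite]
  split_ifs <;> simp

theorem ConvergentAt.eval_le {N : ℕ} {F : MvPowerSeries (Fin N) ℂ} {R C : ℝ}
    (h : ConvergentAt F R C) (D : ℕ) {a : Fin N → ℝ} (ha : ∀ i, 0 ≤ a i) (haR : ∀ i, a i ≤ R) :
    0 ≤ MvPolynomial.eval a (absPoly (MvPowerSeries.truncTotal D F)) ∧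
      MvPolynomial.eval a (absPoly (MvPowerSeries.truncTotal D F)) ≤ C := by
  have := eval_mono_of_nonneg (p := absPoly (MvPowerSeries.truncTotal D F))
    (fun m => by rw [coeff_absPoly]; positivity) ha haR
  exact ⟨this.1, this.2.trans (h D)⟩

/-- Cauchy's estimate without integrals: for nonnegative coefficients, the derivative at a times R/2
is at most the increment of the polynomial from a to a + R/2. -/
theorem ConvergentAt.eval_pderiv_le {N : ℕ} {F : MvPowerSeries (Fin N) ℂ} {R C : ℝ}
    (h : ConvergentAt F R C) (hR : 0 < R) (D : ℕ) {a : Fin N → ℝ} (ha : ∀ i, 0 ≤ a i)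
    (haR : ∀ i, a i ≤ R / 2) (j : Fin N) :
    MvPolynomial.eval a (MvPolynomial.pderiv j (absPoly (MvPowerSeries.truncTotal D F))) ≤
      C / (R / 2) := by
  classical
  set p := absPoly (MvPowerSeries.truncTotal D F) with hp
  have hpn : ∀ m, 0 ≤ p.coeff m := fun m => by rw [hp, coeff_absPoly]; positivity
  -- the Taylor remainder of first order at `a` is nonnegative
  have key : ∀ q : MvPolynomial (Fin N) ℝ, (∀ m, 0 ≤ q.coeff m) →
      0 ≤ MvPolynomial.eval a q ∧
      (∀ j, 0 ≤ MvPolynomial.eval a (MvPolynomial.pderiv j q)) ∧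
      ∀ j, MvPolynomial.eval a (MvPolynomial.pderiv j q) * (R / 2) ≤
        MvPolynomial.eval (fun i => a i + R / 2) q - MvPolynomial.eval a q := by
    intro q hq
    refine mvPolynomial_induction_coeff (T := AddSubmonoid.nonneg ℝ) ?_ ?_ ?_ ?_ q hq
    · simp
    · rintro p q ⟨a1, a2, a3⟩ ⟨b1, b2, b3⟩
      simp only [map_add]
      exact ⟨add_nonneg a1 b1, fun j => add_nonneg (a2 j) (b2 j),
        fun j => by linarith [a3 j, b3 j]⟩
    · intro c hc
      have hc' : 0 ≤ c := hc
      simp [hc']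
    · rintro q i ⟨a1, a2, a3⟩
      have hL : ∀ j, MvPolynomial.eval a (MvPolynomial.pderiv j (q * MvPolynomial.X i)) =
          a i * MvPolynomial.eval a (MvPolynomial.pderiv j q) +
          (if i = j then MvPolynomial.eval a q else 0) := by
        intro j
        rw [Derivation.leibniz, MvPolynomial.pderiv_X]
        by_cases hij : i = j
        · subst hij
          simp
          ring
        · simp [hij]
      have hi := ha i
      simp only [map_mul, MvPolynomial.eval_X, hL]
      have hE : MvPolynomial.eval a q ≤ MvPolynomial.eval (fun i => a i + R / 2) q := by
        have := mul_nonneg (a2 i) (by positivity : 0 ≤ R / 2)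
        linarith [a3 i]
      refine ⟨mul_nonneg a1 hi, fun j => ?_, fun j => ?_⟩
      · have := mul_nonneg hi (a2 j)
        split_ifs <;> linarith
      · have e1 := mul_le_mul_of_nonneg_left (a3 j) hi
        have e2 := mul_le_mul_of_nonneg_right hE (by positivity : 0 ≤ R / 2)
        have e3 := mul_nonneg a1 (by positivity : 0 ≤ R / 2)
        split_ifs <;> nlinarith
  have h1 := (key p hpn).2.2 j
  have h2 := (h.eval_le D (a := fun i => a i + R / 2) (fun i => by have := ha i; positivity)
    (fun i => by have := haR i; linarith)).2
  have h3 := (key p hpn).1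
  rw [le_div_iff₀ (by positivity)]
  rw [← hp] at h2
  linarith


/-! ### Shifted semigroups, damping factors and the weights of orders 0, 1, 2. -/

/-- The semigroup `Γ` with `0` adjoined. -/
def withZero (Γ : AddSubsemigroup ℂ) : Set ℂ := {z | z = 0 ∨ z ∈ Γ}

/-- The intersection of `Γ` and `ν + Γ`. -/
def shiftOne (Γ : AddSubsemigroup ℂ) (ν : ℂ) : Set ℂ := {z | z ∈ Γ ∧ z - ν ∈ Γ}

/-- The intersection of `Γ`, `ν + Γ` and `2 ν + Γ`. -/
def shiftTwo (Γ : AddSubsemigroup ℂ) (ν : ℂ) : Set ℂ := {z | z ∈ Γ ∧ z - ν ∈ Γ ∧ z - 2 * ν ∈ Γ}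

/-- Damping factors that absorb the small divisors. -/
structure IsDamping (Γ : AddSubsemigroup ℂ) (g g₂ : ℂ → ℝ) : Prop where
  -- `g` is meant to account for all divisors up to the one at its argument, while `g₂` leaves out
  -- that last one. Arguments are exponents measured relative to ν.
  pos : ∀ κ, 0 < g κ
  le : ∀ κ, g κ ≤ g₂ κ
  le_one : ∀ κ, g₂ κ ≤ 1
  single : ∀ κ κ₁, κ - κ₁ ∈ Γ → g₂ κ ≤ g κ₁
  -- Needed for products of two unknown coefficients. The real parts satisfy only an inequality
  -- because κ₁ + κ₂ falls short of κ by ν when one factor is itself of second order.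
  pair : ∀ κ κ₁ κ₂, κ - κ₁ ∈ Γ → κ - κ₂ ∈ Γ → κ₁.re + κ₂.re ≤ κ.re → g₂ κ ≤ g κ₁ * g κ₂

theorem isDamping_one (Γ : AddSubsemigroup ℂ) : IsDamping Γ (fun _ => 1) (fun _ => 1) where
  pos _ := one_pos
  le _ := le_rfl
  le_one _ := le_rfl
  single _ _ _ := le_rfl
  pair _ _ _ _ _ _ := by simp

theorem IsDamping.pos₂ {Γ : AddSubsemigroup ℂ} {g g₂ : ℂ → ℝ} (h : IsDamping Γ g g₂) (κ : ℂ) :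
    0 < g₂ κ := (h.pos κ).trans_le (h.le κ)

/-- The weight `r ^ Re μ`. -/
def wt (r : ℝ) (μ : ℂ) : ℝ≥0∞ := ENNReal.ofReal (r ^ μ.re)

/-- The weight for the unknown series. -/
def wtOne (g : ℂ → ℝ) (ν : ℂ) (r M : ℝ) (μ : ℂ) : ℝ≥0∞ :=
  if μ.re ≤ M then ENNReal.ofReal (g (μ - ν) * r ^ (μ - ν).re) else 0

/-- The weight for the remainder of second order. -/
def wtTwo (g₂ : ℂ → ℝ) (ν : ℂ) (r M : ℝ) (μ : ℂ) : ℝ≥0∞ :=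
  -- The equation is read at μ = l + ν with Re l ≤ M. There μ - 2ν = l - ν, so the weight matches
  -- that of the unknown at l.
  if μ.re ≤ M + ν.re then ENNReal.ofReal (g₂ (μ - 2 * ν) * r ^ (μ - 2 * ν).re) else 0

theorem wt_zero (r : ℝ) : wt r 0 = 1 := by simp [wt]

theorem wt_add {r : ℝ} (hr : 0 < r) (a b : ℂ) : wt r (a + b) = wt r a * wt r b := by
  rw [wt, wt, wt, ← ENNReal.ofReal_mul (by positivity), Complex.add_re, Real.rpow_add hr]

section Closure

variable {Γ : AddSubsemigroup ℂ} {g g₂ : ℂ → ℝ} {ν : ℂ} {r M : ℝ}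

theorem withZero_add {a b : ℂ} (ha : a ∈ withZero Γ) (hb : b ∈ withZero Γ) :
    a + b ∈ withZero Γ := by
  rcases ha with rfl | ha
  · rwa [zero_add]
  · rcases hb with rfl | hb
    · rw [add_zero]; exact Or.inr ha
    · exact Or.inr (add_mem ha hb)

theorem add_mem_of_withZero {a b : ℂ} (ha : a ∈ withZero Γ) (hb : b ∈ Γ) : a + b ∈ Γ := by
  rcases ha with rfl | ha
  · rwa [zero_add]
  · exact add_mem ha hb

theorem shiftOne_add {a b : ℂ} (ha : a ∈ withZero Γ) (hb : b ∈ shiftOne Γ ν) :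
    a + b ∈ shiftOne Γ ν := by
  refine ⟨add_mem_of_withZero ha hb.1, ?_⟩
  rw [add_sub_assoc]
  exact add_mem_of_withZero ha hb.2

theorem shiftTwo_add {a b : ℂ} (ha : a ∈ withZero Γ) (hb : b ∈ shiftTwo Γ ν) :
    a + b ∈ shiftTwo Γ ν := by
  refine ⟨add_mem_of_withZero ha hb.1, ?_, ?_⟩
  · rw [add_sub_assoc]
    exact add_mem_of_withZero ha hb.2.1
  · rw [add_sub_assoc]
    exact add_mem_of_withZero ha hb.2.2

theorem shiftOne_add_shiftOne {a b : ℂ} (ha : a ∈ shiftOne Γ ν) (hb : b ∈ shiftOne Γ ν) :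
    a + b ∈ shiftTwo Γ ν := by
  refine ⟨add_mem ha.1 hb.1, ?_, ?_⟩
  · rw [add_sub_assoc]
    exact add_mem ha.1 hb.2
  · have : a + b - 2 * ν = (a - ν) + (b - ν) := by ring
    rw [this]
    exact add_mem ha.2 hb.2

variable (hpos : ∀ z ∈ Γ, 0 < z.re) (hν : 0 ≤ ν.re) (hr : 0 < r) (hr1 : r ≤ 1)
  (hg : IsDamping Γ g g₂)

include hpos hr hg

theorem wtOne_add_le {a b : ℂ} (ha : a ∈ withZero Γ) :
    wtOne g ν r M (a + b) ≤ wt r a * wtOne g ν r M b := by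
  rcases ha with rfl | ha
  · rw [zero_add, wt_zero, one_mul]
  unfold wtOne wt
  by_cases h : (a + b).re ≤ M
  · have h' : b.re ≤ M := by
      have := hpos a ha
      rw [Complex.add_re] at h
      linarith
    rw [if_pos h, if_pos h', ← ENNReal.ofReal_mul (by positivity)]
    refine ENNReal.ofReal_le_ofReal ?_
    have e : (a + b - ν).re = a.re + (b - ν).re := by simp; ring
    rw [e, Real.rpow_add hr]
    have h1 : g (a + b - ν) ≤ g (b - ν) :=
      (hg.le _).trans (hg.single _ _ (by convert ha using 1; ring))
    calc g (a + b - ν) * (r ^ a.re * r ^ (b - ν).re)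
        ≤ g (b - ν) * (r ^ a.re * r ^ (b - ν).re) := by gcongr
      _ = _ := by ring
  · rw [if_neg h]
    exact zero_le

theorem wtTwo_add_le {a b : ℂ} (ha : a ∈ withZero Γ) :
    wtTwo g₂ ν r M (a + b) ≤ wt r a * wtTwo g₂ ν r M b := by
  rcases ha with rfl | ha
  · rw [zero_add, wt_zero, one_mul]
  unfold wtTwo wt
  by_cases h : (a + b).re ≤ M + ν.re
  · have h' : b.re ≤ M + ν.re := by
      have := hpos a ha
      rw [Complex.add_re] at h
      linarith
    rw [if_pos h, if_pos h', ← ENNReal.ofReal_mul (by positivity)]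
    refine ENNReal.ofReal_le_ofReal ?_
    have e : (a + b - 2 * ν).re = a.re + (b - 2 * ν).re := by simp; ring
    rw [e, Real.rpow_add hr]
    have h1 : g₂ (a + b - 2 * ν) ≤ g₂ (b - 2 * ν) :=
      (hg.single _ _ (by convert ha using 1; ring)).trans (hg.le _)
    calc g₂ (a + b - 2 * ν) * (r ^ a.re * r ^ (b - 2 * ν).re)
        ≤ g₂ (b - 2 * ν) * (r ^ a.re * r ^ (b - 2 * ν).re) := by gcongr
      _ = _ := by ring
  · rw [if_neg h]
    exact zero_le

theorem wtTwo_add_le_of_shiftOne {a b : ℂ} (ha : a ∈ shiftOne Γ ν) (hb : b ∈ shiftOne Γ ν) :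
    wtTwo g₂ ν r M (a + b) ≤ wtOne g ν r M a * wtOne g ν r M b := by
  unfold wtTwo wtOne
  by_cases h : (a + b).re ≤ M + ν.re
  · have ha2 := hpos _ ha.2
    have hb2 := hpos _ hb.2
    rw [Complex.sub_re] at ha2 hb2
    rw [Complex.add_re] at h
    rw [if_pos (by rwa [Complex.add_re]), if_pos (by linarith), if_pos (by linarith),
      ← ENNReal.ofReal_mul (by have := hg.pos (a - ν); positivity)]
    refine ENNReal.ofReal_le_ofReal ?_
    have e : (a + b - 2 * ν).re = (a - ν).re + (b - ν).re := by simp; ring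
    have h1 : g₂ (a + b - 2 * ν) ≤ g (a - ν) * g (b - ν) :=
      hg.pair _ _ _ (by convert hb.2 using 1; ring) (by convert ha.2 using 1; ring) e.ge
    rw [e, Real.rpow_add hr]
    calc g₂ (a + b - 2 * ν) * (r ^ (a - ν).re * r ^ (b - ν).re)
        ≤ (g (a - ν) * g (b - ν)) * (r ^ (a - ν).re * r ^ (b - ν).re) := by gcongr
      _ = _ := by ring
  · rw [if_neg h]
    exact zero_le

/-- A coefficient with exponent in `ν + Γ` times the unknown series. -/
theorem wtTwo_add_le_of_sub_mem {a b : ℂ} (ha : a - ν ∈ Γ) :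
    wtTwo g₂ ν r M (a + b) ≤ wt r (a - ν) * wtOne g ν r M b := by
  unfold wtTwo wtOne wt
  by_cases h : (a + b).re ≤ M + ν.re
  · have ha2 := hpos _ ha
    rw [Complex.sub_re] at ha2
    rw [Complex.add_re] at h
    rw [if_pos (by rwa [Complex.add_re]), if_pos (by linarith),
      ← ENNReal.ofReal_mul (by positivity)]
    refine ENNReal.ofReal_le_ofReal ?_
    have e : (a + b - 2 * ν).re = (a - ν).re + (b - ν).re := by simp; ring
    have h1 : g₂ (a + b - 2 * ν) ≤ g (b - ν) :=
      hg.single _ _ (by convert ha using 1; ring)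
    rw [e, Real.rpow_add hr]
    calc g₂ (a + b - 2 * ν) * (r ^ (a - ν).re * r ^ (b - ν).re)
        ≤ g (b - ν) * (r ^ (a - ν).re * r ^ (b - ν).re) := by gcongr
      _ = _ := by ring
  · rw [if_neg h]
    exact zero_le

include hν hr1

/-- The relative exponents add up only to κ - ν. The surplus factor r^{Re ν} is harmless because Re
ν ≥ 0 and r ≤ 1. -/
theorem wtTwo_add_le_of_shiftTwo {a b : ℂ} (ha : a ∈ shiftOne Γ ν) (hb : b ∈ shiftTwo Γ ν) :
    wtTwo g₂ ν r M (a + b) ≤ wtOne g ν r M a * wtTwo g₂ ν r M b := by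
  unfold wtTwo wtOne
  by_cases h : (a + b).re ≤ M + ν.re
  · have ha2 := hpos _ ha.1
    have hb2 := hpos _ hb.2.1
    rw [Complex.sub_re] at hb2
    rw [Complex.add_re] at h
    rw [if_pos (by rwa [Complex.add_re]), if_pos (by linarith), if_pos (by linarith),
      ← ENNReal.ofReal_mul (by have := hg.pos (a - ν); positivity)]
    refine ENNReal.ofReal_le_ofReal ?_
    have e : (a + b - 2 * ν).re = (a - ν).re + (b - 2 * ν).re + ν.re := by simp; ring
    have h1 : g₂ (a + b - 2 * ν) ≤ g (a - ν) * g₂ (b - 2 * ν) :=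
      (hg.pair _ (a - ν) (b - 2 * ν) (by convert hb.2.1 using 1; ring)
        (by convert ha.1 using 1; ring) (by linarith)).trans
        (mul_le_mul_of_nonneg_left (hg.le _) (hg.pos _).le)
    have h2 : r ^ ν.re ≤ 1 := Real.rpow_le_one hr.le hr1 hν
    have h3 := hg.pos (a - ν)
    have h4 := hg.pos₂ (b - 2 * ν)
    rw [e, Real.rpow_add hr, Real.rpow_add hr]
    calc g₂ (a + b - 2 * ν) * (r ^ (a - ν).re * r ^ (b - 2 * ν).re * r ^ ν.re)
        ≤ (g (a - ν) * g₂ (b - 2 * ν)) * (r ^ (a - ν).re * r ^ (b - 2 * ν).re * 1) := by gcongr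
      _ = _ := by ring
  · rw [if_neg h]
    exact zero_le

/-- The Taylor expansion of first order in the weighted norms. -/
theorem taylor_mem_normClass {σ : Type*} [Fintype σ] {v w : σ → HS} {a : σ → ℝ} {s : ℝ}
    (hv : ∀ i, (v i, a i) ∈ normClass (withZero Γ) (wt r))
    (hw : ∀ i, (w i, s) ∈ normClass (shiftOne Γ ν) (wtOne g ν r M)) (p : MvPolynomial σ ℂ) :
    (MvPolynomial.aeval v p, MvPolynomial.eval a (absPoly p)) ∈
        normClass (withZero Γ) (wt r) ∧
    (∀ j, (MvPolynomial.aeval v (MvPolynomial.pderiv j p),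
      MvPolynomial.eval a (MvPolynomial.pderiv j (absPoly p))) ∈
        normClass (withZero Γ) (wt r)) ∧
    (∀ μ, cf (∑ j, MvPolynomial.aeval v (MvPolynomial.pderiv j p) * w j) μ ≠ 0 →
      μ ∈ shiftOne Γ ν) ∧
    (MvPolynomial.aeval (v + w) p - MvPolynomial.aeval v p -
        ∑ j, MvPolynomial.aeval v (MvPolynomial.pderiv j p) * w j,
      MvPolynomial.eval (fun i => a i + s) (absPoly p) - MvPolynomial.eval a (absPoly p) -
        ∑ j, MvPolynomial.eval a (MvPolynomial.pderiv j (absPoly p)) * s) ∈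
        normClass (shiftTwo Γ ν) (wtTwo g₂ ν r M) :=
  remainder_mem_normClass (Or.inl rfl) (wt_zero r).le
    (fun _ ha _ hb => ⟨withZero_add ha hb, (wt_add hr _ _).le⟩)
    (fun _ ha _ hb => ⟨shiftOne_add ha hb, wtOne_add_le hpos hr hg ha⟩)
    (fun _ ha _ hb => ⟨shiftTwo_add ha hb, wtTwo_add_le hpos hr hg ha⟩)
    (fun _ ha _ hb => ⟨shiftOne_add_shiftOne ha hb, wtTwo_add_le_of_shiftOne hpos hr hg ha hb⟩)
    (fun _ ha _ hb => ⟨shiftTwo_add (Or.inr ha.1) hb,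
      wtTwo_add_le_of_shiftTwo hpos hν hr hr1 hg ha hb⟩) hv hw p

end Closure

/-! ### The a priori estimate and the continuity argument in the radius. -/

/-- A generalized polynomial in `r` that vanishes at `0` and omits a positive value on `(0, r₀]`
stays below it. -/
theorem sum_rpow_lt_of_ne (T : Finset ℂ) {a e : ℂ → ℝ} (he : ∀ l ∈ T, 0 < e l)
    {b r₀ : ℝ} (hb : 0 < b) (hr₀ : 0 < r₀)
    (h : ∀ r, 0 < r → r ≤ r₀ → ∑ l ∈ T, a l * r ^ e l ≠ b) : ∑ l ∈ T, a l * r₀ ^ e l < b := by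
  by_contra hcon
  push Not at hcon
  have hc : ContinuousOn (fun r : ℝ => ∑ l ∈ T, a l * r ^ e l) (Set.Icc 0 r₀) := by
    refine continuousOn_finsetSum _ fun l hl => ?_
    exact (continuous_const.mul (Real.continuous_rpow_const (he l hl).le)).continuousOn
  have h0 : ∑ l ∈ T, a l * (0 : ℝ) ^ e l = 0 :=
    Finset.sum_eq_zero fun l hl => by rw [Real.zero_rpow (he l hl).ne', mul_zero]
  obtain ⟨r, hr, hrb⟩ := intermediate_value_Icc hr₀.le hc
    (show b ∈ Set.Icc _ _ from ⟨by simp only [h0]; exact hb.le, hcon⟩)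
  rcases hr.1.eq_or_lt with h1 | h1
  · subst h1
    simp only [h0] at hrb
    exact hb.ne hrb
  · exact h r h1 hr.2 hrb


/-- The weighted norm of the unknown series over a finite set of exponents. -/
def dampedSum (χ : ℂ → ℂ) (ω g : ℂ → ℝ) (ν : ℂ) (r : ℝ) (T : Finset ℂ) : ℝ :=
  ∑ l ∈ T, ω l * ‖χ l‖ * g (l - ν) * r ^ (l - ν).re

theorem sum_comp_add_le_tsum (T : Finset ℂ) (ν : ℂ) (f : ℂ → ℝ≥0∞) :
    ∑ l ∈ T, f (l + ν) ≤ ∑' μ, f μ := by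
  rw [← (Equiv.addRight ν).tsum_eq]
  exact ENNReal.sum_le_tsum (f := fun l => f (l + ν)) T

theorem wt_mono {r r₁ : ℝ} (hr : 0 < r) (hrr : r ≤ r₁) {μ : ℂ} (hμ : 0 ≤ μ.re) :
    wt r μ ≤ wt r₁ μ :=
  ENNReal.ofReal_le_ofReal (Real.rpow_le_rpow hr.le hrr hμ)

/-- Shrinking the radius gains a power of the quotient of the radii. -/
theorem rpow_le_of_le {r r₁ ε x : ℝ} (hr : 0 < r) (hrr : r ≤ r₁) (hx : ε ≤ x) :
    r ^ x ≤ (r / r₁) ^ ε * r₁ ^ x := by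
  have hr₁ : 0 < r₁ := hr.trans_le hrr
  have h1 : r ^ x = (r / r₁) ^ x * r₁ ^ x := by
    rw [Real.div_rpow hr.le hr₁.le, div_mul_cancel₀]
    positivity
  rw [h1]
  gcongr ?_ * _
  exact Real.rpow_le_rpow_of_exponent_ge (by positivity) ((div_le_one hr₁).mpr hrr) hx

variable {m : ℕ} {Γ : AddSubsemigroup ℂ} {ε : ℝ} {ν : ℂ} {g g₂ : ℂ → ℝ}
  {F : MvPowerSeries (Fin m) ℂ} {R C : ℝ} {v w : Fin m → HS} {r₁ : ℝ}

/-- At the exponents l + ν the equation equates ∑ A_j (w_j)_l, up to sign, with the coefficients of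
F along v, of the linear terms beyond x^ν, and of the quadratic remainder; the three summands bound
these in turn. The first is small with r because l - ν ∈ Γ has real part at least ε. The number s
bounds the norms of all `w j`. -/
theorem dampedSum_le (hε : 0 < ε) (hΓ : ∀ z ∈ Γ, ε ≤ z.re) (hν : 0 ≤ ν.re)
    (hg : IsDamping Γ g g₂) (hR : 0 < R) (hFc : ConvergentAt F R C) (hr₁ : r₁ ≤ 1)
    (hv : ∀ i μ, cf (v i) μ ≠ 0 → μ ∈ Γ) (hvn : ∀ i, nm (wt r₁) (v i) ≤ ENNReal.ofReal (R / 2))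
    (hw : ∀ i μ, cf (w i) μ ≠ 0 → μ ∈ shiftOne Γ ν)
    (hF : ∀ μ, substCoeff F (v + w) μ = 0) (A : Fin m → ℂ) {χ : ℂ → ℂ} {ω : ℂ → ℝ}
    (hχ : ∀ l, χ l ≠ 0 → l ∈ shiftOne Γ ν) {T : Finset ℂ} {M : ℝ}
    (hT : ∀ l ∈ T, χ l ≠ 0 ∧ l.re ≤ M) {K : ℝ} (hK : 0 < K)
    (hE : ∀ l, χ l ≠ 0 → g (l - ν) * (ω l * ‖χ l‖) ≤
      K * (g₂ (l - ν) * ‖∑ j, A j * cf (w j) l‖))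
    {r s η : ℝ} (hr : 0 < r) (hrr : r ≤ r₁) (hs : 0 ≤ s) (hsR : s ≤ R / 2) (hη : 0 ≤ η)
    (hwn : ∀ j, nm (wtOne g ν r M) (w j) ≤ ENNReal.ofReal s)
    {D : ℕ} (hD : M + ν.re < D * ε)
    (hlin : nm (wtTwo g₂ ν r M) (∑ j, (MvPolynomial.aeval v (MvPolynomial.pderiv j
      (MvPowerSeries.truncTotal D F)) - HahnSeries.single (ReExp.of ν) (A j)) * w j) ≤
        ENNReal.ofReal η) :
    dampedSum χ ω g ν r T ≤
      K * (C * ((r / r₁) ^ ε * r₁ ^ (-(2 * ν.re))) + η + C * (s / (R / 2)) ^ 2) := by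
  have hr1 : r ≤ 1 := hrr.trans hr₁
  have hr₁0 : 0 < r₁ := hr.trans_le hrr
  have hpos : ∀ z ∈ Γ, 0 < z.re := fun z hz => hε.trans_le (hΓ z hz)
  set P := MvPowerSeries.truncTotal D F with hP
  have hvc : ∀ r', 0 < r' → r' ≤ r₁ → ∀ i, (v i, R / 2) ∈ normClass (withZero Γ) (wt r') := by
    intro r' h0 h1 i
    have : (v i, R / 2) ∈ normClass (Γ : Set ℂ) (wt r₁) := ⟨hv i, by positivity, hvn i⟩
    exact mem_normClass_mono (fun a ha => ⟨Or.inr ha, wt_mono h0 h1 (hpos a ha).le⟩) this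
  have hwc : ∀ i, (w i, s) ∈ normClass (shiftOne Γ ν) (wtOne g ν r M) :=
    fun i => ⟨hw i, hs, hwn i⟩
  obtain ⟨-, -, -, -, -, k4⟩ := taylor_mem_normClass hpos hν hr hr1 hg (hvc r hr hrr) hwc P
  have k1 := (taylor_mem_normClass (M := M) (ν := ν) hpos hν hr₁0 hr₁ hg (hvc r₁ hr₁0 le_rfl)
    (s := 0) (w := 0) (fun i => zero_mem _) P).1.2.2
  have hC0 : 0 ≤ C := (hFc.eval_le D (a := fun _ => 0) (fun _ => le_rfl)
    (fun _ => hR.le)).1.trans (hFc.eval_le D (fun _ => le_rfl) (fun _ => hR.le)).2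
  set V := MvPolynomial.aeval v P with hV
  set Z := ∑ j, (MvPolynomial.aeval v (MvPolynomial.pderiv j P) -
    HahnSeries.single (ReExp.of ν) (A j)) * w j with hZ
  set Q := MvPolynomial.aeval (v + w) P - V -
    ∑ j, MvPolynomial.aeval v (MvPolynomial.pderiv j P) * w j with hQ
  have hVn : nm (wt r₁) V ≤ ENNReal.ofReal C := by
    refine k1.trans (ENNReal.ofReal_le_ofReal ?_)
    exact (hFc.eval_le D (fun _ => by positivity) (fun _ => by linarith)).2
  have hQn : nm (wtTwo g₂ ν r M) Q ≤ ENNReal.ofReal (C * (s / (R / 2)) ^ 2) := by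
    refine k4.trans (ENNReal.ofReal_le_ofReal ?_)
    refine (remainder_le (fun _ => by positivity) hs (by positivity) hsR _
      (fun m => by rw [coeff_absPoly]; positivity)).trans ?_
    rw [mul_comm C]
    refine mul_le_mul_of_nonneg_left ?_ (by positivity)
    exact (hFc.eval_le D (fun _ => by positivity) (fun _ => by linarith)).2
  -- the equation at the exponent `l + ν`
  have hreg : ∀ i, ReGe ε ((v + w) i) := by
    intro i μ hμ
    by_cases h : cf (v i) μ = 0
    · have : cf (w i) μ ≠ 0 := fun h' => hμ (by simp [h, h'])
      exact hΓ _ (hw i μ this).1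
    · exact hΓ _ (hv i μ h)
  have heq : ∀ l ∈ T, ∑ j, A j * cf (w j) l =
      -(cf V (l + ν) + cf Z (l + ν) + cf Q (l + ν)) := by
    intro l hl
    have h1 : cf (MvPolynomial.aeval (v + w) P) (l + ν) = 0 := by
      rw [hP, ← substCoeff_eq F hε.le hreg, hF]
      rw [Complex.add_re]
      linarith [(hT l hl).2]
    have h2 : cf (∑ j, HahnSeries.single (ReExp.of ν) (A j) * w j) (l + ν) =
        ∑ j, A j * cf (w j) l := by
      simp [cf_sum, cf_single_mul]
    have h3 : Z = ∑ j, MvPolynomial.aeval v (MvPolynomial.pderiv j P) * w j -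
        ∑ j, HahnSeries.single (ReExp.of ν) (A j) * w j := by
      rw [hZ, ← Finset.sum_sub_distrib]
      exact Finset.sum_congr rfl fun j _ => sub_mul _ _ _
    rw [← h2, hQ, h3]
    simp only [cf_sub, h1]
    ring
  have hwt : ∀ l ∈ T, wtTwo g₂ ν r M (l + ν) =
      ENNReal.ofReal (g₂ (l - ν) * r ^ (l - ν).re) := by
    intro l hl
    have : l + ν - 2 * ν = l - ν := by ring
    rw [wtTwo, if_pos (by rw [Complex.add_re]; linarith [(hT l hl).2]), this]
  have hterm : ∀ l ∈ T, ENNReal.ofReal (ω l * ‖χ l‖ * g (l - ν) * r ^ (l - ν).re) ≤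
      ENNReal.ofReal K * (‖cf V (l + ν)‖ₑ * wtTwo g₂ ν r M (l + ν) +
        ‖cf Z (l + ν)‖ₑ * wtTwo g₂ ν r M (l + ν) + ‖cf Q (l + ν)‖ₑ * wtTwo g₂ ν r M (l + ν)) := by
    intro l hl
    have h1 : ω l * ‖χ l‖ * g (l - ν) * r ^ (l - ν).re ≤
        K * (‖∑ j, A j * cf (w j) l‖ * (g₂ (l - ν) * r ^ (l - ν).re)) := by
      have := mul_le_mul_of_nonneg_right (hE l (hT l hl).1)
        (Real.rpow_nonneg hr.le (l - ν).re)
      calc _ = g (l - ν) * (ω l * ‖χ l‖) * r ^ (l - ν).re := by ring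
        _ ≤ _ := this
        _ = _ := by ring
    refine (ENNReal.ofReal_le_ofReal h1).trans ?_
    rw [ENNReal.ofReal_mul hK.le, ENNReal.ofReal_mul (norm_nonneg _), ofReal_norm, ← hwt l hl,
      heq l hl, ← add_mul, ← add_mul]
    gcongr
    rw [enorm_neg]
    exact (enorm_add_le _ _).trans (add_le_add_left (enorm_add_le _ _) _)
  have hVT : ∑ l ∈ T, ‖cf V (l + ν)‖ₑ * wtTwo g₂ ν r M (l + ν) ≤
      ENNReal.ofReal (C * ((r / r₁) ^ ε * r₁ ^ (-(2 * ν.re)))) := by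
    have h1 : ∀ l ∈ T, ‖cf V (l + ν)‖ₑ * wtTwo g₂ ν r M (l + ν) ≤
        (‖cf V (l + ν)‖ₑ * wt r₁ (l + ν)) *
          ENNReal.ofReal ((r / r₁) ^ ε * r₁ ^ (-(2 * ν.re))) := by
      intro l hl
      rw [hwt l hl, mul_assoc, wt, ← ENNReal.ofReal_mul (by positivity)]
      refine mul_le_mul' le_rfl (ENNReal.ofReal_le_ofReal ?_)
      have h2 : ε ≤ (l - ν).re := hΓ _ (hχ l (hT l hl).1).2
      have h3 := rpow_le_of_le hr hrr h2
      have h4 := Real.rpow_nonneg hr.le (l - ν).re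
      calc g₂ (l - ν) * r ^ (l - ν).re ≤ 1 * r ^ (l - ν).re := by
            gcongr
            exact hg.le_one _
        _ ≤ (r / r₁) ^ ε * r₁ ^ (l - ν).re := by rwa [one_mul]
        _ = _ := by
            have : (l - ν).re = (l + ν).re + -(2 * ν.re) := by simp; ring
            rw [this, Real.rpow_add hr₁0]
            ring
    refine (Finset.sum_le_sum h1).trans ?_
    rw [← Finset.sum_mul, ENNReal.ofReal_mul hC0]
    gcongr
    exact (sum_comp_add_le_tsum T ν fun μ => ‖cf V μ‖ₑ * wt r₁ μ).trans hVn
  have hZT := (sum_comp_add_le_tsum T ν fun μ => ‖cf Z μ‖ₑ * wtTwo g₂ ν r M μ).trans hlin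
  have hQT := (sum_comp_add_le_tsum T ν fun μ => ‖cf Q μ‖ₑ * wtTwo g₂ ν r M μ).trans hQn
  have hsum : ENNReal.ofReal (dampedSum χ ω g ν r T) ≤ ENNReal.ofReal
      (K * (C * ((r / r₁) ^ ε * r₁ ^ (-(2 * ν.re))) + η + C * (s / (R / 2)) ^ 2)) := by
    calc ENNReal.ofReal (dampedSum χ ω g ν r T)
        ≤ ∑ l ∈ T, ENNReal.ofReal (ω l * ‖χ l‖ * g (l - ν) * r ^ (l - ν).re) := by
          unfold dampedSum
          classical
          induction T using Finset.induction_on with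
          | empty => simp
          | insert a T' ha ih =>
            rw [Finset.sum_insert ha, Finset.sum_insert ha]
            refine ENNReal.ofReal_add_le.trans (add_le_add_right (ih ?_ ?_ ?_ ?_ ?_ ?_ ?_) _)
            · exact fun l hl => hT l (Finset.mem_insert_of_mem hl)
            · exact fun l hl => heq l (Finset.mem_insert_of_mem hl)
            · exact fun l hl => hwt l (Finset.mem_insert_of_mem hl)
            · exact fun l hl => hterm l (Finset.mem_insert_of_mem hl)
            · refine le_trans (Finset.sum_le_sum_of_subset (Finset.subset_insert _ _)) hVT
            · refine le_trans (Finset.sum_le_sum_of_subset (Finset.subset_insert _ _)) hZT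
            · refine le_trans (Finset.sum_le_sum_of_subset (Finset.subset_insert _ _)) hQT
      _ ≤ _ := Finset.sum_le_sum hterm
      _ ≤ _ := by
          rw [← Finset.mul_sum, Finset.sum_add_distrib, Finset.sum_add_distrib,
            ENNReal.ofReal_mul hK.le, ENNReal.ofReal_add (by positivity) (by positivity),
            ENNReal.ofReal_add (by positivity) hη]
          gcongr
  exact (ENNReal.ofReal_le_ofReal_iff (by positivity)).mp hsum

/-- A series whose coefficients satisfy the equation with damped divisors converges. -/
theorem summable_of_equation (hε : 0 < ε) (hΓ : ∀ z ∈ Γ, ε ≤ z.re) (hν : 0 ≤ ν.re)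
    (hg : IsDamping Γ g g₂) (hR : 0 < R) (hFc : ConvergentAt F R C) (hr₁0 : 0 < r₁)
    (hr₁ : r₁ ≤ 1)
    (hv : ∀ i μ, cf (v i) μ ≠ 0 → μ ∈ Γ) (hvn : ∀ i, nm (wt r₁) (v i) ≤ ENNReal.ofReal (R / 2))
    (hw : ∀ i μ, cf (w i) μ ≠ 0 → μ ∈ shiftOne Γ ν)
    (hF : ∀ μ, substCoeff F (v + w) μ = 0) (A : Fin m → ℂ) {χ : ℂ → ℂ} {ω : ℂ → ℝ}
    (hω : ∀ l, 0 ≤ ω l) (hχ : ∀ l, χ l ≠ 0 → l ∈ shiftOne Γ ν)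
    (hfin : ∀ M : ℝ, {l | χ l ≠ 0 ∧ l.re ≤ M}.Finite) {K Kw : ℝ} (hK : 0 < K) (hKw : 0 < Kw)
    (hE : ∀ l, χ l ≠ 0 → g (l - ν) * (ω l * ‖χ l‖) ≤
      K * (g₂ (l - ν) * ‖∑ j, A j * cf (w j) l‖))
    (hwn : ∀ r M : ℝ, 0 < r → r ≤ r₁ → ∀ j, nm (wtOne g ν r M) (w j) ≤
      ENNReal.ofReal (Kw * dampedSum χ ω g ν r (hfin M).toFinset))
    (hlin : ∀ η > 0, ∃ ρ > 0, ∀ r M : ℝ, 0 < r → r ≤ ρ → ∀ᶠ D in atTop,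
      nm (wtTwo g₂ ν r M) (∑ j, (MvPolynomial.aeval v (MvPolynomial.pderiv j
        (MvPowerSeries.truncTotal D F)) - HahnSeries.single (ReExp.of ν) (A j)) * w j) ≤
        ENNReal.ofReal (η * dampedSum χ ω g ν r (hfin M).toFinset)) :
    ∃ r : ℝ, 0 < r ∧ r ≤ 1 ∧ Summable fun l => ω l * ‖χ l‖ * g (l - ν) * r ^ (l - ν).re := by
  set C' := |C| + 1 with hC'
  have hC'0 : 0 < C' := by positivity
  have hFc' : ConvergentAt F R C' := fun D => (hFc D).trans ((le_abs_self C).trans (by linarith))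
  -- The barrier b keeps w inside the polydisc (Kw b ≤ R/2) and the quadratic term below b/4. The
  -- choice η = 1/(4K) and the radius r₀ below make the linear and the constant term at most b/4
  -- each.
  set b := min (R / 2 / Kw) ((R / 2) ^ 2 / (4 * K * C' * Kw ^ 2)) with hb
  have hb0 : 0 < b := by positivity
  have hb1 : Kw * b ≤ R / 2 := by
    have := min_le_left (R / 2 / Kw) ((R / 2) ^ 2 / (4 * K * C' * Kw ^ 2))
    rw [← hb, le_div_iff₀ hKw] at this
    linarith
  have hb2 : K * (C' * (Kw * b / (R / 2)) ^ 2) ≤ b / 4 := by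
    have := min_le_right (R / 2 / Kw) ((R / 2) ^ 2 / (4 * K * C' * Kw ^ 2))
    rw [← hb, le_div_iff₀ (by positivity)] at this
    have h2 : K * (C' * (Kw * b / (R / 2)) ^ 2) =
        (b * (4 * K * C' * Kw ^ 2)) * (b / 4) / (R / 2) ^ 2 := by
      rw [div_pow]
      ring
    rw [h2, div_le_iff₀ (by positivity)]
    nlinarith
  obtain ⟨ρ, hρ, hρlin⟩ := hlin (1 / (4 * K)) (by positivity)
  set B := r₁ ^ (-(2 * ν.re)) with hB
  have hB0 : 0 < B := by positivity
  set δ := b / (4 * K * C' * B) with hδ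
  have hδ0 : 0 < δ := by positivity
  set r₀ := min (min r₁ ρ) (r₁ * δ ^ (1 / ε)) with hr₀
  have hr₀0 : 0 < r₀ := by positivity
  have hr₀1 : r₀ ≤ r₁ := (min_le_left _ _).trans (min_le_left _ _)
  -- If the sum took the value b at some r ≤ r₀, the estimate would give b ≤ 3b/4. Since r₀ does not
  -- depend on M, the bound is uniform in M; only the truncation degree D depends on it.
  have hmain : ∀ M : ℝ, dampedSum χ ω g ν r₀ (hfin M).toFinset < b := by
    intro M
    unfold dampedSum
    have hTM : ∀ l ∈ (hfin M).toFinset, χ l ≠ 0 ∧ l.re ≤ M := fun l hl => by simpa using hl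
    refine sum_rpow_lt_of_ne _ (fun l hl => ?_) hb0 hr₀0 fun r hr hrr hcon => ?_
    · exact hε.trans_le (hΓ _ (hχ l (hTM l hl).1).2)
    · obtain ⟨D, hD1, hD2⟩ := ((hρlin r M hr (hrr.trans ((min_le_left _ _).trans
        (min_le_right _ _)))).and (eventually_gt_atTop ⌈(M + ν.re) / ε⌉₊)).exists
      have hrr₁ : r ≤ r₁ := hrr.trans hr₀1
      have hSb : dampedSum χ ω g ν r (hfin M).toFinset = b := hcon
      have hw' := hwn r M hr hrr₁
      rw [hSb] at hD1 hw'
      have hDε : M + ν.re < D * ε := by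
        rw [← div_lt_iff₀ hε]
        exact (Nat.le_ceil _).trans_lt (by exact_mod_cast hD2)
      have := dampedSum_le hε hΓ hν hg hR hFc' hr₁ hv hvn hw hF A hχ hTM hK hE hr hrr₁
        (by positivity) hb1 (by positivity) hw' hDε hD1
      rw [hSb, ← hB] at this
      have h1 : (r / r₁) ^ ε ≤ δ := by
        have h2 : r / r₁ ≤ δ ^ (1 / ε) := by
          rw [div_le_iff₀ hr₁0, mul_comm]
          exact hrr.trans (min_le_right _ _)
        calc (r / r₁) ^ ε ≤ (δ ^ (1 / ε)) ^ ε := Real.rpow_le_rpow (by positivity) h2 hε.le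
          _ = δ := by rw [← Real.rpow_mul hδ0.le, one_div_mul_cancel hε.ne', Real.rpow_one]
      have h3 : K * (C' * ((r / r₁) ^ ε * B)) ≤ b / 4 := by
        calc K * (C' * ((r / r₁) ^ ε * B)) ≤ K * (C' * (δ * B)) := by gcongr
          _ = b / 4 := by rw [hδ]; field_simp
      have h4 : K * (1 / (4 * K) * b) = b / 4 := by field_simp
      have h5 : K * (C' * ((r / r₁) ^ ε * B) + 1 / (4 * K) * b + C' * (Kw * b / (R / 2)) ^ 2) =
        K * (C' * ((r / r₁) ^ ε * B)) + K * (1 / (4 * K) * b) +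
          K * (C' * (Kw * b / (R / 2)) ^ 2) := by ring
      linarith
  have hnn : ∀ l, 0 ≤ ω l * ‖χ l‖ * g (l - ν) * r₀ ^ (l - ν).re := fun l => by
    have := hω l
    have := hg.pos (l - ν)
    positivity
  refine ⟨r₀, hr₀0, hr₀1.trans hr₁, summable_of_sum_le hnn (c := b) fun u => ?_⟩
  obtain ⟨M, hM⟩ : ∃ M : ℝ, ∀ l ∈ u, l.re ≤ M := by
    obtain ⟨M, hM⟩ := (u.image Complex.re).bddAbove
    exact ⟨M, fun l hl => hM (by simpa using ⟨l, hl, rfl⟩)⟩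
  refine le_trans ?_ (hmain M).le
  classical
  calc ∑ l ∈ u, ω l * ‖χ l‖ * g (l - ν) * r₀ ^ (l - ν).re
      = ∑ l ∈ u with χ l ≠ 0, ω l * ‖χ l‖ * g (l - ν) * r₀ ^ (l - ν).re := by
        refine (Finset.sum_filter_of_ne fun l _ h => ?_).symm
        intro h0
        simp [h0] at h
    _ ≤ _ := by
        refine Finset.sum_le_sum_of_subset_of_nonneg (fun l hl => ?_) fun l _ _ => hnn l
        rw [Finset.mem_filter] at hl
        simpa using ⟨hl.2, hM l hl.1⟩


/-! ### Counting small divisors. -/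

/-- The distance (at most `E`) from `κ` down to the nearest element of `B` below it. -/
def badDepth (Γ : AddSubsemigroup ℂ) (B : Set ℂ) (E : ℝ) (κ : ℂ) : ℝ :=
  sInf (insert E {t | ∃ κ' ∈ B, (κ' = κ ∨ κ - κ' ∈ Γ) ∧ t = κ.re - κ'.re})

/-- A bound for the number of elements of `B` met on the way up to `κ`. -/
def badCount (Γ : AddSubsemigroup ℂ) (B : Set ℂ) (E : ℝ) (κ : ℂ) : ℝ :=
  max 0 (2 * κ.re / E - max 1 (2 * badDepth Γ B E κ / E))

section BadCount

variable {Γ : AddSubsemigroup ℂ} {B : Set ℂ} {E : ℝ}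

theorem badCount_nonneg (κ : ℂ) : 0 ≤ badCount Γ B E κ := le_max_left _ _

theorem badCount_le (hE : 0 < E) {κ : ℂ} (hκ : 0 ≤ κ.re) :
    badCount Γ B E κ ≤ 2 * κ.re / E := by
  refine max_le (by positivity) ?_
  have := le_max_left (1 : ℝ) (2 * badDepth Γ B E κ / E)
  linarith

variable (hpos : ∀ z ∈ Γ, 0 < z.re) (hE : 0 < E) (h1 : ∀ κ ∈ B, E ≤ κ.re)
  (h2 : ∀ κ ∈ B, ∀ κ' ∈ B, κ - κ' ∈ Γ → E ≤ (κ - κ').re)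

include hpos hE

theorem badDepth_bddBelow (κ : ℂ) :
    BddBelow (insert E {t | ∃ κ' ∈ B, (κ' = κ ∨ κ - κ' ∈ Γ) ∧ t = κ.re - κ'.re}) := by
  refine ⟨0, ?_⟩
  rintro t (rfl | ⟨κ', -, h | h, rfl⟩)
  · exact hE.le
  · rw [h, sub_self]
  · have := hpos _ h
    rw [Complex.sub_re] at this
    exact this.le

theorem badDepth_le (κ : ℂ) : badDepth Γ B E κ ≤ E :=
  csInf_le (badDepth_bddBelow hpos hE κ) (Set.mem_insert _ _)

theorem badDepth_of_mem {κ : ℂ} (hκ : κ ∈ B) : badDepth Γ B E κ ≤ 0 :=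
  csInf_le (badDepth_bddBelow hpos hE κ) (Set.mem_insert_of_mem _
    ⟨κ, hκ, Or.inl rfl, by rw [sub_self]⟩)

theorem badDepth_sub_le {κ κ₁ : ℂ} (h : κ - κ₁ ∈ Γ) :
    badDepth Γ B E κ - (κ.re - κ₁.re) ≤ badDepth Γ B E κ₁ := by
  have h0 := hpos _ h
  rw [Complex.sub_re] at h0
  refine le_csInf (Set.insert_nonempty _ _) ?_
  rintro t (rfl | ⟨κ', hκ', h', rfl⟩)
  · linarith [badDepth_le hpos hE κ (B := B)]
  · have : badDepth Γ B E κ ≤ κ.re - κ'.re := by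
      refine csInf_le (badDepth_bddBelow hpos hE κ) (Set.mem_insert_of_mem _
        ⟨κ', hκ', Or.inr ?_, rfl⟩)
      rcases h' with rfl | h'
      · exact h
      · convert add_mem h h' using 1
        ring
    linarith

include h2 in
-- Separation of bad elements: anything bad below κ₁ lies at distance at least E below the bad
-- element κ.
theorem le_badDepth_of_mem {κ κ₁ : ℂ} (hκ : κ ∈ B) (h : κ - κ₁ ∈ Γ) :
    E - (κ.re - κ₁.re) ≤ badDepth Γ B E κ₁ := by
  have h0 := hpos _ h
  rw [Complex.sub_re] at h0
  refine le_csInf (Set.insert_nonempty _ _) ?_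
  rintro t (rfl | ⟨κ', hκ', h', rfl⟩)
  · linarith
  · have : E ≤ (κ - κ').re := by
      refine h2 κ hκ κ' hκ' ?_
      rcases h' with rfl | h'
      · exact h
      · convert add_mem h h' using 1
        ring
    rw [Complex.sub_re] at this
    linarith

include h1

theorem badCount_of_mem {κ : ℂ} (hκ : κ ∈ B) :
    badCount Γ B E κ = 2 * κ.re / E - 1 ∧ 1 ≤ badCount Γ B E κ := by
  have h3 : 2 * badDepth Γ B E κ / E ≤ 1 := by
    have := badDepth_of_mem hpos hE hκ
    have : 2 * badDepth Γ B E κ / E ≤ 0 := div_nonpos_of_nonpos_of_nonneg (by linarith) hE.le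
    linarith
  have h4 : 2 ≤ 2 * κ.re / E := by
    rw [le_div_iff₀ hE]
    linarith [h1 κ hκ]
  have : badCount Γ B E κ = 2 * κ.re / E - 1 := by
    unfold badCount
    rw [max_eq_left h3, max_eq_right (by linarith)]
  exact ⟨this, by rw [this]; linarith⟩

theorem indicator_le_badCount (κ : ℂ) : B.indicator 1 κ ≤ badCount Γ B E κ := by
  by_cases h : κ ∈ B
  · rw [Set.indicator_of_mem h]
    exact (badCount_of_mem hpos hE h1 h).2
  · rw [Set.indicator_of_notMem h]
    exact badCount_nonneg κ

include h2

/-- If κ is bad, separation gives depth(κ₁) ≥ E - Re(κ - κ₁), so the count at κ₁ is at most 2 Re κ /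
E - 2, one less than at κ. Otherwise going up by Re(κ - κ₁) raises the depth by at most that amount,
and the term 2 Re κ / E compensates. -/
theorem badCount_single {κ κ₁ : ℂ} (h : κ - κ₁ ∈ Γ) :
    badCount Γ B E κ₁ ≤ badCount Γ B E κ - B.indicator 1 κ := by
  rcases le_total (2 * κ₁.re / E - max 1 (2 * badDepth Γ B E κ₁ / E)) 0 with h0 | h0
  · have : badCount Γ B E κ₁ = 0 := max_eq_left h0
    rw [this]
    linarith [indicator_le_badCount hpos hE h1 κ]
  · have h3 : badCount Γ B E κ₁ = _ := max_eq_right h0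
    have e1 : 2 * κ.re / E = 2 * κ₁.re / E + 2 * (κ.re - κ₁.re) / E := by ring
    by_cases hκ : κ ∈ B
    · rw [Set.indicator_of_mem hκ, (badCount_of_mem hpos hE h1 hκ).1, h3, Pi.one_apply]
      have h4 := le_badDepth_of_mem hpos hE h2 hκ h
      have h5 : 2 - 2 * (κ.re - κ₁.re) / E ≤ 2 * badDepth Γ B E κ₁ / E := by
        rw [le_div_iff₀ hE, sub_mul, div_mul_cancel₀ _ hE.ne']
        linarith
      have h6 := le_max_right 1 (2 * badDepth Γ B E κ₁ / E)
      linarith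
    · rw [Set.indicator_of_notMem hκ, h3, sub_zero]
      refine le_trans ?_ (le_max_right _ _)
      have h4 := badDepth_sub_le hpos hE h (B := B)
      have h0' := hpos _ h
      rw [Complex.sub_re] at h0'
      have h5 : 2 * badDepth Γ B E κ / E ≤
          2 * badDepth Γ B E κ₁ / E + 2 * (κ.re - κ₁.re) / E := by
        rw [← add_div]
        exact div_le_div_of_nonneg_right (by linarith) hE.le
      have h7 : 0 ≤ 2 * (κ.re - κ₁.re) / E := by positivity
      have h6 : max 1 (2 * badDepth Γ B E κ / E) ≤
          max 1 (2 * badDepth Γ B E κ₁ / E) + 2 * (κ.re - κ₁.re) / E := by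
        refine max_le ?_ ?_
        · linarith [le_max_left 1 (2 * badDepth Γ B E κ₁ / E)]
        · linarith [le_max_right 1 (2 * badDepth Γ B E κ₁ / E)]
      linarith

/-- The counting lemma for branching. If both counts on the left are positive, each has lost at
least 1, so their sum is at most 2 Re κ / E - 2. This is the count minus one at a bad κ, and a lower
bound for the count at any other κ since the depth never exceeds E. If one of them vanishes, the
single-branch estimate applies. -/
theorem badCount_pair {κ κ₁ κ₂ : ℂ} (h : κ - κ₁ ∈ Γ) (h' : κ - κ₂ ∈ Γ)
    (hre : κ₁.re + κ₂.re ≤ κ.re) :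
    badCount Γ B E κ₁ + badCount Γ B E κ₂ ≤ badCount Γ B E κ - B.indicator 1 κ := by
  have s1 := badCount_single hpos hE h1 h2 h
  have s2 := badCount_single hpos hE h1 h2 h'
  rcases le_total (2 * κ₁.re / E - max 1 (2 * badDepth Γ B E κ₁ / E)) 0 with h0 | h0
  · have : badCount Γ B E κ₁ = 0 := max_eq_left h0
    linarith
  rcases le_total (2 * κ₂.re / E - max 1 (2 * badDepth Γ B E κ₂ / E)) 0 with h0' | h0'
  · have : badCount Γ B E κ₂ = 0 := max_eq_left h0'
    linarith
  have h3 : badCount Γ B E κ₁ = _ := max_eq_right h0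
  have h3' : badCount Γ B E κ₂ = _ := max_eq_right h0'
  have m1 := le_max_left 1 (2 * badDepth Γ B E κ₁ / E)
  have m2 := le_max_left 1 (2 * badDepth Γ B E κ₂ / E)
  have e1 : 2 * κ₁.re / E + 2 * κ₂.re / E ≤ 2 * κ.re / E := by
    rw [← add_div]
    exact div_le_div_of_nonneg_right (by linarith) hE.le
  by_cases hκ : κ ∈ B
  · rw [Set.indicator_of_mem hκ, (badCount_of_mem hpos hE h1 hκ).1, Pi.one_apply]
    linarith
  · rw [Set.indicator_of_notMem hκ, sub_zero]
    refine le_trans ?_ (le_max_right _ _)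
    have h5 : max 1 (2 * badDepth Γ B E κ / E) ≤ 2 := by
      refine max_le (by norm_num) ?_
      rw [div_le_iff₀ hE]
      linarith [badDepth_le hpos hE κ (B := B)]
    linarith

end BadCount

/-- Small divisors with polynomial lower bounds and the separation property of Siegel can be
absorbed by damping factors of exponential size. -/
theorem exists_isDamping {Γ : AddSubsemigroup ℂ} (hpos : ∀ z ∈ Γ, 0 < z.re) {ι : Type*}
    [Fintype ι] (d : ι → ℂ → ℝ) (Λ : Set ℂ) {c γ : ℝ} (hc : 0 < c) (hγ : 0 < γ)
    (hΛ : ∀ κ ∈ Λ, 0 < κ.re)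
    (hsep : ∀ i, ∀ κ ∈ Λ, ∀ κ' ∈ Λ, κ - κ' ∈ Γ → ∀ t, d i κ ≤ t → d i κ' ≤ t →
      t ≤ 1 → c * (κ - κ').re ^ (-γ) ≤ t)
    (hlow : ∀ i, ∀ κ ∈ Λ, c * κ.re ^ (-γ) ≤ d i κ) :
    ∃ g g₂ : ℂ → ℝ, IsDamping Γ g g₂ ∧
      (∃ k : ℝ, ∀ κ : ℂ, 0 ≤ κ.re → Real.exp (-(k * κ.re)) ≤ g κ) ∧
      ∀ κ ∈ Λ, g κ ≤ g₂ κ * ∏ i, min 1 (d i κ) := by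
  -- Dyadic scales: `B i k` collects the exponents whose i-th divisor is at most 2^{-k}. By the
  -- lower bounds they are separated by E_k, the solution of c E^{-γ} = 2^{-k}.
  set B : ι → ℕ → Set ℂ := fun i k => {κ | κ ∈ Λ ∧ d i κ ≤ (1 / 2 : ℝ) ^ k} with hB
  set E : ℕ → ℝ := fun k => (c * 2 ^ k) ^ (1 / γ) with hEdef
  have hE : ∀ k, 0 < E k := fun k => by positivity
  have hEle : ∀ (k : ℕ) (x : ℝ), 0 < x → c * x ^ (-γ) ≤ (1 / 2 : ℝ) ^ k → E k ≤ x := by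
    intro k x hx h
    have h1 : c * 2 ^ k ≤ x ^ γ := by
      rw [Real.rpow_neg hx.le, one_div, inv_pow, ← div_eq_mul_inv, div_le_iff₀ (by positivity),
        inv_mul_eq_div, le_div_iff₀ (by positivity)] at h
      exact h
    calc E k ≤ (x ^ γ) ^ (1 / γ) := Real.rpow_le_rpow (by positivity) h1 (by positivity)
      _ = x := by rw [← Real.rpow_mul hx.le, mul_one_div_cancel hγ.ne', Real.rpow_one]
  have h1 : ∀ i k, ∀ κ ∈ B i k, E k ≤ κ.re := fun i k κ hκ =>
    hEle k _ (hΛ κ hκ.1) ((hlow i κ hκ.1).trans hκ.2)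
  have h2 : ∀ i k, ∀ κ ∈ B i k, ∀ κ' ∈ B i k, κ - κ' ∈ Γ → E k ≤ (κ - κ').re := by
    intro i k κ hκ κ' hκ' h
    exact hEle k _ (hpos _ h) (hsep i κ hκ.1 κ' hκ'.1 h _ hκ.2 hκ'.2
      (pow_le_one₀ (by norm_num) (by norm_num)))
  have hEinv : ∀ k, (E k)⁻¹ = (c ^ (1 / γ))⁻¹ * (((2 : ℝ) ^ (1 / γ))⁻¹) ^ k := by
    intro k
    simp only [hEdef]
    rw [Real.mul_rpow hc.le (by positivity), mul_inv, inv_pow, ← Real.rpow_natCast,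
      ← Real.rpow_natCast, ← Real.rpow_mul (by norm_num), ← Real.rpow_mul (by norm_num),
      mul_comm (k : ℝ)]
  -- E_k grows geometrically, so the total over all scales stays linear in Re κ. This is what makes
  -- the damping at worst exponential.
  have hEsum : Summable fun k => (E k)⁻¹ := by
    simp_rw [hEinv]
    refine (summable_geometric_of_lt_one (by positivity) ?_).mul_left _
    exact inv_lt_one_of_one_lt₀ (Real.one_lt_rpow (by norm_num) (by positivity))
  have hU : ∀ i κ, Summable fun k => badCount Γ (B i k) (E k) κ := by
    intro i κ
    refine Summable.of_nonneg_of_le (fun k => badCount_nonneg κ) (fun k => ?_)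
      (hEsum.mul_left (2 * |κ.re|))
    rcases le_total 0 κ.re with h | h
    · rw [abs_of_nonneg h, ← div_eq_mul_inv]
      exact badCount_le (hE k) h
    · have : badCount Γ (B i k) (E k) κ = 0 := by
        refine max_eq_left ?_
        have a1 := le_max_left (1 : ℝ) (2 * badDepth Γ (B i k) (E k) κ / E k)
        have a2 : 2 * κ.re / E k ≤ 0 := div_nonpos_of_nonpos_of_nonneg (by linarith) (hE k).le
        linarith
      rw [this]
      have := hE k
      positivity
  have hind0 : ∀ i k κ, 0 ≤ (B i k).indicator (1 : ℂ → ℝ) κ := fun i k κ =>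
    Set.indicator_nonneg (fun _ _ => zero_le_one) κ
  have hI : ∀ i κ, Summable fun k => (B i k).indicator (1 : ℂ → ℝ) κ := fun i κ =>
    Summable.of_nonneg_of_le (fun k => hind0 i k κ)
      (fun k => indicator_le_badCount hpos (hE k) (h1 i k) κ) (hU i κ)
  have hl2 : 0 < Real.log 2 := Real.log_pos (by norm_num)
  -- Each count costs a factor 1/2. Subtracting the indicators in `G₂` removes exactly the divisors
  -- at κ itself.
  set G : ℂ → ℝ := fun κ => Real.log 2 * ∑ i, ∑' k, badCount Γ (B i k) (E k) κ with hG
  set G₂ : ℂ → ℝ := fun κ => Real.log 2 * ∑ i, ∑' k, (badCount Γ (B i k) (E k) κ -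
    (B i k).indicator (1 : ℂ → ℝ) κ) with hG₂
  refine ⟨fun κ => Real.exp (-G κ), fun κ => Real.exp (-G₂ κ), ⟨fun κ => Real.exp_pos _,
    fun κ => ?_, fun κ => ?_, fun κ κ₁ h => ?_, fun κ κ₁ κ₂ h h' hre => ?_⟩,
    ⟨Real.log 2 * (Fintype.card ι * (2 * ∑' k, (E k)⁻¹)), fun κ hκ => ?_⟩, fun κ hκ => ?_⟩
  · rw [Real.exp_le_exp, neg_le_neg_iff]
    refine mul_le_mul_of_nonneg_left (Finset.sum_le_sum fun i _ => ?_) hl2.le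
    refine Summable.tsum_le_tsum (fun k => ?_) ((hU i κ).sub (hI i κ)) (hU i κ)
    linarith [hind0 i k κ]
  · rw [Real.exp_le_one_iff, neg_nonpos]
    refine mul_nonneg hl2.le (Finset.sum_nonneg fun i _ => tsum_nonneg fun k => ?_)
    linarith [indicator_le_badCount hpos (hE k) (h1 i k) κ]
  · rw [Real.exp_le_exp, neg_le_neg_iff]
    refine mul_le_mul_of_nonneg_left (Finset.sum_le_sum fun i _ => ?_) hl2.le
    exact Summable.tsum_le_tsum (fun k => badCount_single hpos (hE k) (h1 i k) (h2 i k) h)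
      (hU i κ₁) ((hU i κ).sub (hI i κ))
  · rw [← Real.exp_add, Real.exp_le_exp, ← neg_add, neg_le_neg_iff]
    simp only [hG, hG₂]
    rw [← mul_add, ← Finset.sum_add_distrib]
    refine mul_le_mul_of_nonneg_left (Finset.sum_le_sum fun i _ => ?_) hl2.le
    rw [← (hU i κ₁).tsum_add (hU i κ₂)]
    exact Summable.tsum_le_tsum (fun k => badCount_pair hpos (hE k) (h1 i k) (h2 i k) h h' hre)
      ((hU i κ₁).add (hU i κ₂)) ((hU i κ).sub (hI i κ))
  · rw [Real.exp_le_exp, neg_le_neg_iff]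
    simp only [hG]
    rw [mul_assoc]
    refine mul_le_mul_of_nonneg_left ?_ hl2.le
    have : ∀ i ∈ Finset.univ (α := ι), ∑' k, badCount Γ (B i k) (E k) κ ≤
        2 * κ.re * ∑' k, (E k)⁻¹ := by
      intro i _
      rw [← tsum_mul_left]
      refine Summable.tsum_le_tsum (fun k => ?_) (hU i κ) (hEsum.mul_left _)
      rw [← div_eq_mul_inv]
      exact badCount_le (hE k) hκ
    refine (Finset.sum_le_sum this).trans ?_
    rw [Finset.sum_const, Finset.card_univ, nsmul_eq_mul]
    exact le_of_eq (by ring)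
  · have hd : ∀ i, 0 < d i κ := fun i =>
      lt_of_lt_of_le (by have := hΛ κ hκ; positivity) (hlow i κ hκ)
    have hi : ∀ i, Real.exp (-(Real.log 2 * ∑' k, (B i k).indicator (1 : ℂ → ℝ) κ)) ≤
        min 1 (d i κ) := by
      intro i
      have h0 : 0 ≤ ∑' k, (B i k).indicator (1 : ℂ → ℝ) κ := tsum_nonneg fun k => hind0 i k κ
      refine le_min ?_ ?_
      · rw [Real.exp_le_one_iff, neg_nonpos]
        positivity
      · rcases le_total 1 (d i κ) with h | h
        · refine le_trans ?_ h
          rw [Real.exp_le_one_iff, neg_nonpos]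
          positivity
        -- With 2^{-(n+1)} < d ≤ 2^{-n}, κ is bad on the n + 1 scales 0, …, n, and the resulting
        -- factor 2^{-(n+1)} is already below d.
        · obtain ⟨n, hn1, hn2⟩ := exists_nat_pow_near_of_lt_one (hd i) h
            (by norm_num : (0 : ℝ) < 1 / 2) (by norm_num)
          have hn : ((n + 1 : ℕ) : ℝ) ≤ ∑' k, (B i k).indicator (1 : ℂ → ℝ) κ := by
            have := (hI i κ).sum_le_tsum (Finset.range (n + 1)) fun k _ => hind0 i k κ
            refine le_trans (le_of_eq ?_) this
            rw [Finset.sum_congr rfl (g := fun _ => (1 : ℝ))]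
            · simp
            · intro k hk
              rw [Finset.mem_range] at hk
              refine Set.indicator_of_mem ?_ _
              exact ⟨hκ, hn2.trans (pow_le_pow_of_le_one (by norm_num) (by norm_num)
                (by omega))⟩
          refine le_trans ?_ hn1.le
          rw [show (1 / 2 : ℝ) ^ (n + 1) = Real.exp (-(Real.log 2 * ((n + 1 : ℕ) : ℝ))) by
            rw [Real.exp_neg, mul_comm, Real.exp_nat_mul, Real.exp_log (by norm_num), one_div,
              inv_pow]]
          rw [Real.exp_le_exp, neg_le_neg_iff]
          gcongr
    have hsplit : G κ = G₂ κ + ∑ i, Real.log 2 * ∑' k, (B i k).indicator (1 : ℂ → ℝ) κ := by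
      simp only [hG, hG₂]
      rw [← Finset.mul_sum, ← mul_add, ← Finset.sum_add_distrib]
      congr 1
      refine Finset.sum_congr rfl fun i _ => ?_
      rw [(hU i κ).tsum_sub (hI i κ)]
      ring
    change Real.exp (-G κ) ≤ Real.exp (-G₂ κ) * _
    rw [hsplit, neg_add, Real.exp_add, ← Finset.sum_neg_distrib, Real.exp_sum]
    refine mul_le_mul_of_nonneg_left ?_ (Real.exp_pos _).le
    exact Finset.prod_le_prod (fun i _ => (Real.exp_pos _).le) fun i _ => hi i


/-! ### The coefficients of (1 + g)^l as polynomials in l. -/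

section Binomial

theorem choose_eq_eval (l : ℂ) (j : ℕ) :
    Ring.choose l j = (j.factorial : ℂ)⁻¹ * Polynomial.eval l (descPochhammer ℂ j) := by
  rw [Ring.choose_eq_smul, ← Polynomial.aeval_eq_smeval, Polynomial.aeval_def,
    Polynomial.eval₂_eq_eval_map, algebraMap_int_eq, descPochhammer_map, smul_eq_mul]

/-- `onePowCoeff g l i` as a polynomial in `l`. -/
def onePowPoly (g : PowerSeries ℂ) (i : ℕ) : Polynomial ℂ :=
  ∑ j ∈ Finset.range (i + 1), Polynomial.C ((j.factorial : ℂ)⁻¹ * PowerSeries.coeff i (g ^ j)) *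
    descPochhammer ℂ j

theorem eval_onePowPoly (g : PowerSeries ℂ) (i : ℕ) (l : ℂ) :
    (onePowPoly g i).eval l = onePowCoeff g l i := by
  rw [onePowPoly, onePowCoeff, Polynomial.eval_finsetSum]
  refine Finset.sum_congr rfl fun j _ => ?_
  rw [Polynomial.eval_mul, Polynomial.eval_C, choose_eq_eval]
  ring

/-- Identities for complex exponents follow from those for natural exponents, where (1 + g)^l is an
ordinary power. -/
theorem polynomial_eval_eq_of_nat {p q : Polynomial ℂ}
    (h : ∀ n : ℕ, p.eval (n : ℂ) = q.eval (n : ℂ)) (l : ℂ) : p.eval l = q.eval l := by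
  have : p = q := by
    refine Polynomial.eq_of_infinite_eval_eq p q ?_
    refine Set.Infinite.mono ?_ (Set.infinite_range_of_injective (Nat.cast_injective (R := ℂ)))
    rintro _ ⟨n, rfl⟩
    exact h n
  rw [this]

theorem coeff_pow_eq_zero {g : PowerSeries ℂ} (hg : PowerSeries.coeff 0 g = 0) {i j : ℕ}
    (hij : i < j) : PowerSeries.coeff i (g ^ j) = 0 := by
  have h1 : (PowerSeries.X : PowerSeries ℂ) ∣ g := by
    rw [PowerSeries.X_dvd_iff, ← PowerSeries.coeff_zero_eq_constantCoeff_apply, hg]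
  exact PowerSeries.X_pow_dvd_iff.mp (pow_dvd_pow_of_dvd h1 j) i hij

theorem onePowCoeff_natCast {g : PowerSeries ℂ} (hg : PowerSeries.coeff 0 g = 0) (n i : ℕ) :
    onePowCoeff g n i = PowerSeries.coeff i ((1 + g) ^ n) := by
  have h1 : onePowCoeff g n i = ∑ j ∈ Finset.range (n + i + 1),
      (n.choose j : ℂ) * PowerSeries.coeff i (g ^ j) := by
    rw [onePowCoeff]
    simp_rw [Ring.choose_natCast]
    refine Finset.sum_subset (fun j hj => ?_) fun j _ hj => ?_
    · rw [Finset.mem_range] at hj ⊢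
      omega
    · rw [Finset.mem_range] at hj
      rw [coeff_pow_eq_zero hg (by omega), mul_zero]
  rw [h1, add_comm 1 g, add_pow, map_sum]
  symm
  refine (Finset.sum_congr rfl fun j _ => ?_).trans
    (Finset.sum_subset (s₁ := Finset.range (n + 1)) (fun j hj => ?_) fun j _ hj => ?_)
  · rw [one_pow, mul_one, mul_comm, ← nsmul_eq_mul, map_nsmul, nsmul_eq_mul]
  · rw [Finset.mem_range] at hj ⊢
    omega
  · rw [Finset.mem_range] at hj
    rw [Nat.choose_eq_zero_of_lt (by omega), Nat.cast_zero, zero_mul]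

/-- Both sides are polynomials in each of α and β, and for natural numbers the identity is the law
for powers. The two exponents are freed one after the other. -/
theorem onePowCoeff_add {g : PowerSeries ℂ} (hg : PowerSeries.coeff 0 g = 0) (α β : ℂ) (k : ℕ) :
    onePowCoeff g (α + β) k =
      ∑ p ∈ Finset.HasAntidiagonal.antidiagonal k, onePowCoeff g α p.1 * onePowCoeff g β p.2 := by
  have hnat : ∀ a b : ℕ, onePowCoeff g ((a : ℂ) + b) k =
      ∑ p ∈ Finset.HasAntidiagonal.antidiagonal k, onePowCoeff g a p.1 * onePowCoeff g b p.2 := by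
    intro a b
    rw [← Nat.cast_add]
    simp_rw [onePowCoeff_natCast hg]
    rw [pow_add, PowerSeries.coeff_mul]
  have h1 : ∀ (b : ℕ) (α : ℂ), onePowCoeff g (α + b) k =
      ∑ p ∈ Finset.HasAntidiagonal.antidiagonal k, onePowCoeff g α p.1 * onePowCoeff g b p.2 := by
    intro b α
    have := polynomial_eval_eq_of_nat
      (p := (onePowPoly g k).comp (Polynomial.X + Polynomial.C (b : ℂ)))
      (q := ∑ p ∈ Finset.HasAntidiagonal.antidiagonal k, onePowPoly g p.1 * Polynomial.C (onePowCoeff g b p.2))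
      (fun n => by
        simpa [Polynomial.eval_finsetSum, eval_onePowPoly, -map_natCast] using hnat n b) α
    simpa [Polynomial.eval_finsetSum, eval_onePowPoly, -map_natCast] using this
  have := polynomial_eval_eq_of_nat
      (p := (onePowPoly g k).comp (Polynomial.C α + Polynomial.X))
      (q := ∑ p ∈ Finset.HasAntidiagonal.antidiagonal k, Polynomial.C (onePowCoeff g α p.1) * onePowPoly g p.2)
      (fun n => by
        simpa [Polynomial.eval_finsetSum, eval_onePowPoly] using h1 n α) β
  simpa [Polynomial.eval_finsetSum, eval_onePowPoly] using this

theorem onePowCoeff_zero_right (g : PowerSeries ℂ) (l : ℂ) : onePowCoeff g l 0 = 1 := by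
  simp [onePowCoeff]

theorem onePowCoeff_zero_left (g : PowerSeries ℂ) {i : ℕ} (hi : i ≠ 0) :
    onePowCoeff g 0 i = 0 := by
  rw [onePowCoeff]
  refine Finset.sum_eq_zero fun j _ => ?_
  rcases Nat.eq_zero_or_pos j with rfl | hj
  · simp [PowerSeries.coeff_one, hi]
  · rw [Ring.choose_zero_pos ℂ hj, zero_mul]

theorem onePowCoeff_zero_series {i : ℕ} (hi : i ≠ 0) (l : ℂ) : onePowCoeff 0 l i = 0 := by
  rw [onePowCoeff]
  refine Finset.sum_eq_zero fun j _ => ?_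
  rcases Nat.eq_zero_or_pos j with rfl | hj
  · simp [PowerSeries.coeff_one, hi]
  · rw [zero_pow hj.ne', map_zero, mul_zero]

theorem coeff_zero_unitTail (f : PowerSeries ℂ) (d : ℕ) :
    PowerSeries.coeff 0 (unitTail f d) = 0 := by
  simp [unitTail]

theorem eq_mul_unitTail {f : PowerSeries ℂ} (h0 : PowerSeries.coeff 0 f = 0)
    (h1 : PowerSeries.coeff 1 f ≠ 0) :
    f = PowerSeries.X * (PowerSeries.C (PowerSeries.coeff 1 f) * (1 + unitTail f 1)) := by
  ext i
  rcases i with _ | i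
  · simpa using h0
  · rw [PowerSeries.coeff_succ_X_mul, PowerSeries.coeff_C_mul, map_add, unitTail,
      PowerSeries.coeff_mk, PowerSeries.coeff_one]
    rcases i with _ | i
    · simp
    · simp only [Nat.add_eq_zero_iff, one_ne_zero, and_false, if_false, zero_add]
      rw [mul_div_cancel₀ _ h1, add_comm 1 (i + 1)]

theorem coeff_pow_eq_onePowCoeff {f : PowerSeries ℂ} (h0 : PowerSeries.coeff 0 f = 0)
    (h1 : PowerSeries.coeff 1 f ≠ 0) (n k : ℕ) :
    PowerSeries.coeff (n + k) (f ^ n) =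
      PowerSeries.coeff 1 f ^ n * onePowCoeff (unitTail f 1) n k := by
  conv_lhs => rw [eq_mul_unitTail h0 h1]
  rw [mul_pow, mul_pow, ← map_pow, add_comm n k, PowerSeries.coeff_X_pow_mul,
    PowerSeries.coeff_C_mul, onePowCoeff_natCast (coeff_zero_unitTail f 1)]

theorem hasSubst_of_coeff_zero {g : PowerSeries ℂ} (hg : PowerSeries.coeff 0 g = 0) :
    PowerSeries.HasSubst g := by
  refine PowerSeries.HasSubst.of_constantCoeff_zero' ?_
  rw [← PowerSeries.coeff_zero_eq_constantCoeff_apply, hg]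

theorem coeff_subst_eq_sum {g : PowerSeries ℂ} (hg : PowerSeries.coeff 0 g = 0)
    (f : PowerSeries ℂ) {n K : ℕ} (hn : n < K) :
    PowerSeries.coeff n (f.subst g) =
      ∑ d ∈ Finset.range K, PowerSeries.coeff d f * PowerSeries.coeff n (g ^ d) := by
  rw [PowerSeries.coeff_subst' (hasSubst_of_coeff_zero hg)]
  refine finsum_eq_sum_of_support_subset _ fun d hd => ?_
  rw [Finset.coe_range, Set.mem_Iio]
  by_contra hcon
  push Not at hcon
  refine hd ?_
  simp only [smul_eq_mul]
  rw [coeff_pow_eq_zero hg (by omega), mul_zero]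

theorem coeff_zero_subst {f g : PowerSeries ℂ} (hf : PowerSeries.coeff 0 f = 0)
    (hg : PowerSeries.coeff 0 g = 0) : PowerSeries.coeff 0 (f.subst g) = 0 := by
  rw [coeff_subst_eq_sum hg f zero_lt_one, Finset.sum_range_one, hf, zero_mul]

theorem coeff_one_subst {f g : PowerSeries ℂ} (hf : PowerSeries.coeff 0 f = 0)
    (hg : PowerSeries.coeff 0 g = 0) : PowerSeries.coeff 1 (f.subst g) =
      PowerSeries.coeff 1 f * PowerSeries.coeff 1 g := by
  rw [coeff_subst_eq_sum hg f (Nat.lt_succ_self 1), Nat.succ_eq_add_one, Finset.sum_range_succ, Finset.sum_range_one, hf,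
    zero_mul, zero_add, pow_one]

/-- For l = n natural this compares the coefficients of degree n + k in (f ∘ g)^n = f^n ∘ g, after
cancelling the powers of the multipliers. Both sides are polynomial in l. -/
theorem onePowCoeff_subst {f g : PowerSeries ℂ} (hf : PowerSeries.coeff 0 f = 0)
    (hf1 : PowerSeries.coeff 1 f ≠ 0) (hg : PowerSeries.coeff 0 g = 0)
    (hg1 : PowerSeries.coeff 1 g ≠ 0) (l : ℂ) (k : ℕ) :
    onePowCoeff (unitTail (f.subst g) 1) l k = ∑ p ∈ Finset.HasAntidiagonal.antidiagonal k,
      onePowCoeff (unitTail g 1) (l + p.2) p.1 *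
        (onePowCoeff (unitTail f 1) l p.2 * PowerSeries.coeff 1 g ^ p.2) := by
  have hs0 := coeff_zero_subst hf hg
  have hs1 := coeff_one_subst hf hg
  have hnat : ∀ n : ℕ, onePowCoeff (unitTail (f.subst g) 1) n k = ∑ p ∈ Finset.HasAntidiagonal.antidiagonal k,
      onePowCoeff (unitTail g 1) (n + p.2) p.1 *
        (onePowCoeff (unitTail f 1) n p.2 * PowerSeries.coeff 1 g ^ p.2) := by
    intro n
    have h1 := coeff_pow_eq_onePowCoeff hs0 (by rw [hs1]; exact mul_ne_zero hf1 hg1) n k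
    rw [hs1, ← PowerSeries.subst_pow (hasSubst_of_coeff_zero hg),
      coeff_subst_eq_sum hg _ (Nat.lt_succ_self (n + k)), Nat.succ_eq_add_one, add_assoc,
      Finset.sum_range_add, Finset.sum_eq_zero, zero_add] at h1
    · refine mul_left_cancel₀ (pow_ne_zero n (mul_ne_zero hf1 hg1)) ?_
      rw [← h1, Finset.mul_sum, ← Finset.Nat.sum_antidiagonal_swap,
        Finset.Nat.sum_antidiagonal_eq_sum_range_succ_mk]
      refine Finset.sum_congr rfl fun j hj => ?_
      rw [Finset.mem_range] at hj
      have e : n + k = (n + j) + (k - j) := by omega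
      rw [coeff_pow_eq_onePowCoeff hf hf1, e, coeff_pow_eq_onePowCoeff hg hg1]
      simp only [Prod.swap_prod_mk, Nat.cast_add]
      rw [mul_pow, pow_add]
      ring
    · intro j hj
      rw [Finset.mem_range] at hj
      rw [coeff_pow_eq_zero hf hj, zero_mul]
  have := polynomial_eval_eq_of_nat (p := onePowPoly (unitTail (f.subst g) 1) k)
    (q := ∑ p ∈ Finset.HasAntidiagonal.antidiagonal k,
      (onePowPoly (unitTail g 1) p.1).comp (Polynomial.X + Polynomial.C (p.2 : ℂ)) *
        (onePowPoly (unitTail f 1) p.2 * Polynomial.C (PowerSeries.coeff 1 g ^ p.2)))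
    (fun n => by
      simpa [Polynomial.eval_finsetSum, eval_onePowPoly, -map_natCast, -map_pow] using hnat n) l
  simpa [Polynomial.eval_finsetSum, eval_onePowPoly, -map_natCast, -map_pow] using this

end Binomial

/-! ### Formal composition is compatible with composition of germs. -/

section Composition

theorem compCoeff_eq_sum (f : PowerSeries ℂ) {d : ℕ} (hd : 1 ≤ d) (la : ℂ) (φ : GenSeries) {μ : ℂ}
    {K : ℕ} (hK : μ.re ≤ K) : compCoeff f d la φ μ = ∑ i ∈ Finset.range K,
      φ.coeff ((μ - i) / d) * Complex.exp ((μ - i) / d * la) *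
        onePowCoeff (unitTail f d) ((μ - i) / d) i := by
  refine finsum_eq_sum_of_support_subset _ fun i hi => ?_
  have h1 := φ.re_pos _ (left_ne_zero_of_mul (left_ne_zero_of_mul hi))
  have hd' : (0 : ℝ) < d := by exact_mod_cast hd
  rw [Complex.div_natCast_re, Complex.sub_re, Complex.natCast_re, div_pos_iff_of_pos_right hd'] at h1
  rw [Finset.coe_range, Set.mem_Iio]
  have : (i : ℝ) < K := by linarith
  exact_mod_cast this

theorem compCoeff_one_eq_sum (f : PowerSeries ℂ) (la : ℂ) (φ : GenSeries) {μ : ℂ}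
    {K : ℕ} (hK : μ.re ≤ K) : compCoeff f 1 la φ μ = ∑ i ∈ Finset.range K,
      φ.coeff (μ - i) * Complex.exp ((μ - i) * la) * onePowCoeff (unitTail f 1) (μ - i) i := by
  rw [compCoeff_eq_sum f le_rfl la φ hK]
  simp

theorem sum_antidiagonal_eq_sum_range (T : ℕ → ℕ → ℂ) (K : ℕ) (h : ∀ i j, K ≤ i + j → T i j = 0) :
    ∑ k ∈ Finset.range K, ∑ p ∈ Finset.HasAntidiagonal.antidiagonal k, T p.1 p.2 =
      ∑ i ∈ Finset.range K, ∑ j ∈ Finset.range K, T i j := by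
  rw [← Finset.sum_product', ← Finset.sum_filter_of_ne (p := fun p : ℕ × ℕ => p.1 + p.2 < K)]
  · rw [← Finset.sum_fiberwise_of_maps_to (t := Finset.range K) (g := fun p : ℕ × ℕ => p.1 + p.2)]
    · refine Finset.sum_congr rfl fun k hk => Finset.sum_congr ?_ fun _ _ => rfl
      ext p
      simp only [Finset.HasAntidiagonal.mem_antidiagonal, Finset.mem_filter, Finset.mem_product,
        Finset.mem_range] at hk ⊢
      omega
    · intro p hp
      rw [Finset.mem_filter] at hp
      exact Finset.mem_range.mpr hp.2
  · intro p _ hp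
    by_contra hcon
    exact hp (h _ _ (by omega))

/-- The chosen logarithms add, which fixes the branch for the composite. The rest is the expansion
of (f ∘ g)^l, rearranged as a double sum over the two integer shifts. -/
theorem GenSeries.comp_comp {f g : PowerSeries ℂ} {la lb : ℂ} (hf : PowerSeries.coeff 0 f = 0)
    (hf1 : PowerSeries.coeff 1 f = Complex.exp la) (hg : PowerSeries.coeff 0 g = 0)
    (hg1 : PowerSeries.coeff 1 g = Complex.exp lb) (φ : GenSeries) :
    GenSeries.comp g 1 lb (GenSeries.comp f 1 la φ) =
      GenSeries.comp (f.subst g) 1 (la + lb) φ := by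
  ext μ
  change compCoeff g 1 lb (GenSeries.comp f 1 la φ) μ = compCoeff (f.subst g) 1 (la + lb) φ μ
  set K := ⌈μ.re⌉₊
  have hK : μ.re ≤ K := Nat.le_ceil _
  rw [compCoeff_one_eq_sum _ _ _ hK, compCoeff_one_eq_sum _ _ _ hK]
  have hf1' : PowerSeries.coeff 1 f ≠ 0 := by rw [hf1]; exact Complex.exp_ne_zero _
  have hg1' : PowerSeries.coeff 1 g ≠ 0 := by rw [hg1]; exact Complex.exp_ne_zero _
  set T : ℕ → ℕ → ℂ := fun i j => φ.coeff (μ - (i + j : ℕ)) *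
    Complex.exp ((μ - (i + j : ℕ)) * (la + lb)) *
    (onePowCoeff (unitTail g 1) (μ - i) i *
      (onePowCoeff (unitTail f 1) (μ - (i + j : ℕ)) j * Complex.exp lb ^ j)) with hT
  -- Shifting μ down by at least Re μ leaves the exponents of φ, so the triangular sum can be
  -- completed to a square.
  have hT0 : ∀ i j, K ≤ i + j → T i j = 0 := by
    intro i j hij
    have : φ.coeff (μ - (i + j : ℕ)) = 0 := by
      by_contra hcon
      have h1 := φ.re_pos _ hcon
      rw [Complex.sub_re, Complex.natCast_re] at h1
      have : (K : ℝ) ≤ (i + j : ℕ) := by exact_mod_cast hij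
      linarith
    simp only [hT, this, zero_mul]
  have hr : ∀ k ∈ Finset.range K, φ.coeff (μ - k) * Complex.exp ((μ - k) * (la + lb)) *
      onePowCoeff (unitTail (f.subst g) 1) (μ - k) k =
      ∑ p ∈ Finset.HasAntidiagonal.antidiagonal k, T p.1 p.2 := by
    intro k _
    rw [onePowCoeff_subst hf hf1' hg hg1', Finset.mul_sum]
    refine Finset.sum_congr rfl fun p hp => ?_
    rw [Finset.HasAntidiagonal.mem_antidiagonal] at hp
    have e : μ - (k : ℂ) + p.2 = μ - p.1 := by
      rw [← hp]
      push_cast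
      ring
    simp only [hT, hp, e, hg1]
  rw [Finset.sum_congr rfl hr, sum_antidiagonal_eq_sum_range T K hT0]
  refine Finset.sum_congr rfl fun i _ => ?_
  have h1 : (GenSeries.comp f 1 la φ).coeff (μ - i) = _ :=
    compCoeff_one_eq_sum f la φ (μ := μ - i) (K := K) (by
      rw [Complex.sub_re, Complex.natCast_re]
      have : (0 : ℝ) ≤ i := Nat.cast_nonneg i
      linarith)
  rw [h1, Finset.sum_mul, Finset.sum_mul]
  refine Finset.sum_congr rfl fun j _ => ?_
  have e : μ - (i : ℂ) - j = μ - (i + j : ℕ) := by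
    push_cast
    ring
  simp only [hT, e]
  have e2 : Complex.exp ((μ - (i + j : ℕ)) * (la + lb)) * Complex.exp lb ^ j =
      Complex.exp ((μ - (i + j : ℕ)) * la) * Complex.exp ((μ - i) * lb) := by
    rw [← Complex.exp_nat_mul, ← Complex.exp_add, ← Complex.exp_add]
    congr 1
    push_cast
    ring
  linear_combination (- φ.coeff (μ - (i + j : ℕ)) * onePowCoeff (unitTail g 1) (μ - i) i *
      onePowCoeff (unitTail f 1) (μ - (i + j : ℕ)) j) * e2

theorem unitTail_C_mul_X (q : ℂ) : unitTail (PowerSeries.C q * PowerSeries.X) 1 = 0 := by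
  ext i
  rw [unitTail, PowerSeries.coeff_mk, map_zero]
  split_ifs with h
  · rfl
  · rw [PowerSeries.coeff_C_mul, PowerSeries.coeff_X, if_neg (by omega), mul_zero, zero_div]

theorem coeff_comp_C_mul_X (q lq : ℂ) (φ : GenSeries) (μ : ℂ) :
    (GenSeries.comp (PowerSeries.C q * PowerSeries.X) 1 lq φ).coeff μ =
      φ.coeff μ * Complex.exp (μ * lq) := by
  have h := compCoeff_one_eq_sum (PowerSeries.C q * PowerSeries.X) lq φ (μ := μ)
    (K := ⌈μ.re⌉₊ + 1) ((Nat.le_ceil _).trans (by push_cast; linarith))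
  refine h.trans ?_
  rw [unitTail_C_mul_X, Finset.sum_range_succ', Finset.sum_eq_zero, zero_add]
  · simp [onePowCoeff_zero_right]
  · intro i _
    rw [onePowCoeff_zero_series (Nat.succ_ne_zero i), mul_zero]

theorem comp_X (φ : GenSeries) : GenSeries.comp PowerSeries.X 1 0 φ = φ := by
  ext μ
  have := coeff_comp_C_mul_X 1 0 φ μ
  simpa using this

theorem coeff_iterate_comp_C_mul_X (q lq : ℂ) (φ : GenSeries) (j : ℕ) (μ : ℂ) :
    ((GenSeries.comp (PowerSeries.C q * PowerSeries.X) 1 lq)^[j] φ).coeff μ =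
      φ.coeff μ * Complex.exp (μ * lq) ^ j := by
  induction j generalizing φ with
  | zero => simp
  | succ j ih =>
    rw [Function.iterate_succ_apply, ih, coeff_comp_C_mul_X, pow_succ']
    ring

theorem coeff_comp_add {f : PowerSeries ℂ} {d : ℕ} (hd : 1 ≤ d) (la : ℂ) {φ a b : GenSeries}
    (h : ∀ l, φ.coeff l = a.coeff l + b.coeff l) (l : ℂ) :
    (GenSeries.comp f d la φ).coeff l =
      (GenSeries.comp f d la a).coeff l + (GenSeries.comp f d la b).coeff l := by
  change compCoeff f d la φ l = compCoeff f d la a l + compCoeff f d la b l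
  rw [compCoeff_eq_sum f hd la _ (Nat.le_ceil _), compCoeff_eq_sum f hd la _ (Nat.le_ceil _),
    compCoeff_eq_sum f hd la _ (Nat.le_ceil _), ← Finset.sum_add_distrib]
  refine Finset.sum_congr rfl fun i _ => ?_
  rw [h]
  ring

theorem coeff_iterate_comp_add {f : PowerSeries ℂ} {d : ℕ} (hd : 1 ≤ d) (la : ℂ)
    {φ a b : GenSeries} (h : ∀ l, φ.coeff l = a.coeff l + b.coeff l) (j : ℕ) (l : ℂ) :
    ((GenSeries.comp f d la)^[j] φ).coeff l =
      ((GenSeries.comp f d la)^[j] a).coeff l + ((GenSeries.comp f d la)^[j] b).coeff l := by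
  induction j generalizing φ a b with
  | zero => exact h l
  | succ j ih =>
    simp only [Function.iterate_succ_apply]
    exact ih (coeff_comp_add hd la h)

end Composition


/-! ### Norm estimates for composition. -/

section CompositionNorm

/-- With m = ⌈|l|⌉ one has |l - i| ≤ m + i, so |binom(l, j)| ≤ binom(m + j - 1, j) ≤ 2^{m + j}. -/
theorem norm_choose_le (l : ℂ) (j : ℕ) : ‖Ring.choose l j‖ ≤ 2 ^ (⌈‖l‖⌉₊ + j) := by
  set m := ⌈‖l‖⌉₊ with hm
  have h1 : ‖∏ i ∈ Finset.range j, (l - i)‖ ≤ (m.ascFactorial j : ℝ) := by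
    rw [norm_prod, Nat.ascFactorial_eq_prod_range]
    push_cast
    refine Finset.prod_le_prod (fun _ _ => norm_nonneg _) fun i _ => ?_
    refine (norm_sub_le _ _).trans ?_
    rw [Complex.norm_natCast]
    gcongr
    exact Nat.le_ceil _
  have h2 : ((m + j - 1).choose j : ℝ) ≤ 2 ^ (m + j) := by
    have h3 : (m + j - 1).choose j ≤ 2 ^ (m + j) :=
      (Nat.choose_le_two_pow _ _).trans (Nat.pow_le_pow_right two_pos (Nat.sub_le _ _))
    exact_mod_cast h3
  rw [choose_eq_eval, descPochhammer_eval_eq_prod_range, norm_mul, norm_inv, Complex.norm_natCast,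
    inv_mul_le_iff₀ (by positivity)]
  refine h1.trans ?_
  rw [Nat.ascFactorial_eq_factorial_mul_choose', Nat.cast_mul]
  gcongr

/-- The sum of the moduli of the terms of a power series at `r`. -/
def pw (r : ℝ) (g : PowerSeries ℂ) : ℝ≥0∞ :=
  ∑' i : ℕ, ‖PowerSeries.coeff i g‖ₑ * ENNReal.ofReal r ^ i

theorem pw_one (r : ℝ) : pw r 1 = 1 := by
  unfold pw
  rw [tsum_eq_single 0]
  · simp
  · intro i hi
    rw [PowerSeries.coeff_one, if_neg hi, enorm_zero, zero_mul]

theorem pw_mul_le (r : ℝ) (g h : PowerSeries ℂ) : pw r (g * h) ≤ pw r g * pw r h := by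
  unfold pw
  calc ∑' i, ‖PowerSeries.coeff i (g * h)‖ₑ * ENNReal.ofReal r ^ i
      ≤ ∑' i, ∑ p ∈ Finset.HasAntidiagonal.antidiagonal i,
        (‖PowerSeries.coeff p.1 g‖ₑ * ENNReal.ofReal r ^ p.1) *
          (‖PowerSeries.coeff p.2 h‖ₑ * ENNReal.ofReal r ^ p.2) := by
        refine ENNReal.tsum_le_tsum fun i => ?_
        rw [PowerSeries.coeff_mul]
        refine (mul_le_mul_left (enorm_sum_le _ _) _).trans ?_
        rw [Finset.sum_mul]
        refine Finset.sum_le_sum fun p hp => ?_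
        rw [Finset.HasAntidiagonal.mem_antidiagonal] at hp
        rw [enorm_mul, ← hp, pow_add]
        exact le_of_eq (by ring)
    _ = ∑' p : ℕ × ℕ, (‖PowerSeries.coeff p.1 g‖ₑ * ENNReal.ofReal r ^ p.1) *
          (‖PowerSeries.coeff p.2 h‖ₑ * ENNReal.ofReal r ^ p.2) := by
        rw [← (Finset.HasAntidiagonal.sigmaAntidiagonalEquivProd (A := ℕ)).tsum_eq,
          ENNReal.tsum_sigma']
        refine tsum_congr fun i => ?_
        exact (Finset.tsum_subtype _ fun p : ℕ × ℕ =>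
          (‖PowerSeries.coeff p.1 g‖ₑ * ENNReal.ofReal r ^ p.1) *
          (‖PowerSeries.coeff p.2 h‖ₑ * ENNReal.ofReal r ^ p.2)).symm
    _ = _ := by
        refine (ENNReal.tsum_prod (f := fun i j => (‖PowerSeries.coeff i g‖ₑ *
          ENNReal.ofReal r ^ i) * (‖PowerSeries.coeff j h‖ₑ * ENNReal.ofReal r ^ j))).trans ?_
        simp_rw [ENNReal.tsum_mul_left, ENNReal.tsum_mul_right]

theorem pw_pow_le (r : ℝ) (g : PowerSeries ℂ) (j : ℕ) : pw r (g ^ j) ≤ pw r g ^ j := by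
  induction j with
  | zero => simp [pw_one]
  | succ j ih =>
    rw [pow_succ, pow_succ]
    exact (pw_mul_le _ _ _).trans (mul_le_mul_left ih _)

/-- The bound 1/4 on g beats the growth 2^j of the binomial coefficients and leaves a geometric
series of ratio 1/2. The price is exponential in |l|, hence only a change of radius once |l| ≤ κ Re
l. -/
theorem tsum_onePowCoeff_le {r : ℝ} {g : PowerSeries ℂ} (hg : pw r g ≤ 4⁻¹) (l : ℂ) :
    ∑' i, ‖onePowCoeff g l i‖ₑ * ENNReal.ofReal r ^ i ≤ 2 ^ (⌈‖l‖⌉₊ + 1) := by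
  calc ∑' i, ‖onePowCoeff g l i‖ₑ * ENNReal.ofReal r ^ i
      ≤ ∑' i, ∑' j, ‖Ring.choose l j‖ₑ *
          (‖PowerSeries.coeff i (g ^ j)‖ₑ * ENNReal.ofReal r ^ i) := by
        refine ENNReal.tsum_le_tsum fun i => ?_
        refine le_trans ?_ (ENNReal.sum_le_tsum (Finset.range (i + 1)))
        rw [onePowCoeff]
        refine (mul_le_mul_left (enorm_sum_le _ _) _).trans ?_
        rw [Finset.sum_mul]
        refine Finset.sum_le_sum fun j _ => ?_
        rw [enorm_mul, mul_assoc]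
    _ = ∑' j, ‖Ring.choose l j‖ₑ * pw r (g ^ j) := by
        rw [ENNReal.tsum_comm]
        simp_rw [ENNReal.tsum_mul_left]
        rfl
    _ ≤ ∑' j : ℕ, 2 ^ ⌈‖l‖⌉₊ * 2⁻¹ ^ j := by
        refine ENNReal.tsum_le_tsum fun j => ?_
        have h1 : ‖Ring.choose l j‖ₑ ≤ 2 ^ (⌈‖l‖⌉₊ + j) := by
          rw [← ofReal_norm, ← ENNReal.ofReal_ofNat 2, ← ENNReal.ofReal_pow (by norm_num)]
          exact ENNReal.ofReal_le_ofReal (norm_choose_le l j)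
        have h2 : pw r (g ^ j) ≤ 4⁻¹ ^ j := (pw_pow_le r g j).trans (pow_le_pow_left' hg j)
        refine (mul_le_mul' h1 h2).trans (le_of_eq ?_)
        rw [pow_add, mul_assoc, ← mul_pow]
        congr 2
        rw [show (4 : ℝ≥0∞) = 2 * 2 by norm_num, ENNReal.mul_inv (by simp) (by simp), ← mul_assoc,
          ENNReal.mul_inv_cancel (by simp) (by simp), one_mul]
    _ = _ := by
        rw [ENNReal.tsum_mul_left, ENNReal.tsum_geometric_two, pow_succ]

theorem pw_le_of_le {g : PowerSeries ℂ} (hg : PowerSeries.coeff 0 g = 0) {r r₀ : ℝ} (hr : 0 < r)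
    (hrr : r ≤ r₀) : pw r g ≤ ENNReal.ofReal (r / r₀) * pw r₀ g := by
  have hr₀ := hr.trans_le hrr
  unfold pw
  rw [← ENNReal.tsum_mul_left]
  refine ENNReal.tsum_le_tsum fun i => ?_
  rcases i with _ | i
  · simp [hg]
  · rw [mul_left_comm]
    gcongr
    rw [← ENNReal.ofReal_pow hr.le, ← ENNReal.ofReal_pow hr₀.le,
      ← ENNReal.ofReal_mul (by positivity)]
    refine ENNReal.ofReal_le_ofReal ?_
    have h1 : r ^ (i + 1) = (r / r₀) * (r₀ * r ^ i) := by
      field_simp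
      ring
    rw [h1, pow_succ' r₀]
    gcongr

theorem exists_pw_le {g : PowerSeries ℂ} (hg : PowerSeries.coeff 0 g = 0) {r₀ : ℝ} (hr₀ : 0 < r₀)
    (h : pw r₀ g < ⊤) : ∃ ρ > 0, ∀ r, 0 < r → r ≤ ρ → pw r g ≤ 4⁻¹ := by
  set N := (pw r₀ g).toReal with hN
  have hN0 : 0 ≤ N := ENNReal.toReal_nonneg
  refine ⟨r₀ / (4 * (N + 1)), by positivity, fun r hr hrr => ?_⟩
  have h1 : r ≤ r₀ := hrr.trans (div_le_self hr₀.le (by linarith))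
  refine (pw_le_of_le hg hr h1).trans ?_
  rw [← ENNReal.ofReal_toReal h.ne, ← hN, ← ENNReal.ofReal_mul (by positivity)]
  have h2 : (4 : ℝ≥0∞)⁻¹ = ENNReal.ofReal (1 / 4) := by
    rw [one_div, ENNReal.ofReal_inv_of_pos (by norm_num)]
    norm_num
  rw [h2]
  refine ENNReal.ofReal_le_ofReal ?_
  rw [le_div_iff₀ (by positivity)] at hrr
  rw [div_mul_eq_mul_div, div_le_div_iff₀ hr₀ (by norm_num)]
  nlinarith

theorem HasTaylorSeries₁.exists_pw_lt_top {f : ℂ → ℂ} {fs : PowerSeries ℂ}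
    (h : HasTaylorSeries₁ f fs) : ∃ r > 0, pw r fs < ⊤ := by
  obtain ⟨δ, hδ, hball⟩ := Metric.eventually_nhds_iff.mp h
  refine ⟨δ / 2, by positivity, ?_⟩
  have h1 := hball (y := ((δ / 2 : ℝ) : ℂ)) (by
    rw [dist_zero_right, Complex.norm_real, Real.norm_of_nonneg (by positivity)]
    linarith)
  have h2 := h1.summable.norm
  have h3 := h2.tsum_ofReal_lt_top
  refine lt_of_eq_of_lt ?_ h3
  refine tsum_congr fun i => ?_
  rw [← ofReal_norm, ← ENNReal.ofReal_pow (by positivity), ← ENNReal.ofReal_mul (norm_nonneg _),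
    norm_mul, norm_pow, Complex.norm_real, Real.norm_of_nonneg (by positivity)]

theorem pw_unitTail_lt_top {f : PowerSeries ℂ} {d : ℕ} (hf : PowerSeries.coeff d f ≠ 0) {r : ℝ}
    (hr : 0 < r) (h : pw r f < ⊤) : pw r (unitTail f d) < ⊤ := by
  set a := PowerSeries.coeff d f
  have hr' : ENNReal.ofReal r ≠ 0 := by simpa using hr
  have h1 : pw r (unitTail f d) ≤ (‖a‖ₑ * ENNReal.ofReal r ^ d)⁻¹ * pw r f := by
    unfold pw
    rw [← ENNReal.tsum_mul_left]
    have h2 : ∀ i, ‖PowerSeries.coeff i (unitTail f d)‖ₑ * ENNReal.ofReal r ^ i ≤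
        (‖a‖ₑ * ENNReal.ofReal r ^ d)⁻¹ *
          (‖PowerSeries.coeff (d + i) f‖ₑ * ENNReal.ofReal r ^ (d + i)) := by
      intro i
      rw [unitTail, PowerSeries.coeff_mk]
      split_ifs with hi
      · simp
      · have ha : ‖a‖ₑ ≠ 0 := by simpa using hf
        have hrd : ENNReal.ofReal r ^ d ≠ 0 := pow_ne_zero _ hr'
        have hrt : ENNReal.ofReal r ^ d ≠ ⊤ := by finiteness
        rw [div_eq_mul_inv, enorm_mul, enorm_inv hf, pow_add,
          ENNReal.mul_inv (Or.inl ha) (Or.inl enorm_ne_top)]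
        refine le_of_eq ?_
        calc ‖PowerSeries.coeff (d + i) f‖ₑ * ‖a‖ₑ⁻¹ * ENNReal.ofReal r ^ i
            = ‖a‖ₑ⁻¹ * (((ENNReal.ofReal r ^ d)⁻¹ * ENNReal.ofReal r ^ d) *
              (‖PowerSeries.coeff (d + i) f‖ₑ * ENNReal.ofReal r ^ i)) := by
              rw [ENNReal.inv_mul_cancel hrd hrt]
              ring
          _ = _ := by ring
    refine (ENNReal.tsum_le_tsum h2).trans ?_
    exact ENNReal.tsum_comp_le_tsum_of_injective (add_right_injective d)
      (fun i => (‖a‖ₑ * ENNReal.ofReal r ^ d)⁻¹ *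
          (‖PowerSeries.coeff i f‖ₑ * ENNReal.ofReal r ^ i))
  refine h1.trans_lt (ENNReal.mul_lt_top ?_ h)
  rw [ENNReal.inv_lt_top]
  exact pos_iff_ne_zero.mpr (mul_ne_zero (by simpa using hf) (pow_ne_zero _ hr'))

theorem nm_comp_le (f : PowerSeries ℂ) {d : ℕ} (hd : 1 ≤ d) (la : ℂ) (φ : GenSeries)
    (W : ℂ → ℝ≥0∞) : nm W (GenSeries.comp f d la φ).toHahn ≤
      ∑' l, ‖φ.coeff l‖ₑ * (‖Complex.exp (l * la)‖ₑ *
        ∑' i : ℕ, ‖onePowCoeff (unitTail f d) l i‖ₑ * W (d * l + i)) := by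
  have hd0 : (d : ℂ) ≠ 0 := Nat.cast_ne_zero.mpr (by omega)
  have h1 : ∀ μ, ‖cf (GenSeries.comp f d la φ).toHahn μ‖ₑ ≤ ∑' i : ℕ,
      ‖φ.coeff ((μ - i) / d) * Complex.exp ((μ - i) / d * la) *
        onePowCoeff (unitTail f d) ((μ - i) / d) i‖ₑ := by
    intro μ
    have h2 : cf (GenSeries.comp f d la φ).toHahn μ = _ :=
      compCoeff_eq_sum f hd la φ (Nat.le_ceil μ.re)
    rw [h2]
    exact (enorm_sum_le _ _).trans (ENNReal.sum_le_tsum _)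
  calc nm W (GenSeries.comp f d la φ).toHahn
      ≤ ∑' μ, ∑' i : ℕ, ‖φ.coeff ((μ - i) / d) * Complex.exp ((μ - i) / d * la) *
        onePowCoeff (unitTail f d) ((μ - i) / d) i‖ₑ * W μ := by
        refine ENNReal.tsum_le_tsum fun μ => ?_
        rw [ENNReal.tsum_mul_right]
        exact mul_le_mul_left (h1 μ) _
    _ = ∑' i : ℕ, ∑' μ, ‖φ.coeff ((μ - i) / d) * Complex.exp ((μ - i) / d * la) *
        onePowCoeff (unitTail f d) ((μ - i) / d) i‖ₑ * W μ := ENNReal.tsum_comm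
    _ = ∑' i : ℕ, ∑' l, ‖φ.coeff l * Complex.exp (l * la) *
        onePowCoeff (unitTail f d) l i‖ₑ * W (d * l + i) := by
        refine tsum_congr fun i => ?_
        rw [← ((Equiv.mulLeft₀ (d : ℂ) hd0).trans (Equiv.addRight (i : ℂ))).tsum_eq]
        refine tsum_congr fun l => ?_
        have e : ((Equiv.mulLeft₀ (d : ℂ) hd0).trans (Equiv.addRight (i : ℂ))) l = d * l + i := rfl
        rw [e, add_sub_cancel_right, mul_div_cancel_left₀ _ hd0]
    _ = _ := by
        rw [ENNReal.tsum_comm]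
        refine tsum_congr fun l => ?_
        rw [← ENNReal.tsum_mul_left, ← ENNReal.tsum_mul_left]
        refine tsum_congr fun i => ?_
        rw [enorm_mul, enorm_mul]
        ring

/-- The weight `r ^ Re μ`, cut off at real part `B`. -/
def wtCut (r B : ℝ) (μ : ℂ) : ℝ≥0∞ := if μ.re ≤ B then wt r μ else 0

/-- Both |a^l| and 2^{|l|} are exponential in |l| ≤ κ Re l, so composition multiplies the new radius
r^d by the fixed factor exp(κ(1 + |la|)). As Re(d l + i) ≥ d Re l, a cut-off at B needs only the
coefficients up to B/d. -/
theorem nm_comp_wtCut_le {f : PowerSeries ℂ} {d : ℕ} (hd : 1 ≤ d) (la : ℂ) {κ : ℝ}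
    {φ : GenSeries} (hφ : ∀ l, φ.coeff l ≠ 0 → ‖l‖ ≤ κ * l.re) {r : ℝ} (hr : 0 < r)
    (hg : pw r (unitTail f d) ≤ 4⁻¹) (B : ℝ) :
    nm (wtCut r B) (GenSeries.comp f d la φ).toHahn ≤
      4 * nm (wtCut (Real.exp (κ * (1 + ‖la‖)) * r ^ d) (B / d)) φ.toHahn := by
  have hd0 : (0 : ℝ) < d := by exact_mod_cast hd
  refine (nm_comp_le f hd la φ _).trans ?_
  unfold nm
  rw [← ENNReal.tsum_mul_left]
  refine ENNReal.tsum_le_tsum fun l => ?_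
  change ‖φ.coeff l‖ₑ * _ ≤ 4 * (‖φ.coeff l‖ₑ * _)
  by_cases hl : φ.coeff l = 0
  · simp [hl]
  rw [mul_left_comm 4]
  suffices hmain : _ ≤ _ from mul_le_mul_right hmain ‖φ.coeff l‖ₑ
  have hre : (d * l : ℂ).re = d * l.re := by simp
  by_cases hB : l.re ≤ B / d
  · have h1 : ∑' i : ℕ, ‖onePowCoeff (unitTail f d) l i‖ₑ * wtCut r B (d * l + i) ≤
        ENNReal.ofReal (2 ^ (⌈‖l‖⌉₊ + 1)) * wt r (d * l) := by
      calc _ ≤ ∑' i : ℕ, ‖onePowCoeff (unitTail f d) l i‖ₑ * ENNReal.ofReal r ^ i *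
            wt r (d * l) := by
            refine ENNReal.tsum_le_tsum fun i => ?_
            rw [mul_assoc]
            gcongr
            unfold wtCut
            split_ifs
            · rw [wt_add hr, mul_comm]
              gcongr
              rw [wt, Complex.natCast_re, Real.rpow_natCast, ENNReal.ofReal_pow hr.le]
            · exact zero_le
        _ = (∑' i : ℕ, ‖onePowCoeff (unitTail f d) l i‖ₑ * ENNReal.ofReal r ^ i) *
            wt r (d * l) := ENNReal.tsum_mul_right
        _ ≤ _ := by
            gcongr
            refine (tsum_onePowCoeff_le hg l).trans (le_of_eq ?_)
            rw [ENNReal.ofReal_pow (by norm_num), ENNReal.ofReal_ofNat]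
    rw [wtCut, if_pos hB]
    refine (mul_le_mul_right h1 _).trans ?_
    unfold wt
    rw [← ofReal_norm, ← ENNReal.ofReal_mul (by positivity), ← ENNReal.ofReal_mul (by positivity),
      ← ENNReal.ofReal_ofNat 4, ← ENNReal.ofReal_mul (by positivity)]
    refine ENNReal.ofReal_le_ofReal ?_
    have hk := hφ l hl
    have e1 : ‖Complex.exp (l * la)‖ ≤ Real.exp (‖l‖ * ‖la‖) := by
      rw [Complex.norm_exp, ← norm_mul]
      exact Real.exp_le_exp.mpr (Complex.re_le_norm _)
    have e2 : (2 : ℝ) ^ (⌈‖l‖⌉₊ + 1) ≤ 4 * Real.exp ‖l‖ := by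
      have h3 : (⌈‖l‖⌉₊ : ℝ) ≤ ‖l‖ + 1 := (Nat.ceil_lt_add_one (norm_nonneg l)).le
      have h4 : (2 : ℝ) ^ ((⌈‖l‖⌉₊ : ℝ) + 1) ≤ 2 ^ (‖l‖ + 2) :=
        Real.rpow_le_rpow_of_exponent_le one_le_two (by linarith)
      have h5 : (2 : ℝ) ^ ‖l‖ ≤ Real.exp ‖l‖ := by
        rw [← Real.exp_one_rpow]
        exact Real.rpow_le_rpow (by norm_num) (by linarith [Real.add_one_le_exp 1])
          (norm_nonneg l)
      rw [Real.rpow_add two_pos ‖l‖] at h4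
      have h6 : (2 : ℝ) ^ (⌈‖l‖⌉₊ + 1) = (2 : ℝ) ^ ((⌈‖l‖⌉₊ : ℝ) + 1) := by
        rw [← Real.rpow_natCast]
        push_cast
        rfl
      rw [h6]
      refine h4.trans ?_
      norm_num
      linarith
    have hrd : (r ^ d) ^ l.re = r ^ (d * l.re) := by
      rw [← Real.rpow_natCast, ← Real.rpow_mul hr.le]
    rw [hre, Real.mul_rpow (by positivity) (by positivity), ← Real.exp_mul, hrd]
    have e3 : Real.exp (‖l‖ * ‖la‖) * Real.exp ‖l‖ ≤ Real.exp (κ * (1 + ‖la‖) * l.re) := by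
      rw [← Real.exp_add]
      refine Real.exp_le_exp.mpr ?_
      nlinarith [norm_nonneg la]
    calc ‖Complex.exp (l * la)‖ * (2 ^ (⌈‖l‖⌉₊ + 1) * r ^ (d * l.re))
        ≤ Real.exp (‖l‖ * ‖la‖) * ((4 * Real.exp ‖l‖) * r ^ (d * l.re)) := by gcongr
      _ = 4 * ((Real.exp (‖l‖ * ‖la‖) * Real.exp ‖l‖) * r ^ (d * l.re)) := by ring
      _ ≤ _ := by gcongr
  · have : ∀ i : ℕ, wtCut r B (d * l + i) = 0 := by
      intro i
      rw [wtCut, if_neg]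
      rw [Complex.add_re, hre, Complex.natCast_re]
      rw [not_le, div_lt_iff₀ hd0] at hB
      have : (0 : ℝ) ≤ i := Nat.cast_nonneg i
      linarith
    simp [this]

theorem nm_wt_eq_iSup (r : ℝ) (H : HS) : nm (wt r) H = ⨆ B : ℝ, nm (wtCut r B) H := by
  refine le_antisymm ?_ (iSup_le fun B => ENNReal.tsum_le_tsum fun μ => ?_)
  · rw [nm, ENNReal.tsum_eq_iSup_sum]
    refine iSup_le fun s => ?_
    obtain ⟨B, hB⟩ := (s.image Complex.re).exists_le
    refine le_trans ?_ (le_iSup _ B)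
    refine le_trans (le_of_eq (Finset.sum_congr rfl fun μ hμ => ?_)) (ENNReal.sum_le_tsum s)
    rw [wtCut, if_pos (hB _ (Finset.mem_image_of_mem _ hμ))]
  · gcongr
    unfold wtCut
    split_ifs
    · exact le_rfl
    · exact zero_le

theorem nm_comp_wt_le {f : PowerSeries ℂ} {d : ℕ} (hd : 1 ≤ d) (la : ℂ) {κ : ℝ}
    {φ : GenSeries} (hφ : ∀ l, φ.coeff l ≠ 0 → ‖l‖ ≤ κ * l.re) {r : ℝ} (hr : 0 < r)
    (hg : pw r (unitTail f d) ≤ 4⁻¹) :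
    nm (wt r) (GenSeries.comp f d la φ).toHahn ≤
      4 * nm (wt (Real.exp (κ * (1 + ‖la‖)) * r ^ d)) φ.toHahn := by
  rw [nm_wt_eq_iSup]
  refine iSup_le fun B => (nm_comp_wtCut_le hd la hφ hr hg B).trans ?_
  gcongr
  rw [nm_wt_eq_iSup]
  exact le_iSup (fun B => nm (wtCut _ B) φ.toHahn) _

end CompositionNorm


/-! ### The substitution x ↦ x(1 + g) as a multiplicative relation. -/

section Relation

theorem ReGe.add {c : ℝ} {H K : HS} (hH : ReGe c H) (hK : ReGe c K) : ReGe c (H + K) := by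
  intro μ hμ
  by_cases h : cf H μ = 0
  · refine hK μ fun h' => hμ ?_
    rw [cf_add, h, h', add_zero]
  · exact hH μ h

theorem ReGe.sum {ι : Type*} {c : ℝ} {H : ι → HS} (s : Finset ι) (hH : ∀ i ∈ s, ReGe c (H i)) :
    ReGe c (∑ i ∈ s, H i) :=
  Finset.sum_induction _ (ReGe c) (fun _ _ => ReGe.add) (fun _ h => absurd rfl h) hH

theorem ReGe.mono {c d : ℝ} {H : HS} (hcd : c ≤ d) (hH : ReGe d H) : ReGe c H :=
  fun μ hμ => hcd.trans (hH μ hμ)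

theorem reGe_C (c : ℂ) : ReGe 0 (HahnSeries.C c : HS) := by
  intro μ hμ
  by_cases h : μ = 0
  · simp [h]
  · exact absurd (by rw [cf_C, if_neg h]) hμ

theorem reGe_single (a c : ℂ) : ReGe a.re (HahnSeries.single (ReExp.of a) c) := by
  intro μ hμ
  by_cases h : μ = a
  · rw [h]
  · exact absurd (by rw [cf_single, if_neg h]) hμ

theorem GenSeries.reGe (φ : GenSeries) : ReGe 0 φ.toHahn := fun μ hμ => (φ.re_pos μ hμ).le

theorem cf_mul_of_subset {H K : HS} {s t : Set ReExp} (hs : s.IsPWO) (ht : t.IsPWO)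
    (hHs : H.support ⊆ s) (hKt : K.support ⊆ t) (μ : ℂ) :
    cf (H * K) μ = ∑ ij ∈ Finset.antidiagonal hs ht (ReExp.of μ), cf H ij.1.val * cf K ij.2.val := by
  rw [cf_mul]
  refine Finset.sum_subset (fun ij hij => ?_) fun ij hij hn => ?_
  · rw [Finset.mem_antidiagonal] at hij ⊢
    exact ⟨hHs hij.1, hKt hij.2.1, hij.2.2⟩
  · by_contra hcon
    rw [Finset.mem_antidiagonal] at hij
    exact hn (Finset.mem_antidiagonal.mpr
      ⟨left_ne_zero_of_mul hcon, right_ne_zero_of_mul hcon, hij.2.2⟩)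

/-- Multiplication of the coefficient of `x ^ l` by that of `x ^ k` in `(1 + g) ^ l`. -/
def powOp (g : PowerSeries ℂ) (k : ℕ) (H : HS) : HS where
  coeff z := cf H z.val * onePowCoeff g z.val k
  isPWO_support' := H.isPWO_support.mono fun _ hz => left_ne_zero_of_mul hz

theorem cf_powOp (g : PowerSeries ℂ) (k : ℕ) (H : HS) (μ : ℂ) :
    cf (powOp g k H) μ = cf H μ * onePowCoeff g μ k := rfl

theorem ReGe.powOp {c : ℝ} {H : HS} (hH : ReGe c H) (g : PowerSeries ℂ) (k : ℕ) :
    ReGe c (powOp g k H) := fun μ hμ => hH μ (left_ne_zero_of_mul hμ)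

theorem powOp_add (g : PowerSeries ℂ) (k : ℕ) (H K : HS) :
    powOp g k (H + K) = powOp g k H + powOp g k K :=
  cf_ext fun μ => by simp only [cf_powOp, cf_add, add_mul]

theorem powOp_C (g : PowerSeries ℂ) (k : ℕ) (c : ℂ) :
    powOp g k (HahnSeries.C c) = if k = 0 then HahnSeries.C c else 0 := by
  refine cf_ext fun μ => ?_
  rw [cf_powOp, cf_C]
  by_cases hμ : μ = 0
  · subst hμ
    rw [if_pos rfl]
    split_ifs with hk
    · rw [hk, onePowCoeff_zero_right, cf_C, if_pos rfl, mul_one]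
    · rw [onePowCoeff_zero_left g hk, mul_zero, cf_zero]
  · rw [if_neg hμ, zero_mul]
    split_ifs
    · rw [cf_C, if_neg hμ]
    · rw [cf_zero]

/-- A Leibniz rule, coefficientwise the law (1 + g)^{α+β} = (1 + g)^α (1 + g)^β. It makes the
substitution multiplicative. -/
theorem powOp_mul {g : PowerSeries ℂ} (hg : PowerSeries.coeff 0 g = 0) (k : ℕ) (H K : HS) :
    powOp g k (H * K) = ∑ p ∈ Finset.HasAntidiagonal.antidiagonal k,
      powOp g p.1 H * powOp g p.2 K := by
  refine cf_ext fun μ => ?_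
  rw [cf_powOp, cf_mul, cf_sum, Finset.sum_mul]
  have hsub : ∀ (i : ℕ) (H : HS), (powOp g i H).support ⊆ H.support := fun i H z hz =>
    left_ne_zero_of_mul (a := H.coeff z) (b := onePowCoeff g z.val i) hz
  have h1 : ∀ p : ℕ × ℕ, cf (powOp g p.1 H * powOp g p.2 K) μ = _ := fun p =>
    cf_mul_of_subset H.isPWO_support K.isPWO_support (hsub p.1 H) (hsub p.2 K) μ
  simp only [h1]
  rw [Finset.sum_comm]
  refine Finset.sum_congr rfl fun ij hij => ?_
  rw [Finset.mem_antidiagonal] at hij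
  have h2 : ij.1.val + ij.2.val = μ := hij.2.2
  rw [← h2, onePowCoeff_add hg, Finset.mul_sum]
  refine Finset.sum_congr rfl fun p _ => ?_
  rw [cf_powOp, cf_powOp]
  ring

theorem sum_antidiagonal_eq_sum_filter {B : Type*} [AddCommMonoid B] (T : ℕ → ℕ → B) (K : ℕ) :
    ∑ k ∈ Finset.range K, ∑ p ∈ Finset.HasAntidiagonal.antidiagonal k, T p.1 p.2 =
      ∑ p ∈ Finset.range K ×ˢ Finset.range K with p.1 + p.2 < K, T p.1 p.2 := by
  rw [← Finset.sum_fiberwise_of_maps_to (t := Finset.range K) (g := fun p : ℕ × ℕ => p.1 + p.2)]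
  · refine Finset.sum_congr rfl fun k hk => Finset.sum_congr ?_ fun _ _ => rfl
    ext p
    simp only [Finset.HasAntidiagonal.mem_antidiagonal, Finset.mem_filter, Finset.mem_product,
      Finset.mem_range] at hk ⊢
    omega
  · intro p hp
    rw [Finset.mem_filter] at hp
    exact Finset.mem_range.mpr hp.2

/-- `H'` is the result of substituting `x (1 + g x)` for `x` in `H`. -/
structure IsComp (g : PowerSeries ℂ) (H H' : HS) : Prop where
  reGe : ReGe 0 H
  reGe' : ReGe 0 H'
  -- The sum over all k is described modulo real part K for every K, which determines each
  -- coefficient without forming an infinite sum.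
  approx : ∀ K : ℕ, ReGe K (H' - ∑ k ∈ Finset.range K,
    HahnSeries.single (ReExp.of k) 1 * powOp g k H)

theorem IsComp.add {g : PowerSeries ℂ} {H H' K K' : HS} (h : IsComp g H H') (k : IsComp g K K') :
    IsComp g (H + K) (H' + K') := by
  refine ⟨h.reGe.add k.reGe, h.reGe'.add k.reGe', fun N => ?_⟩
  convert (h.approx N).add (k.approx N) using 1
  simp_rw [powOp_add, mul_add, Finset.sum_add_distrib]
  ring

theorem isComp_C (g : PowerSeries ℂ) (c : ℂ) : IsComp g (HahnSeries.C c) (HahnSeries.C c) := by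
  refine ⟨reGe_C c, reGe_C c, fun N => ?_⟩
  rcases N with _ | N
  · simpa using reGe_C c
  · rw [Finset.sum_range_succ', Finset.sum_eq_zero]
    · rw [powOp_C, if_pos rfl, zero_add, Nat.cast_zero]
      have : HahnSeries.single (ReExp.of 0) (1 : ℂ) = 1 := rfl
      rw [this, one_mul, sub_self]
      exact fun _ h => absurd rfl h
    · intro k _
      rw [powOp_C, if_neg (Nat.succ_ne_zero k), mul_zero]

/-- The product of the two truncated sums contains the truncated sum of the product, by the Leibniz
rule. The leftover pairs have total index at least N and contribute only exponents of real part at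
least N. -/
theorem IsComp.mul {g : PowerSeries ℂ} (hg : PowerSeries.coeff 0 g = 0) {H H' K K' : HS}
    (h : IsComp g H H') (k : IsComp g K K') : IsComp g (H * K) (H' * K') := by
  refine ⟨by simpa using h.reGe.mul k.reGe, by simpa using h.reGe'.mul k.reGe', fun N => ?_⟩
  set X : ℕ → HS := fun i => HahnSeries.single (ReExp.of i) 1 with hX
  have hXadd : ∀ i j, X i * X j = X (i + j) := by
    intro i j
    simp only [hX, HahnSeries.single_mul_single, mul_one]
    congr 2
    exact (Nat.cast_add (R := ℂ) i j).symm
  have hXre : ∀ i : ℕ, ReGe i (X i) := fun i => by simpa using reGe_single (i : ℂ) 1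
  set A := ∑ i ∈ Finset.range N, X i * powOp g i H with hA
  set B := ∑ i ∈ Finset.range N, X i * powOp g i K with hB
  have hB0 : ReGe 0 B := ReGe.sum _ fun i _ =>
    ((hXre i).mul (k.reGe.powOp g i)).mono (by positivity)
  set T : ℕ → ℕ → HS := fun i j => X (i + j) * (powOp g i H * powOp g j K) with hT
  have hAB : A * B = ∑ p ∈ Finset.range N ×ˢ Finset.range N, T p.1 p.2 := by
    rw [hA, hB, Finset.sum_mul_sum, ← Finset.sum_product']
    refine Finset.sum_congr rfl fun p _ => ?_
    simp only [hT, ← hXadd]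
    ring
  have hS : ∑ i ∈ Finset.range N, X i * powOp g i (H * K) =
      ∑ p ∈ Finset.range N ×ˢ Finset.range N with p.1 + p.2 < N, T p.1 p.2 := by
    rw [← sum_antidiagonal_eq_sum_filter]
    refine Finset.sum_congr rfl fun i _ => ?_
    rw [powOp_mul hg, Finset.mul_sum]
    refine Finset.sum_congr rfl fun p hp => ?_
    rw [Finset.HasAntidiagonal.mem_antidiagonal] at hp
    simp only [hT, hp]
  have hdiff : A * B - ∑ i ∈ Finset.range N, X i * powOp g i (H * K) =
      ∑ p ∈ Finset.range N ×ˢ Finset.range N with ¬ p.1 + p.2 < N, T p.1 p.2 := by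
    rw [hAB, hS, ← Finset.sum_filter_add_sum_filter_not (Finset.range N ×ˢ Finset.range N)
      (fun p => p.1 + p.2 < N), add_sub_cancel_left]
  have hD : ReGe N (A * B - ∑ i ∈ Finset.range N, X i * powOp g i (H * K)) := by
    rw [hdiff]
    refine ReGe.sum _ fun p hp => ?_
    have h1 : (N : ℝ) ≤ (p.1 + p.2 : ℕ) := by
      have := (Finset.mem_filter.mp hp).2
      exact_mod_cast not_lt.mp this
    refine ((hXre (p.1 + p.2)).mul ((h.reGe.powOp g p.1).mul (k.reGe.powOp g p.2))).mono ?_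
    linarith
  have e : H' * K' - ∑ i ∈ Finset.range N, X i * powOp g i (H * K) =
      H' * (K' - B) + (H' - A) * B +
        (A * B - ∑ i ∈ Finset.range N, X i * powOp g i (H * K)) := by ring
  rw [e]
  refine ReGe.add (ReGe.add ?_ ?_) hD
  · simpa using h.reGe'.mul (k.approx N)
  · simpa using (h.approx N).mul hB0

theorem IsComp.aeval {g : PowerSeries ℂ} (hg : PowerSeries.coeff 0 g = 0) {σ : Type*}
    {v v' : σ → HS} (h : ∀ i, IsComp g (v i) (v' i)) (p : MvPolynomial σ ℂ) :
    IsComp g (MvPolynomial.aeval v p) (MvPolynomial.aeval v' p) := by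
  induction p using MvPolynomial.induction_on with
  | C a =>
    simp only [MvPolynomial.aeval_C]
    exact isComp_C g a
  | add p q hp hq =>
    simp only [map_add]
    exact hp.add hq
  | mul_X p i hp =>
    simp only [map_mul, MvPolynomial.aeval_X]
    exact hp.mul hg (h i)

theorem IsComp.cf_eq {g : PowerSeries ℂ} {H H' : HS} (h : IsComp g H H') {μ : ℂ} {K : ℕ}
    (hK : μ.re < K) :
    cf H' μ = ∑ k ∈ Finset.range K, cf H (μ - k) * onePowCoeff g (μ - k) k := by
  have h1 : cf (H' - ∑ k ∈ Finset.range K, HahnSeries.single (ReExp.of k) 1 * powOp g k H) μ = 0 := by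
    by_contra hcon
    exact absurd (h.approx K μ hcon) (not_le.mpr hK)
  rw [cf_sub, sub_eq_zero] at h1
  rw [h1, cf_sum]
  refine Finset.sum_congr rfl fun k _ => ?_
  rw [cf_single_mul, one_mul, cf_powOp]

theorem IsComp.exists_of_cf_ne_zero {g : PowerSeries ℂ} {H H' : HS} (h : IsComp g H H') {μ : ℂ}
    (hμ : cf H' μ ≠ 0) : ∃ k : ℕ, cf H (μ - k) ≠ 0 := by
  obtain ⟨K, hK⟩ := exists_nat_gt μ.re
  rw [h.cf_eq hK] at hμ
  obtain ⟨k, -, hk⟩ := Finset.exists_ne_zero_of_sum_ne_zero hμ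
  exact ⟨k, left_ne_zero_of_mul hk⟩

/-- Corrections come from exponents lower by a positive integer, so a coefficient with nothing at
those exponents survives the substitution unchanged. This applies to leading coefficients. -/
theorem IsComp.cf_eq_self {g : PowerSeries ℂ} {H H' : HS} (h : IsComp g H H') {μ : ℂ}
    (hμ : ∀ k : ℕ, k ≠ 0 → cf H (μ - k) = 0) : cf H' μ = cf H μ := by
  obtain ⟨K, hK⟩ := exists_nat_gt μ.re
  rw [h.cf_eq (K := K + 1) (hK.trans (by push_cast; linarith)), Finset.sum_range_succ',
    Finset.sum_eq_zero, zero_add]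
  · rw [onePowCoeff_zero_right, Nat.cast_zero, sub_zero, mul_one]
  · intro k _
    rw [hμ _ (Nat.succ_ne_zero k), zero_mul]

theorem GenSeries.isComp_comp (h : PowerSeries ℂ) (φ : GenSeries) :
    IsComp (unitTail h 1) φ.toHahn (GenSeries.comp h 1 0 φ).toHahn := by
  refine ⟨φ.reGe, GenSeries.reGe _, fun K μ hμ => ?_⟩
  by_contra hcon
  refine hμ ?_
  have h1 : cf (GenSeries.comp h 1 0 φ).toHahn μ = _ :=
    compCoeff_one_eq_sum h 0 φ (not_le.mp hcon).le
  rw [cf_sub, h1, cf_sum, sub_eq_zero]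
  refine Finset.sum_congr rfl fun k _ => ?_
  rw [cf_single_mul, one_mul, cf_powOp, mul_zero, Complex.exp_zero, mul_one]
  rfl

end Relation


/-! ### The linearized equation: supports and smallness of its higher terms. -/

section Linearized

theorem nm_sum_le {ι : Type*} (W : ℂ → ℝ≥0∞) (s : Finset ι) (H : ι → HS) :
    nm W (∑ i ∈ s, H i) ≤ ∑ i ∈ s, nm W (H i) :=
  Finset.le_sum_of_subadditive (nm W) (nm_zero W).le (nm_add_le W) s H

theorem nm_mono {W W' : ℂ → ℝ≥0∞} {H : HS} (h : ∀ μ, cf H μ ≠ 0 → W μ ≤ W' μ) :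
    nm W H ≤ nm W' H := by
  refine ENNReal.tsum_le_tsum fun μ => ?_
  by_cases hμ : cf H μ = 0
  · simp [hμ]
  · exact mul_le_mul_right (h μ hμ) _

theorem nm_mul_const (W : ℂ → ℝ≥0∞) (c : ℝ≥0∞) (H : HS) :
    nm (fun μ => W μ * c) H = nm W H * c := by
  unfold nm
  rw [← ENNReal.tsum_mul_right]
  exact tsum_congr fun μ => (mul_assoc _ _ _).symm

theorem nm_const_mul (W : ℂ → ℝ≥0∞) (c : ℝ≥0∞) (H : HS) :
    nm (fun μ => c * W μ) H = c * nm W H := by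
  simp_rw [mul_comm c]
  exact nm_mul_const W c H

theorem nm_sub_le (W : ℂ → ℝ≥0∞) (H K : HS) : nm W (H - K) ≤ nm W H + nm W K := by
  have h : nm W (-K) = nm W K := by simp [nm]
  rw [sub_eq_add_neg, ← h]
  exact nm_add_le W H (-K)

theorem nm_single (W : ℂ → ℝ≥0∞) (a c : ℂ) :
    nm W (HahnSeries.single (ReExp.of a) c) = ‖c‖ₑ * W a := by
  unfold nm
  rw [tsum_eq_single a]
  · rw [cf_single, if_pos rfl]
  · intro b hb
    rw [cf_single, if_neg hb, enorm_zero, zero_mul]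

theorem nm_wt_le_of_le {H : HS} {ε r r₁ : ℝ} (hH : ∀ μ, cf H μ ≠ 0 → ε ≤ μ.re) (hr : 0 < r)
    (hrr : r ≤ r₁) : nm (wt r) H ≤ ENNReal.ofReal ((r / r₁) ^ ε) * nm (wt r₁) H := by
  rw [← nm_const_mul]
  refine nm_mono fun μ hμ => ?_
  have hr₁ := hr.trans_le hrr
  unfold wt
  rw [← ENNReal.ofReal_mul (by positivity)]
  exact ENNReal.ofReal_le_ofReal (rpow_le_of_le hr hrr (hH μ hμ))

theorem tendsto_rpow_zero {ε r₁ : ℝ} (hε : 0 < ε) (K : ℝ) :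
    Tendsto (fun r : ℝ => (r / r₁) ^ ε * K) (𝓝[>] 0) (𝓝 0) := by
  have h1 : Tendsto (fun r : ℝ => (r / r₁) ^ ε * K) (𝓝 0) (𝓝 ((0 / r₁) ^ ε * K)) := by
    refine Tendsto.mul_const K (Tendsto.rpow_const ?_ (Or.inr hε.le))
    exact tendsto_id.div_const r₁
  rw [zero_div, Real.zero_rpow hε.ne', zero_mul] at h1
  exact h1.mono_left nhdsWithin_le_nhds

theorem eventually_nm_wt_le {H : HS} {ε : ℝ} (hε : 0 < ε) (hH : ∀ μ, cf H μ ≠ 0 → ε ≤ μ.re)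
    (h : ∃ r > 0, nm (wt r) H < ⊤) {δ : ℝ} (hδ : 0 < δ) :
    ∀ᶠ r in 𝓝[>] 0, nm (wt r) H ≤ ENNReal.ofReal δ := by
  obtain ⟨r₁, hr₁, hfin⟩ := h
  have h1 := (tendsto_rpow_zero (r₁ := r₁) hε (nm (wt r₁) H).toReal).eventually_le_const hδ
  filter_upwards [h1, self_mem_nhdsWithin, Ioc_mem_nhdsGT hr₁] with r h2 h3 h4
  have h3' : 0 < r := h3
  refine (nm_wt_le_of_le hH h3 h4.2).trans ?_
  rw [← ENNReal.ofReal_toReal hfin.ne, ← ENNReal.ofReal_mul (by positivity)]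
  exact ENNReal.ofReal_le_ofReal h2

/-- The exponents occurring in the Taylor expansion of first order. -/
theorem remainder_supp {σ : Type*} [Fintype σ] {S₀ S₁ S₂ : Set ℂ} (h0 : (0 : ℂ) ∈ S₀)
    (h00 : ∀ a ∈ S₀, ∀ b ∈ S₀, a + b ∈ S₀) (h01 : ∀ a ∈ S₀, ∀ b ∈ S₁, a + b ∈ S₁)
    (h02 : ∀ a ∈ S₀, ∀ b ∈ S₂, a + b ∈ S₂) (h11 : ∀ a ∈ S₁, ∀ b ∈ S₁, a + b ∈ S₂)
    (h12 : ∀ a ∈ S₁, ∀ b ∈ S₂, a + b ∈ S₂) {v w : σ → HS}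
    (hv : ∀ i μ, cf (v i) μ ≠ 0 → μ ∈ S₀) (hw : ∀ i μ, cf (w i) μ ≠ 0 → μ ∈ S₁)
    (p : MvPolynomial σ ℂ) :
    (∀ μ, cf (MvPolynomial.aeval v p) μ ≠ 0 → μ ∈ S₀) ∧
    (∀ μ, cf (∑ j, MvPolynomial.aeval v (MvPolynomial.pderiv j p) * w j) μ ≠ 0 → μ ∈ S₁) ∧
    (∀ μ, cf (MvPolynomial.aeval (v + w) p - MvPolynomial.aeval v p -
        ∑ j, MvPolynomial.aeval v (MvPolynomial.pderiv j p) * w j) μ ≠ 0 → μ ∈ S₂) := by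
  -- With zero weights the norm conditions are void, and only the assertion about supports remains.
  have hz : ∀ H : HS, nm (fun _ => 0) H ≤ ENNReal.ofReal 0 := fun H => by simp [nm]
  obtain ⟨k1, -, k2, k3⟩ := remainder_mem_normClass (S₀ := S₀) (S₁ := S₁) (S₂ := S₂)
    (W₀ := fun _ => 0) (W₁ := fun _ => 0) (W₂ := fun _ => 0) h0 zero_le
    (fun a ha b hb => ⟨h00 a ha b hb, zero_le⟩) (fun a ha b hb => ⟨h01 a ha b hb, zero_le⟩)
    (fun a ha b hb => ⟨h02 a ha b hb, zero_le⟩) (fun a ha b hb => ⟨h11 a ha b hb, zero_le⟩)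
    (fun a ha b hb => ⟨h12 a ha b hb, zero_le⟩) (v := v) (w := w) (a := fun _ => 0) (s := 0)
    (fun i => ⟨hv i, le_rfl, hz _⟩) (fun i => ⟨hw i, le_rfl, hz _⟩) p
  exact ⟨k1.1, k2, k3.1⟩

theorem aeval_sub_supp {σ : Type*} [Fintype σ] {S₀ S₁ : Set ℂ} (h0 : (0 : ℂ) ∈ S₀)
    (h00 : ∀ a ∈ S₀, ∀ b ∈ S₀, a + b ∈ S₀) (h01 : ∀ a ∈ S₀, ∀ b ∈ S₁, a + b ∈ S₁)
    (h11 : ∀ a ∈ S₁, ∀ b ∈ S₁, a + b ∈ S₁) {v w : σ → HS}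
    (hv : ∀ i μ, cf (v i) μ ≠ 0 → μ ∈ S₀) (hw : ∀ i μ, cf (w i) μ ≠ 0 → μ ∈ S₁)
    (p : MvPolynomial σ ℂ) {μ : ℂ}
    (hμ : cf (MvPolynomial.aeval (v + w) p - MvPolynomial.aeval v p) μ ≠ 0) : μ ∈ S₁ := by
  obtain ⟨-, k2, k3⟩ := remainder_supp h0 h00 h01 h01 h11 h11 hv hw p
  by_cases h : cf (∑ j, MvPolynomial.aeval v (MvPolynomial.pderiv j p) * w j) μ = 0
  · refine k3 μ ?_
    rwa [cf_sub, h, sub_zero]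
  · exact k2 μ h

variable {Γ : AddSubsemigroup ℂ} {ε : ℝ} {ν : ℂ} {m : ℕ} {F : MvPowerSeries (Fin m) ℂ}
  {v w : Fin m → HS}

/-- The coefficients of the linearized equation along the initial part of the solution. -/
theorem eventually_pderiv_supp (hε : 0 < ε) (hΓ : ∀ z ∈ Γ, ε ≤ z.re)
    (hv : ∀ i μ, cf (v i) μ ≠ 0 → μ ∈ Γ) (hw : ∀ i μ, cf (w i) μ ≠ 0 → μ ∈ shiftOne Γ ν)
    {j : Fin m} {A : ℂ} (hA : substCoeff (MvPowerSeries.pderiv ℂ j F) (v + w) ν = A)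
    (hA' : ∀ μ, μ ≠ ν → substCoeff (MvPowerSeries.pderiv ℂ j F) (v + w) μ ≠ 0 → μ - ν ∈ Γ)
    (B : ℝ) : ∀ᶠ D in atTop, ∀ μ : ℂ, μ.re ≤ B →
      cf (MvPolynomial.aeval v (MvPolynomial.pderiv j (MvPowerSeries.truncTotal D F)) -
        HahnSeries.single (ReExp.of ν) A) μ ≠ 0 → μ - ν ∈ Γ := by
  obtain ⟨D₀, hD₀⟩ := exists_nat_gt (B / ε)
  filter_upwards [eventually_ge_atTop (D₀ + 1)] with D hD μ hμ hne
  obtain ⟨D, rfl⟩ : ∃ D', D = D' + 1 := ⟨D - 1, by omega⟩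
  have hDε : μ.re < D * ε := by
    rw [div_lt_iff₀ hε] at hD₀
    have : (D₀ : ℝ) ≤ D := by exact_mod_cast (by omega : D₀ ≤ D)
    nlinarith
  have hvw : ∀ i, ReGe ε ((v + w) i) := by
    intro i
    exact ReGe.add (fun μ h => hΓ _ (hv i μ h)) (fun μ h => hΓ _ (hw i μ h).1)
  have h1 := substCoeff_eq (MvPowerSeries.pderiv ℂ j F) hε.le hvw hDε
  rw [← pderiv_truncTotal] at h1
  set p := MvPolynomial.pderiv j (MvPowerSeries.truncTotal (D + 1) F)
  -- The exponents of the derivative are known along v + w. Passing to v changes them only by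
  -- exponents in `shiftOne Γ ν`, which are in ν + Γ as well.
  by_cases h2 : cf (MvPolynomial.aeval (v + w) p - MvPolynomial.aeval v p) μ = 0
  · rw [cf_sub, sub_eq_zero] at h2
    rw [cf_sub, ← h2, ← h1, cf_single] at hne
    by_cases h3 : μ = ν
    · rw [if_pos h3, h3, hA, sub_self] at hne
      exact absurd rfl hne
    · rw [if_neg h3, sub_zero] at hne
      exact hA' μ h3 hne
  · exact (aeval_sub_supp (S₀ := withZero Γ) (S₁ := shiftOne Γ ν) (Or.inl rfl)
      (fun _ ha _ hb => withZero_add ha hb) (fun _ ha _ hb => shiftOne_add ha hb)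
      (fun _ ha _ hb => shiftOne_add (Or.inr ha.1) hb) (fun i μ h => Or.inr (hv i μ h)) hw p h2).2

theorem nm_aeval_pderiv_le {R C r : ℝ} (hR : 0 < R) (hFc : ConvergentAt F R C) (hr : 0 < r)
    (hv : ∀ i μ, cf (v i) μ ≠ 0 → μ ∈ Γ) (hvn : ∀ i, nm (wt r) (v i) ≤ ENNReal.ofReal (R / 2))
    (j : Fin m) (D : ℕ) :
    (∀ μ, cf (MvPolynomial.aeval v (MvPolynomial.pderiv j
      (MvPowerSeries.truncTotal D F))) μ ≠ 0 → μ ∈ withZero Γ) ∧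
    nm (wt r) (MvPolynomial.aeval v (MvPolynomial.pderiv j (MvPowerSeries.truncTotal D F))) ≤
      ENNReal.ofReal (C / (R / 2)) := by
  have h0 : ∀ a ∈ withZero Γ, ∀ b ∈ withZero Γ, a + b ∈ withZero Γ ∧
      wt r (a + b) ≤ wt r a * wt r b := fun a ha b hb => ⟨withZero_add ha hb, (wt_add hr _ _).le⟩
  obtain ⟨-, h, -, -⟩ := remainder_mem_normClass (Or.inl rfl) (wt_zero r).le h0 h0 h0 h0 h0
    (v := v) (w := 0) (a := fun _ => R / 2) (s := 0)
    (fun i => ⟨fun μ hμ => Or.inr (hv i μ hμ), by positivity, hvn i⟩)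
    (fun i => ⟨fun μ hμ => absurd rfl hμ, le_rfl, by simp [nm_zero]⟩)
    (MvPowerSeries.truncTotal D F)
  exact ⟨(h j).1, (h j).2.2.trans (ENNReal.ofReal_le_ofReal
    (hFc.eval_pderiv_le hR D (fun _ => by positivity) (fun _ => le_rfl) j))⟩

/-- The linear terms of higher order are small compared with the unknown series. -/
theorem eventually_nm_linear_le (hε : 0 < ε) (hΓ : ∀ z ∈ Γ, ε ≤ z.re) {g g₂ : ℂ → ℝ}
    (hg : IsDamping Γ g g₂) {R C r₁ : ℝ} (hR : 0 < R) (hFc : ConvergentAt F R C) (hr₁ : 0 < r₁)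
    (hv : ∀ i μ, cf (v i) μ ≠ 0 → μ ∈ Γ) (hvn : ∀ i, nm (wt r₁) (v i) ≤ ENNReal.ofReal (R / 2))
    {j : Fin m} {A : ℂ} (hY : ∀ B : ℝ, ∀ᶠ D in atTop, ∀ μ : ℂ, μ.re ≤ B →
      cf (MvPolynomial.aeval v (MvPolynomial.pderiv j (MvPowerSeries.truncTotal D F)) -
        HahnSeries.single (ReExp.of ν) A) μ ≠ 0 → μ - ν ∈ Γ) {H : HS} (hH : ReGe 0 H)
    {η : ℝ} (hη : 0 < η) : ∃ ρ > 0, ∀ r M : ℝ, 0 < r → r ≤ ρ → ∀ᶠ D in atTop,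
      nm (wtTwo g₂ ν r M) ((MvPolynomial.aeval v (MvPolynomial.pderiv j
        (MvPowerSeries.truncTotal D F)) - HahnSeries.single (ReExp.of ν) A) * H) ≤
        ENNReal.ofReal η * nm (wtOne g ν r M) H := by
  set K := (|C / (R / 2)| + ‖A‖ * r₁ ^ ν.re) * r₁ ^ (-ν.re) with hK
  have hpos : ∀ z ∈ Γ, 0 < z.re := fun z hz => hε.trans_le (hΓ z hz)
  have h1 := (tendsto_rpow_zero (r₁ := r₁) hε K).eventually_le_const hη
  obtain ⟨ρ, hρ, hρ'⟩ := mem_nhdsGT_iff_exists_Ioc_subset.mp h1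
  refine ⟨min ρ r₁, lt_min hρ hr₁, fun r M hr hrr => ?_⟩
  filter_upwards [hY (M + ν.re)] with D hD
  set Y := MvPolynomial.aeval v (MvPolynomial.pderiv j (MvPowerSeries.truncTotal D F)) -
        HahnSeries.single (ReExp.of ν) A with hYdef
  classical
  have h2 : nm (wtTwo g₂ ν r M) (Y * H) ≤
      nm (fun a => if a - ν ∈ Γ then wt r (a - ν) else 0) Y * nm (wtOne g ν r M) H := by
    refine nm_mul_le fun a b ha hb => ?_
    by_cases h3 : a - ν ∈ Γ
    · rw [if_pos h3]
      exact wtTwo_add_le_of_sub_mem hpos hr hg h3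
    -- For this D the exponents of Y are controlled only up to M + Re ν; beyond that the weight
    -- vanishes.
    · have h4 : ¬ (a + b).re ≤ M + ν.re := by
        intro h5
        refine h3 (hD a ?_ ha)
        have := hH b hb
        rw [Complex.add_re] at h5
        linarith
      rw [wtTwo, if_neg h4]
      exact zero_le
  refine h2.trans (mul_le_mul_left ?_ _)
  -- Past x^ν the next real part is higher by at least ε, so shrinking the radius gains (r / r₁)^ε,
  -- uniformly in M and D.
  have h3 : nm (fun a => if a - ν ∈ Γ then wt r (a - ν) else 0) Y ≤
      nm (fun a => ENNReal.ofReal ((r / r₁) ^ ε * r₁ ^ (-ν.re)) * wt r₁ a) Y := by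
    refine nm_mono fun a _ => ?_
    split_ifs with h4
    · unfold wt
      rw [← ENNReal.ofReal_mul (by positivity)]
      refine ENNReal.ofReal_le_ofReal ?_
      refine (rpow_le_of_le hr (hrr.trans (min_le_right _ _)) (hΓ _ h4)).trans (le_of_eq ?_)
      rw [mul_assoc, ← Real.rpow_add hr₁, Complex.sub_re]
      congr 2
      ring
    · exact zero_le
  have h4 : nm (wt r₁) Y ≤ ENNReal.ofReal (|C / (R / 2)| + ‖A‖ * r₁ ^ ν.re) := by
    refine (nm_sub_le _ _ _).trans ?_
    rw [ENNReal.ofReal_add (by positivity) (by positivity)]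
    refine add_le_add ((nm_aeval_pderiv_le hR hFc hr₁ hv hvn j D).2.trans
      (ENNReal.ofReal_le_ofReal (le_abs_self _))) ?_
    rw [nm_single, ENNReal.ofReal_mul (norm_nonneg _), ofReal_norm]
    rfl
  refine h3.trans ?_
  rw [nm_const_mul]
  refine (mul_le_mul_right h4 _).trans ?_
  rw [← ENNReal.ofReal_mul (by positivity)]
  refine ENNReal.ofReal_le_ofReal (le_trans (le_of_eq ?_)
    (hρ' ⟨hr, hrr.trans (min_le_left _ _)⟩))
  rw [hK]
  ring

theorem tsum_eq_dampedSum {g : ℂ → ℝ} (hg : ∀ κ, 0 < g κ) {χ : ℂ → ℂ} {ω : ℂ → ℝ}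
    (hω : ∀ l, 0 ≤ ω l) {r M : ℝ} (hr : 0 < r) (hfin : {l | χ l ≠ 0 ∧ l.re ≤ M}.Finite) :
    ∑' l, ENNReal.ofReal (ω l) * ‖χ l‖ₑ * wtOne g ν r M l =
      ENNReal.ofReal (dampedSum χ ω g ν r hfin.toFinset) := by
  rw [dampedSum, ENNReal.ofReal_sum_of_nonneg]
  · rw [tsum_eq_sum (s := hfin.toFinset)]
    · refine Finset.sum_congr rfl fun l hl => ?_
      have h1 : χ l ≠ 0 ∧ l.re ≤ M := by simpa using hl
      have h2 := hω l
      have h3 := hg (l - ν)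
      rw [wtOne, if_pos h1.2, ← ofReal_norm, ← ENNReal.ofReal_mul h2,
        ← ENNReal.ofReal_mul (by positivity)]
      congr 1
      ring
    · intro l hl
      have h1 : ¬ (χ l ≠ 0 ∧ l.re ≤ M) := by simpa using hl
      by_cases h2 : χ l = 0
      · simp [h2]
      · rw [wtOne, if_neg (fun h3 => h1 ⟨h2, h3⟩), mul_zero]
  · intro l _
    have h2 := hω l
    have h3 := hg (l - ν)
    positivity

/-- Since g(κ) ≥ exp(-k Re κ), removing the damping only multiplies the radius by exp(-k). -/
theorem nm_lt_top_of_summable (χ : GenSeries) {g : ℂ → ℝ} {ω : ℂ → ℝ}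
    (hω : ∀ l, 1 ≤ ω l) (hgpos : ∀ κ, 0 < g κ) (hχ : ∀ l, χ.coeff l ≠ 0 → 0 ≤ (l - ν).re)
    (hgexp : ∃ k : ℝ, ∀ κ : ℂ, 0 ≤ κ.re → Real.exp (-(k * κ.re)) ≤ g κ) {r : ℝ} (hr : 0 < r)
    (h : Summable fun l => ω l * ‖χ.coeff l‖ * g (l - ν) * r ^ (l - ν).re) :
    ∃ r > 0, nm (wt r) χ.toHahn < ⊤ := by
  obtain ⟨k, hk⟩ := hgexp
  set ρ := r * Real.exp (-k) with hρ
  have hρ0 : 0 < ρ := by positivity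
  refine ⟨ρ, hρ0, ?_⟩
  have h1 : nm (wt ρ) χ.toHahn ≤ ∑' l, ENNReal.ofReal (ρ ^ ν.re) *
      ENNReal.ofReal (ω l * ‖χ.coeff l‖ * g (l - ν) * r ^ (l - ν).re) := by
    refine ENNReal.tsum_le_tsum fun l => ?_
    change ‖χ.coeff l‖ₑ * _ ≤ _
    by_cases hl : χ.coeff l = 0
    · simp [hl]
    have hl' := hχ l hl
    have hg' := hgpos (l - ν)
    have hω' : 0 ≤ ω l := zero_le_one.trans (hω l)
    rw [← ofReal_norm, wt, ← ENNReal.ofReal_mul (norm_nonneg _),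
      ← ENNReal.ofReal_mul (by positivity)]
    refine ENNReal.ofReal_le_ofReal ?_
    have e1 : ρ ^ l.re = ρ ^ ν.re * (Real.exp (-(k * (l - ν).re)) * r ^ (l - ν).re) := by
      have : l.re = ν.re + (l - ν).re := by simp
      rw [this, Real.rpow_add hρ0]
      congr 1
      rw [hρ, Real.mul_rpow hr.le (by positivity), ← Real.exp_mul, mul_comm]
      congr 2
      ring_nf
    rw [e1]
    calc ‖χ.coeff l‖ * (ρ ^ ν.re * (Real.exp (-(k * (l - ν).re)) * r ^ (l - ν).re))
        ≤ ‖χ.coeff l‖ * (ρ ^ ν.re * (g (l - ν) * r ^ (l - ν).re)) := by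
          gcongr
          exact hk _ hl'
      _ = ρ ^ ν.re * (1 * ‖χ.coeff l‖ * g (l - ν) * r ^ (l - ν).re) := by ring
      _ ≤ _ := by
          gcongr
          exact hω l
  refine h1.trans_lt ?_
  rw [ENNReal.tsum_mul_left]
  exact ENNReal.mul_lt_top ENNReal.ofReal_lt_top h.tsum_ofReal_lt_top

end Linearized


/-! ### Convergence for linear substitutions and for substitutions of order at least two. -/

section Convergence

variable {Γ : AddSubsemigroup ℂ} {ε : ℝ} {ν : ℂ} {n : ℕ} {F : MvPowerSeries (Fin (n + 2)) ℂ}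
  {v w : Fin (n + 2) → HS} {R C : ℝ} {χ : GenSeries}

theorem GenSeries.finite_ne (χ : GenSeries) (M : ℝ) : {l | χ.coeff l ≠ 0 ∧ l.re ≤ M}.Finite :=
  χ.finite_le M

theorem charPoly_eval (A : Fin (n + 1) → ℂ) (z : ℂ) :
    (charPoly A).eval z = ∑ j, A j * z ^ (j : ℕ) := by
  simp [charPoly, Polynomial.eval_finsetSum]

theorem exists_radius (hε : 0 < ε) (hΓ : ∀ z ∈ Γ, ε ≤ z.re)
    (hv : ∀ i μ, cf (v i) μ ≠ 0 → μ ∈ Γ) (hvn : ∀ i, ∃ r > 0, nm (wt r) (v i) < ⊤)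
    (hR : 0 < R) {r₀ : ℝ} (hr₀ : 0 < r₀) : ∃ r, 0 < r ∧ r ≤ r₀ ∧
      ∀ i, nm (wt r) (v i) ≤ ENNReal.ofReal (R / 2) := by
  have h1 : ∀ᶠ r in 𝓝[>] (0 : ℝ), ∀ i, nm (wt r) (v i) ≤ ENNReal.ofReal (R / 2) :=
    eventually_all.mpr fun i => eventually_nm_wt_le hε (fun μ hμ => hΓ μ (hv i μ hμ)) (hvn i)
      (by positivity)
  obtain ⟨r, h2, h3⟩ := (h1.and (Ioc_mem_nhdsGT hr₀)).exists
  exact ⟨r, h3.1, h3.2, h2⟩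

theorem exists_nm_sum_mul_le {g₂ : ℂ → ℝ} (hw0 : w 0 = 0) (Y : ℕ → Fin (n + 2) → HS)
    (S : ℝ → ℝ → ℝ) (h : ∀ j : Fin (n + 1), ∀ η > 0, ∃ ρ > 0, ∀ r M : ℝ, 0 < r → r ≤ ρ →
      ∀ᶠ D in atTop, nm (wtTwo g₂ ν r M) (Y D j.succ * w j.succ) ≤ ENNReal.ofReal (η * S r M))
    {η : ℝ} (hη : 0 < η) : ∃ ρ > 0, ∀ r M : ℝ, 0 < r → r ≤ ρ → ∀ᶠ D in atTop,
      nm (wtTwo g₂ ν r M) (∑ j, Y D j * w j) ≤ ENNReal.ofReal (η * S r M) := by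
  choose ρ hρ hρ' using fun j => h j (η / (n + 1)) (by positivity)
  refine ⟨Finset.univ.inf' Finset.univ_nonempty ρ, ?_, fun r M hr hrr => ?_⟩
  · rw [gt_iff_lt, Finset.lt_inf'_iff]
    exact fun j _ => hρ j
  · have h2 : ∀ᶠ D in atTop, ∀ j : Fin (n + 1), _ := eventually_all.mpr fun j =>
      hρ' j r M hr (hrr.trans (Finset.inf'_le _ (Finset.mem_univ j)))
    filter_upwards [h2] with D hD
    rw [Fin.sum_univ_succ, hw0, mul_zero, zero_add]
    refine (nm_sum_le _ _ _).trans ?_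
    refine (Finset.sum_le_card_nsmul _ _ _ fun j _ => hD j).trans (le_of_eq ?_)
    rw [Finset.card_univ, Fintype.card_fin, ← ENNReal.ofReal_nsmul, nsmul_eq_mul]
    congr 1
    push_cast
    field_simp

/-- Convergence for a linear substitution `x ↦ q x`. -/
theorem exists_nm_lt_top_of_linear (hε : 0 < ε) (hΓ : ∀ z ∈ Γ, ε ≤ z.re) (hν : 0 ≤ ν.re)
    (hR : 0 < R) (hFc : ConvergentAt F R C)
    (hv : ∀ i μ, cf (v i) μ ≠ 0 → μ ∈ Γ) (hvn : ∀ i, ∃ r > 0, nm (wt r) (v i) < ⊤) {lq : ℂ}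
    (hw0 : w 0 = 0) (hw : ∀ (j : Fin (n + 1)) l,
      cf (w j.succ) l = χ.coeff l * Complex.exp (l * lq) ^ (j : ℕ))
    {N : ℝ} (hχ : ∀ l, χ.coeff l ≠ 0 → l ∈ shiftOne Γ ν ∧ N < l.re)
    (hF : ∀ μ, substCoeff F (v + w) μ = 0) {A : Fin (n + 1) → ℂ}
    (hA : ∀ j : Fin (n + 1), substCoeff (MvPowerSeries.pderiv ℂ j.succ F) (v + w) ν = A j)
    (hA' : ∀ (j : Fin (n + 1)) μ, μ ≠ ν →
      substCoeff (MvPowerSeries.pderiv ℂ j.succ F) (v + w) μ ≠ 0 → μ - ν ∈ Γ)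
    {g g₂ : ℂ → ℝ} (hg : IsDamping Γ g g₂)
    (hgexp : ∃ k : ℝ, ∀ κ : ℂ, 0 ≤ κ.re → Real.exp (-(k * κ.re)) ≤ g κ) {K : ℝ} (hK : 0 < K)
    (hdiv : ∀ l ∈ shiftOne Γ ν, N < l.re → g (l - ν) * max 1 ‖Complex.exp (l * lq)‖ ^ n ≤
      K * (g₂ (l - ν) * ‖(charPoly A).eval (Complex.exp (l * lq))‖)) :
    ∃ r > 0, nm (wt r) χ.toHahn < ⊤ := by
  have hpos : ∀ z ∈ Γ, 0 < z.re := fun z hz => hε.trans_le (hΓ z hz)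
  obtain ⟨r₁, hr₁0, hr₁1, hr₁⟩ := exists_radius hε hΓ hv hvn hR one_pos
  have hws : ∀ i μ, cf (w i) μ ≠ 0 → μ ∈ shiftOne Γ ν := by
    intro i μ hμ
    induction i using Fin.cases with
    | zero => exact absurd (by rw [hw0, cf_zero]) hμ
    | succ j =>
      rw [hw] at hμ
      exact (hχ μ (left_ne_zero_of_mul hμ)).1
  -- This dominates |q^l|^j for all j ≤ n, so one sum over χ controls every component of w, even
  -- where |q^l| > 1.
  set ω : ℂ → ℝ := fun l => max 1 ‖Complex.exp (l * lq)‖ ^ n with hω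
  have hω1 : ∀ l, 1 ≤ ω l := fun l => one_le_pow₀ (le_max_left _ _)
  have hω0 : ∀ l, 0 ≤ ω l := fun l => zero_le_one.trans (hω1 l)
  have hwn : ∀ r M : ℝ, 0 < r → ∀ j, nm (wtOne g ν r M) (w j) ≤
      ENNReal.ofReal (dampedSum χ.coeff ω g ν r (χ.finite_ne M).toFinset) := by
    intro r M hr i
    rw [← tsum_eq_dampedSum hg.pos hω0 hr]
    refine ENNReal.tsum_le_tsum fun l => mul_le_mul_left ?_ _
    induction i using Fin.cases with
    | zero => rw [hw0, cf_zero, enorm_zero]; exact zero_le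
    | succ j =>
      rw [hw, enorm_mul, mul_comm]
      refine mul_le_mul_left ?_ _
      rw [enorm_pow, ← ofReal_norm, ← ENNReal.ofReal_pow (norm_nonneg _)]
      refine ENNReal.ofReal_le_ofReal ?_
      calc ‖Complex.exp (l * lq)‖ ^ (j : ℕ)
          ≤ max 1 ‖Complex.exp (l * lq)‖ ^ (j : ℕ) :=
            pow_le_pow_left₀ (norm_nonneg _) (le_max_right _ _) _
        _ ≤ _ := pow_le_pow_right₀ (le_max_left _ _) (Nat.lt_succ_iff.mp j.2)
  have hE : ∀ l, χ.coeff l ≠ 0 → g (l - ν) * (ω l * ‖χ.coeff l‖) ≤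
      K * (g₂ (l - ν) * ‖∑ j, (Fin.cons 0 A : Fin (n + 2) → ℂ) j * cf (w j) l‖) := by
    intro l hl
    have h1 := hdiv l (hχ l hl).1 (hχ l hl).2
    have h2 : ∑ j, (Fin.cons 0 A : Fin (n + 2) → ℂ) j * cf (w j) l =
        χ.coeff l * (charPoly A).eval (Complex.exp (l * lq)) := by
      rw [Fin.sum_univ_succ, charPoly_eval, Finset.mul_sum]
      simp only [Fin.cons_zero, Fin.cons_succ, zero_mul, zero_add, hw]
      exact Finset.sum_congr rfl fun j _ => by ring
    rw [h2, norm_mul]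
    calc g (l - ν) * (ω l * ‖χ.coeff l‖) = g (l - ν) * ω l * ‖χ.coeff l‖ := by ring
      _ ≤ K * (g₂ (l - ν) * ‖(charPoly A).eval (Complex.exp (l * lq))‖) * ‖χ.coeff l‖ := by gcongr
      _ = _ := by ring
  have hlin : ∀ j : Fin (n + 1), ∀ η > 0, ∃ ρ > 0, ∀ r M : ℝ, 0 < r → r ≤ ρ →
      ∀ᶠ D in atTop, nm (wtTwo g₂ ν r M) ((MvPolynomial.aeval v (MvPolynomial.pderiv j.succ
        (MvPowerSeries.truncTotal D F)) - HahnSeries.single (ReExp.of ν)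
          ((Fin.cons 0 A : Fin (n + 2) → ℂ) j.succ)) * w j.succ) ≤
      ENNReal.ofReal (η * dampedSum χ.coeff ω g ν r (χ.finite_ne M).toFinset) := by
    intro j η hη
    obtain ⟨ρ, hρ, hρ'⟩ := eventually_nm_linear_le (ν := ν) (H := w j.succ) hε hΓ hg hR hFc hr₁0 hv
      hr₁ (eventually_pderiv_supp hε hΓ hv hws (hA j) (hA' j))
      (fun μ hμ => (hpos _ (hws _ μ hμ).1).le) hη
    refine ⟨ρ, hρ, fun r M hr hrr => ?_⟩
    filter_upwards [hρ' r M hr hrr] with D hD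
    rw [ENNReal.ofReal_mul hη.le, Fin.cons_succ]
    exact hD.trans (mul_le_mul_right (hwn r M hr _) _)
  obtain ⟨r, hr, -, hsum⟩ := summable_of_equation (Kw := 1) hε hΓ hν hg hR hFc hr₁0 hr₁1 hv hr₁
    hws hF (Fin.cons 0 A) hω0 (fun l hl => (hχ l hl).1) χ.finite_ne hK one_pos hE
    (fun r M hr _ j => by rw [one_mul]; exact hwn r M hr j) fun η hη =>
      exists_nm_sum_mul_le hw0 (fun D j => MvPolynomial.aeval v (MvPolynomial.pderiv j
        (MvPowerSeries.truncTotal D F)) - HahnSeries.single (ReExp.of ν)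
          ((Fin.cons 0 A : Fin (n + 2) → ℂ) j))
        (fun r M => dampedSum χ.coeff ω g ν r (χ.finite_ne M).toFinset) hlin hη
  exact nm_lt_top_of_summable χ hω1 hg.pos (fun l hl => (hpos _ (hχ l hl).1.2).le) hgexp hr hsum

/-- One composition with f of order at least two passes from the radius r to c r² and halves the
cut-off. As c r² ≤ r for r ≤ ρ, further compositions only help, up to a factor 4 each. -/
theorem nm_iterate_comp_wtCut_le {f : PowerSeries ℂ} {d : ℕ} (hd : 2 ≤ d) (la : ℂ) {κ : ℝ}
    (hκ : 0 ≤ κ) (h1 : (1 : ℂ) ∈ Γ) (hpos : ∀ z ∈ Γ, 0 < z.re) (hnorm : ∀ z ∈ Γ, ‖z‖ ≤ κ * z.re)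
    {ρ : ℝ} (hρ : ∀ r, 0 < r → r ≤ ρ → pw r (unitTail f d) ≤ 4⁻¹) {c : ℝ}
    (hc : c = Real.exp (κ * (1 + ‖la‖))) (hρ1 : ρ * c ≤ 1) :
    ∀ (j : ℕ) (χ : GenSeries), χ.ExponentsIn Γ →
      ((GenSeries.comp f d la)^[j] χ).ExponentsIn Γ ∧ ∀ r B : ℝ, 0 < r → r ≤ ρ →
      nm (wtCut r B) ((GenSeries.comp f d la)^[j + 1] χ).toHahn ≤
        4 ^ (j + 1) * nm (wtCut (c * r ^ 2) (B / 2)) χ.toHahn := by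
  have hc1 : 1 ≤ c := by
    rw [hc]
    exact Real.one_le_exp (by positivity)
  have hstep : ∀ χ : GenSeries, χ.ExponentsIn Γ → ∀ r B : ℝ, 0 < r → r ≤ ρ →
      nm (wtCut r B) (GenSeries.comp f d la χ).toHahn ≤
        4 * nm (wtCut (c * r ^ 2) (B / 2)) χ.toHahn := by
    intro χ hχ r B hr hrr
    refine (nm_comp_wtCut_le (by omega) la (fun l hl => hnorm l (hχ l hl)) hr (hρ r hr hrr) B).trans ?_
    refine mul_le_mul_right (nm_mono fun μ hμ => ?_) _
    have hμ0 := hpos _ (hχ μ hμ)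
    have hr1 : r ≤ 1 := by nlinarith
    have hd' : (2 : ℝ) ≤ d := by exact_mod_cast hd
    unfold wtCut
    by_cases hB : μ.re ≤ B / d
    · have hB2 : μ.re ≤ B / 2 := by
        rw [le_div_iff₀ (by positivity)] at hB
        rw [le_div_iff₀ (by positivity)]
        nlinarith
      rw [if_pos hB, if_pos hB2, ← hc]
      refine wt_mono (by positivity) ?_ hμ0.le
      gcongr ?_ * ?_
      exact pow_le_pow_of_le_one hr.le hr1 hd
    · rw [if_neg hB]
      exact zero_le
  have hexp : ∀ χ : GenSeries, χ.ExponentsIn Γ → (GenSeries.comp f d la χ).ExponentsIn Γ := by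
    intro χ hχ μ hμ
    obtain ⟨-, i, l, hl, rfl⟩ := exists_of_compCoeff_ne_zero hμ
    have h2 : ∀ k : ℕ, 1 ≤ k → (k : ℂ) * l ∈ Γ := by
      intro k hk
      induction k, hk using Nat.le_induction with
      | base => simpa using hχ l hl
      | succ k _ ih =>
        push_cast
        rw [add_mul, one_mul]
        exact add_mem ih (hχ l hl)
    have h3 : ∀ (k : ℕ) (z : ℂ), z ∈ Γ → z + k ∈ Γ := by
      intro k z hz
      induction k with
      | zero => simpa using hz
      | succ k ih =>
        push_cast
        rw [← add_assoc]
        exact add_mem ih h1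
    exact h3 i _ (h2 d (by omega))
  intro j
  induction j with
  | zero =>
    intro χ hχ
    exact ⟨hχ, by simpa using hstep χ hχ⟩
  | succ j ih =>
    intro χ hχ
    refine ⟨?_, fun r B hr hrr => ?_⟩
    · rw [Function.iterate_succ_apply]
      exact (ih _ (hexp χ hχ)).1
    · have hr1 : r * c ≤ 1 := (mul_le_mul_of_nonneg_right hrr (by linarith)).trans hρ1
      have hrr2 : c * r ^ 2 ≤ r := by nlinarith
      rw [Function.iterate_succ_apply]
      refine ((ih _ (hexp χ hχ)).2 r B hr hrr).trans ?_
      rw [pow_succ 4 (j + 1), mul_assoc]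
      refine mul_le_mul_right ((hstep χ hχ (c * r ^ 2) (B / 2) (by positivity)
        (hrr2.trans hrr)).trans (mul_le_mul_right (nm_mono fun μ hμ => ?_) _)) _
      have hμ0 := hpos _ (hχ μ hμ)
      unfold wtCut
      by_cases hB : μ.re ≤ B / 2 / 2
      · rw [if_pos hB, if_pos (by linarith)]
        refine wt_mono (by positivity) ?_ hμ0.le
        refine mul_le_mul_of_nonneg_left ?_ (by linarith)
        exact pow_le_pow_left₀ (by positivity) hrr2 2
      · rw [if_neg hB]
        exact zero_le

/-- Convergence for a substitution `f` of order at least two. -/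
theorem exists_nm_lt_top_of_order {f : PowerSeries ℂ} {d : ℕ} (hd : 2 ≤ d) (la : ℂ) {κ : ℝ}
    (hκ : 0 ≤ κ) (h1 : (1 : ℂ) ∈ Γ) (hε : 0 < ε) (hΓ : ∀ z ∈ Γ, ε ≤ z.re)
    (hnorm : ∀ z ∈ Γ, ‖z‖ ≤ κ * z.re) (hf : ∃ ρ > 0, ∀ r, 0 < r → r ≤ ρ →
      pw r (unitTail f d) ≤ 4⁻¹) (hν : 0 ≤ ν.re) (hR : 0 < R) (hFc : ConvergentAt F R C)
    (hv : ∀ i μ, cf (v i) μ ≠ 0 → μ ∈ Γ) (hvn : ∀ i, ∃ r > 0, nm (wt r) (v i) < ⊤)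
    (hw0 : w 0 = 0)
    (hw : ∀ j : Fin (n + 1), w j.succ = ((GenSeries.comp f d la)^[(j : ℕ)] χ).toHahn)
    (hws : ∀ i μ, cf (w i) μ ≠ 0 → μ ∈ shiftOne Γ ν)
    (hχ : ∀ l, χ.coeff l ≠ 0 → l ∈ shiftOne Γ ν ∧ 2 * ν.re ≤ l.re)
    (hF : ∀ μ, substCoeff F (v + w) μ = 0) {A : ℂ} (hA0 : A ≠ 0)
    (hA : substCoeff (MvPowerSeries.pderiv ℂ 1 F) (v + w) ν = A)
    (hA' : ∀ μ, μ ≠ ν → substCoeff (MvPowerSeries.pderiv ℂ 1 F) (v + w) μ ≠ 0 → μ - ν ∈ Γ) :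
    ∃ r > 0, nm (wt r) χ.toHahn < ⊤ := by
  have hpos : ∀ z ∈ Γ, 0 < z.re := fun z hz => hε.trans_le (hΓ z hz)
  have hχΓ : χ.ExponentsIn Γ := fun l hl => (hχ l hl).1.1
  obtain ⟨ρ, hρ, hρ'⟩ := hf
  set c := Real.exp (κ * (1 + ‖la‖)) with hc
  have hc1 : 1 ≤ c := Real.one_le_exp (by positivity)
  set ρ₁ := min ρ c⁻¹ with hρ₁
  have hρ₁0 : 0 < ρ₁ := by positivity
  have hρ₁c : ρ₁ * c ≤ 1 := by
    rw [← le_div_iff₀ (by positivity), one_div]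
    exact min_le_right _ _
  have hρ₁1 : ρ₁ ≤ 1 := (min_le_right _ _).trans (inv_le_one_of_one_le₀ hc1)
  have hit := nm_iterate_comp_wtCut_le hd la hκ h1 hpos hnorm
    (fun r hr hrr => hρ' r hr (hrr.trans (min_le_left _ _))) hc hρ₁c
  obtain ⟨r₁, hr₁0, hr₁1, hr₁⟩ := exists_radius hε hΓ hv hvn hR hρ₁0
  -- The divisor is the constant A, so no damping is needed.
  set g : ℂ → ℝ := fun _ => 1 with hgdef
  have hg : IsDamping Γ g g := isDamping_one Γ
  have hsum : ∀ r M : ℝ, 0 < r → nm (wtOne g ν r M) χ.toHahn =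
      ENNReal.ofReal (dampedSum χ.coeff g g ν r (χ.finite_ne M).toFinset) := by
    intro r M hr
    rw [← tsum_eq_dampedSum hg.pos (fun _ => zero_le_one) hr]
    refine tsum_congr fun l => ?_
    rw [hgdef, ENNReal.ofReal_one, one_mul]
    rfl
  have hone : ∀ r M : ℝ, 0 < r → wtOne g ν r M = fun μ => wtCut r M μ * wt r (-ν) := by
    intro r M hr
    funext μ
    unfold wtOne wtCut
    split_ifs
    · rw [hgdef, one_mul, ← wt_add hr]
      rfl
    · rw [zero_mul]
  have hwn : ∀ r M : ℝ, 0 < r → r ≤ r₁ → ∀ j, nm (wtOne g ν r M) (w j) ≤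
      ENNReal.ofReal (4 ^ n * dampedSum χ.coeff g g ν r (χ.finite_ne M).toFinset) := by
    intro r M hr hrr i
    have hrρ := hrr.trans hr₁1
    rw [ENNReal.ofReal_mul (by positivity), ← hsum r M hr, ENNReal.ofReal_pow (by norm_num),
      ENNReal.ofReal_ofNat]
    induction i using Fin.cases with
    | zero => rw [hw0, nm_zero]; exact zero_le
    | succ j =>
      have hj : (j : ℕ) ≤ n := Nat.lt_succ_iff.mp j.2
      refine le_trans ?_ (mul_le_mul_left (pow_le_pow_right₀ (by norm_num) hj) _)
      rw [hw]
      rcases hj' : (j : ℕ) with _ | k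
      · simp
      · rw [hone r M hr, nm_mul_const, nm_mul_const, ← mul_assoc]
        refine mul_le_mul_left (((hit k χ hχΓ).2 r M hr hrρ).trans (mul_le_mul_right
          (nm_mono fun μ hμ => ?_) _)) _
        have hμ0 := hpos _ (hχΓ μ hμ)
        unfold wtCut
        by_cases hB : μ.re ≤ M / 2
        · rw [if_pos hB, if_pos (by linarith)]
          refine wt_mono (by positivity) ?_ hμ0.le
          have : r * c ≤ 1 := (mul_le_mul_of_nonneg_right hrρ (by linarith)).trans hρ₁c
          nlinarith
        · rw [if_neg hB]
          exact zero_le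
  -- The main part consists of y₀ alone; its index is 1 because index 0 is the variable x.
  have hE : ∀ l, χ.coeff l ≠ 0 → g (l - ν) * (g l * ‖χ.coeff l‖) ≤
      ‖A‖⁻¹ * (g (l - ν) * ‖∑ j, (Pi.single 1 A : Fin (n + 2) → ℂ) j * cf (w j) l‖) := by
    intro l hl
    have h2 : ∑ j, (Pi.single 1 A : Fin (n + 2) → ℂ) j * cf (w j) l = A * χ.coeff l := by
      rw [Finset.sum_eq_single 1]
      · rw [Pi.single_eq_same, ← Fin.succ_zero_eq_one, hw]
        rfl
      · intro j _ hj
        rw [Pi.single_eq_of_ne hj, zero_mul]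
      · simp
    have hA0' : ‖A‖ ≠ 0 := norm_ne_zero_iff.mpr hA0
    rw [h2, norm_mul]
    refine le_of_eq ?_
    simp only [hgdef]
    field_simp
  -- Smallness of the terms with j ≥ 1. Split (c r²)^{Re l} = (c² r)^{Re l / 2} r^{3 Re l / 2}.
  -- Since Re l ≥ 2 Re ν, the second factor makes up for the shift by 2ν against the weight r^{Re(l
  -- - ν)}, and the first tends to 0 with r.
  have hcut : ∀ r M : ℝ, 0 < r → r ≤ ρ₁ → c ^ 2 * r ≤ 1 → ∀ l, χ.coeff l ≠ 0 →
      wtCut (c * r ^ 2) ((M + ν.re) / 2) l * wt r (-(2 * ν)) ≤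
        ENNReal.ofReal ((r / (c ^ 2)⁻¹) ^ (ε / 2)) * wtOne g ν r M l := by
    intro r M hr hrr hcr l hl
    have hl2 := (hχ l hl).2
    have hlε := hΓ l (hχΓ l hl)
    unfold wtCut
    by_cases hB : l.re ≤ (M + ν.re) / 2
    · rw [if_pos hB, wtOne, if_pos (by linarith)]
      unfold wt
      rw [← ENNReal.ofReal_mul (by positivity), ← ENNReal.ofReal_mul (by positivity)]
      refine ENNReal.ofReal_le_ofReal ?_
      have e1 : (c * r ^ 2) ^ l.re = (c ^ 2 * r) ^ (l.re / 2) * r ^ (3 * (l.re / 2)) := by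
        have h3 : c * r ^ 2 = ((c ^ 2 * r) * r ^ 3) ^ (1 / 2 : ℝ) := by
          rw [← Real.sqrt_eq_rpow, show c ^ 2 * r * r ^ 3 = (c * r ^ 2) ^ 2 by ring,
            Real.sqrt_sq (by positivity)]
        rw [h3, ← Real.rpow_mul (by positivity), Real.mul_rpow (by positivity) (by positivity),
          ← Real.rpow_natCast r 3, ← Real.rpow_mul hr.le]
        congr 2 <;> push_cast <;> ring
      have e2 : (c ^ 2 * r) ^ (l.re / 2) ≤ (c ^ 2 * r) ^ (ε / 2) :=
        Real.rpow_le_rpow_of_exponent_ge (by positivity) hcr (by linarith)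
      have e3 : r ^ (3 * (l.re / 2)) * r ^ (-(2 * ν)).re ≤ r ^ (l - ν).re := by
        rw [← Real.rpow_add hr]
        refine Real.rpow_le_rpow_of_exponent_ge hr (hrr.trans hρ₁1) ?_
        simp
        linarith
      rw [e1, div_inv_eq_mul, mul_comm r, hgdef, one_mul, mul_assoc]
      exact mul_le_mul e2 e3 (by positivity) (by positivity)
    · rw [if_neg hB, zero_mul]
      exact zero_le
  have hlin : ∀ j : Fin (n + 1), ∀ η > 0, ∃ ρ > 0, ∀ r M : ℝ, 0 < r → r ≤ ρ →
      ∀ᶠ D in atTop, nm (wtTwo g ν r M) ((MvPolynomial.aeval v (MvPolynomial.pderiv j.succ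
        (MvPowerSeries.truncTotal D F)) - HahnSeries.single (ReExp.of ν)
          ((Pi.single 1 A : Fin (n + 2) → ℂ) j.succ)) * w j.succ) ≤
      ENNReal.ofReal (η * dampedSum χ.coeff g g ν r (χ.finite_ne M).toFinset) := by
    intro j η hη
    induction j using Fin.cases with
    | zero =>
      obtain ⟨ρ, hρ, hρ'⟩ := eventually_nm_linear_le (ν := ν) (H := χ.toHahn) hε hΓ hg hR hFc hr₁0
        hv hr₁ (eventually_pderiv_supp hε hΓ hv hws hA hA') χ.reGe hη
      refine ⟨ρ, hρ, fun r M hr hrr => ?_⟩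
      filter_upwards [hρ' r M hr hrr] with D hD
      rw [ENNReal.ofReal_mul hη.le, hw, Fin.succ_zero_eq_one, Pi.single_eq_same, ← hsum r M hr]
      exact hD
    | succ k =>
      set K := |C / (R / 2)| * 4 ^ ((k : ℕ) + 1) with hK
      have h1 := (tendsto_rpow_zero (r₁ := (c ^ 2)⁻¹) (half_pos hε) K).eventually_le_const hη
      obtain ⟨ρ₂, hρ₂, hρ₂'⟩ := mem_nhdsGT_iff_exists_Ioc_subset.mp h1
      refine ⟨min (min ρ₂ r₁) (c ^ 2)⁻¹, lt_min (lt_min hρ₂ hr₁0) (by positivity),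
        fun r M hr hrr => Eventually.of_forall fun D => ?_⟩
      have hrρ₂ : r ≤ ρ₂ := hrr.trans ((min_le_left _ _).trans (min_le_left _ _))
      have hrr₁ : r ≤ r₁ := hrr.trans ((min_le_left _ _).trans (min_le_right _ _))
      have hcr : c ^ 2 * r ≤ 1 := by
        have := hrr.trans (min_le_right _ _)
        rwa [← one_div, le_div_iff₀ (by positivity), mul_comm] at this
      obtain ⟨hP1, hP2⟩ := nm_aeval_pderiv_le hR hFc hr₁0 hv hr₁ k.succ.succ D
      have hne : (k.succ.succ : Fin (n + 2)) ≠ 1 := by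
        rw [← Fin.succ_zero_eq_one]
        exact fun h => Fin.succ_ne_zero k (Fin.succ_injective _ h)
      rw [Pi.single_eq_of_ne hne, HahnSeries.single_eq_zero, sub_zero, hw]
      set P := MvPolynomial.aeval v (MvPolynomial.pderiv k.succ.succ
        (MvPowerSeries.truncTotal D F))
      have hP0 : ReGe 0 P := by
        intro μ hμ
        rcases hP1 μ hμ with rfl | h
        · simp
        · exact (hpos μ h).le
      have hP3 : nm (wt r) P ≤ ENNReal.ofReal |C / (R / 2)| :=
        (nm_mono fun μ hμ => wt_mono hr hrr₁ (hP0 μ hμ)).trans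
          (hP2.trans (ENNReal.ofReal_le_ofReal (le_abs_self _)))
      have h2 : nm (wtTwo g ν r M) (P * ((GenSeries.comp f d la)^[(k : ℕ) + 1] χ).toHahn) ≤
          nm (wt r) P * nm (fun b => wtCut r (M + ν.re) b * wt r (-(2 * ν)))
            ((GenSeries.comp f d la)^[(k : ℕ) + 1] χ).toHahn := by
        refine nm_mul_le fun a b ha hb => ?_
        have ha0 := hP0 a ha
        unfold wtTwo
        by_cases hB : (a + b).re ≤ M + ν.re
        · rw [if_pos hB, wtCut, if_pos (by rw [Complex.add_re] at hB; linarith), hgdef, one_mul,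
            ← wt_add hr, ← wt_add hr, ← add_assoc, ← sub_eq_add_neg]
          rfl
        · rw [if_neg hB]
          exact zero_le
      refine h2.trans ?_
      rw [nm_mul_const]
      have h3 := (hit k χ hχΓ).2 r (M + ν.re) hr (hrr₁.trans hr₁1)
      have h4 : nm (wtCut (c * r ^ 2) ((M + ν.re) / 2)) χ.toHahn * wt r (-(2 * ν)) ≤
          ENNReal.ofReal ((r / (c ^ 2)⁻¹) ^ (ε / 2)) * nm (wtOne g ν r M) χ.toHahn := by
        rw [← nm_mul_const, ← nm_const_mul]
        exact nm_mono fun l hl => hcut r M hr (hrr₁.trans hr₁1) hcr l hl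
      calc _ ≤ ENNReal.ofReal |C / (R / 2)| * ((4 ^ ((k : ℕ) + 1) *
            nm (wtCut (c * r ^ 2) ((M + ν.re) / 2)) χ.toHahn) * wt r (-(2 * ν))) :=
            mul_le_mul' hP3 (mul_le_mul_left h3 _)
        _ ≤ ENNReal.ofReal |C / (R / 2)| * (4 ^ ((k : ℕ) + 1) *
            (ENNReal.ofReal ((r / (c ^ 2)⁻¹) ^ (ε / 2)) * nm (wtOne g ν r M) χ.toHahn)) := by
            rw [mul_assoc (4 ^ ((k : ℕ) + 1))]
            exact mul_le_mul_right (mul_le_mul_right h4 _) _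
        _ = ENNReal.ofReal ((r / (c ^ 2)⁻¹) ^ (ε / 2) * K) * nm (wtOne g ν r M) χ.toHahn := by
            rw [hK, ENNReal.ofReal_mul (by positivity), ENNReal.ofReal_mul (by positivity),
              ENNReal.ofReal_pow (by norm_num), ENNReal.ofReal_ofNat]
            ring
        _ ≤ ENNReal.ofReal η * nm (wtOne g ν r M) χ.toHahn := by
            refine mul_le_mul_left (ENNReal.ofReal_le_ofReal (hρ₂' ⟨hr, hrρ₂⟩)) _
        _ = _ := by rw [hsum r M hr, ENNReal.ofReal_mul hη.le]
  obtain ⟨r, hr, -, hs⟩ := summable_of_equation (Kw := 4 ^ n) (K := ‖A‖⁻¹) hε hΓ hν hg hR hFc hr₁0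
    (hr₁1.trans hρ₁1) hv hr₁ hws hF (Pi.single 1 A) (fun _ => zero_le_one)
    (fun l hl => (hχ l hl).1) χ.finite_ne (by positivity) (by positivity) hE hwn fun η hη =>
      exists_nm_sum_mul_le hw0 (fun D j => MvPolynomial.aeval v (MvPolynomial.pderiv j
        (MvPowerSeries.truncTotal D F)) - HahnSeries.single (ReExp.of ν)
          ((Pi.single 1 A : Fin (n + 2) → ℂ) j))
        (fun r M => dampedSum χ.coeff g g ν r (χ.finite_ne M).toFinset) hlin hη
  exact nm_lt_top_of_summable χ (fun _ => le_rfl) hg.pos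
      (fun l hl => (hpos _ (hχ l hl).1.2).le) ⟨0, fun κ _ => by simp [hgdef]⟩ hr hs

end Convergence


/-! ### Finitely generated semigroups and the Diophantine condition. -/

section Semigroup

theorem natCast_mul_mem {Γ : AddSubsemigroup ℂ} {z : ℂ} (hz : z ∈ Γ) {k : ℕ} (hk : k ≠ 0) :
    (k : ℂ) * z ∈ Γ := by
  induction k with
  | zero => exact absurd rfl hk
  | succ k ih =>
    push_cast
    rw [add_mul, one_mul]
    by_cases h : k = 0
    · simpa [h] using hz
    · exact add_mem (ih h) hz

theorem add_natCast_mem {Γ : AddSubsemigroup ℂ} (h1 : (1 : ℂ) ∈ Γ) {z : ℂ} (hz : z ∈ Γ) (k : ℕ) :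
    z + k ∈ Γ := by
  rcases Nat.eq_zero_or_pos k with rfl | hk
  · simpa using hz
  · simpa using add_mem hz (natCast_mul_mem h1 hk.ne')

variable {τ : ℕ} {ρ : Fin τ → ℂ}

theorem sum_mem_semigroup (m : Fin τ → ℕ) (hm : m ≠ 0) : ∑ i, (m i : ℂ) * ρ i ∈ semigroup ρ := by
  classical
  have h : ∀ s : Finset (Fin τ), (∀ i ∈ s, m i = 0) ∨ ∑ i ∈ s, (m i : ℂ) * ρ i ∈ semigroup ρ := by
    intro s
    induction s using Finset.induction_on with
    | empty => simp
    | insert a s ha ih =>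
      rw [Finset.sum_insert ha]
      by_cases h : m a = 0
      · rcases ih with ih | ih
        · left
          intro i hi
          rcases Finset.mem_insert.mp hi with rfl | hi
          · exact h
          · exact ih i hi
        · right
          simpa [h] using ih
      · right
        have h1 : (m a : ℂ) * ρ a ∈ semigroup ρ :=
          natCast_mul_mem (AddSubsemigroup.subset_closure (Set.mem_range_self a)) h
        rcases ih with ih | ih
        · rw [Finset.sum_eq_zero fun i hi => by rw [ih i hi, Nat.cast_zero, zero_mul], add_zero]
          exact h1
        · exact add_mem h1 ih
  refine (h Finset.univ).resolve_left fun h0 => hm (funext fun i => h0 i (Finset.mem_univ i))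

theorem exists_of_mem_semigroup {z : ℂ} (hz : z ∈ semigroup ρ) :
    ∃ m : Fin τ → ℕ, m ≠ 0 ∧ z = ∑ i, (m i : ℂ) * ρ i := by
  induction hz using AddSubsemigroup.closure_induction with
  | mem x hx =>
    obtain ⟨i, rfl⟩ := hx
    refine ⟨Pi.single i 1, by simp, ?_⟩
    rw [Finset.sum_eq_single i]
    · simp
    · intro j _ hj
      simp [Pi.single_eq_of_ne hj]
    · simp
  | add x y _ _ hx hy =>
    obtain ⟨a, ha, rfl⟩ := hx
    obtain ⟨b, hb, rfl⟩ := hy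
    refine ⟨a + b, fun h => ha ?_, ?_⟩
    · funext i
      have := congrFun h i
      simp only [Pi.add_apply, Pi.zero_apply] at this ⊢
      omega
    · rw [← Finset.sum_add_distrib]
      refine Finset.sum_congr rfl fun i _ => ?_
      push_cast [Pi.add_apply]
      ring

theorem exists_le_re_generators (hρ : ∀ i, 0 < (ρ i).re) : ∃ ε > 0, ∀ i, ε ≤ (ρ i).re := by
  have h : ∀ᶠ ε in 𝓝[>] (0 : ℝ), ∀ i, ε ≤ (ρ i).re := eventually_all.mpr fun i => by
    filter_upwards [Ioc_mem_nhdsGT (hρ i)] with x hx using hx.2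
  obtain ⟨ε, h1, h2⟩ := (h.and self_mem_nhdsWithin).exists
  exact ⟨ε, h2, h1⟩

theorem exists_le_re_semigroup (hρ : ∀ i, 0 < (ρ i).re) :
    ∃ ε > 0, ∀ z ∈ semigroup ρ, ε ≤ z.re := by
  obtain ⟨ε, hε, h⟩ := exists_le_re_generators hρ
  refine ⟨ε, hε, fun z hz => ?_⟩
  induction hz using AddSubsemigroup.closure_induction with
  | mem x hx =>
    obtain ⟨i, rfl⟩ := hx
    exact h i
  | add x y _ _ hx hy =>
    rw [Complex.add_re]
    linarith

theorem exists_norm_le_semigroup (hρ : ∀ i, 0 < (ρ i).re) :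
    ∃ κ ≥ 0, ∀ z ∈ semigroup ρ, ‖z‖ ≤ κ * z.re := by
  have h : ∀ᶠ κ in atTop, ∀ i, ‖ρ i‖ ≤ κ * (ρ i).re := eventually_all.mpr fun i => by
    filter_upwards [eventually_ge_atTop (‖ρ i‖ / (ρ i).re)] with κ hκ
    rwa [div_le_iff₀ (hρ i)] at hκ
  obtain ⟨κ, h1, h2⟩ := (h.and (eventually_ge_atTop 0)).exists
  refine ⟨κ, h2, fun z hz => ?_⟩
  induction hz using AddSubsemigroup.closure_induction with
  | mem x hx =>
    obtain ⟨i, rfl⟩ := hx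
    exact h1 i
  | add x y _ _ hx hy =>
    rw [Complex.add_re, mul_add]
    exact (norm_add_le _ _).trans (add_le_add hx hy)

/-- The Diophantine condition in multiplicative form. -/
theorem Diophantine.exists_le_norm_sub {lq : ℂ} {R : Set ℂ} (h : Diophantine lq ρ R)
    (hρ : ∀ i, 0 < (ρ i).re) {b : ℂ} (hb : b ∈ R) (hb0 : b ≠ 0) : ∃ c > (0 : ℝ), ∃ γ > (0 : ℝ),
      ∀ l ∈ semigroup ρ, c * l.re ^ (-γ) ≤ ‖Complex.exp (l * lq) - b‖ := by
  obtain ⟨c, hc, γ, hγ, hd⟩ := h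
  obtain ⟨ε, hε, hερ⟩ := exists_le_re_generators hρ
  have hbn : 0 < ‖b‖ := norm_pos_iff.mpr hb0
  refine ⟨‖b‖ * min (1 / 2) (2 / 3 * c) * ε ^ γ, by positivity, γ, hγ, fun l hl => ?_⟩
  obtain ⟨m, hm, rfl⟩ := exists_of_mem_semigroup hl
  set l := ∑ i, (m i : ℂ) * ρ i with hldef
  set S : ℝ := ∑ i, (m i : ℝ) with hS
  have hS1 : 1 ≤ S := by
    have h1 : ∑ i, m i ≠ 0 := fun h0 => hm (funext fun i => by
      simpa using (Finset.sum_eq_zero_iff.mp h0) i (Finset.mem_univ i))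
    have h2 : 1 ≤ ∑ i, m i := Nat.one_le_iff_ne_zero.mpr h1
    rw [hS]
    exact_mod_cast h2
  have hlS : ε * S ≤ l.re := by
    rw [hldef, hS, Complex.re_sum, Finset.mul_sum]
    refine Finset.sum_le_sum fun i _ => ?_
    rw [Complex.mul_re, Complex.natCast_re, Complex.natCast_im, zero_mul, sub_zero, mul_comm]
    exact mul_le_mul_of_nonneg_left (hερ i) (Nat.cast_nonneg _)
  have hl0 : 0 < l.re := lt_of_lt_of_le (by positivity) hlS
  have hpow : ε ^ γ * l.re ^ (-γ) ≤ S ^ (-γ) := by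
    rw [Real.rpow_neg hl0.le, Real.rpow_neg (by positivity), ← div_eq_mul_inv,
      div_le_iff₀ (by positivity), inv_mul_eq_div, le_div_iff₀ (by positivity),
      ← Real.mul_rpow hε.le (by positivity)]
    exact Real.rpow_le_rpow (by positivity) hlS hγ.le
  set z := l * lq - Complex.log b with hz
  have hexp : Complex.exp (l * lq) - b = b * (Complex.exp z - 1) := by
    rw [hz, Complex.exp_sub, Complex.exp_log hb0]
    field_simp
  have hSγ : S ^ (-γ) ≤ 1 := Real.rpow_le_one_of_one_le_of_nonpos hS1 (by linarith)
  have hSγ0 : 0 < S ^ (-γ) := by positivity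
  have key : min (1 / 2) (2 / 3 * c) * S ^ (-γ) ≤ ‖Complex.exp z - 1‖ := by
    -- Near 1, |log(1 + w)| ≤ (3/2)|w|, so |e^z - 1| is at least 2/3 of the distance from z to some
    -- multiple of 2πi. This explains 2c/3; away from 1 the bound 1/2 suffices as S^{-γ} ≤ 1.
    by_cases h1 : ‖Complex.exp z - 1‖ ≤ 1 / 2
    · have h2 := Complex.norm_log_one_add_half_le_self h1
      rw [add_sub_cancel] at h2
      obtain ⟨k, hk⟩ := Complex.exp_eq_exp_iff_exists_int.mp
        (Complex.exp_log (Complex.exp_ne_zero z))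
      have h3 := hd b hb m hm (-k)
      have h4 : Complex.log (Complex.exp z) = l * lq - Complex.log b -
          2 * Real.pi * (-k : ℤ) * Complex.I := by
        rw [hk, hz]
        push_cast
        ring
      rw [← hldef, ← h4] at h3
      calc min (1 / 2) (2 / 3 * c) * S ^ (-γ) ≤ (2 / 3 * c) * S ^ (-γ) := by
            gcongr
            exact min_le_right _ _
        _ ≤ _ := by linarith
    · calc min (1 / 2) (2 / 3 * c) * S ^ (-γ) ≤ (1 / 2) * 1 := by
            gcongr
            exact min_le_left _ _
        _ ≤ _ := by linarith
  rw [hexp, norm_mul]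
  calc ‖b‖ * min (1 / 2) (2 / 3 * c) * ε ^ γ * l.re ^ (-γ)
      = ‖b‖ * (min (1 / 2) (2 / 3 * c) * (ε ^ γ * l.re ^ (-γ))) := by ring
    _ ≤ ‖b‖ * (min (1 / 2) (2 / 3 * c) * S ^ (-γ)) := by gcongr
    _ ≤ ‖b‖ * ‖Complex.exp z - 1‖ := mul_le_mul_of_nonneg_left key hbn.le

end Semigroup

/-! ### From estimates at the roots of L to damping factors. -/

section Divisors

theorem rpow_neg_le_rpow_neg {x ε γ γ₁ : ℝ} (hε : 0 < ε) (hx : ε ≤ x) (hγ : γ₁ ≤ γ) :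
    x ^ (-γ) ≤ ε ^ (-(γ - γ₁)) * x ^ (-γ₁) := by
  have hx0 := hε.trans_le hx
  have h : x ^ (-γ) = x ^ (-(γ - γ₁)) * x ^ (-γ₁) := by
    rw [← Real.rpow_add hx0]
    congr 1
    ring
  rw [h]
  gcongr ?_ * _
  exact Real.rpow_le_rpow_of_nonpos hε hx (by linarith)

theorem coeff_charPoly_last {n : ℕ} (A : Fin (n + 1) → ℂ) :
    (charPoly A).coeff n = A (Fin.last n) := by
  rw [charPoly, Polynomial.finsetSum_coeff, Finset.sum_eq_single (Fin.last n)]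
  · simp
  · intro j _ hj
    rw [Polynomial.coeff_C_mul_X_pow, if_neg]
    intro h
    exact hj (Fin.ext h.symm)
  · simp

theorem natDegree_charPoly_le {n : ℕ} (A : Fin (n + 1) → ℂ) : (charPoly A).natDegree ≤ n := by
  refine Polynomial.natDegree_sum_le_of_forall_le _ _ fun j _ => ?_
  exact (Polynomial.natDegree_C_mul_X_pow_le _ _).trans (Nat.lt_succ_iff.mp j.2)

variable {Γ : AddSubsemigroup ℂ} {ε : ℝ} {ν lq : ℂ}

/-- The estimates needed for a single root `b` of the characteristic polynomial. -/
theorem exists_divisor_of_root (hε : 0 < ε) (hΓ : ∀ z ∈ Γ, ε ≤ z.re) {b : ℂ}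
    (hb : (∃ c > (0 : ℝ), ∃ N : ℝ, ∀ l ∈ Γ, N < l.re →
        c * max 1 ‖Complex.exp (l * lq)‖ ≤ ‖Complex.exp (l * lq) - b‖) ∨
      (b ≠ 0 ∧ (∃ c > (0 : ℝ), ∃ γ > (0 : ℝ), ∃ N : ℝ, ∀ l ∈ Γ, N < l.re →
          c * l.re ^ (-γ) ≤ ‖Complex.exp (l * lq) - b‖) ∧
        ∃ c > (0 : ℝ), ∃ γ > (0 : ℝ), ∀ l ∈ Γ, c * l.re ^ (-γ) ≤ ‖Complex.exp (l * lq) - 1‖)) :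
    ∃ (d : ℂ → ℝ) (C γ₀ N₀ : ℝ), 0 < C ∧
      (∀ l ∈ Γ, N₀ < l.re → max 1 ‖Complex.exp (l * lq)‖ * min 1 (d l) ≤
        C * ‖Complex.exp (l * lq) - b‖) ∧ (∀ l, 0 ≤ d l) ∧
      ∀ γ, γ₀ ≤ γ → 0 < γ → ∃ c₀ > 0, ∀ c, 0 < c → c ≤ c₀ →
        (∀ l l', l - l' ∈ Γ → ∀ t, d l ≤ t → d l' ≤ t → t ≤ 1 →
          c * (l - l').re ^ (-γ) ≤ t) ∧
        ∀ l ∈ Γ, l - ν ∈ Γ → N₀ < l.re → 2 * ν.re ≤ l.re → c * (l - ν).re ^ (-γ) ≤ d l := by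
  rcases hb with ⟨c, hc, N, h⟩ | ⟨hb0, ⟨c, hc, γ₁, hγ₁, N, h⟩, ⟨c₁, hc₁, γ₂, hγ₂, h1⟩⟩
  -- A root that causes no small divisors. The value 2 exceeds every t ≤ 1, so the separation
  -- requirement is vacuous.
  · refine ⟨fun _ => 2, c⁻¹, 0, N, by positivity, fun l hl hN => ?_, fun _ => zero_le_two,
      fun γ _ hγ => ⟨ε ^ γ, by positivity, fun c hc0 hc => ⟨?_, ?_⟩⟩⟩
    · have := h l hl hN
      rw [min_eq_left (by norm_num), mul_one, ← div_eq_inv_mul, le_div_iff₀ hc, mul_comm]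
      exact this
    · intro l l' _ t ht _ ht1
      linarith
    · intro l hl hlν _ _
      have h2 : (l - ν).re ^ (-γ) ≤ ε ^ (-γ) :=
        Real.rpow_le_rpow_of_nonpos hε (hΓ _ hlν) (by linarith)
      have hpos := hε.trans_le (hΓ _ hlν)
      calc c * (l - ν).re ^ (-γ) ≤ ε ^ γ * ε ^ (-γ) := by gcongr
        _ = 1 := by rw [← Real.rpow_add hε, add_neg_cancel, Real.rpow_zero]
        _ ≤ 2 := by norm_num
  · have hbn : 0 < ‖b‖ := norm_pos_iff.mpr hb0
    set s := 2 / ‖b‖ with hs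
    have hs0 : 0 < s := by positivity
    refine ⟨fun l => s * ‖Complex.exp (l * lq) - b‖, (1 + ‖b‖) * s + 1, max γ₁ γ₂, N, by positivity,
      fun l hl hN => ?_, fun _ => mul_nonneg hs0.le (norm_nonneg _), fun γ hγ0 hγ => ?_⟩
    · set z := Complex.exp (l * lq)
      have h2 : max 1 ‖z‖ ≤ 1 + ‖b‖ + ‖z - b‖ := by
        refine max_le (by linarith [norm_nonneg (z - b)]) ?_
        have := norm_add_le (z - b) b
        rw [sub_add_cancel] at this
        linarith
      have h3 : min 1 (s * ‖z - b‖) ≤ 1 := min_le_left _ _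
      have h4 : min 1 (s * ‖z - b‖) ≤ s * ‖z - b‖ := min_le_right _ _
      have h5 : 0 ≤ min 1 (s * ‖z - b‖) := by positivity
      calc max 1 ‖z‖ * min 1 (s * ‖z - b‖) ≤ (1 + ‖b‖ + ‖z - b‖) * min 1 (s * ‖z - b‖) := by gcongr
        _ = (1 + ‖b‖) * min 1 (s * ‖z - b‖) + ‖z - b‖ * min 1 (s * ‖z - b‖) := by ring
        _ ≤ (1 + ‖b‖) * (s * ‖z - b‖) + ‖z - b‖ * 1 := by gcongr
        _ = _ := by ring
    · have hγ1 : γ₁ ≤ γ := (le_max_left _ _).trans hγ0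
      have hγ2 : γ₂ ≤ γ := (le_max_right _ _).trans hγ0
      refine ⟨min (c₁ / 2 * ε ^ (γ - γ₂)) (s * c * 2 ^ (-γ₁) * ε ^ (γ - γ₁)), by positivity,
        fun c' hc'0 hc' => ⟨fun l l' hll t ht ht' ht1 => ?_, fun l hl hlν hN hl2 => ?_⟩⟩
      -- Siegel's separation. If q^l and q^{l'} are both within t|b|/2 of b, then |q^{l'}| ≥ |b|/2
      -- and hence |q^{l-l'} - 1| ≤ 2t, so the estimate at the root 1 bounds t below. The
      -- normalization 2/|b| of the divisor serves this step.
      · set z := Complex.exp (l * lq)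
        set z' := Complex.exp (l' * lq)
        have h2 := h1 _ hll
        have h3 : z = z' * Complex.exp ((l - l') * lq) := by
          rw [← Complex.exp_add, ← add_mul, add_sub_cancel]
        have e1 : ‖z - b‖ ≤ t * ‖b‖ / 2 := by
          change s * ‖z - b‖ ≤ t at ht
          rw [hs, div_mul_eq_mul_div, div_le_iff₀ hbn] at ht
          linarith
        have e2 : ‖z' - b‖ ≤ t * ‖b‖ / 2 := by
          change s * ‖z' - b‖ ≤ t at ht'
          rw [hs, div_mul_eq_mul_div, div_le_iff₀ hbn] at ht'
          linarith
        have e3 : ‖b‖ / 2 ≤ ‖z'‖ := by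
          have := norm_sub_norm_le b z'
          rw [norm_sub_rev] at this
          nlinarith
        have e4 : ‖z'‖ * ‖Complex.exp ((l - l') * lq) - 1‖ ≤ t * ‖b‖ := by
          rw [← norm_mul, mul_sub, ← h3, mul_one]
          calc ‖z - z'‖ = ‖(z - b) - (z' - b)‖ := by congr 1; ring
            _ ≤ _ := (norm_sub_le _ _).trans (by linarith)
        have e5 : ‖Complex.exp ((l - l') * lq) - 1‖ ≤ 2 * t := by
          have h4 : ‖b‖ / 2 * ‖Complex.exp ((l - l') * lq) - 1‖ ≤ t * ‖b‖ :=
            (mul_le_mul_of_nonneg_right e3 (norm_nonneg _)).trans e4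
          have h5 : ‖b‖ * ‖Complex.exp ((l - l') * lq) - 1‖ ≤ ‖b‖ * (2 * t) := by linarith
          exact le_of_mul_le_mul_left h5 hbn
        have h6 := rpow_neg_le_rpow_neg hε (hΓ _ hll) hγ2
        have hpos := hε.trans_le (hΓ _ hll)
        calc c' * (l - l').re ^ (-γ)
            ≤ (c₁ / 2 * ε ^ (γ - γ₂)) * (ε ^ (-(γ - γ₂)) * (l - l').re ^ (-γ₂)) := by
              gcongr
              exact hc'.trans (min_le_left _ _)
          _ = (c₁ * (l - l').re ^ (-γ₂)) / 2 * (ε ^ (γ - γ₂) * ε ^ (-(γ - γ₂))) := by ring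
          _ = (c₁ * (l - l').re ^ (-γ₂)) / 2 := by
              rw [← Real.rpow_add hε, add_neg_cancel, Real.rpow_zero, mul_one]
          _ ≤ t := by linarith
      · have h2 := h l hl hN
        have hpos := hε.trans_le (hΓ _ hlν)
        have h6 := rpow_neg_le_rpow_neg hε (hΓ _ hlν) hγ1
        have hlpos := hε.trans_le (hΓ _ hl)
        -- From Re l ≥ 2 Re ν one gets Re l ≤ 2 Re(l - ν), so the lower bound can be expressed
        -- through the relative exponent.
        have h7 : 2 ^ (-γ₁) * (l - ν).re ^ (-γ₁) ≤ l.re ^ (-γ₁) := by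
          rw [← Real.mul_rpow zero_le_two hpos.le]
          refine Real.rpow_le_rpow_of_nonpos hlpos ?_ (by linarith)
          rw [Complex.sub_re]
          linarith
        calc c' * (l - ν).re ^ (-γ)
            ≤ (s * c * 2 ^ (-γ₁) * ε ^ (γ - γ₁)) * (ε ^ (-(γ - γ₁)) * (l - ν).re ^ (-γ₁)) := by
              gcongr
              exact hc'.trans (min_le_right _ _)
          _ = s * (c * (2 ^ (-γ₁) * (l - ν).re ^ (-γ₁))) * (ε ^ (γ - γ₁) * ε ^ (-(γ - γ₁))) := by
              ring
          _ = s * (c * (2 ^ (-γ₁) * (l - ν).re ^ (-γ₁))) := by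
              rw [← Real.rpow_add hε, add_neg_cancel, Real.rpow_zero, mul_one]
          _ ≤ s * (c * l.re ^ (-γ₁)) := by gcongr
          _ ≤ s * ‖Complex.exp (l * lq) - b‖ := mul_le_mul_of_nonneg_left h2 hs0.le

/-- L splits over ℂ, and each root, with multiplicity, contributes one family of divisors; c and γ
are chosen common to all. Every factor pays for one power of max(1, |q^l|). The n powers required
are available because deg L = n, or because |q^l| ≤ 1 makes them trivial. -/
theorem exists_damping_of_roots (hε : 0 < ε) (hΓ : ∀ z ∈ Γ, ε ≤ z.re) {n : ℕ}
    {A : Fin (n + 1) → ℂ} (hL : charPoly A ≠ 0)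
    (hdeg : A (Fin.last n) ≠ 0 ∨ ∀ l ∈ Γ, ‖Complex.exp (l * lq)‖ ≤ 1)
    (hroots : ∀ b ∈ (charPoly A).roots, (∃ c > (0 : ℝ), ∃ N : ℝ, ∀ l ∈ Γ, N < l.re →
        c * max 1 ‖Complex.exp (l * lq)‖ ≤ ‖Complex.exp (l * lq) - b‖) ∨
      (b ≠ 0 ∧ (∃ c > (0 : ℝ), ∃ γ > (0 : ℝ), ∃ N : ℝ, ∀ l ∈ Γ, N < l.re →
          c * l.re ^ (-γ) ≤ ‖Complex.exp (l * lq) - b‖) ∧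
        ∃ c > (0 : ℝ), ∃ γ > (0 : ℝ), ∀ l ∈ Γ, c * l.re ^ (-γ) ≤ ‖Complex.exp (l * lq) - 1‖)) (ν : ℂ) :
    ∃ (g g₂ : ℂ → ℝ) (N K : ℝ), IsDamping Γ g g₂ ∧
      (∃ k : ℝ, ∀ κ : ℂ, 0 ≤ κ.re → Real.exp (-(k * κ.re)) ≤ g κ) ∧ 0 < K ∧
      ∀ l ∈ shiftOne Γ ν, N < l.re → g (l - ν) * max 1 ‖Complex.exp (l * lq)‖ ^ n ≤
        K * (g₂ (l - ν) * ‖(charPoly A).eval (Complex.exp (l * lq))‖) := by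
  set L := charPoly A with hLdef
  set s := L.roots.toList with hs
  have hlen : s.length = L.natDegree := by
    rw [hs, Multiset.length_toList, IsAlgClosed.card_roots_eq_natDegree]
  have heval : ∀ z, ‖L.eval z‖ = ‖L.leadingCoeff‖ * ∏ i : Fin s.length, ‖z - s[i.1]‖ := by
    intro z
    rw [(IsAlgClosed.splits L).eval_eq_prod_roots z, norm_mul, ← norm_prod,
      Fin.prod_univ_fun_getElem s (fun b => z - b), ← Multiset.prod_coe, ← Multiset.map_coe, hs,
      Multiset.coe_toList]
  have hd : ∀ i : Fin s.length, _ := fun i => exists_divisor_of_root (ν := ν) hε hΓ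
    (hroots s[i.1] (by rw [← Multiset.mem_toList]; exact List.getElem_mem _))
  choose d C γ₀ N₀ hC hd1 hd0 hd2 using hd
  obtain ⟨γ, hγ, hγ0⟩ : ∃ γ, (∀ i, γ₀ i ≤ γ) ∧ 0 < γ :=
    ((eventually_all.mpr fun i => eventually_ge_atTop (γ₀ i)).and (eventually_gt_atTop 0)).exists
  choose c₀ hc₀ hd3 using fun i => hd2 i γ (hγ i) hγ0
  obtain ⟨N, hN, hNν⟩ : ∃ N, (∀ i, N₀ i ≤ N) ∧ 2 * ν.re ≤ N :=
    ((eventually_all.mpr fun i => eventually_ge_atTop (N₀ i)).and (eventually_ge_atTop _)).exists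
  obtain ⟨c, hc, hc0⟩ : ∃ c, (∀ i, c ≤ c₀ i) ∧ 0 < c := by
    have h : ∀ᶠ c in 𝓝[>] (0 : ℝ), ∀ i, c ≤ c₀ i := eventually_all.mpr fun i => by
      filter_upwards [Ioc_mem_nhdsGT (hc₀ i)] with x hx using hx.2
    obtain ⟨c, h1, h2⟩ := (h.and self_mem_nhdsWithin).exists
    exact ⟨c, h1, h2⟩
  obtain ⟨g, g₂, hg, hexp, hgg⟩ := exists_isDamping (Γ := Γ) (fun z hz => hε.trans_le (hΓ z hz))
    (fun i κ => d i (κ + ν)) {κ | κ + ν ∈ shiftOne Γ ν ∧ N < (κ + ν).re} hc0 hγ0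
    (fun κ hκ => by
      have := hκ.1.2
      rw [add_sub_cancel_right] at this
      exact hε.trans_le (hΓ κ this))
    (fun i κ _ κ' _ hκκ t ht ht' ht1 => by
      have := (hd3 i c hc0 (hc i)).1 (κ + ν) (κ' + ν) (by rwa [add_sub_add_right_eq_sub]) t ht ht' ht1
      rwa [add_sub_add_right_eq_sub] at this)
    (fun i κ hκ => by
      have := (hd3 i c hc0 (hc i)).2 (κ + ν) hκ.1.1 hκ.1.2 ((hN i).trans_lt hκ.2)
        (hNν.trans hκ.2.le)
      rwa [add_sub_cancel_right] at this)
  have hlc : 0 < ‖L.leadingCoeff‖ := norm_pos_iff.mpr (Polynomial.leadingCoeff_ne_zero.mpr hL)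
  have hCp : 0 < ∏ i, C i := Finset.prod_pos fun i _ => hC i
  refine ⟨g, g₂, N, (∏ i, C i) / ‖L.leadingCoeff‖, hg, hexp, by positivity, fun l hl hNl => ?_⟩
  set z := Complex.exp (l * lq) with hz
  have h1 := hgg (l - ν) ⟨by rwa [sub_add_cancel], by rwa [sub_add_cancel]⟩
  simp only [sub_add_cancel] at h1
  have h2 : max 1 ‖z‖ ^ n = max 1 ‖z‖ ^ s.length := by
    rcases hdeg with h | h
    · rw [hlen]
      congr 1
      refine le_antisymm ?_ (natDegree_charPoly_le A)
      exact Polynomial.le_natDegree_of_ne_zero (by rwa [hLdef, coeff_charPoly_last])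
    · rw [max_eq_left (h l hl.1), one_pow, one_pow]
  have h3 : (∏ i, min 1 (d i l)) * max 1 ‖z‖ ^ s.length ≤
      (∏ i, C i) * ∏ i : Fin s.length, ‖z - s[i.1]‖ := by
    have h4 : max 1 ‖z‖ ^ s.length = ∏ _i : Fin s.length, max 1 ‖z‖ := by simp
    rw [h4, ← Finset.prod_mul_distrib, ← Finset.prod_mul_distrib]
    refine Finset.prod_le_prod (fun i _ => ?_) fun i _ => ?_
    · have := hd0 i l
      positivity
    · rw [mul_comm]
      exact hd1 i l hl.1 ((hN i).trans_lt hNl)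
  have hg2 := hg.pos₂ (l - ν)
  rw [h2, heval]
  calc g (l - ν) * max 1 ‖z‖ ^ s.length
      ≤ (g₂ (l - ν) * ∏ i, min 1 (d i l)) * max 1 ‖z‖ ^ s.length := by gcongr
    _ = g₂ (l - ν) * ((∏ i, min 1 (d i l)) * max 1 ‖z‖ ^ s.length) := by ring
    _ ≤ g₂ (l - ν) * ((∏ i, C i) * ∏ i : Fin s.length, ‖z - s[i.1]‖) := by gcongr
    _ = _ := by field_simp

end Divisors


/-! ### Ordinary power series as generalized ones. -/

section PowerSeriesEmbedding

/-- The exponents `0, 1, 2, …`. -/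
def natExp : ℕ →+ ReExp where
  toFun k := ReExp.of k
  map_zero' := Nat.cast_zero (R := ℂ)
  map_add' a b := Nat.cast_add (R := ℂ) a b

theorem natExp_injective : Function.Injective natExp := fun _ _ h => Nat.cast_injective (R := ℂ) h

theorem natExp_le (a b : ℕ) : natExp a ≤ natExp b ↔ a ≤ b := by
  rw [ReExp.le_def, le_iff_eq_or_lt, natExp_injective.eq_iff]
  refine or_congr Iff.rfl ?_
  change (a : ℂ).re < (b : ℂ).re ↔ _
  simp

/-- Power series as generalized power series. -/
def psHom : PowerSeries ℂ →+* HS :=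
  (HahnSeries.embDomainRingHom natExp natExp_injective natExp_le).comp
    (HahnSeries.toPowerSeries (R := ℂ)).symm.toRingHom

theorem cf_psHom (u : PowerSeries ℂ) (k : ℕ) : cf (psHom u) k = PowerSeries.coeff k u :=
  HahnSeries.embDomain_coeff

theorem exists_of_cf_psHom_ne_zero {u : PowerSeries ℂ} {μ : ℂ} (h : cf (psHom u) μ ≠ 0) :
    ∃ k : ℕ, μ = k ∧ PowerSeries.coeff k u ≠ 0 := by
  by_cases hμ : ReExp.of μ ∈ Set.range natExp
  · obtain ⟨k, hk⟩ := hμ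
    have hk' : μ = k := hk.symm
    subst hk'
    exact ⟨k, rfl, by rwa [cf_psHom] at h⟩
  · exact absurd (HahnSeries.embDomain_of_notMem_range hμ) h

/-- The terms of positive degree of a power series, as a generalized power series. -/
def GenSeries.ofPowerSeries (u : PowerSeries ℂ) (hu : PowerSeries.coeff 0 u = 0) : GenSeries where
  coeff := cf (psHom u)
  re_pos l hl := by
    obtain ⟨k, rfl, hk⟩ := exists_of_cf_psHom_ne_zero hl
    have hk0 : k ≠ 0 := by
      rintro rfl
      exact hk hu
    simpa using Nat.pos_of_ne_zero hk0
  finite_le N := by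
    refine ((Set.finite_Iic ⌊N⌋₊).image fun k : ℕ => (k : ℂ)).subset ?_
    rintro l ⟨hl, hN⟩
    obtain ⟨k, rfl, -⟩ := exists_of_cf_psHom_ne_zero hl
    exact ⟨k, Nat.le_floor (by simpa using hN), rfl⟩

theorem nm_psHom {r : ℝ} (hr : 0 ≤ r) (u : PowerSeries ℂ) : nm (wt r) (psHom u) = pw r u := by
  unfold nm pw
  rw [← Function.Injective.tsum_eq (g := fun k : ℕ => (k : ℂ)) Nat.cast_injective]
  · refine tsum_congr fun k => ?_
    rw [cf_psHom, wt, Complex.natCast_re, Real.rpow_natCast, ENNReal.ofReal_pow hr]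
  · intro μ hμ
    have h : cf (psHom u) μ ≠ 0 := by
      intro h
      exact hμ (by simp [h])
    obtain ⟨k, rfl, -⟩ := exists_of_cf_psHom_ne_zero h
    exact ⟨k, rfl⟩

/-- The positive integers as exponents. -/
def posNat : AddSubsemigroup ℂ where
  carrier := {z | ∃ k : ℕ, k ≠ 0 ∧ z = k}
  add_mem' := by
    rintro _ _ ⟨a, ha, rfl⟩ ⟨b, _, rfl⟩
    exact ⟨a + b, by omega, by push_cast; rfl⟩

theorem one_le_re_posNat : ∀ z ∈ posNat, (1 : ℝ) ≤ z.re := by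
  rintro _ ⟨k, hk, rfl⟩
  rw [Complex.natCast_re]
  exact_mod_cast Nat.one_le_iff_ne_zero.mpr hk

theorem mem_posNat_of_cf_psHom_ne_zero {u : PowerSeries ℂ} (hu : PowerSeries.coeff 0 u = 0) {μ : ℂ}
    (h : cf (psHom u) μ ≠ 0) : μ ∈ posNat := by
  obtain ⟨k, rfl, hk⟩ := exists_of_cf_psHom_ne_zero h
  exact ⟨k, fun h0 => hk (by rw [h0, hu]), rfl⟩

theorem hasTaylorSeries₁_of_pw_lt_top {p : PowerSeries ℂ} {r : ℝ} (hr : 0 < r) (h : pw r p < ⊤) :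
    HasTaylorSeries₁ (fun z => ∑' k : ℕ, PowerSeries.coeff k p * z ^ k) p := by
  have h1 : Summable fun k : ℕ => ‖PowerSeries.coeff k p‖ * r ^ k := by
    have h2 := ENNReal.summable_toReal h.ne
    refine h2.congr fun k => ?_
    rw [← ofReal_norm, ← ENNReal.ofReal_pow hr.le, ← ENNReal.ofReal_mul (norm_nonneg _),
      ENNReal.toReal_ofReal (by positivity)]
  filter_upwards [Metric.ball_mem_nhds (0 : ℂ) hr] with z hz
  refine (Summable.of_norm_bounded h1 fun k => ?_).hasSum
  rw [norm_mul, norm_pow]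
  rw [mem_ball_zero_iff] at hz
  gcongr

end PowerSeriesEmbedding

/-! ### Convergence of solutions of α y(qx) + β x = p(y(x)). -/

section Implicit

/-- The Taylor series of `α y₁ + β x - p (y₀)`. -/
def implicitSeries (α β : ℂ) (p : PowerSeries ℂ) : MvPowerSeries (Fin 3) ℂ := fun m =>
  (if m = Finsupp.single 2 1 then α else 0) + (if m = Finsupp.single 0 1 then β else 0) -
    if m = Finsupp.single 1 (m 1) then PowerSeries.coeff (m 1) p else 0

theorem coeff_implicitSeries (α β : ℂ) (p : PowerSeries ℂ) (m : Fin 3 →₀ ℕ) :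
    MvPowerSeries.coeff m (implicitSeries α β p) =
      (if m = Finsupp.single 2 1 then α else 0) + (if m = Finsupp.single 0 1 then β else 0) -
      if m = Finsupp.single 1 (m 1) then PowerSeries.coeff (m 1) p else 0 := rfl

theorem truncTotal_implicitSeries (α β : ℂ) (p : PowerSeries ℂ) {D : ℕ} (hD : 2 ≤ D) :
    MvPowerSeries.truncTotal D (implicitSeries α β p) =
      MvPolynomial.C α * MvPolynomial.X 2 + MvPolynomial.C β * MvPolynomial.X 0 -
        ∑ k ∈ Finset.range D, MvPolynomial.C (PowerSeries.coeff k p) * MvPolynomial.X 1 ^ k := by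
  classical
  ext m
  rw [MvPowerSeries.coeff_truncTotal_eq_ite, coeff_implicitSeries, MvPolynomial.coeff_sub,
    MvPolynomial.coeff_add, MvPolynomial.coeff_C_mul, MvPolynomial.coeff_C_mul,
    MvPolynomial.coeff_X, MvPolynomial.coeff_X, MvPolynomial.coeff_sum]
  simp_rw [MvPolynomial.coeff_C_mul, MvPolynomial.coeff_X_pow]
  have h1 : ∑ k ∈ Finset.range D, PowerSeries.coeff k p *
      (if Finsupp.single 1 k = m then (1 : ℂ) else 0) =
      if m.degree < D then (if m = Finsupp.single 1 (m 1) then PowerSeries.coeff (m 1) p else 0)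
        else 0 := by
    by_cases hm : m = Finsupp.single 1 (m 1)
    · have hdeg : m.degree = m 1 := by
        conv_lhs => rw [hm]
        rw [Finsupp.degree_single]
      rw [if_pos hm, hdeg]
      split_ifs with h
      · rw [Finset.sum_eq_single (m 1)]
        · rw [if_pos hm.symm, mul_one]
        · intro k _ hk
          rw [if_neg, mul_zero]
          rintro rfl
          exact hk (by simp)
        · intro h'
          exact absurd (Finset.mem_range.mpr h) h'
      · refine Finset.sum_eq_zero fun k hk => ?_
        rw [if_neg, mul_zero]
        rintro rfl
        exact h (by simpa using hk)
    · rw [if_neg hm, ite_self]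
      refine Finset.sum_eq_zero fun k _ => ?_
      rw [if_neg, mul_zero]
      rintro rfl
      exact hm (by simp)
  rw [h1]
  by_cases h : m.degree < D
  · simp only [if_pos h, eq_comm (a := m), mul_ite, mul_one, mul_zero]
  · have e : ∀ i : Fin 3, Finsupp.single i 1 ≠ m := by
      rintro i rfl
      exact h (by rw [Finsupp.degree_single]; omega)
    simp [h, e]

theorem exists_convergentAt_implicitSeries (α β : ℂ) {p : PowerSeries ℂ} {r : ℝ} (hr : 0 < r)
    (h : pw r p < ⊤) : ∃ R > 0, ∃ C, ConvergentAt (implicitSeries α β p) R C := by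
  refine HasTaylorSeries.convergentAt (F := fun z => α * z 2 + β * z 0 -
    ∑' k : ℕ, PowerSeries.coeff k p * z 1 ^ k) ?_
  have h1 : Tendsto (fun z : Fin 3 → ℂ => z 1) (𝓝 0) (𝓝 0) := (continuous_apply 1).tendsto' _ _ rfl
  filter_upwards [h1.eventually (hasTaylorSeries₁_of_pw_lt_top hr h)] with z hz
  have e : ∀ (i : Fin 3) (k : ℕ), ∏ j, z j ^ (Finsupp.single i k j) = z i ^ k := by
    intro i k
    rw [Finset.prod_eq_single i]
    · simp
    · intro j _ hj
      rw [Finsupp.single_eq_of_ne hj, pow_zero]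
    · simp
  have hs : ∀ (i : Fin 3) (a : ℂ), HasSum (fun m : Fin 3 →₀ ℕ =>
      (if m = Finsupp.single i 1 then a else 0) * ∏ j, z j ^ m j) (a * z i) := by
    intro i a
    have := hasSum_single (f := fun m : Fin 3 →₀ ℕ =>
      (if m = Finsupp.single i 1 then a else 0) * ∏ j, z j ^ m j) (Finsupp.single i 1)
      (fun m hm => by rw [if_neg hm, zero_mul])
    simpa [e] using this
  have hp : HasSum (fun m : Fin 3 →₀ ℕ =>
      (if m = Finsupp.single 1 (m 1) then PowerSeries.coeff (m 1) p else 0) * ∏ j, z j ^ m j)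
      (∑' k : ℕ, PowerSeries.coeff k p * z 1 ^ k) := by
    rw [← Function.Injective.hasSum_iff (g := fun k : ℕ => (Finsupp.single 1 k : Fin 3 →₀ ℕ))
      (Finsupp.single_injective 1)]
    · refine hz.congr_fun fun k => ?_
      simp [e]
    · intro m hm
      rw [if_neg, zero_mul]
      intro h'
      exact hm ⟨m 1, h'.symm⟩
  refine (((hs 2 α).add (hs 0 β)).sub hp).congr_fun fun m => ?_
  rw [coeff_implicitSeries]
  ring

/-- The convergence result for linear substitutions with n = 1, ν = 0 and L(z) = αz - p'(0). It
serves twice: α = 1, β = 0 is the conjugation equation h(qx) = f(h(x)), and α = 0, β = 1 is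
inversion of p. -/
theorem exists_pw_lt_top_of_eq {α β lq : ℂ} {p u : PowerSeries ℂ} (hu : PowerSeries.coeff 0 u = 0)
    {r : ℝ} (hr : 0 < r) (hp : pw r p < ⊤)
    (h : ∀ k : ℕ, PowerSeries.coeff k (p.subst u) =
      α * Complex.exp lq ^ k * PowerSeries.coeff k u + if k = 1 then β else 0)
    (hL : charPoly ![-PowerSeries.coeff 1 p, α] ≠ 0)
    (hdeg : α ≠ 0 ∨ ∀ l ∈ posNat, ‖Complex.exp (l * lq)‖ ≤ 1)
    (hroots : ∀ b ∈ (charPoly ![-PowerSeries.coeff 1 p, α]).roots,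
      (∃ c > (0 : ℝ), ∃ N : ℝ, ∀ l ∈ posNat, N < l.re →
        c * max 1 ‖Complex.exp (l * lq)‖ ≤ ‖Complex.exp (l * lq) - b‖) ∨
      (b ≠ 0 ∧ (∃ c > (0 : ℝ), ∃ γ > (0 : ℝ), ∃ N : ℝ, ∀ l ∈ posNat, N < l.re →
          c * l.re ^ (-γ) ≤ ‖Complex.exp (l * lq) - b‖) ∧
        ∃ c > (0 : ℝ), ∃ γ > (0 : ℝ), ∀ l ∈ posNat,
          c * l.re ^ (-γ) ≤ ‖Complex.exp (l * lq) - 1‖)) :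
    ∃ r > 0, pw r u < ⊤ := by
  have hΓ := one_le_re_posNat
  obtain ⟨g, g₂, N, K, hg, hgexp, hK, hdiv⟩ := exists_damping_of_roots (A := ![-PowerSeries.coeff 1 p, α])
    one_pos hΓ hL hdeg hroots 0
  obtain ⟨R, hR, C, hFc⟩ := exists_convergentAt_implicitSeries α β hr hp
  set q := Complex.exp lq with hq
  -- The divisor estimates hold only beyond N, so the finitely many terms of degree below M go into
  -- the known part.
  set M := ⌊N⌋₊ + 1 with hM
  set u₀ : PowerSeries ℂ := PowerSeries.mk fun k => if k < M then PowerSeries.coeff k u else 0 with hu₀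
  set u₁ : PowerSeries ℂ := PowerSeries.mk fun k => if k < M then 0 else PowerSeries.coeff k u with hu₁
  have hu01 : u₀ + u₁ = u := by
    ext k
    rw [map_add, hu₀, hu₁, PowerSeries.coeff_mk, PowerSeries.coeff_mk]
    split_ifs <;> simp
  have hu₀0 : PowerSeries.coeff 0 u₀ = 0 := by simp [hu₀, hu]
  have hu₁0 : PowerSeries.coeff 0 u₁ = 0 := by simp [hu₁, hM]
  have hres0 : ∀ (u : PowerSeries ℂ) (a : ℂ), PowerSeries.coeff 0 u = 0 →
      PowerSeries.coeff 0 (PowerSeries.rescale a u) = 0 := fun u a h => by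
    rw [PowerSeries.coeff_rescale, h, mul_zero]
  set χ := GenSeries.ofPowerSeries u₁ hu₁0 with hχ
  set v : Fin 3 → HS := ![psHom PowerSeries.X, psHom u₀, psHom (PowerSeries.rescale q u₀)] with hv
  set w : Fin 3 → HS := ![0, psHom u₁, psHom (PowerSeries.rescale q u₁)] with hw
  set V : Fin 3 → HS := ![psHom PowerSeries.X, psHom u, psHom (PowerSeries.rescale q u)] with hV
  have hvw : v + w = V := by
    funext i
    fin_cases i
    · simp [hv, hw, hV]
    · simp [hv, hw, hV, ← map_add, hu01]
    · simp [hv, hw, hV, ← map_add, hu01]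
  have hvs : ∀ i μ, cf (v i) μ ≠ 0 → μ ∈ posNat := by
    intro i μ hμ
    fin_cases i
    · exact mem_posNat_of_cf_psHom_ne_zero (by simp) hμ
    · exact mem_posNat_of_cf_psHom_ne_zero hu₀0 hμ
    · exact mem_posNat_of_cf_psHom_ne_zero (hres0 _ _ hu₀0) hμ
  have hVs : ∀ i μ, cf (V i) μ ≠ 0 → μ ∈ posNat := by
    intro i μ hμ
    fin_cases i
    · exact mem_posNat_of_cf_psHom_ne_zero (by simp) hμ
    · exact mem_posNat_of_cf_psHom_ne_zero hu hμ
    · exact mem_posNat_of_cf_psHom_ne_zero (hres0 _ _ hu) hμ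
  have hVge : ∀ i, ReGe 1 (V i) := fun i μ hμ => hΓ μ (hVs i μ hμ)
  have hpw : ∀ u : PowerSeries ℂ, (∀ k, M ≤ k → PowerSeries.coeff k u = 0) → pw 1 u < ⊤ := by
    intro u hu
    unfold pw
    rw [tsum_eq_sum (s := Finset.range M)]
    · exact ENNReal.sum_lt_top.mpr fun k _ => by finiteness
    · intro k hk
      rw [hu k (by simpa using hk), enorm_zero, zero_mul]
  have hvn : ∀ i, ∃ r > 0, nm (wt r) (v i) < ⊤ := by
    intro i
    refine ⟨1, one_pos, ?_⟩
    have hu₀M : ∀ k, M ≤ k → PowerSeries.coeff k u₀ = 0 := fun k hk => by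
      rw [hu₀, PowerSeries.coeff_mk, if_neg (not_lt.mpr hk)]
    fin_cases i
    · change nm (wt 1) (psHom PowerSeries.X) < ⊤
      rw [nm_psHom zero_le_one]
      unfold pw
      rw [tsum_eq_single 1]
      · simp
      · intro k hk
        rw [PowerSeries.coeff_X, if_neg hk, enorm_zero, zero_mul]
    · change nm (wt 1) (psHom u₀) < ⊤
      rw [nm_psHom zero_le_one]
      exact hpw _ hu₀M
    · change nm (wt 1) (psHom (PowerSeries.rescale q u₀)) < ⊤
      rw [nm_psHom zero_le_one]
      exact hpw _ fun k hk => by rw [PowerSeries.coeff_rescale, hu₀M k hk, mul_zero]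
  have hqk : ∀ k : ℕ, Complex.exp (k * lq) = q ^ k := fun k => by rw [Complex.exp_nat_mul]
  have hwc : ∀ (j : Fin 2) l, cf (w j.succ) l = χ.coeff l * Complex.exp (l * lq) ^ (j : ℕ) := by
    intro j l
    fin_cases j
    · change cf (psHom u₁) l = cf (psHom u₁) l * _ ^ 0
      rw [pow_zero, mul_one]
    · change cf (psHom (PowerSeries.rescale q u₁)) l = cf (psHom u₁) l * _ ^ 1
      by_cases hl : ∃ k : ℕ, l = k
      · obtain ⟨k, rfl⟩ := hl
        rw [cf_psHom, cf_psHom, PowerSeries.coeff_rescale, pow_one, hqk, mul_comm]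
      · have h0 : ∀ u : PowerSeries ℂ, cf (psHom u) l = 0 := fun u => by
          by_contra hcon
          obtain ⟨k, hk, -⟩ := exists_of_cf_psHom_ne_zero hcon
          exact hl ⟨k, hk⟩
        rw [h0, h0, zero_mul]
  have hχs : ∀ l, χ.coeff l ≠ 0 → l ∈ shiftOne posNat 0 ∧ N < l.re := by
    intro l hl
    have h1 := mem_posNat_of_cf_psHom_ne_zero hu₁0 hl
    refine ⟨⟨h1, by simpa using h1⟩, ?_⟩
    obtain ⟨k, rfl, hk⟩ := exists_of_cf_psHom_ne_zero hl
    rw [hu₁, PowerSeries.coeff_mk] at hk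
    have hkM : M ≤ k := by
      by_contra hcon
      exact hk (if_pos (not_le.mp hcon))
    rw [Complex.natCast_re]
    have h2 := Nat.lt_floor_add_one N
    have h3 : ((⌊N⌋₊ + 1 : ℕ) : ℝ) ≤ k := by exact_mod_cast hkM
    push_cast at h3
    linarith
  have hF : ∀ μ, substCoeff (implicitSeries α β p) (v + w) μ = 0 := by
    intro μ
    rw [hvw]
    obtain ⟨D, hD⟩ := exists_nat_gt μ.re
    have hD2 : μ.re < (D + 2 : ℕ) * (1 : ℝ) := by push_cast; linarith
    rw [substCoeff_eq _ zero_le_one hVge hD2, truncTotal_implicitSeries α β p (by omega)]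
    have e : MvPolynomial.aeval V (MvPolynomial.C α * MvPolynomial.X 2 +
        MvPolynomial.C β * MvPolynomial.X 0 - ∑ k ∈ Finset.range (D + 2),
          MvPolynomial.C (PowerSeries.coeff k p) * MvPolynomial.X 1 ^ k) =
        HahnSeries.C α * psHom (PowerSeries.rescale q u) + HahnSeries.C β * psHom PowerSeries.X -
          ∑ k ∈ Finset.range (D + 2), HahnSeries.C (PowerSeries.coeff k p) * psHom (u ^ k) := by
      simp only [map_sub, map_add, map_mul, map_sum, map_pow, MvPolynomial.aeval_X,
        MvPolynomial.aeval_C]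
      rfl
    rw [e, cf_sub, cf_add, cf_sum, cf_C_mul, cf_C_mul]
    simp_rw [cf_C_mul]
    by_cases hμ : ∃ k : ℕ, μ = k
    · obtain ⟨k, rfl⟩ := hμ
      simp_rw [cf_psHom]
      have hk : k < D + 2 := by
        rw [Complex.natCast_re] at hD
        have : k < D := by exact_mod_cast hD
        omega
      rw [← coeff_subst_eq_sum hu p hk, h, PowerSeries.coeff_rescale, PowerSeries.coeff_X]
      simp only [mul_ite, mul_one, mul_zero]
      ring
    · have h0 : ∀ u : PowerSeries ℂ, cf (psHom u) μ = 0 := fun u => by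
        by_contra hcon
        obtain ⟨k, hk, -⟩ := exists_of_cf_psHom_ne_zero hcon
        exact hμ ⟨k, hk⟩
      simp only [h0, mul_zero, add_zero, sub_zero, Finset.sum_const_zero]
  have hpd : ∀ (j : Fin 3) (μ : ℂ) (D : ℕ), μ.re < D →
      substCoeff (MvPowerSeries.pderiv ℂ j (implicitSeries α β p)) (v + w) μ =
      cf (MvPolynomial.aeval V (MvPolynomial.pderiv j
        (MvPowerSeries.truncTotal (D + 1) (implicitSeries α β p)))) μ := by
    intro j μ D hD
    rw [hvw, pderiv_truncTotal]
    exact substCoeff_eq _ zero_le_one hVge (by rwa [mul_one])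
  have hA' : ∀ (j : Fin 2) (μ : ℂ), μ ≠ 0 →
      substCoeff (MvPowerSeries.pderiv ℂ j.succ (implicitSeries α β p)) (v + w) μ ≠ 0 →
      μ - 0 ∈ posNat := by
    intro j μ hμ hne
    obtain ⟨D, hD⟩ := exists_nat_gt μ.re
    rw [hpd j.succ μ (D + 1) (by push_cast; linarith)] at hne
    have := (remainder_supp (S₀ := withZero posNat) (S₁ := withZero posNat) (S₂ := withZero posNat)
      (Or.inl rfl) (fun _ ha _ hb => withZero_add ha hb) (fun _ ha _ hb => withZero_add ha hb)
      (fun _ ha _ hb => withZero_add ha hb) (fun _ ha _ hb => withZero_add ha hb)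
      (fun _ ha _ hb => withZero_add ha hb) (v := V) (w := 0) (fun i μ h => Or.inr (hVs i μ h))
      (fun i μ h => absurd rfl h) _).1 μ hne
    rw [sub_zero]
    exact this.resolve_left hμ
  have hA : ∀ j : Fin 2, substCoeff (MvPowerSeries.pderiv ℂ j.succ (implicitSeries α β p))
      (v + w) 0 = (![-PowerSeries.coeff 1 p, α] : Fin 2 → ℂ) j := by
    intro j
    rw [hpd j.succ 0 1 (by simp), truncTotal_implicitSeries α β p le_rfl,
      Finset.sum_range_succ, Finset.sum_range_one]
    have e1 : ∀ c : ℂ, cf (MvPolynomial.aeval V (MvPolynomial.C c)) 0 = c := fun c => by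
      rw [MvPolynomial.aeval_C]
      exact (cf_C c 0).trans (if_pos rfl)
    fin_cases j
    · change cf (MvPolynomial.aeval V (MvPolynomial.pderiv 1 _)) 0 = -PowerSeries.coeff 1 p
      rw [← e1 (-PowerSeries.coeff 1 p)]
      congr 2
      simp [MvPolynomial.pderiv_X]
    · change cf (MvPolynomial.aeval V (MvPolynomial.pderiv 2 _)) 0 = α
      refine Eq.trans ?_ (e1 α)
      congr 2
      simp [MvPolynomial.pderiv_X]
  obtain ⟨r', hr', hfin⟩ := exists_nm_lt_top_of_linear (Γ := posNat) (χ := χ) (lq := lq) one_pos hΓ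
    (ν := 0) (by simp) hR hFc hvs hvn rfl hwc hχs hF hA hA' hg hgexp hK hdiv
  refine ⟨r', hr', ?_⟩
  have h1 : nm (wt r') (psHom u₁) < ⊤ := hfin
  rw [nm_psHom hr'.le] at h1
  have h2 : pw r' u₀ < ⊤ := by
    unfold pw
    rw [tsum_eq_sum (s := Finset.range M)]
    · exact ENNReal.sum_lt_top.mpr fun k _ => by finiteness
    · intro k hk
      rw [hu₀, PowerSeries.coeff_mk, if_neg (by simpa using hk), enorm_zero, zero_mul]
  rw [← hu01, ← nm_psHom hr'.le, map_add]
  refine (nm_add_le _ _ _).trans_lt (ENNReal.add_lt_top.mpr ⟨?_, hfin⟩)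
  rwa [nm_psHom hr'.le]

end Implicit


/-! ### Linearization of a univalent germ. -/

section Linearization

/-- The coefficients of the solution `k = x + …` of Schröder's equation `k (f x) = q k (x)`. -/
def schroederCoeff (f : PowerSeries ℂ) (q : ℂ) : ℕ → ℂ
  | 0 => 0
  | 1 => 1
  | m + 2 => (∑ i : Fin (m + 2), schroederCoeff f q i * PowerSeries.coeff (m + 2) (f ^ (i : ℕ))) /
      (q - q ^ (m + 2))
decreasing_by exact i.2

theorem pow_succ_ne_self {q : ℂ} (hq : q ≠ 0) (hS : ‖q‖ = 1 → SiegelCondition q) {m : ℕ}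
    (hm : m ≠ 0) : q ^ (m + 1) ≠ q := by
  intro h
  have h1 : q ^ m = 1 := by
    rw [pow_succ] at h
    exact mul_right_cancel₀ hq (h.trans (one_mul q).symm)
  obtain ⟨c, hc, γ, hγ, h2⟩ := hS (Complex.norm_eq_one_of_pow_eq_one h1 hm)
  have h3 := h2 m (Nat.one_le_iff_ne_zero.mpr hm)
  rw [h1, sub_self, norm_zero] at h3
  have : (0 : ℝ) < m := by exact_mod_cast Nat.pos_of_ne_zero hm
  have := Real.rpow_pos_of_pos this (-γ)
  nlinarith [mul_pos hc this]

/-- In degree m + 2 the unknown coefficient enters with the factor q^{m+2} on the left and q on the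
right. These differ since q is not a root of unity, so the recursion solves the equation. -/
theorem subst_schroeder {f : PowerSeries ℂ} {q : ℂ} (hf : PowerSeries.coeff 0 f = 0)
    (hf1 : PowerSeries.coeff 1 f = q) (hq : q ≠ 0) (hS : ‖q‖ = 1 → SiegelCondition q) :
    (PowerSeries.mk (schroederCoeff f q)).subst f =
      PowerSeries.C q * PowerSeries.mk (schroederCoeff f q) := by
  ext m
  rw [coeff_subst_eq_sum hf _ (Nat.lt_succ_self m), PowerSeries.coeff_C_mul]
  simp only [PowerSeries.coeff_mk]
  match m with
  | 0 => simp [schroederCoeff]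
  | 1 => simp [schroederCoeff, Finset.sum_range_succ, hf1]
  | m + 2 =>
    have h1 : PowerSeries.coeff (m + 2) (f ^ (m + 2)) = q ^ (m + 2) := by
      have := coeff_pow_eq_onePowCoeff hf (hf1 ▸ hq) (m + 2) 0
      rwa [onePowCoeff_zero_right, hf1, mul_one] at this
    have h2 : q - q ^ (m + 2) ≠ 0 :=
      sub_ne_zero.mpr (pow_succ_ne_self hq hS (Nat.succ_ne_zero m)).symm
    have h3 : schroederCoeff f q (m + 2) * (q - q ^ (m + 2)) =
        ∑ i ∈ Finset.range (m + 2), schroederCoeff f q i * PowerSeries.coeff (m + 2) (f ^ i) := by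
      rw [schroederCoeff, div_mul_cancel₀ _ h2,
        Fin.sum_univ_eq_sum_range fun i => schroederCoeff f q i * PowerSeries.coeff (m + 2) (f ^ i)]
    rw [Finset.sum_range_succ, h1, ← h3]
    ring

/-- The conjugation equation has L(z) = z - q. The divisor q^k - q vanishes at k = 1, which the
bound 1 < Re l excludes. For larger k it is comparable to max(1, |q|^k) if |q| ≠ 1, and Siegel's
condition bounds it below if |q| = 1. -/
theorem exists_pow_sub_divisor {lq : ℂ}
    (hS : ‖Complex.exp lq‖ = 1 → SiegelCondition (Complex.exp lq)) :
    (∃ c > (0 : ℝ), ∃ N : ℝ, ∀ l ∈ posNat, N < l.re →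
        c * max 1 ‖Complex.exp (l * lq)‖ ≤ ‖Complex.exp (l * lq) - Complex.exp lq‖) ∨
      (Complex.exp lq ≠ 0 ∧ (∃ c > (0 : ℝ), ∃ γ > (0 : ℝ), ∃ N : ℝ, ∀ l ∈ posNat, N < l.re →
          c * l.re ^ (-γ) ≤ ‖Complex.exp (l * lq) - Complex.exp lq‖) ∧
        ∃ c > (0 : ℝ), ∃ γ > (0 : ℝ), ∀ l ∈ posNat,
          c * l.re ^ (-γ) ≤ ‖Complex.exp (l * lq) - 1‖) := by
  set q := Complex.exp lq with hq
  have hqk : ∀ k : ℕ, Complex.exp (k * lq) = q ^ k := fun k => by rw [Complex.exp_nat_mul]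
  have hq0 : q ≠ 0 := Complex.exp_ne_zero lq
  have hqpos : 0 < ‖q‖ := norm_pos_iff.mpr hq0
  have hform : ∀ m : ℕ, ‖q ^ (m + 2) - q‖ = ‖q‖ * ‖q ^ (m + 1) - 1‖ := fun m => by
    rw [← norm_mul]
    ring_nf
  have key : ∀ l ∈ posNat, (1 : ℝ) < l.re → ∃ m : ℕ, l = (m + 2 : ℕ) := by
    rintro _ ⟨k, _, rfl⟩ h1
    rw [Complex.natCast_re] at h1
    have : 1 < k := by exact_mod_cast h1
    exact ⟨k - 2, by congr 1; omega⟩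
  rcases lt_trichotomy ‖q‖ 1 with h | h | h
  · refine Or.inl ⟨‖q‖ * (1 - ‖q‖), mul_pos hqpos (by linarith), 1, fun l hl h1 => ?_⟩
    obtain ⟨m, rfl⟩ := key l hl h1
    rw [hqk, hform, norm_pow, max_eq_left (pow_le_one₀ hqpos.le h.le), mul_one]
    refine mul_le_mul_of_nonneg_left ?_ hqpos.le
    have h2 := norm_sub_norm_le (1 : ℂ) (q ^ (m + 1))
    rw [norm_one, norm_pow, norm_sub_rev] at h2
    have h3 : ‖q‖ ^ (m + 1) ≤ ‖q‖ := pow_le_of_le_one hqpos.le h.le (Nat.succ_ne_zero m)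
    linarith
  · obtain ⟨c, hc, γ, hγ, h2⟩ := hS h
    refine Or.inr ⟨hq0, ⟨c, hc, γ, hγ, 1, fun l hl h1 => ?_⟩, ⟨c, hc, γ, hγ, ?_⟩⟩
    · obtain ⟨m, rfl⟩ := key l hl h1
      rw [hqk, hform, h, one_mul, Complex.natCast_re]
      refine le_trans (mul_le_mul_of_nonneg_left ?_ hc.le) (h2 (m + 1) (by omega))
      refine Real.rpow_le_rpow_of_nonpos (by positivity) ?_ (by linarith)
      push_cast
      linarith
    · rintro _ ⟨k, hk, rfl⟩
      rw [hqk, Complex.natCast_re]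
      exact h2 k (Nat.one_le_iff_ne_zero.mpr hk)
  · refine Or.inl ⟨1 - ‖q‖⁻¹, sub_pos.mpr (inv_lt_one_of_one_lt₀ h), 1, fun l hl h1 => ?_⟩
    obtain ⟨m, rfl⟩ := key l hl h1
    rw [hqk, hform, norm_pow, max_eq_right (one_le_pow₀ h.le)]
    have h2 := norm_sub_norm_le (q ^ (m + 1)) 1
    rw [norm_one, norm_pow] at h2
    have h3 : (1 - ‖q‖⁻¹) * ‖q‖ ^ (m + 2) = ‖q‖ * (‖q‖ ^ (m + 1) - ‖q‖ ^ m) := by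
      field_simp
      ring
    rw [h3]
    refine mul_le_mul_of_nonneg_left ?_ hqpos.le
    have h4 : 1 ≤ ‖q‖ ^ m := one_le_pow₀ h.le
    linarith

/-- Linearization of a germ with a multiplier satisfying Siegel's condition. -/
theorem exists_linearization {f : PowerSeries ℂ} {lq : ℂ} (hf : PowerSeries.coeff 0 f = 0)
    (hf1 : PowerSeries.coeff 1 f = Complex.exp lq)
    (hS : ‖Complex.exp lq‖ = 1 → SiegelCondition (Complex.exp lq)) {r : ℝ} (hr : 0 < r)
    (hpw : pw r f < ⊤) :
    ∃ h k : PowerSeries ℂ, PowerSeries.coeff 0 h = 0 ∧ PowerSeries.coeff 1 h = 1 ∧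
      PowerSeries.coeff 0 k = 0 ∧ PowerSeries.coeff 1 k = 1 ∧ h.subst k = PowerSeries.X ∧
      f.subst h = h.subst (PowerSeries.C (Complex.exp lq) * PowerSeries.X : PowerSeries ℂ) ∧
      (∃ r > 0, pw r h < ⊤) ∧ ∃ r > 0, pw r k < ⊤ := by
  set q := Complex.exp lq with hq
  have hq0 : q ≠ 0 := Complex.exp_ne_zero lq
  set k := PowerSeries.mk (schroederCoeff f q) with hk
  have hk0 : PowerSeries.coeff 0 k = 0 := by simp [hk, schroederCoeff]
  have hk1 : PowerSeries.coeff 1 k = 1 := by simp [hk, schroederCoeff]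
  have hkf : k.subst f = PowerSeries.C q * k := subst_schroeder hf hf1 hq0 hS
  have hk0' : PowerSeries.constantCoeff k = 0 := by
    rw [← PowerSeries.coeff_zero_eq_constantCoeff_apply, hk0]
  have hu : IsUnit (PowerSeries.coeff 1 k) := by rw [hk1]; exact isUnit_one
  set h := k.substInvOfIsUnit hu with hh
  have hhk : h.subst k = PowerSeries.X := PowerSeries.subst_substInvOfIsUnit_left k hk0' hu
  have hkh : k.subst h = PowerSeries.X := PowerSeries.subst_substInvOfIsUnit_right k hk0' hu
  have hh0 : PowerSeries.coeff 0 h = 0 := by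
    rw [PowerSeries.coeff_zero_eq_constantCoeff_apply]
    exact PowerSeries.constantCoeff_substInvOfIsUnit ..
  have hh1 : PowerSeries.coeff 1 h = 1 := by
    have := coeff_one_subst hh0 hk0
    rwa [hhk, hk1, mul_one, PowerSeries.coeff_one_X, eq_comm] at this
  have hS0 := @hasSubst_of_coeff_zero
  have hqX : PowerSeries.coeff 0 (PowerSeries.C q * PowerSeries.X : PowerSeries ℂ) = 0 := by simp
  -- Conjugating k ∘ f = q k by the inverse h of k gives f ∘ h = h ∘ (q x), in which the
  -- substitution acting on the unknown is linear.
  have hconj : f.subst h = h.subst (PowerSeries.C q * PowerSeries.X : PowerSeries ℂ) := by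
    have hfh : PowerSeries.coeff 0 (f.subst h) = 0 := coeff_zero_subst hf hh0
    have e1 : k.subst (f.subst h) = (PowerSeries.C q * PowerSeries.X : PowerSeries ℂ) := by
      rw [← PowerSeries.subst_comp_subst_apply (hS0 hf) (hS0 hh0), hkf,
        PowerSeries.subst_mul (hS0 hh0), hkh]
      congr 1
      ext m
      rw [coeff_subst_eq_sum hh0 _ (Nat.lt_succ_self m),
        Finset.sum_eq_single 0]
      · simp [PowerSeries.coeff_C, PowerSeries.coeff_one]
      · intro b _ hb
        rw [PowerSeries.coeff_C, if_neg hb, zero_mul]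
      · simp
    rw [← e1, ← PowerSeries.subst_comp_subst_apply (hS0 hk0) (hS0 hfh), hhk]
    exact (PowerSeries.subst_X (hS0 hfh)).symm
  have hcoeff : ∀ m, PowerSeries.coeff m (f.subst h) = q ^ m * PowerSeries.coeff m h := by
    intro m
    rw [hconj, coeff_subst_eq_sum hqX _ (Nat.lt_succ_self m), Finset.sum_eq_single m]
    · rw [mul_pow, ← map_pow, PowerSeries.coeff_C_mul, PowerSeries.coeff_X_pow_self, mul_one,
        mul_comm]
    · intro b _ hb
      rw [mul_pow, ← map_pow, PowerSeries.coeff_C_mul, PowerSeries.coeff_X_pow, if_neg hb.symm,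
        mul_zero, mul_zero]
    · simp
  -- Convergence is proved for h first, because the equation for k involves composition with f. Once
  -- h converges, k follows as its inverse; there L is the constant -1 and has no roots.
  have hhpw : ∃ r > 0, pw r h < ⊤ := by
    refine exists_pw_lt_top_of_eq (α := 1) (β := 0) (lq := lq) hh0 hr hpw (fun m => ?_) ?_ ?_ ?_
    · rw [hcoeff, one_mul, ite_self, add_zero]
    · intro h0
      have := coeff_charPoly_last ![-PowerSeries.coeff 1 f, 1]
      rw [h0] at this
      simp at this
    · exact Or.inl one_ne_zero
    · intro b hb
      have hb' : b = q := by
        have := (Polynomial.mem_roots'.mp hb).2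
        rw [Polynomial.IsRoot, charPoly_eval, Fin.sum_univ_two, hf1] at this
        simp at this
        linear_combination this
      rw [hb']
      exact exists_pow_sub_divisor hS
  refine ⟨h, k, hh0, hh1, hk0, hk1, hhk, hconj, hhpw, ?_⟩
  obtain ⟨r', hr', hpw'⟩ := hhpw
  have heval : ∀ b, (charPoly ![-PowerSeries.coeff 1 h, 0]).eval b = -1 := fun b => by
    rw [charPoly_eval, Fin.sum_univ_two, hh1]
    simp
  refine exists_pw_lt_top_of_eq (α := 0) (β := 1) (lq := 0) hk0 hr' hpw' (fun m => ?_) ?_ ?_ ?_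
  · rw [hhk, PowerSeries.coeff_X]
    simp
  · intro h0
    have := heval 0
    rw [h0] at this
    simp at this
  · exact Or.inr fun l _ => by simp
  · intro b hb
    have := (Polynomial.mem_roots'.mp hb).2
    rw [Polynomial.IsRoot, heval] at this
    norm_num at this

end Linearization


/-! ### Embedding finitely many exponents into an admissible semigroup. -/

section Admissible

/-- T is the absolute value of the negative part of ∑ c_i x_i. Choose rationals r_i slightly below
c_i x_i for c_i > 0 whose sum Q still exceeds T, and put u_i = r_i / (Q c_i). Then u_i T < r_i / c_i
< x_i. -/
theorem exists_rat_weights {τ : ℕ} {c : Fin τ → ℚ} {x : Fin τ → ℝ} (hx : ∀ i, 0 < x i)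
    (hpos : 0 < ∑ i, (c i : ℝ) * x i) :
    ∃ u : Fin τ → ℚ, (∀ i, 0 ≤ u i) ∧ (∀ i, u i * max (-c i) 0 = 0) ∧
      ∑ i, max (c i) 0 * u i = 1 ∧
      ∀ i, u i * ∑ j, ((max (-c j) 0 : ℚ) : ℝ) * x j < x i := by
  set T := ∑ j, ((max (-c j) 0 : ℚ) : ℝ) * x j with hT
  have hT0 : 0 ≤ T := Finset.sum_nonneg fun j _ => mul_nonneg (by simp) (hx j).le
  set P := Finset.univ.filter fun i => 0 < c i with hP
  have hsum : T < ∑ i ∈ P, (c i : ℝ) * x i := by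
    have h1 : ∑ i ∈ P, (c i : ℝ) * x i - T = ∑ i, (c i : ℝ) * x i := by
      rw [hT, hP, Finset.sum_filter, ← Finset.sum_sub_distrib]
      refine Finset.sum_congr rfl fun i _ => ?_
      split_ifs with h
      · rw [max_eq_right (by linarith)]
        simp
      · rw [max_eq_left (by linarith)]
        push_cast
        ring
    linarith
  have hPne : P.Nonempty := by
    rw [Finset.nonempty_iff_ne_empty]
    intro h
    rw [h, Finset.sum_empty] at hsum
    linarith
  set δ := (∑ i ∈ P, (c i : ℝ) * x i - T) / P.card with hδ
  have hcard : (0 : ℝ) < P.card := by exact_mod_cast hPne.card_pos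
  have hδ0 : 0 < δ := div_pos (sub_pos.mpr hsum) hcard
  have hr : ∀ i, ∃ r : ℚ, i ∈ P → 0 < r ∧ (c i : ℝ) * x i - δ < r ∧ (r : ℝ) < c i * x i := by
    intro i
    by_cases hi : i ∈ P
    · have hci : (0 : ℝ) < c i := by exact_mod_cast (Finset.mem_filter.mp hi).2
      obtain ⟨r, h1, h2⟩ := exists_rat_btwn
        (show max 0 ((c i : ℝ) * x i - δ) < c i * x i from
          max_lt (mul_pos hci (hx i)) (by linarith))
      exact ⟨r, fun _ => ⟨by exact_mod_cast (le_max_left _ _).trans_lt h1,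
        (le_max_right _ _).trans_lt h1, h2⟩⟩
    · exact ⟨0, fun h => absurd h hi⟩
  choose r hr using hr
  set Q := ∑ i ∈ P, r i with hQ
  have hQT : T < Q := by
    have h1 : ∑ i ∈ P, ((c i : ℝ) * x i - δ) < ∑ i ∈ P, (r i : ℝ) :=
      Finset.sum_lt_sum_of_nonempty hPne fun i hi => (hr i hi).2.1
    rw [Finset.sum_sub_distrib, Finset.sum_const, nsmul_eq_mul, hδ,
      mul_div_cancel₀ _ hcard.ne'] at h1
    rw [hQ]
    push_cast
    linarith
  have hQ0 : 0 < Q := Finset.sum_pos (fun i hi => (hr i hi).1) hPne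
  have hQ0' : (0 : ℝ) < Q := by exact_mod_cast hQ0
  refine ⟨fun i => if 0 < c i then r i / Q / c i else 0, fun i => ?_, fun i => ?_, ?_, fun i => ?_⟩
  · dsimp only
    split_ifs with h
    · exact div_nonneg (div_nonneg (hr i (by simp [hP, h])).1.le hQ0.le) h.le
    · exact le_rfl
  · dsimp only
    split_ifs with h
    · rw [max_eq_right (by linarith), mul_zero]
    · rw [zero_mul]
  · have h1 : ∀ i, max (c i) 0 * (if 0 < c i then r i / Q / c i else 0) =
        if 0 < c i then r i / Q else 0 := fun i => by
      split_ifs with h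
      · rw [max_eq_left h.le, mul_div_cancel₀ _ h.ne']
      · rw [mul_zero]
    simp_rw [h1]
    rw [← Finset.sum_filter, ← Finset.sum_div, ← hP, ← hQ, div_self hQ0.ne']
  · dsimp only
    split_ifs with h
    · have hc : (0 : ℝ) < c i := by exact_mod_cast h
      obtain ⟨h1, -, h2⟩ := hr i (by simp [hP, h])
      have h1' : (0 : ℝ) < r i := by exact_mod_cast h1
      push_cast
      rw [div_div, div_mul_eq_mul_div, div_lt_iff₀ (mul_pos hQ0' hc)]
      calc (r i : ℝ) * T ≤ r i * Q := by gcongr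
        _ < c i * x i * Q := by gcongr
        _ = x i * (Q * c i) := by ring
    · simp [hx i]

/-- Exponents are added one by one. A new t outside the rational span becomes a generator. If t lies
in the span with some negative coordinates, these are absorbed by tilting the basis so that the cone
comes to contain t and still contains its old elements. -/
theorem exists_rat_cone (S : Finset ℂ) (hS : ∀ s ∈ S, 0 < s.re) :
    ∃ (τ : ℕ) (ρ : Fin τ → ℂ), LinearIndependent ℚ ρ ∧ (∀ i, 0 < (ρ i).re) ∧
      ∀ s ∈ S, ∃ c : Fin τ → ℚ, (∀ i, 0 ≤ c i) ∧ s = ∑ i, (c i : ℂ) * ρ i := by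
  classical
  induction S using Finset.induction_on with
  | empty => exact ⟨0, Fin.elim0, linearIndependent_empty_type, fun i => i.elim0, by simp⟩
  | insert t S ht ih =>
    obtain ⟨τ, ρ, hind, hre, hcone⟩ := ih fun s hs => hS s (Finset.mem_insert_of_mem hs)
    have htre := hS t (Finset.mem_insert_self t S)
    by_cases hspan : t ∈ Submodule.span ℚ (Set.range ρ)
    · obtain ⟨c, hc⟩ := (Submodule.mem_span_range_iff_exists_fun ℚ).mp hspan
      have hc' : t = ∑ i, (c i : ℂ) * ρ i := by
        rw [← hc]
        exact Finset.sum_congr rfl fun i _ => Rat.smul_def (c i) (ρ i)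
      have hre_sum : ∀ d : Fin τ → ℚ, (∑ i, (d i : ℂ) * ρ i).re = ∑ i, (d i : ℝ) * (ρ i).re := by
        intro d
        rw [Complex.re_sum]
        refine Finset.sum_congr rfl fun i _ => ?_
        rw [Complex.mul_re, Complex.ratCast_re, Complex.ratCast_im, zero_mul, sub_zero]
      obtain ⟨u, hu0, hu1, hu2, hu3⟩ := exists_rat_weights (c := c) hre (by
        rw [← hre_sum, ← hc']
        exact htre)
      set T := ∑ j, ((max (-c j) 0 : ℚ) : ℂ) * ρ j with hT
      -- T is minus the negative part of t. Since ∑ c_i⁺ u_i = 1, one has t = ∑ c_i⁺ ρ_i - T = ∑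
      -- c_i⁺ ρ'_i.
      set ρ' : Fin τ → ℂ := fun i => ρ i - u i * T with hρ'
      -- The weights u vanish wherever c is negative, so T has the same coordinates in the new
      -- basis. Hence ρ_i = ρ'_i + u_i T stays in the new cone.
      have hT' : T = ∑ j, ((max (-c j) 0 : ℚ) : ℂ) * ρ' j := by
        rw [hT]
        refine Finset.sum_congr rfl fun j _ => ?_
        have : (u j : ℂ) * ((max (-c j) 0 : ℚ) : ℂ) = 0 := by exact_mod_cast hu1 j
        rw [hρ']
        linear_combination (T : ℂ) * this
      have hρ : ∀ i, ρ i = ρ' i + u i * T := fun i => by rw [hρ']; ring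
      have ht' : t = ∑ i, ((max (c i) 0 : ℚ) : ℂ) * ρ' i := by
        have h1 : ∑ i, ((max (c i) 0 : ℚ) : ℂ) * (u i : ℂ) = 1 := by exact_mod_cast hu2
        have h2 : ∀ i, ((max (c i) 0 : ℚ) : ℂ) * ρ' i =
            (c i : ℂ) * ρ i + ((max (-c i) 0 : ℚ) : ℂ) * ρ i -
              ((max (c i) 0 : ℚ) : ℂ) * (u i : ℂ) * T := by
          intro i
          have h3 : ((max (c i) 0 : ℚ) : ℂ) = c i + ((max (-c i) 0 : ℚ) : ℂ) := by
            have : max (c i) 0 = c i + max (-c i) 0 := by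
              rcases le_total (c i) 0 with h | h
              · rw [max_eq_right h, max_eq_left (by linarith)]; ring
              · rw [max_eq_left h, max_eq_right (by linarith)]; ring
            exact_mod_cast this
          rw [hρ']
          linear_combination (ρ i) * h3
        simp_rw [h2]
        rw [Finset.sum_sub_distrib, Finset.sum_add_distrib, ← Finset.sum_mul, h1, ← hc', ← hT]
        ring
      have hcombo : ∀ d : Fin τ → ℚ, ∑ i, (d i : ℂ) * ρ i =
          ∑ i, ((d i + (∑ j, d j * u j) * max (-c i) 0 : ℚ) : ℂ) * ρ' i := by
        intro d
        have h2 : ∀ i, ((d i + (∑ j, d j * u j) * max (-c i) 0 : ℚ) : ℂ) * ρ' i =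
            (d i : ℂ) * ρ' i + (∑ j, (d j : ℂ) * u j) * (((max (-c i) 0 : ℚ) : ℂ) * ρ' i) := by
          intro i
          push_cast
          ring
        simp_rw [h2]
        rw [Finset.sum_add_distrib, ← Finset.mul_sum, ← hT', Finset.sum_mul,
          ← Finset.sum_add_distrib]
        refine Finset.sum_congr rfl fun i _ => ?_
        rw [hρ i]
        ring
      refine ⟨τ, ρ', ?_, fun i => ?_, fun s hs => ?_⟩
      -- Independence by dimension: the span of the ρ'_i contains the τ independent numbers ρ_i.
      · rw [linearIndependent_iff_card_le_finrank_span, ← finrank_span_eq_card hind]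
        have := FiniteDimensional.span_of_finite ℚ (Set.finite_range ρ')
        refine Submodule.finrank_mono (Submodule.span_le.mpr ?_)
        rintro _ ⟨i, rfl⟩
        have hmem : ∀ j, ρ' j ∈ Submodule.span ℚ (Set.range ρ') := fun j =>
          Submodule.subset_span ⟨j, rfl⟩
        have hTm : T ∈ Submodule.span ℚ (Set.range ρ') := by
          rw [hT']
          refine Submodule.sum_mem _ fun j _ => ?_
          rw [← Rat.smul_def]
          exact Submodule.smul_mem _ _ (hmem j)
        rw [hρ i, ← Rat.smul_def]
        exact Submodule.add_mem _ (hmem i) (Submodule.smul_mem _ _ hTm)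
      · have h1 := hu3 i
        rw [← hre_sum, ← hT] at h1
        rw [hρ', Complex.sub_re, Complex.mul_re, Complex.ratCast_re, Complex.ratCast_im, zero_mul,
          sub_zero]
        linarith
      · rcases Finset.mem_insert.mp hs with rfl | hs
        · exact ⟨fun i => max (c i) 0, fun i => le_max_right _ _, ht'⟩
        · obtain ⟨d, hd0, hd⟩ := hcone s hs
          exact ⟨_, fun i => add_nonneg (hd0 i) (mul_nonneg
            (Finset.sum_nonneg fun j _ => mul_nonneg (hd0 j) (hu0 j)) (le_max_right _ _)),
            hd.trans (hcombo d)⟩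
    · refine ⟨τ + 1, Fin.cons t ρ, hind.finCons hspan, fun i => ?_, fun s hs => ?_⟩
      · refine Fin.cases ?_ (fun i => ?_) i
        · exact htre
        · exact hre i
      · rcases Finset.mem_insert.mp hs with rfl | hs
        · refine ⟨Fin.cons 1 0, fun i => ?_, ?_⟩
          · refine Fin.cases ?_ (fun i => ?_) i <;> simp
          · simp [Fin.sum_univ_succ]
        · obtain ⟨d, hd0, hd⟩ := hcone s hs
          refine ⟨Fin.cons 0 d, fun i => ?_, ?_⟩
          · refine Fin.cases ?_ (fun i => ?_) i
            · simp
            · simpa using hd0 i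
          · simpa [Fin.sum_univ_succ] using hd

/-- Dividing the generators of the rational cone by a common denominator turns nonnegative rational
coordinates into nonnegative integers. -/
theorem exists_admissibleGenerators {S : Set ℂ} (hfin : S.Finite) (hS : ∀ s ∈ S, 0 < s.re) :
    ∃ (τ : ℕ) (ρ : Fin τ → ℂ), AdmissibleGenerators ρ ∧ S ⊆ semigroup ρ := by
  obtain ⟨τ, ρ, hind, hre, hcone⟩ := exists_rat_cone hfin.toFinset fun s hs =>
    hS s (hfin.mem_toFinset.mp hs)
  choose! c hc0 hc using hcone
  set D : ℕ := ∏ s ∈ hfin.toFinset, ∏ i, (c s i).den with hD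
  have hD0 : D ≠ 0 := Finset.prod_ne_zero_iff.mpr fun s _ =>
    Finset.prod_ne_zero_iff.mpr fun i _ => (c s i).den_nz
  have hDC : (D : ℂ) ≠ 0 := Nat.cast_ne_zero.mpr hD0
  have hDR : (0 : ℝ) < D := by exact_mod_cast Nat.pos_of_ne_zero hD0
  refine ⟨τ, fun i => ρ i / D, ⟨?_, fun i => ?_⟩, fun s hs => ?_⟩
  · have h1 : LinearIndependent ℤ ρ := hind.restrict_scalars (by
      intro a b hab
      simpa using hab)
    rw [Fintype.linearIndependent_iff] at h1 ⊢
    intro g hg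
    refine h1 g ?_
    have h2 : ∑ i, g i • ρ i = (∑ i, g i • (ρ i / D)) * D := by
      rw [Finset.sum_mul]
      refine Finset.sum_congr rfl fun i _ => ?_
      rw [smul_mul_assoc, div_mul_cancel₀ _ hDC]
    rw [h2, hg, zero_mul]
  · rw [Complex.div_natCast_re]
    exact div_pos (hre i) hDR
  · have hs' := hfin.mem_toFinset.mpr hs
    have h1 : ∀ i, ∃ m : ℕ, c s i * D = m := by
      intro i
      have hdvd : (c s i).den ∣ D :=
        (Finset.dvd_prod_of_mem (fun i => (c s i).den) (Finset.mem_univ i)).trans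
          (Finset.dvd_prod_of_mem (fun s => ∏ i, (c s i).den) hs')
      obtain ⟨e, he⟩ := hdvd
      have hnum : 0 ≤ (c s i).num := Rat.num_nonneg.mpr (hc0 s hs' i)
      refine ⟨(c s i).num.toNat * e, ?_⟩
      rw [he]
      push_cast
      rw [← mul_assoc, Rat.mul_den_eq_num]
      congr 1
      have := Int.toNat_of_nonneg hnum
      exact_mod_cast this.symm
    choose m hm using h1
    have h2 : s = ∑ i, (m i : ℂ) * (ρ i / D) := by
      rw [hc s hs']
      refine Finset.sum_congr rfl fun i _ => ?_
      have : (c s i : ℂ) * D = m i := by exact_mod_cast hm i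
      rw [← this]
      field_simp
    rw [h2]
    refine sum_mem_semigroup m ?_
    rintro rfl
    have := hS s hs
    rw [h2] at this
    simp at this

end Admissible


/-! ### The equation at the first exponent not accounted for. -/

section LinearizedEquation

variable {Γ₀ Γ : AddSubsemigroup ℂ} {ν lam : ℂ} {N ε : ℝ}

/-- Exponents of order at least `λ`, or of terms of lower order whose exponents are known. -/
def knownOne (Γ : AddSubsemigroup ℂ) (ν lam : ℂ) (N : ℝ) : Set ℂ :=
  {μ | N < μ.re ∧ (μ ∈ shiftOne Γ ν ∨ lam.re ≤ μ.re)}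

/-- Exponents of order greater than `λ + ν`, or of quadratic terms whose exponents are known. -/
def knownTwo (Γ : AddSubsemigroup ℂ) (ν lam : ℂ) : Set ℂ :=
  {μ | μ ∈ shiftTwo Γ ν ∨ lam.re + ν.re < μ.re}

theorem knownOne_add (h0 : Γ₀ ≤ Γ) (hpos : ∀ z ∈ Γ, 0 < z.re) {a b : ℂ} (ha : a ∈ withZero Γ₀)
    (hb : b ∈ knownOne Γ ν lam N) : a + b ∈ knownOne Γ ν lam N := by
  rcases ha with rfl | ha
  · rwa [zero_add]
  · have h1 := hpos a (h0 ha)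
    refine ⟨by rw [Complex.add_re]; linarith [hb.1], hb.2.imp (fun h => ?_) fun h => ?_⟩
    · exact shiftOne_add (Or.inr (h0 ha)) h
    · rw [Complex.add_re]
      linarith

theorem knownTwo_add (h0 : Γ₀ ≤ Γ) (hpos : ∀ z ∈ Γ, 0 < z.re) {a b : ℂ} (ha : a ∈ withZero Γ₀)
    (hb : b ∈ knownTwo Γ ν lam) : a + b ∈ knownTwo Γ ν lam := by
  rcases ha with rfl | ha
  · rwa [zero_add]
  · have h1 := hpos a (h0 ha)
    refine hb.imp (fun h => ?_) fun h => ?_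
    · exact shiftTwo_add (Or.inr (h0 ha)) h
    · rw [Complex.add_re]
      linarith

/-- If one factor has real part at least Re λ, the other exceeds N ≥ Re ν, so the product lies
beyond λ + ν. Otherwise both exponents are known. -/
theorem knownOne_add_knownOne (hN : ν.re ≤ N) {a b : ℂ}
    (ha : a ∈ knownOne Γ ν lam N) (hb : b ∈ knownOne Γ ν lam N) : a + b ∈ knownTwo Γ ν lam := by
  have h1 := ha.1
  have h2 := hb.1
  rcases ha.2 with h3 | h3
  · rcases hb.2 with h4 | h4
    · exact Or.inl (shiftOne_add_shiftOne h3 h4)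
    · refine Or.inr ?_
      rw [Complex.add_re]
      linarith
  · refine Or.inr ?_
    rw [Complex.add_re]
    linarith

theorem knownOne_add_knownTwo (hpos : ∀ z ∈ Γ, 0 < z.re) (hN0 : 0 ≤ N) {a b : ℂ}
    (ha : a ∈ knownOne Γ ν lam N) (hb : b ∈ knownTwo Γ ν lam) : a + b ∈ knownTwo Γ ν lam := by
  have h1 := ha.1
  rcases hb with h3 | h3
  · rcases ha.2 with h4 | h4
    · exact Or.inl (shiftTwo_add (Or.inr h4.1) h3)
    · have h5 := hpos _ h3.2.1
      rw [Complex.sub_re] at h5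
      refine Or.inr ?_
      rw [Complex.add_re]
      linarith
  · refine Or.inr ?_
    rw [Complex.add_re]
    linarith

variable {n : ℕ} {F : MvPowerSeries (Fin (n + 2)) ℂ} {v w : Fin (n + 2) → HS}

/-- The equation for the coefficient of `x ^ λ` in the rest of a solution, if the exponent `λ` is
the first that is not accounted for by the semigroup `Γ`. -/
theorem sum_mul_cf_eq_zero (hε : 0 < ε) (hΓ : ∀ z ∈ Γ, ε ≤ z.re) (h0 : Γ₀ ≤ Γ)
    (hs1 : ∀ p ∈ withZero Γ₀, ν.re < p.re → p - ν ∈ Γ)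
    (hs2 : ∀ p ∈ Γ₀, 2 * ν.re < p.re → p - 2 * ν ∈ Γ)
    (hν : 0 ≤ ν.re) (hN : 2 * ν.re ≤ N) (hlam : N < lam.re) (hbad : lam ∉ shiftOne Γ ν)
    (hv : ∀ i μ, cf (v i) μ ≠ 0 → μ ∈ Γ₀) (hw0 : w 0 = 0)
    (hw : ∀ i μ, cf (w i) μ ≠ 0 → μ ∈ knownOne Γ ν lam N) {J : Finset (Fin (n + 1))}
    (hw2 : ∀ j ∉ J, ∀ μ, cf (w (Fin.succ j)) μ ≠ 0 → μ ∈ knownTwo Γ ν lam)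
    (hF : substCoeff F (v + w) (lam + ν) = 0) {A : Fin (n + 1) → ℂ}
    (hA : ∀ j ∈ J, HasLeadingTerm (substCoeff (MvPowerSeries.pderiv ℂ j.succ F) (v + w)) (A j) ν) :
    ∑ j ∈ J, A j * cf (w j.succ) lam = 0 := by
  classical
  have hpos : ∀ z ∈ Γ, 0 < z.re := fun z hz => hε.trans_le (hΓ z hz)
  have hνN : ν.re ≤ N := by linarith
  have hN0 : 0 ≤ N := by linarith
  -- Membership would make λ an element of `shiftOne Γ ν`. Therefore no second-order term
  -- contributes at x^{λ+ν}.
  have hnot2 : lam + ν ∉ knownTwo Γ ν lam := by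
    rintro (⟨-, h1, h2⟩ | h)
    · refine hbad ⟨by simpa using h1, ?_⟩
      have : lam + ν - 2 * ν = lam - ν := by ring
      rwa [this] at h2
    · rw [Complex.add_re] at h
      exact lt_irrefl _ h
  set ε' := min ε lam.re with hε'
  have hε'0 : 0 < ε' := lt_min hε (by linarith)
  have hvw : ∀ i, ReGe ε' ((v + w) i) := fun i =>
    ReGe.add (fun μ h => (min_le_left _ _).trans (hΓ _ (h0 (hv i μ h)))) fun μ h => by
      rcases (hw i μ h).2 with h1 | h1
      · exact (min_le_left _ _).trans (hΓ _ h1.1)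
      · exact (min_le_right _ _).trans h1
  obtain ⟨D, hD⟩ := exists_nat_gt ((lam.re + ν.re) / ε')
  rw [div_lt_iff₀ hε'0] at hD
  set p := MvPowerSeries.truncTotal (D + 1) F with hp
  have hF' : cf (MvPolynomial.aeval (v + w) p) (lam + ν) = 0 := by
    rw [hp, ← substCoeff_eq F hε'0.le hvw, hF]
    rw [Complex.add_re]
    push_cast
    linarith
  have hv' : ∀ i μ, cf (v i) μ ≠ 0 → μ ∈ withZero Γ₀ := fun i μ h => Or.inr (hv i μ h)
  have h00 : (0 : ℂ) ∈ withZero Γ₀ := Or.inl rfl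
  obtain ⟨k1, -, k3⟩ := remainder_supp (S₀ := withZero Γ₀) (S₁ := knownOne Γ ν lam N)
    (S₂ := knownTwo Γ ν lam) h00 (fun _ ha _ hb => withZero_add ha hb)
    (fun _ ha _ hb => knownOne_add h0 hpos ha hb) (fun _ ha _ hb => knownTwo_add h0 hpos ha hb)
    (fun _ ha _ hb => knownOne_add_knownOne hνN ha hb)
    (fun _ ha _ hb => knownOne_add_knownTwo hpos hN0 ha hb) hv' hw p
  have e1 : cf (MvPolynomial.aeval v p) (lam + ν) = 0 := by
    by_contra hne
    have h1 : lam + ν ∈ Γ₀ := (k1 _ hne).resolve_left fun h => by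
      have := congrArg Complex.re h
      rw [Complex.add_re, Complex.zero_re] at this
      linarith
    refine hbad ⟨?_, ?_⟩
    · have := hs1 _ (Or.inr h1) (by rw [Complex.add_re]; linarith)
      simpa using this
    · have := hs2 _ h1 (by rw [Complex.add_re]; linarith)
      have e : lam + ν - 2 * ν = lam - ν := by ring
      rwa [e] at this
  have e3 : cf (MvPolynomial.aeval (v + w) p - MvPolynomial.aeval v p -
      ∑ j, MvPolynomial.aeval v (MvPolynomial.pderiv j p) * w j) (lam + ν) = 0 := by
    by_contra hne
    exact hnot2 (k3 _ hne)
  rw [cf_sub, cf_sub, hF', e1, sub_zero, zero_sub, neg_eq_zero, cf_sum, Fin.sum_univ_succ, hw0,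
    mul_zero, cf_zero, zero_add] at e3
  -- Up to the relevant order, the derivative along v differs from A_j x^ν only by exponents of Γ₀
  -- (or 0) beyond Re ν. Multiplied by `w`, these give either exponents tied to Γ, which λ is not,
  -- or exponents beyond λ + ν.
  have hder : ∀ j ∈ J, ∀ a : ℂ, a.re ≤ lam.re + ν.re →
      cf (MvPolynomial.aeval v (MvPolynomial.pderiv j.succ p) -
        HahnSeries.single (ReExp.of ν) (A j)) a ≠ 0 → a ∈ withZero Γ₀ ∧ ν.re < a.re := by
    intro j hj a ha hne
    have h1 := substCoeff_eq (MvPowerSeries.pderiv ℂ j.succ F) hε'0.le hvw (ha.trans_lt hD)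
    rw [← pderiv_truncTotal, ← hp] at h1
    have hsupp := (remainder_supp h00 (fun _ ha _ hb => withZero_add ha hb)
      (fun _ ha _ hb => knownOne_add h0 hpos ha hb) (fun _ ha _ hb => knownTwo_add h0 hpos ha hb)
      (fun _ ha _ hb => knownOne_add_knownOne hνN ha hb)
      (fun _ ha _ hb => knownOne_add_knownTwo hpos hN0 ha hb) hv' hw
      (MvPolynomial.pderiv j.succ p)).1
    by_cases h2 : cf (MvPolynomial.aeval (v + w) (MvPolynomial.pderiv j.succ p) -
        MvPolynomial.aeval v (MvPolynomial.pderiv j.succ p)) a = 0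
    · rw [cf_sub, sub_eq_zero] at h2
      rw [cf_sub, cf_single] at hne
      by_cases h3 : a = ν
      · rw [if_pos h3, ← h2, ← h1, h3, (hA j hj).1, sub_self] at hne
        exact absurd rfl hne
      · rw [if_neg h3, sub_zero] at hne
        refine ⟨hsupp a hne, (hA j hj).2 a h3 ?_⟩
        rwa [h1, h2]
    · have h3 := aeval_sub_supp (S₀ := withZero Γ₀) (S₁ := {μ : ℂ | N < μ.re}) h00
        (fun _ ha _ hb => withZero_add ha hb)
        (fun a ha b hb => by
          have : 0 ≤ a.re := by
            rcases ha with rfl | ha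
            · exact le_rfl
            · exact (hpos _ (h0 ha)).le
          change N < (a + b).re
          rw [Complex.add_re]
          linarith [show N < b.re from hb])
        (fun a ha b hb => by
          change N < (a + b).re
          rw [Complex.add_re]
          linarith [show N < b.re from hb, show N < a.re from ha]) hv'
        (fun i μ h => (hw i μ h).1) _ h2
      have h4 : ν.re < a.re := hνN.trans_lt h3
      refine ⟨hsupp a ?_, h4⟩
      rwa [cf_sub, cf_single, if_neg, sub_zero] at hne
      rintro rfl
      exact lt_irrefl _ h4
  rw [← e3, ← Finset.sum_subset (Finset.subset_univ J)]
  · refine Finset.sum_congr rfl fun j hj => ?_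
    have h1 : MvPolynomial.aeval v (MvPolynomial.pderiv j.succ p) * w j.succ =
        HahnSeries.single (ReExp.of ν) (A j) * w j.succ +
        (MvPolynomial.aeval v (MvPolynomial.pderiv j.succ p) -
          HahnSeries.single (ReExp.of ν) (A j)) * w j.succ := by ring
    rw [h1, cf_add, cf_single_mul, add_sub_cancel_right, left_eq_add]
    by_contra hne
    obtain ⟨a, b, hab, ha, hb⟩ := exists_of_cf_mul_ne_zero hne
    have hre : a.re + b.re = lam.re + ν.re := by rw [← Complex.add_re, hab, Complex.add_re]
    have hb' := hw _ b hb
    obtain ⟨ha0, haν⟩ := hder j hj a (by linarith [hb'.1]) ha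
    rcases hb'.2 with h | h
    · have h2 := hs1 a ha0 haν
      have e4 : lam = b + (a - ν) := by linear_combination -hab
      refine hbad ⟨?_, ?_⟩
      · rw [e4]
        exact add_mem h.1 h2
      · have e5 : lam - ν = (b - ν) + (a - ν) := by linear_combination -hab
        rw [e5]
        exact add_mem h.2 h2
    · linarith
  -- For j outside J the series `w j.succ` is itself of second order, so its linear term cannot
  -- contribute at λ + ν.
  · intro j _ hj
    by_contra hne
    obtain ⟨a, b, hab, ha, hb⟩ := exists_of_cf_mul_ne_zero hne
    have hsupp := (remainder_supp h00 (fun _ ha _ hb => withZero_add ha hb)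
      (fun _ ha _ hb => knownOne_add h0 hpos ha hb) (fun _ ha _ hb => knownTwo_add h0 hpos ha hb)
      (fun _ ha _ hb => knownOne_add_knownOne hνN ha hb)
      (fun _ ha _ hb => knownOne_add_knownTwo hpos hN0 ha hb) hv' hw
      (MvPolynomial.pderiv j.succ p)).1 a ha
    refine hnot2 ?_
    rw [← hab]
    exact knownTwo_add h0 hpos hsupp (hw2 j hj b hb)

end LinearizedEquation


/-! ### Finitely many generators for shifted and for resonant exponents. -/

section SemigroupExistence

open Classical in
/-- The part of a generalized power series with exponents in a given set. -/
def GenSeries.restrict (φ : GenSeries) (p : ℂ → Prop) : GenSeries where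
  coeff l := if p l then φ.coeff l else 0
  re_pos l hl := φ.re_pos l fun h => hl (by rw [h, ite_self])
  finite_le N := (φ.finite_le N).subset fun l hl => ⟨fun h => hl.1 (by rw [h, ite_self]), hl.2⟩

theorem GenSeries.coeff_restrict_ne_zero {φ : GenSeries} {p : ℂ → Prop} {l : ℂ} :
    (φ.restrict p).coeff l ≠ 0 ↔ p l ∧ φ.coeff l ≠ 0 := by
  simp [GenSeries.restrict]

theorem GenSeries.coeff_restrict_add (φ : GenSeries) (p : ℂ → Prop) (l : ℂ) :
    φ.coeff l = (φ.restrict p).coeff l + (φ.restrict fun l => ¬ p l).coeff l := by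
  by_cases h : p l <;> simp [GenSeries.restrict, h]

theorem exists_of_coeff_iterate_comp_ne_zero {f : PowerSeries ℂ} {d : ℕ} {la : ℂ} {φ : GenSeries}
    {j : ℕ} {μ : ℂ} (h : ((GenSeries.comp f d la)^[j] φ).coeff μ ≠ 0) :
    ∃ (i : ℕ) (l : ℂ), φ.coeff l ≠ 0 ∧ μ = (d ^ j : ℕ) * l + i := by
  induction j generalizing μ with
  | zero => exact ⟨0, μ, h, by simp⟩
  | succ j ih =>
    rw [Function.iterate_succ_apply'] at h
    obtain ⟨-, i, l, hl, rfl⟩ := exists_of_compCoeff_ne_zero h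
    obtain ⟨i', l', hl', rfl⟩ := ih hl
    exact ⟨d * i' + i, l', hl', by push_cast; ring⟩

theorem finite_closure_re_le {S : Set ℂ} (hfin : S.Finite) (hS : ∀ s ∈ S, 0 < s.re) (B : ℝ) :
    {p | p ∈ AddSubsemigroup.closure S ∧ p.re ≤ B}.Finite := by
  obtain ⟨τ, ρ, hρ, hsub⟩ := exists_admissibleGenerators hfin hS
  have h1 : AddSubsemigroup.closure S ≤ semigroup ρ := AddSubsemigroup.closure_le.mpr hsub
  obtain ⟨δ, hδ, hle⟩ := exists_le_re_generators hρ.2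
  have h2 : (Set.univ.pi fun _ : Fin τ => Set.Iic ⌊B / δ⌋₊).Finite :=
    Set.Finite.pi fun _ => Set.finite_Iic _
  refine (h2.image fun m : Fin τ → ℕ => ∑ i, (m i : ℂ) * ρ i).subset ?_
  rintro p ⟨hp, hpB⟩
  obtain ⟨m, -, rfl⟩ := exists_of_mem_semigroup (h1 hp)
  refine ⟨m, fun i _ => ?_, rfl⟩
  rw [Complex.re_sum] at hpB
  simp only [Complex.mul_re, Complex.natCast_re, Complex.natCast_im, zero_mul, sub_zero] at hpB
  have h3 : (m i : ℝ) * (ρ i).re ≤ B :=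
    (Finset.single_le_sum (f := fun i => (m i : ℝ) * (ρ i).re)
      (fun j _ => mul_nonneg (Nat.cast_nonneg _) (hρ.2 j).le) (Finset.mem_univ i)).trans hpB
  refine Nat.le_floor ?_
  rw [le_div_iff₀ hδ]
  exact (mul_le_mul_of_nonneg_left (hle i) (Nat.cast_nonneg _)).trans h3

/-- The elements of `Γ - ν` with positive real part lie in a finitely generated semigroup. -/
theorem exists_shift_generators {S : Set ℂ} (hfin : S.Finite) (hS : ∀ s ∈ S, 0 < s.re) (ν : ℂ) :
    ∃ S' : Set ℂ, S'.Finite ∧ (∀ s ∈ S', 0 < s.re) ∧ ∀ Γ : AddSubsemigroup ℂ, S ⊆ Γ → S' ⊆ Γ →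
      ∀ p ∈ AddSubsemigroup.closure S, ν.re < p.re → p - ν ∈ Γ := by
  obtain ⟨M, hM⟩ := (hfin.image Complex.re).bddAbove
  -- If neither summand of a + b exceeds Re ν in real part, then Re(a + b) ≤ 2 Re ν. Subtracting ν
  -- is thus needed only for the finitely many elements of real part at most B; for all others it
  -- can be passed on to a summand.
  set B := max (2 * ν.re) M with hB
  refine ⟨(fun p => p - ν) '' {p | p ∈ AddSubsemigroup.closure S ∧ p.re ≤ B ∧ ν.re < p.re},
    Set.Finite.image _ ((finite_closure_re_le hfin hS B).subset fun p hp => ⟨hp.1, hp.2.1⟩),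
    ?_, fun Γ hΓ hΓ' p hp => ?_⟩
  · rintro _ ⟨p, ⟨-, -, hp⟩, rfl⟩
    rw [Complex.sub_re]
    linarith
  · have hle : AddSubsemigroup.closure S ≤ Γ := AddSubsemigroup.closure_le.mpr hΓ
    induction hp using AddSubsemigroup.closure_induction with
    | mem s hs =>
      exact fun h => hΓ' ⟨s, ⟨AddSubsemigroup.subset_closure hs,
        (hM ⟨s, hs, rfl⟩).trans (le_max_right _ _), h⟩, rfl⟩
    | add a b ha hb iha ihb =>
      intro h
      by_cases h1 : ν.re < a.re
      · have : a + b - ν = (a - ν) + b := by ring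
        rw [this]
        exact add_mem (iha h1) (hle hb)
      · by_cases h2 : ν.re < b.re
        · have : a + b - ν = a + (b - ν) := by ring
          rw [this]
          exact add_mem (hle ha) (ihb h2)
        · refine hΓ' ⟨a + b, ⟨add_mem ha hb, ?_, h⟩, rfl⟩
          refine le_trans ?_ (le_max_left _ _)
          rw [Complex.add_re]
          linarith

/-- The exponents `λ` of a series for which `q ^ λ` takes a given value. -/
theorem exists_resonance_generators (χ : GenSeries) {lq : ℂ} (hlq : lq ≠ 0) {ν : ℂ}
    (hχ : ∀ l, χ.coeff l ≠ 0 → ν.re < l.re) (b : ℂ) :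
    ∃ S : Set ℂ, S.Finite ∧ (∀ s ∈ S, 0 < s.re) ∧ ∀ Γ : AddSubsemigroup ℂ, S ⊆ Γ →
      ∀ l, χ.coeff l ≠ 0 → Complex.exp (l * lq) = b → l ∈ shiftOne Γ ν := by
  set X := {l | χ.coeff l ≠ 0 ∧ Complex.exp (l * lq) = b} with hX
  by_cases hne : X.Nonempty
  swap
  · exact ⟨∅, Set.finite_empty, by simp, fun Γ _ l h1 h2 => absurd ⟨l, h1, h2⟩ hne⟩
  obtain ⟨l₁, hl₁⟩ := hne
  obtain ⟨l₀, ⟨hl₀, hl₀₁⟩, hmin⟩ := Set.exists_min_image {l | l ∈ X ∧ l.re ≤ l₁.re} Complex.re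
    ((χ.finite_le l₁.re).subset fun l hl => ⟨hl.1.1, hl.2⟩) ⟨l₁, hl₁, le_rfl⟩
  have hmin' : ∀ l ∈ X, l₀.re ≤ l.re := fun l hl => by
    rcases le_total l.re l₁.re with h | h
    · exact hmin l ⟨hl, h⟩
    · exact hl₀₁.trans h
  set ω := 2 * Real.pi * Complex.I / lq with hω
  have hdiff : ∀ l ∈ X, ∃ k : ℤ, l = l₀ + k * ω := by
    intro l hl
    obtain ⟨k, hk⟩ := Complex.exp_eq_exp_iff_exists_int.mp (hl.2.trans hl₀.2.symm)
    refine ⟨k, ?_⟩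
    rw [hω]
    field_simp
    rw [hk]
    ring
  have hpos : ∀ l ∈ X, 0 < (l - ν).re := fun l hl => by
    rw [Complex.sub_re]
    linarith [hχ l hl.1]
  -- The solutions of q^l = b differ by multiples of ω = 2πi / ln q. If Re ω ≠ 0, all occurring
  -- exponents go upwards from the lowest one l₀ in steps of ±ω. If Re ω = 0 they share one real
  -- part and are finite in number.
  have hω' : ω.re = 0 ∨ ∃ ω' : ℂ, 0 < ω'.re ∧ ∀ l ∈ X, ∃ k : ℕ, l = l₀ + k * ω' := by
    rcases lt_trichotomy ω.re 0 with h | h | h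
    · refine Or.inr ⟨-ω, by rw [Complex.neg_re]; linarith, fun l hl => ?_⟩
      obtain ⟨k, hk⟩ := hdiff l hl
      have h1 := hmin' l hl
      rw [hk, Complex.add_re, Complex.mul_re, Complex.intCast_re, Complex.intCast_im, zero_mul,
        sub_zero] at h1
      have h2 : (k : ℝ) ≤ 0 := by
        by_contra hcon
        push Not at hcon
        nlinarith
      have h3 : k ≤ 0 := by exact_mod_cast h2
      obtain ⟨m, hm⟩ := Int.eq_ofNat_of_zero_le (neg_nonneg.mpr h3)
      refine ⟨m, ?_⟩
      have h4 : (k : ℂ) = -(m : ℂ) := by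
        rw [← neg_eq_iff_eq_neg]
        exact_mod_cast hm
      rw [hk, h4]
      ring
    · exact Or.inl h
    · refine Or.inr ⟨ω, h, fun l hl => ?_⟩
      obtain ⟨k, hk⟩ := hdiff l hl
      have h1 := hmin' l hl
      rw [hk, Complex.add_re, Complex.mul_re, Complex.intCast_re, Complex.intCast_im, zero_mul,
        sub_zero] at h1
      have h2 : (0 : ℝ) ≤ k := by
        by_contra hcon
        push Not at hcon
        nlinarith
      have h3 : 0 ≤ k := by exact_mod_cast h2
      obtain ⟨m, hm⟩ := Int.eq_ofNat_of_zero_le h3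
      refine ⟨m, ?_⟩
      rw [hk, hm]
      push_cast
      rfl
  rcases hω' with h | ⟨ω', h, hk⟩
  · have hXfin : X.Finite := (χ.finite_le l₀.re).subset fun l hl => by
      refine ⟨hl.1, ?_⟩
      obtain ⟨k, hk⟩ := hdiff l hl
      rw [hk, Complex.add_re, Complex.mul_re, h, Complex.intCast_im]
      simp
    refine ⟨X ∪ (fun l => l - ν) '' X, hXfin.union (hXfin.image _), ?_, fun Γ hΓ l h1 h2 =>
      ⟨hΓ (Or.inl ⟨h1, h2⟩), hΓ (Or.inr ⟨l, ⟨h1, h2⟩, rfl⟩)⟩⟩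
    rintro s (hs | ⟨l, hl, rfl⟩)
    · exact χ.re_pos s hs.1
    · exact hpos l hl
  · refine ⟨{l₀, l₀ - ν, ω'}, by simp, ?_, fun Γ hΓ l h1 h2 => ?_⟩
    · rintro s (rfl | rfl | rfl)
      · exact χ.re_pos _ hl₀.1
      · exact hpos _ hl₀
      · exact h
    · obtain ⟨k, hk⟩ := hk l ⟨h1, h2⟩
      have e1 : (k : ℂ) * ω' ∈ withZero Γ := by
        rcases Nat.eq_zero_or_pos k with rfl | hk0
        · exact Or.inl (by simp)
        · exact Or.inr (natCast_mul_mem (hΓ (by simp)) hk0.ne')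
      refine ⟨?_, ?_⟩
      · rw [hk, add_comm]
        exact add_mem_of_withZero e1 (hΓ (by simp))
      · have : l - ν = k * ω' + (l₀ - ν) := by rw [hk]; ring
        rw [this]
        exact add_mem_of_withZero e1 (hΓ (by simp))

theorem re_nonneg_of_substCoeff_ne_zero {N : ℕ} {G : MvPowerSeries (Fin N) ℂ} {v : Fin N → HS}
    (hv : ∀ i, ReGe 0 (v i)) {μ : ℂ} (h : substCoeff G v μ ≠ 0) : 0 ≤ μ.re := by
  obtain ⟨m, hm⟩ : ∃ m : Fin N →₀ ℕ,
      MvPowerSeries.coeff m G * (∏ i, v i ^ m i).coeff (ReExp.of μ) ≠ 0 := by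
    by_contra hcon
    push Not at hcon
    exact h (finsum_eq_zero_of_forall_eq_zero hcon)
  simpa using ReGe.prod_pow hv m μ (right_ne_zero_of_mul hm)

theorem reGe_args (n : ℕ) (f : PowerSeries ℂ) (d : ℕ) (la : ℂ) (φ : GenSeries) (i : Fin (n + 2)) :
    ReGe 0 (args n f d la φ i) := by
  induction i using Fin.cases with
  | zero =>
    intro μ hμ
    change cf (HahnSeries.single (ReExp.of 1) 1) μ ≠ 0 at hμ
    rw [cf_single] at hμ
    by_cases h : μ = 1
    · simp [h]
    · exact absurd (if_neg h) hμ
  | succ j => exact fun μ hμ => (GenSeries.re_pos _ μ hμ).le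

end SemigroupExistence


/-! ### Splitting off the initial part, and the semigroup of a solution. -/

section Decomposition

/-- The tuple `(0, χ(x), χ(f(x)), …)`. -/
def restArgs (n : ℕ) (f : PowerSeries ℂ) (d : ℕ) (la : ℂ) (χ : GenSeries) : Fin (n + 2) → HS :=
  Fin.cons 0 fun j : Fin (n + 1) => ((GenSeries.comp f d la)^[(j : ℕ)] χ).toHahn

theorem args_eq_add {n : ℕ} {f : PowerSeries ℂ} {d : ℕ} (hd : 1 ≤ d) (la : ℂ) {φ a b : GenSeries}
    (h : ∀ l, φ.coeff l = a.coeff l + b.coeff l) :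
    args n f d la φ = args n f d la a + restArgs n f d la b := by
  funext i
  induction i using Fin.cases with
  | zero => exact (add_zero _).symm
  | succ j => exact cf_ext fun μ => coeff_iterate_comp_add hd la h j μ

theorem args_supp {n : ℕ} {f : PowerSeries ℂ} {d : ℕ} (hd : 1 ≤ d) (la : ℂ) {φ : GenSeries}
    {Γ : AddSubsemigroup ℂ} (h1 : (1 : ℂ) ∈ Γ) (hφ : φ.ExponentsIn Γ) (i : Fin (n + 2)) (μ : ℂ)
    (hμ : cf (args n f d la φ i) μ ≠ 0) : μ ∈ Γ := by
  induction i using Fin.cases with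
  | zero =>
    change cf (HahnSeries.single (ReExp.of 1) 1) μ ≠ 0 at hμ
    rw [cf_single] at hμ
    by_cases h : μ = 1
    · rwa [h]
    · exact absurd (if_neg h) hμ
  | succ j =>
    obtain ⟨i, l, hl, rfl⟩ := exists_of_coeff_iterate_comp_ne_zero hμ
    exact add_natCast_mem h1 (natCast_mul_mem (hφ l hl) (pow_ne_zero _ (by omega))) i

theorem natCast_mul_mem_withZero {Γ : AddSubsemigroup ℂ} {z : ℂ} (hz : z ∈ Γ) (k : ℕ) :
    (k : ℂ) * z ∈ withZero Γ := by
  rcases Nat.eq_zero_or_pos k with rfl | hk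
  · exact Or.inl (by simp)
  · exact Or.inr (natCast_mul_mem hz hk.ne')

variable {Γ : AddSubsemigroup ℂ} {ν : ℂ}

theorem natCast_mul_add_mem_shiftOne (h1 : (1 : ℂ) ∈ Γ) {l : ℂ} (hl : l ∈ shiftOne Γ ν) {k : ℕ}
    (hk : 1 ≤ k) (i : ℕ) : (k : ℂ) * l + i ∈ shiftOne Γ ν := by
  obtain ⟨e, rfl⟩ := Nat.exists_eq_add_of_le hk
  have h2 : ((1 + e : ℕ) : ℂ) * l + i = ((e : ℂ) * l + (i : ℂ) * 1) + l := by push_cast; ring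
  rw [h2]
  exact shiftOne_add (withZero_add (natCast_mul_mem_withZero hl.1 e)
    (natCast_mul_mem_withZero h1 i)) hl

/-- A multiple k l with k ≥ 2 contains l + l, so composing with a germ of order at least two puts
the unknown among the second-order terms. -/
theorem natCast_mul_add_mem_shiftTwo (h1 : (1 : ℂ) ∈ Γ) {l : ℂ} (hl : l ∈ shiftOne Γ ν) {k : ℕ}
    (hk : 2 ≤ k) (i : ℕ) : (k : ℂ) * l + i ∈ shiftTwo Γ ν := by
  obtain ⟨e, rfl⟩ := Nat.exists_eq_add_of_le hk
  have h2 : ((2 + e : ℕ) : ℂ) * l + i = ((e : ℂ) * l + (i : ℂ) * 1) + (l + l) := by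
    push_cast
    ring
  rw [h2]
  exact shiftTwo_add (withZero_add (natCast_mul_mem_withZero hl.1 e)
    (natCast_mul_mem_withZero h1 i)) (shiftOne_add_shiftOne hl hl)

/-- `J` holds the indices of the main part: all of them if f is univalent, only 0 if d ≥ 2. The
finite set `G` must account for every exponent at which the main part can vanish. The semigroup is
built from 1, the low exponents of φ, their sums shifted by ν and 2ν, and G. -/
theorem exists_semigroup_of_equation {n : ℕ} {F : MvPowerSeries (Fin (n + 2)) ℂ}
    {f : PowerSeries ℂ} {d : ℕ} (hd : 1 ≤ d) {la : ℂ} {φ : GenSeries}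
    (hF : IsFormalSolution n F f d la φ) (hν : 0 ≤ ν.re) {J : Finset (Fin (n + 1))}
    {A : Fin (n + 1) → ℂ} (hA : ∀ j ∈ J, HasLeadingTerm (partialAlong n F f d la φ j) (A j) ν)
    (hJ : ∀ j ∉ J, 2 ≤ d ^ (j : ℕ)) {G : Set ℂ} (hGfin : G.Finite) (hG0 : ∀ s ∈ G, 0 < s.re)
    (hG : ∀ Γ : AddSubsemigroup ℂ, G ⊆ Γ → ∀ l,
      (φ.restrict fun l => ¬ l.re ≤ 2 * ν.re).coeff l ≠ 0 →
      (∀ k : ℕ, k ≠ 0 → (φ.restrict fun l => ¬ l.re ≤ 2 * ν.re).coeff (l - k) = 0) →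
      ∑ j ∈ J, A j * ((GenSeries.comp f d la)^[(j : ℕ)]
        (φ.restrict fun l => ¬ l.re ≤ 2 * ν.re)).coeff l = 0 → l ∈ shiftOne Γ ν) :
    ∃ (τ : ℕ) (ρ : Fin τ → ℂ), AdmissibleGenerators ρ ∧ (1 : ℂ) ∈ semigroup ρ ∧
      φ.ExponentsIn (semigroup ρ) ∧
      (∀ l, φ.coeff l ≠ 0 → 2 * ν.re < l.re → l - ν ∈ semigroup ρ) ∧
      ∀ j ∈ J, ∀ μ, μ ≠ ν → partialAlong n F f d la φ j μ ≠ 0 → μ - ν ∈ semigroup ρ := by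
  set φ₀ := φ.restrict fun l => l.re ≤ 2 * ν.re with hφ₀
  set χ := φ.restrict fun l => ¬ l.re ≤ 2 * ν.re with hχ
  set S : Set ℂ := {1} ∪ {l | φ.coeff l ≠ 0 ∧ l.re ≤ 2 * ν.re} with hS
  have hSfin : S.Finite := (Set.finite_singleton _).union (φ.finite_le _)
  have hSpos : ∀ s ∈ S, 0 < s.re := by
    rintro s (rfl | hs)
    · simp
    · exact φ.re_pos s hs.1
  obtain ⟨S₁, hS₁fin, hS₁pos, hS₁⟩ := exists_shift_generators hSfin hSpos ν
  obtain ⟨S₂, hS₂fin, hS₂pos, hS₂⟩ := exists_shift_generators hSfin hSpos (2 * ν)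
  obtain ⟨τ, ρ, hρ, hsub⟩ := exists_admissibleGenerators
    ((hSfin.union hS₁fin).union (hS₂fin.union hGfin)) (by
      rintro s ((hs | hs) | (hs | hs))
      · exact hSpos s hs
      · exact hS₁pos s hs
      · exact hS₂pos s hs
      · exact hG0 s hs)
  set Γ := semigroup ρ with hΓdef
  obtain ⟨ε, hε, hΓ⟩ := exists_le_re_semigroup hρ.2
  have hpos : ∀ z ∈ Γ, 0 < z.re := fun z hz => hε.trans_le (hΓ z hz)
  have hSΓ : S ⊆ Γ := fun s hs => hsub (Or.inl (Or.inl hs))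
  set Γ₀ := AddSubsemigroup.closure S with hΓ₀
  have h0 : Γ₀ ≤ Γ := AddSubsemigroup.closure_le.mpr hSΓ
  have h1₀ : (1 : ℂ) ∈ Γ₀ := AddSubsemigroup.subset_closure (Or.inl rfl)
  have h1 : (1 : ℂ) ∈ Γ := h0 h1₀
  have hs1 : ∀ p ∈ withZero Γ₀, ν.re < p.re → p - ν ∈ Γ := by
    rintro p (rfl | hp) h
    · rw [Complex.zero_re] at h
      linarith
    · exact hS₁ Γ hSΓ (fun s hs => hsub (Or.inl (Or.inr hs))) p hp h
  have hs2 : ∀ p ∈ Γ₀, 2 * ν.re < p.re → p - 2 * ν ∈ Γ := fun p hp h =>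
    hS₂ Γ hSΓ (fun s hs => hsub (Or.inr (Or.inl hs))) p hp (by simpa using h)
  have hφ₀Γ : φ₀.ExponentsIn Γ₀ := fun l hl => by
    obtain ⟨h2, h3⟩ := GenSeries.coeff_restrict_ne_zero.mp hl
    exact AddSubsemigroup.subset_closure (Or.inr ⟨h3, h2⟩)
  have hv : ∀ i μ, cf (args n f d la φ₀ i) μ ≠ 0 → μ ∈ Γ₀ := fun i μ =>
    args_supp hd la h1₀ hφ₀Γ i μ
  have hargs : args n f d la φ = args n f d la φ₀ + restArgs n f d la χ :=
    args_eq_add hd la (φ.coeff_restrict_add _)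
  have hχre : ∀ l, χ.coeff l ≠ 0 → 2 * ν.re < l.re := fun l hl =>
    not_le.mp (GenSeries.coeff_restrict_ne_zero.mp hl).1
  have hdpow : ∀ j : ℕ, 1 ≤ d ^ j := fun j => Nat.one_le_pow _ _ (by omega)
  have hgood : ∀ l, χ.coeff l ≠ 0 → l ∈ shiftOne Γ ν := by
    by_contra hcon
    push Not at hcon
    obtain ⟨l₁, hl₁, hl₁'⟩ := hcon
    -- An unaccounted exponent of least real part. No λ - k with k a positive integer occurs in χ,
    -- since it would be lower and its being accounted for would carry over to λ.
    obtain ⟨lam, ⟨⟨hlam, hbad⟩, hlam₁⟩, hmin⟩ := Set.exists_min_image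
      {l | (χ.coeff l ≠ 0 ∧ l ∉ shiftOne Γ ν) ∧ l.re ≤ l₁.re} Complex.re
      ((χ.finite_le l₁.re).subset fun l hl => ⟨hl.1.1, hl.2⟩) ⟨l₁, ⟨hl₁, hl₁'⟩, le_rfl⟩
    have hmin' : ∀ l, χ.coeff l ≠ 0 → l ∈ shiftOne Γ ν ∨ lam.re ≤ l.re := by
      intro l hl
      by_contra hcon
      push Not at hcon
      have := hmin l ⟨⟨hl, hcon.1⟩, by linarith⟩
      linarith
    have hre : ∀ (k i : ℕ) (l : ℂ), ((k : ℂ) * l + i).re = k * l.re + i := fun k i l => by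
      simp
    refine hbad (hG Γ (fun s hs => hsub (Or.inr (Or.inr hs))) lam hlam (fun k hk => ?_) ?_)
    · by_contra hne
      rcases hmin' _ hne with h | h
      · refine hbad ?_
        have := natCast_mul_add_mem_shiftOne h1 h le_rfl k
        simpa using this
      · rw [Complex.sub_re, Complex.natCast_re] at h
        have : (0 : ℝ) < k := by exact_mod_cast Nat.pos_of_ne_zero hk
        linarith
    · refine sum_mul_cf_eq_zero (v := args n f d la φ₀) (w := restArgs n f d la χ) (F := F) hε hΓ h0
        hs1 hs2 hν le_rfl (hχre lam hlam) hbad hv rfl (fun i μ hμ => ?_) (fun j hj μ hμ => ?_)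
        ?_ (fun j hj => ?_)
      · induction i using Fin.cases with
        | zero => exact absurd rfl hμ
        | succ j =>
          obtain ⟨i, l, hl, rfl⟩ := exists_of_coeff_iterate_comp_ne_zero hμ
          have h2 := χ.re_pos l hl
          have h3 : (1 : ℝ) ≤ (d ^ (j : ℕ) : ℕ) := by exact_mod_cast hdpow j
          have h4 : l.re ≤ (((d ^ (j : ℕ) : ℕ) : ℂ) * l + i).re := by
            rw [hre]
            have : (0 : ℝ) ≤ i := Nat.cast_nonneg i
            nlinarith
          exact ⟨(hχre l hl).trans_le h4, (hmin' l hl).imp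
            (fun h => natCast_mul_add_mem_shiftOne h1 h (hdpow j) i) fun h => h.trans h4⟩
      · obtain ⟨i, l, hl, rfl⟩ := exists_of_coeff_iterate_comp_ne_zero hμ
        refine (hmin' l hl).imp (fun h => natCast_mul_add_mem_shiftTwo h1 h (hJ j hj) i) fun h => ?_
        have h2 := hχre lam hlam
        have h3 : (2 : ℝ) ≤ (d ^ (j : ℕ) : ℕ) := by exact_mod_cast hJ j hj
        have h4 : (0 : ℝ) ≤ i := Nat.cast_nonneg i
        have h5 := χ.re_pos l hl
        rw [hre]
        nlinarith
      · rw [← hargs]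
        exact hF _
      · rw [← hargs]
        exact hA j hj
  have hφΓ : φ.ExponentsIn Γ := by
    intro l hl
    by_cases h : l.re ≤ 2 * ν.re
    · exact hSΓ (Or.inr ⟨hl, h⟩)
    · exact (hgood l (GenSeries.coeff_restrict_ne_zero.mpr ⟨h, hl⟩)).1
  refine ⟨τ, ρ, hρ, h1, hφΓ, fun l hl h => (hgood l (GenSeries.coeff_restrict_ne_zero.mpr
    ⟨not_le.mpr h, hl⟩)).2, fun j hj μ hμ hne => ?_⟩
  have hlead := (hA j hj).2 μ hμ hne
  obtain ⟨D, hD⟩ := exists_nat_gt (μ.re / ε)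
  rw [div_lt_iff₀ hε] at hD
  have hge : ∀ i, ReGe ε (args n f d la φ i) := fun i μ h => hΓ μ (args_supp hd la h1 hφΓ i μ h)
  have e1 : partialAlong n F f d la φ j μ = _ :=
    substCoeff_eq (MvPowerSeries.pderiv ℂ j.succ F) hε.le hge hD
  rw [hargs] at e1
  set p := MvPowerSeries.truncTotal D (MvPowerSeries.pderiv ℂ j.succ F)
  -- Either the coefficient comes from adding χ, and then μ is in `shiftOne Γ ν`, or it is present
  -- along φ₀, and then μ is in Γ₀ ∪ {0} with Re μ > Re ν and the shifted generators apply.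
  by_cases h2 : cf (MvPolynomial.aeval (args n f d la φ₀) p) μ = 0
  · refine (aeval_sub_supp (S₀ := withZero Γ) (S₁ := shiftOne Γ ν) (Or.inl rfl)
      (fun _ ha _ hb => withZero_add ha hb) (fun _ ha _ hb => shiftOne_add ha hb)
      (fun _ ha _ hb => shiftOne_add (Or.inr ha.1) hb) (v := args n f d la φ₀)
      (w := restArgs n f d la χ) (fun i μ h => Or.inr (h0 (hv i μ h))) (fun i μ hμ => ?_) p
      (μ := μ) ?_).2
    · induction i using Fin.cases with
      | zero => exact absurd rfl hμ
      | succ j =>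
        obtain ⟨i, l, hl, rfl⟩ := exists_of_coeff_iterate_comp_ne_zero hμ
        exact natCast_mul_add_mem_shiftOne h1 (hgood l hl) (hdpow j) i
    · rw [cf_sub, h2, sub_zero, ← e1]
      exact hne
  · refine hs1 μ ?_ hlead
    exact (remainder_supp (S₀ := withZero Γ₀) (S₁ := withZero Γ₀) (S₂ := withZero Γ₀)
      (Or.inl rfl) (fun _ ha _ hb => withZero_add ha hb) (fun _ ha _ hb => withZero_add ha hb)
      (fun _ ha _ hb => withZero_add ha hb) (fun _ ha _ hb => withZero_add ha hb)
      (fun _ ha _ hb => withZero_add ha hb) (v := args n f d la φ₀) (w := 0)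
      (fun i μ h => Or.inr (hv i μ h)) (fun i μ h => absurd rfl h) p).1 μ h2

end Decomposition


/-! ### The univalent case: resonances and the carrying semigroup. -/

section Carrying

theorem charPoly_ne_zero {n : ℕ} {A : Fin (n + 1) → ℂ} (hA : ∃ j, A j ≠ 0) : charPoly A ≠ 0 := by
  obtain ⟨j, hj⟩ := hA
  intro h
  have h1 : (charPoly A).coeff j = A j := by
    rw [charPoly, Polynomial.finsetSum_coeff, Finset.sum_eq_single j]
    · simp
    · intro i _ hi
      rw [Polynomial.coeff_C_mul, Polynomial.coeff_X_pow, if_neg, mul_zero]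
      exact fun h => hi (Fin.ext h.symm)
    · simp
  rw [h, Polynomial.coeff_zero] at h1
  exact hj h1.symm

/-- Composition with f = q x(1 + …) moves coefficients up only by integers. If no l - k with k ≥ 1
occurs, each iterate just multiplies by q^l. -/
theorem coeff_iterate_comp_eq {f : PowerSeries ℂ} (lq : ℂ) {χ : GenSeries} {l : ℂ}
    (h : ∀ k : ℕ, k ≠ 0 → χ.coeff (l - k) = 0) (j : ℕ) :
    ((GenSeries.comp f 1 lq)^[j] χ).coeff l = χ.coeff l * Complex.exp (l * lq) ^ j := by
  induction j with
  | zero => simp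
  | succ j ih =>
    rw [Function.iterate_succ_apply']
    change compCoeff f 1 lq _ l = _
    rw [compCoeff, finsum_eq_single _ 0]
    · rw [onePowCoeff_zero_right]
      simp only [Nat.cast_zero, sub_zero, Nat.cast_one, div_one, mul_one, ih]
      ring
    · intro i hi
      by_contra hne
      have h1 := left_ne_zero_of_mul (left_ne_zero_of_mul hne)
      obtain ⟨i', l', hl', h2⟩ := exists_of_coeff_iterate_comp_ne_zero h1
      refine hl' ?_
      have h3 : l' = l - (i + i' : ℕ) := by
        push_cast at h2 ⊢
        rw [one_pow, one_mul, div_one] at h2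
        linear_combination -h2
      rw [h3]
      exact h _ (by omega)

/-- Needed for the period 2πi / ln q of the resonances; ln q = 0 would mean q = 1, against Siegel's
condition. -/
theorem ne_zero_of_siegelCondition {lq : ℂ}
    (hS : ‖Complex.exp lq‖ = 1 → SiegelCondition (Complex.exp lq)) : lq ≠ 0 := by
  rintro rfl
  obtain ⟨c, hc, γ, -, h⟩ := hS (by simp)
  have := h 1 le_rfl
  simp at this
  linarith

theorem re_nonneg_of_hasLeadingTerm {n : ℕ} {F : MvPowerSeries (Fin (n + 2)) ℂ}
    {f : PowerSeries ℂ} {d : ℕ} {la : ℂ} {φ : GenSeries} {j : Fin (n + 1)} {A ν : ℂ}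
    (h : HasLeadingTerm (partialAlong n F f d la φ j) A ν) (hA : A ≠ 0) : 0 ≤ ν.re :=
  re_nonneg_of_substCoeff_ne_zero (reGe_args n f d la φ) (h.1.trans_ne hA)

/-- A solution of an equation with a univalent `f` has a semigroup that carries it. -/
theorem exists_carries {n : ℕ} {F : MvPowerSeries (Fin (n + 2)) ℂ} {f : PowerSeries ℂ} {lq : ℂ}
    (hS : ‖Complex.exp lq‖ = 1 → SiegelCondition (Complex.exp lq)) {φ : GenSeries}
    (hF : IsFormalSolution n F f 1 lq φ) {A : Fin (n + 1) → ℂ} {ν : ℂ}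
    (hA : ∀ j, HasLeadingTerm (partialAlong n F f 1 lq φ j) (A j) ν) (hA0 : ∃ j, A j ≠ 0) :
    ∃ (τ : ℕ) (ρ : Fin τ → ℂ), AdmissibleGenerators ρ ∧
      Carries (semigroup ρ) φ (partialAlong n F f 1 lq φ) ν := by
  have hν : 0 ≤ ν.re := by
    obtain ⟨j, hj⟩ := hA0
    exact re_nonneg_of_hasLeadingTerm (hA j) hj
  have hL := charPoly_ne_zero hA0
  set χ := φ.restrict fun l => ¬ l.re ≤ 2 * ν.re with hχ
  have hχν : ∀ l, χ.coeff l ≠ 0 → ν.re < l.re := fun l hl => by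
    have := not_le.mp (GenSeries.coeff_restrict_ne_zero.mp hl).1
    linarith
  choose G hGfin hG0 hG using exists_resonance_generators χ (ne_zero_of_siegelCondition hS) hχν
  obtain ⟨τ, ρ, hρ, h1, hφ, hφν, hpart⟩ := exists_semigroup_of_equation (J := Finset.univ) le_rfl hF
    hν (fun j _ => hA j) (fun j hj => absurd (Finset.mem_univ j) hj)
    (G := ⋃ b ∈ (charPoly A).roots.toFinset, G b)
    (Set.Finite.biUnion (Finset.finite_toSet _) fun b _ => hGfin b)
    (fun s hs => by
      obtain ⟨b, -, hb⟩ := Set.mem_iUnion₂.mp hs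
      exact hG0 b s hb)
    -- The main part is χ_l L(q^l). Its vanishing makes q^l one of the finitely many roots, whose
    -- resonance generators are in Γ.
    (fun Γ hΓ l hl hk hsum => by
      refine hG (Complex.exp (l * lq)) Γ (fun s hs => hΓ (Set.mem_iUnion₂.mpr ⟨_, ?_, hs⟩)) l hl rfl
      rw [Multiset.mem_toFinset, Polynomial.mem_roots hL, Polynomial.IsRoot, charPoly_eval]
      refine mul_left_cancel₀ hl ?_
      rw [mul_zero, ← hsum, Finset.mul_sum]
      refine Finset.sum_congr rfl fun j _ => ?_
      rw [coeff_iterate_comp_eq lq hk]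
      ring)
  refine ⟨τ, ρ, hρ, h1, hφ, (φ.finite_le (2 * ν.re)).subset fun l hl => ⟨hl.1, ?_⟩,
    fun j => hpart j (Finset.mem_univ j)⟩
  by_contra hcon
  exact hl.2 (hφν l hl.1 (not_le.mp hcon))

end Carrying

/-! ### The case of order at least two, and passage from norms to sectors. -/

section Convergence

theorem exists_nm_comp_lt_top {f : PowerSeries ℂ} {d : ℕ} (hd : 1 ≤ d) (la : ℂ) {φ : GenSeries}
    {κ : ℝ} (hφ : ∀ l, φ.coeff l ≠ 0 → ‖l‖ ≤ κ * l.re) {r₀ : ℝ} (hr₀ : 0 < r₀)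
    (hfin : nm (wt r₀) φ.toHahn < ⊤)
    (hf : ∃ ρ > 0, ∀ r, 0 < r → r ≤ ρ → pw r (unitTail f d) ≤ 4⁻¹) :
    ∃ r > 0, nm (wt r) (GenSeries.comp f d la φ).toHahn < ⊤ := by
  obtain ⟨ρ, hρ, hρ'⟩ := hf
  set E := Real.exp (κ * (1 + ‖la‖)) with hE
  have hE0 : 0 < E := Real.exp_pos _
  set r := min (min ρ 1) (r₀ / E) with hr
  have hr0 : 0 < r := by positivity
  refine ⟨r, hr0, (nm_comp_wt_le hd la hφ hr0
    (hρ' r hr0 ((min_le_left _ _).trans (min_le_left _ _)))).trans_lt ?_⟩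
  refine ENNReal.mul_lt_top (by simp) ((nm_wt_le_of_le (H := φ.toHahn) (ε := 0) (r₁ := r₀)
    (fun l hl => (φ.re_pos l hl).le) (by positivity) ?_).trans_lt ?_)
  · have h1 : r ^ d ≤ r :=
      pow_le_of_le_one hr0.le ((min_le_left _ _).trans (min_le_right _ _)) (by omega)
    have h2 : E * r ≤ r₀ := by
      rw [mul_comm, ← le_div_iff₀ hE0]
      exact min_le_right _ _
    nlinarith
  · rwa [Real.rpow_zero, ENNReal.ofReal_one, one_mul]

theorem exists_nm_args_lt_top {n : ℕ} {f : PowerSeries ℂ} {d : ℕ} (hd : 1 ≤ d) (la : ℂ)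
    {φ : GenSeries} {Γ : AddSubsemigroup ℂ} (h1 : (1 : ℂ) ∈ Γ) {κ : ℝ}
    (hκ : ∀ z ∈ Γ, ‖z‖ ≤ κ * z.re) (hφ : φ.ExponentsIn Γ)
    (hfin : ∃ r > 0, nm (wt r) φ.toHahn < ⊤)
    (hf : ∃ ρ > 0, ∀ r, 0 < r → r ≤ ρ → pw r (unitTail f d) ≤ 4⁻¹) (i : Fin (n + 2)) :
    ∃ r > 0, nm (wt r) (args n f d la φ i) < ⊤ := by
  induction i using Fin.cases with
  | zero =>
    refine ⟨1, one_pos, ?_⟩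
    change nm (wt 1) (HahnSeries.single (ReExp.of 1) 1) < ⊤
    rw [nm_single]
    simp [wt]
  | succ j =>
    have key : ∀ j : ℕ, ((GenSeries.comp f d la)^[j] φ).ExponentsIn Γ ∧
        ∃ r > 0, nm (wt r) ((GenSeries.comp f d la)^[j] φ).toHahn < ⊤ := by
      intro j
      induction j with
      | zero => exact ⟨hφ, hfin⟩
      | succ j ih =>
        obtain ⟨ih1, r, hr, ih2⟩ := ih
        rw [Function.iterate_succ_apply']
        refine ⟨fun μ hμ => ?_,
          exists_nm_comp_lt_top hd la (fun l hl => hκ l (ih1 l hl)) hr ih2 hf⟩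
        obtain ⟨-, i, l, hl, rfl⟩ := exists_of_compCoeff_ne_zero hμ
        exact add_natCast_mem h1 (natCast_mul_mem (ih1 l hl) (by omega)) i
    exact (key j).2

theorem exists_nm_lt_top_of_finite {φ : GenSeries} (h : {l | φ.coeff l ≠ 0}.Finite) (r : ℝ) :
    nm (wt r) φ.toHahn < ⊤ := by
  unfold nm
  rw [tsum_eq_sum (s := h.toFinset)]
  · exact ENNReal.sum_lt_top.mpr fun l _ => ENNReal.mul_lt_top enorm_lt_top (by simp [wt])
  · intro l hl
    have : φ.coeff l = 0 := by simpa using hl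
    change ‖φ.coeff l‖ₑ * _ = 0
    rw [this, enorm_zero, zero_mul]

/-- Existence of a semigroup and convergence for an `f` of order at least two. -/
theorem exists_nm_lt_top_of_two_le {n : ℕ} {F : MvPowerSeries (Fin (n + 2)) ℂ} {f : PowerSeries ℂ}
    {d : ℕ} (hd : 2 ≤ d) {la : ℂ} (hf : ∃ ρ > 0, ∀ r, 0 < r → r ≤ ρ → pw r (unitTail f d) ≤ 4⁻¹)
    {R C : ℝ} (hR : 0 < R) (hFc : ConvergentAt F R C) {φ : GenSeries}
    (hF : IsFormalSolution n F f d la φ) {A ν : ℂ}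
    (hA : HasLeadingTerm (partialAlong n F f d la φ 0) A ν) (hA0 : A ≠ 0) :
    ∃ (τ : ℕ) (ρ : Fin τ → ℂ), AdmissibleGenerators ρ ∧ φ.ExponentsIn (semigroup ρ) ∧
      ∃ r > 0, nm (wt r) φ.toHahn < ⊤ := by
  have hν := re_nonneg_of_hasLeadingTerm hA hA0
  have hd1 : 1 ≤ d := by omega
  obtain ⟨τ, ρ, hρ, h1, hφ, hφν, hpart⟩ := exists_semigroup_of_equation (J := {0})
    (A := fun _ => A) hd1 hF hν (fun j hj => by rwa [Finset.mem_singleton.mp hj])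
    (fun j hj => hd.trans (Nat.le_self_pow (fun h => hj (Finset.mem_singleton.mpr (Fin.ext h))) d))
    -- No resonance generators are needed: the main part A χ_l is never zero at an exponent of χ.
    Set.finite_empty (fun s hs => absurd hs (Set.notMem_empty s)) (fun Γ _ l hl _ hsum => by
      rw [Finset.sum_singleton] at hsum
      exact absurd hsum (mul_ne_zero hA0 hl))
  refine ⟨τ, ρ, hρ, hφ, ?_⟩
  set Γ := semigroup ρ
  obtain ⟨ε, hε, hΓ⟩ := exists_le_re_semigroup hρ.2
  obtain ⟨κ, hκ, hnorm⟩ := exists_norm_le_semigroup hρ.2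
  set φ₀ := φ.restrict fun l => l.re ≤ 2 * ν.re with hφ₀
  set χ := φ.restrict fun l => ¬ l.re ≤ 2 * ν.re with hχ
  have hargs : args n f d la φ = args n f d la φ₀ + restArgs n f d la χ :=
    args_eq_add hd1 la (φ.coeff_restrict_add _)
  have hφ₀Γ : φ₀.ExponentsIn Γ := fun l hl => hφ l (GenSeries.coeff_restrict_ne_zero.mp hl).2
  have hφ₀fin : ∀ r, nm (wt r) φ₀.toHahn < ⊤ := exists_nm_lt_top_of_finite
    ((φ.finite_le (2 * ν.re)).subset fun l hl => (GenSeries.coeff_restrict_ne_zero.mp hl).symm)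
  have hχ1 : ∀ l, χ.coeff l ≠ 0 → l ∈ shiftOne Γ ν ∧ 2 * ν.re ≤ l.re := fun l hl => by
    obtain ⟨h2, h3⟩ := GenSeries.coeff_restrict_ne_zero.mp hl
    exact ⟨⟨hφ l h3, hφν l h3 (not_le.mp h2)⟩, (not_le.mp h2).le⟩
  obtain ⟨r, hr, hfin⟩ := exists_nm_lt_top_of_order (F := F) (Γ := Γ) (χ := χ)
    (v := args n f d la φ₀) (w := restArgs n f d la χ) hd la hκ h1 hε hΓ hnorm hf hν hR hFc
    (args_supp hd1 la h1 hφ₀Γ)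
    (exists_nm_args_lt_top hd1 la h1 hnorm hφ₀Γ ⟨1, one_pos, hφ₀fin 1⟩ hf) rfl (fun j => rfl)
    (fun i μ hμ => by
      induction i using Fin.cases with
      | zero => exact absurd rfl hμ
      | succ j =>
        obtain ⟨i, l, hl, rfl⟩ := exists_of_coeff_iterate_comp_ne_zero hμ
        exact natCast_mul_add_mem_shiftOne h1 (hχ1 l hl).1 (Nat.one_le_pow _ _ (by omega)) i)
    hχ1 (fun μ => by rw [← hargs]; exact hF μ) hA0 (by rw [← hargs]; exact hA.1)
    (fun μ hμ hne => hpart 0 (by simp) μ hμ (by rw [← hargs] at hne; exact hne))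
  refine ⟨r, hr, ?_⟩
  have h2 : φ.toHahn = φ₀.toHahn + χ.toHahn := cf_ext (φ.coeff_restrict_add _)
  rw [h2]
  exact (nm_add_le _ _ _).trans_lt (ENNReal.add_lt_top.mpr ⟨hφ₀fin r, hfin⟩)

/-- The branch contributes at most exp(|Im l| (π + |θ|)), and |Im l| ≤ κ Re l turns this into a
rescaling of |x|. -/
theorem norm_branchPow_le {θ κ : ℝ} {x l : ℂ} (hx : x ≠ 0) (hl : ‖l‖ ≤ κ * l.re) :
    ‖branchPow θ x l‖ ≤ (‖x‖ * Real.exp (κ * (Real.pi + |θ|))) ^ l.re := by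
  set y := x * Complex.exp (-(θ * Complex.I)) with hy
  have hyx : ‖y‖ = ‖x‖ := by
    rw [hy, norm_mul, ← neg_mul, ← Complex.ofReal_neg, Complex.norm_exp_ofReal_mul_I, mul_one]
  have hx0 : 0 < ‖x‖ := norm_pos_iff.mpr hx
  have h1 : (l * (Complex.log y + θ * Complex.I)).re =
      l.re * Real.log ‖x‖ - l.im * (y.arg + θ) := by
    simp [Complex.log_re, Complex.log_im, hyx]
  have h2 : -(l.im * (y.arg + θ)) ≤ κ * l.re * (Real.pi + |θ|) := by
    calc -(l.im * (y.arg + θ)) ≤ |l.im * (y.arg + θ)| := neg_le_abs _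
      _ = |l.im| * |y.arg + θ| := abs_mul _ _
      _ ≤ κ * l.re * (Real.pi + |θ|) := by
          refine mul_le_mul ((Complex.abs_im_le_norm l).trans hl)
            ((abs_add_le _ _).trans (by gcongr; exact Complex.abs_arg_le_pi y)) (abs_nonneg _)
            ((norm_nonneg l).trans hl)
  rw [branchPow, Complex.norm_exp, ← hy, h1, Real.mul_rpow hx0.le (Real.exp_pos _).le,
    Real.rpow_def_of_pos hx0, ← Real.exp_mul, ← Real.exp_add]
  refine Real.exp_le_exp.mpr ?_
  nlinarith

theorem convergesInSectors_of_nm {φ : GenSeries} {κ : ℝ}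
    (hφ : ∀ l, φ.coeff l ≠ 0 → ‖l‖ ≤ κ * l.re) {r : ℝ} (hr : 0 < r)
    (hfin : nm (wt r) φ.toHahn < ⊤) : ConvergesInSectors φ := by
  intro θ η _ _
  set E := Real.exp (κ * (Real.pi + |θ|)) with hE
  have hE0 : 0 < E := Real.exp_pos _
  refine ⟨r / E, by positivity, fun x => ∑' l, φ.coeff l * branchPow θ x l, ?_⟩
  have hsum : Summable fun l => ‖φ.coeff l‖ * r ^ l.re := by
    have h2 := ENNReal.summable_toReal hfin.ne
    refine h2.congr fun l => ?_
    change (‖φ.coeff l‖ₑ * ENNReal.ofReal (r ^ l.re)).toReal = _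
    rw [ENNReal.toReal_mul, toReal_enorm, ENNReal.toReal_ofReal (by positivity)]
  refine tendstoUniformlyOn_tsum hsum fun l x hx => ?_
  rw [norm_mul]
  by_cases hl : φ.coeff l = 0
  · rw [hl, norm_zero, zero_mul, zero_mul]
  · refine mul_le_mul_of_nonneg_left ?_ (norm_nonneg _)
    refine (norm_branchPow_le hx.1 (hφ l hl)).trans ?_
    refine Real.rpow_le_rpow (by positivity) ?_ (φ.re_pos l hl).le
    rw [← le_div_iff₀ hE0]
    exact hx.2.1.le

end Convergence


/-! ### The convergence conditions as estimates of q^l - b. -/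

section Conditions

variable {τ : ℕ} {ρ : Fin τ → ℂ} {lq : ℂ}

theorem re_mul_le_of_mem_semigroup {c : ℝ} (h : ∀ i, (ρ i * lq).re ≤ c * (ρ i).re) {l : ℂ}
    (hl : l ∈ semigroup ρ) : (l * lq).re ≤ c * l.re := by
  induction hl using AddSubsemigroup.closure_induction with
  | mem x hx =>
    obtain ⟨i, rfl⟩ := hx
    exact h i
  | add a b _ _ iha ihb =>
    rw [add_mul, Complex.add_re, Complex.add_re, mul_add]
    exact add_le_add iha ihb

theorem exists_re_mul_le (hρ : ∀ i, 0 < (ρ i).re) (h : ∀ i, (ρ i * lq).re < 0) :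
    ∃ δ > 0, ∀ l ∈ semigroup ρ, (l * lq).re ≤ -δ * l.re := by
  have h1 : ∀ᶠ δ in 𝓝[>] (0 : ℝ), ∀ i, (ρ i * lq).re ≤ -δ * (ρ i).re :=
    eventually_all.mpr fun i => by
      filter_upwards [Ioc_mem_nhdsGT (div_pos (neg_pos.mpr (h i)) (hρ i))] with δ hδ
      have := (le_div_iff₀ (hρ i)).mp hδ.2
      linarith
  obtain ⟨δ, h2, h3⟩ := (h1.and self_mem_nhdsWithin).exists
  exact ⟨δ, h3, fun l hl => re_mul_le_of_mem_semigroup h2 hl⟩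

theorem modPow_eq (r : ℂ) : modPow lq r = Real.exp (r * lq).re := Complex.norm_exp _

theorem norm_exp_le_one_of_modPow (h : ∀ i, modPow lq (ρ i) ≤ 1) {l : ℂ} (hl : l ∈ semigroup ρ) :
    ‖Complex.exp (l * lq)‖ ≤ 1 := by
  have := re_mul_le_of_mem_semigroup (c := 0) (lq := lq) (fun i => by
    have h1 := h i
    rw [modPow_eq, Real.exp_le_one_iff] at h1
    simpa using h1) hl
  rw [Complex.norm_exp, Real.exp_le_one_iff]
  simpa using this

theorem one_le_norm_exp_of_modPow (h : ∀ i, 1 ≤ modPow lq (ρ i)) {l : ℂ} (hl : l ∈ semigroup ρ) :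
    1 ≤ ‖Complex.exp (l * lq)‖ := by
  have := re_mul_le_of_mem_semigroup (c := 0) (lq := -lq) (fun i => by
    have h1 := h i
    rw [modPow_eq, Real.one_le_exp_iff] at h1
    simpa using h1) hl
  rw [Complex.norm_exp, Real.one_le_exp_iff]
  simpa using this

theorem ne_zero_of_mem_roots_charPoly {n : ℕ} {A : Fin (n + 1) → ℂ} (hA : A 0 ≠ 0) {b : ℂ}
    (hb : b ∈ (charPoly A).roots) : b ≠ 0 := by
  rintro rfl
  have h := (Polynomial.mem_roots'.mp hb).2
  rw [Polynomial.IsRoot, charPoly_eval, Finset.sum_eq_single 0] at h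
  · simp [hA] at h
  · intro j _ hj
    rw [zero_pow, mul_zero]
    exact fun h => hj (Fin.ext h)
  · simp

theorem mem_resonantRoots {n : ℕ} {A : Fin (n + 1) → ℂ} {b : ℂ}
    (hb : b = 1 ∨ b ∈ (charPoly A).roots) : b ∈ resonantRoots A := by
  change Polynomial.eval b _ = 0
  rw [Polynomial.eval_mul, Polynomial.eval_sub, Polynomial.eval_X, Polynomial.eval_one]
  rcases hb with rfl | hb
  · rw [sub_self, zero_mul]
  · rw [(Polynomial.mem_roots'.mp hb).2, mul_zero]

/-- The small divisors are controlled under any of the conditions for convergence. -/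
theorem ConvergenceCondition.exists_divisor {n : ℕ} {A : Fin (n + 1) → ℂ}
    (h : ConvergenceCondition lq A ρ) (hρ : ∀ i, 0 < (ρ i).re) :
    (A (Fin.last n) ≠ 0 ∨ ∀ l ∈ semigroup ρ, ‖Complex.exp (l * lq)‖ ≤ 1) ∧
    ∀ b ∈ (charPoly A).roots, (∃ c > (0 : ℝ), ∃ N : ℝ, ∀ l ∈ semigroup ρ, N < l.re →
        c * max 1 ‖Complex.exp (l * lq)‖ ≤ ‖Complex.exp (l * lq) - b‖) ∨
      (b ≠ 0 ∧ (∃ c > (0 : ℝ), ∃ γ > (0 : ℝ), ∃ N : ℝ, ∀ l ∈ semigroup ρ, N < l.re →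
          c * l.re ^ (-γ) ≤ ‖Complex.exp (l * lq) - b‖) ∧
        ∃ c > (0 : ℝ), ∃ γ > (0 : ℝ), ∀ l ∈ semigroup ρ,
          c * l.re ^ (-γ) ≤ ‖Complex.exp (l * lq) - 1‖) := by
  have hdio : ∀ {R : Set ℂ} {b : ℂ}, Diophantine lq ρ R → b ∈ R → (1 : ℂ) ∈ R → b ≠ 0 →
      (b ≠ 0 ∧ (∃ c > (0 : ℝ), ∃ γ > (0 : ℝ), ∃ N : ℝ, ∀ l ∈ semigroup ρ, N < l.re →
          c * l.re ^ (-γ) ≤ ‖Complex.exp (l * lq) - b‖) ∧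
        ∃ c > (0 : ℝ), ∃ γ > (0 : ℝ), ∀ l ∈ semigroup ρ,
          c * l.re ^ (-γ) ≤ ‖Complex.exp (l * lq) - 1‖) := by
    intro R b hR hb h1 hb0
    obtain ⟨c, hc, γ, hγ, h2⟩ := hR.exists_le_norm_sub hρ hb hb0
    exact ⟨hb0, ⟨c, hc, γ, hγ, 0, fun l hl _ => h2 l hl⟩, hR.exists_le_norm_sub hρ h1 one_ne_zero⟩
  have hone : (1 : ℂ) ∈ resonantRoots A := mem_resonantRoots (Or.inl rfl)
  have hexp : ∀ l : ℂ, ‖Complex.exp (l * lq)‖ = Real.exp (l * lq).re := fun l => Complex.norm_exp _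
  -- In the special cases |q^l| stays on one side of, or on, the unit circle. Roots that these
  -- values eventually avoid cause no small divisors; the rest, together with 1, are covered by the
  -- Diophantine condition. A₀ ≠ 0 excludes the root 0, and A_n ≠ 0 gives full degree where |q^l| is
  -- unbounded.
  rcases h with ⟨hn, h0, hR⟩ | ⟨h0, hlt⟩ | ⟨hn, hlt⟩ | ⟨heq, hR⟩ | ⟨h0, hle, hR⟩ | ⟨hn, hle, hR⟩
  · exact ⟨Or.inl hn, fun b hb => Or.inr (hdio hR (mem_resonantRoots (Or.inr hb)) hone
      (ne_zero_of_mem_roots_charPoly h0 hb))⟩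
  · have hle := fun l hl => norm_exp_le_one_of_modPow (lq := lq) (ρ := ρ) (fun i => (hlt i).le)
      (l := l) hl
    refine ⟨Or.inr hle, fun b hb => Or.inl ?_⟩
    have hb0 := norm_pos_iff.mpr (ne_zero_of_mem_roots_charPoly h0 hb)
    obtain ⟨δ, hδ, hre⟩ := exists_re_mul_le (lq := lq) hρ fun i => by
      have := hlt i
      rwa [modPow_eq, Real.exp_lt_one_iff] at this
    refine ⟨‖b‖ / 2, by positivity, -Real.log (‖b‖ / 2) / δ, fun l hl hN => ?_⟩
    rw [max_eq_left (hle l hl), mul_one]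
    have h1 : ‖Complex.exp (l * lq)‖ ≤ ‖b‖ / 2 := by
      rw [hexp, ← Real.le_log_iff_exp_le (by positivity)]
      rw [div_lt_iff₀ hδ] at hN
      linarith [hre l hl]
    have h2 := norm_sub_norm_le b (Complex.exp (l * lq))
    rw [norm_sub_rev] at h2
    linarith
  · refine ⟨Or.inl hn, fun b hb => Or.inl ?_⟩
    obtain ⟨δ, hδ, hre⟩ := exists_re_mul_le (lq := -lq) hρ fun i => by
      have := hlt i
      rw [modPow_eq, Real.one_lt_exp_iff] at this
      simpa using this
    refine ⟨1 / 2, by positivity, (2 * ‖b‖) / δ, fun l hl hN => ?_⟩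
    have h3 := one_le_norm_exp_of_modPow (lq := lq) (ρ := ρ) (fun i => (hlt i).le) hl
    rw [max_eq_right h3]
    have h1 : 2 * ‖b‖ ≤ ‖Complex.exp (l * lq)‖ := by
      rw [hexp]
      rw [div_lt_iff₀ hδ] at hN
      have h4 := hre l hl
      rw [mul_neg, Complex.neg_re] at h4
      have := Real.add_one_le_exp (l * lq).re
      linarith
    have h2 := norm_sub_norm_le (Complex.exp (l * lq)) b
    linarith
  · have heq' : ∀ l ∈ semigroup ρ, ‖Complex.exp (l * lq)‖ = 1 := fun l hl =>
      le_antisymm (norm_exp_le_one_of_modPow (fun i => (heq i).le) hl)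
        (one_le_norm_exp_of_modPow (fun i => (heq i).ge) hl)
    refine ⟨Or.inr fun l hl => (heq' l hl).le, fun b hb => ?_⟩
    by_cases hb1 : ‖b‖ = 1
    · exact Or.inr (hdio hR ⟨mem_resonantRoots (Or.inr hb), hb1⟩ ⟨hone, norm_one⟩
        (norm_pos_iff.mp (by rw [hb1]; exact one_pos)))
    · refine Or.inl ⟨|1 - ‖b‖|, abs_pos.mpr (sub_ne_zero.mpr (Ne.symm hb1)), 0, fun l hl _ => ?_⟩
      have h2 := abs_norm_sub_norm_le (Complex.exp (l * lq)) b
      rw [heq' l hl] at h2 ⊢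
      rwa [max_self, mul_one]
  · have hle' := fun l hl => norm_exp_le_one_of_modPow (lq := lq) (ρ := ρ) hle (l := l) hl
    refine ⟨Or.inr hle', fun b hb => ?_⟩
    by_cases hb1 : ‖b‖ ≤ 1
    · exact Or.inr (hdio hR ⟨mem_resonantRoots (Or.inr hb), hb1⟩ ⟨hone, norm_one.le⟩
        (ne_zero_of_mem_roots_charPoly h0 hb))
    · refine Or.inl ⟨‖b‖ - 1, by linarith, 0, fun l hl _ => ?_⟩
      rw [max_eq_left (hle' l hl), mul_one]
      have h2 := norm_sub_norm_le b (Complex.exp (l * lq))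
      rw [norm_sub_rev] at h2
      linarith [hle' l hl]
  · refine ⟨Or.inl hn, fun b hb => ?_⟩
    by_cases hb1 : 1 ≤ ‖b‖
    · exact Or.inr (hdio hR ⟨mem_resonantRoots (Or.inr hb), hb1⟩ ⟨hone, norm_one.ge⟩
        (norm_pos_iff.mp (by linarith)))
    · refine Or.inl ⟨1 - ‖b‖, by linarith, 0, fun l hl _ => ?_⟩
      have h1 := one_le_norm_exp_of_modPow (lq := lq) (ρ := ρ) hle hl
      rw [max_eq_right h1]
      have h2 := norm_sub_norm_le (Complex.exp (l * lq)) b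
      nlinarith [norm_nonneg b]

end Conditions


/-! ### Conjugating a univalent equation to a linear substitution. -/

section ChangeOfVariable

theorem exists_pw_unitTail_le {f : PowerSeries ℂ} {d : ℕ} (hf : PowerSeries.coeff d f ≠ 0)
    (h : ∃ r > 0, pw r f < ⊤) : ∃ ρ > 0, ∀ r, 0 < r → r ≤ ρ → pw r (unitTail f d) ≤ 4⁻¹ := by
  obtain ⟨r, hr, h⟩ := h
  exact exists_pw_le (coeff_zero_unitTail f d) hr (pw_unitTail_lt_top hf hr h)

/-- Substitution commutes with the polynomial truncations of G, so G along v' is the series of G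
along v after the change of variable. Its exponents are the old ones raised by natural numbers. -/
theorem substCoeff_eq_of_isComp {N : ℕ} {g : PowerSeries ℂ} (hg : PowerSeries.coeff 0 g = 0)
    {v v' : Fin N → HS} (h : ∀ i, IsComp g (v i) (v' i)) {ε : ℝ} (hε : 0 < ε)
    (hv : ∀ i, ReGe ε (v i)) (hv' : ∀ i, ReGe ε (v' i)) (G : MvPowerSeries (Fin N) ℂ) (μ : ℂ) :
    (substCoeff G v' μ ≠ 0 → ∃ k : ℕ, substCoeff G v (μ - k) ≠ 0) ∧
    ((∀ k : ℕ, k ≠ 0 → substCoeff G v (μ - k) = 0) → substCoeff G v' μ = substCoeff G v μ) := by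
  obtain ⟨D, hD⟩ := exists_nat_gt (μ.re / ε)
  rw [div_lt_iff₀ hε] at hD
  have hD' : ∀ k : ℕ, (μ - k).re < D * ε := fun k => by
    rw [Complex.sub_re, Complex.natCast_re]
    have : (0 : ℝ) ≤ k := Nat.cast_nonneg k
    linarith
  have h1 := IsComp.aeval hg h (MvPowerSeries.truncTotal D G)
  rw [substCoeff_eq G hε.le hv' hD, substCoeff_eq G hε.le hv hD]
  simp_rw [fun k => substCoeff_eq G hε.le hv (hD' k)]
  exact ⟨h1.exists_of_cf_ne_zero, h1.cf_eq_self⟩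

theorem toHahn_comp_ofPowerSeries_X {h : PowerSeries ℂ} (h0 : PowerSeries.coeff 0 h = 0)
    (h1 : PowerSeries.coeff 1 h = 1) :
    (GenSeries.comp h 1 0 (GenSeries.ofPowerSeries PowerSeries.X (by simp))).toHahn = psHom h := by
  have hX : ∀ l : ℂ, (GenSeries.ofPowerSeries PowerSeries.X (by simp)).coeff l =
      if l = 1 then 1 else 0 := by
    intro l
    change cf (psHom PowerSeries.X) l = _
    by_cases hl : cf (psHom PowerSeries.X) l = 0
    · rw [hl, if_neg]
      rintro rfl
      have := cf_psHom PowerSeries.X 1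
      rw [Nat.cast_one, hl] at this
      simp at this
    · obtain ⟨k, rfl, hk⟩ := exists_of_cf_psHom_ne_zero hl
      rw [PowerSeries.coeff_X] at hk
      have hk1 : k = 1 := by
        by_contra hne
        exact hk (if_neg hne)
      rw [cf_psHom, hk1]
      simp
  refine cf_ext fun μ => ?_
  change compCoeff h 1 0 _ μ = _
  have hval : ∀ i : ℕ, onePowCoeff (unitTail h 1) 1 i = PowerSeries.coeff (1 + i) h := by
    intro i
    have := coeff_pow_eq_onePowCoeff h0 (by rw [h1]; exact one_ne_zero) 1 i
    rw [h1, one_pow, one_mul, pow_one, Nat.cast_one] at this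
    exact this.symm
  by_cases hμ : ∃ i : ℕ, μ = 1 + i
  · obtain ⟨i, rfl⟩ := hμ
    have e : ((1 : ℂ) + i) = ((1 + i : ℕ) : ℂ) := by push_cast; rfl
    rw [compCoeff, finsum_eq_single _ i]
    · rw [add_sub_cancel_right, Nat.cast_one, div_one, hX, if_pos rfl, hval, e, cf_psHom]
      simp
    · intro j hj
      rw [hX, if_neg, zero_mul, zero_mul]
      rw [Nat.cast_one, div_one]
      intro h2
      exact hj (by exact_mod_cast (by linear_combination -h2 : (j : ℂ) = i))
  · have hz : cf (psHom h) μ = 0 := by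
      by_contra hne
      obtain ⟨k, rfl, hk⟩ := exists_of_cf_psHom_ne_zero hne
      obtain ⟨m, rfl⟩ : ∃ m, k = 1 + m := Nat.exists_eq_add_of_le
        (Nat.one_le_iff_ne_zero.mpr fun h' => hk (by rw [h', h0]))
      exact hμ ⟨m, by push_cast; rfl⟩
    rw [hz, compCoeff]
    refine finsum_eq_zero_of_forall_eq_zero fun i => ?_
    rw [hX, if_neg, zero_mul, zero_mul]
    rw [Nat.cast_one, div_one]
    exact fun h2 => hμ ⟨i, by linear_combination h2⟩

/-- Each step uses f ∘ h = h ∘ (q x); the logarithms attached to the two composites agree, as lq + 0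
= 0 + lq. -/
theorem comp_iterate_comp_of_linearization {f h : PowerSeries ℂ} {lq : ℂ}
    (hf : PowerSeries.coeff 0 f = 0) (hf1 : PowerSeries.coeff 1 f = Complex.exp lq)
    (h0 : PowerSeries.coeff 0 h = 0) (h1 : PowerSeries.coeff 1 h = 1)
    (hconj : f.subst h = h.subst (PowerSeries.C (Complex.exp lq) * PowerSeries.X : PowerSeries ℂ))
    (φ : GenSeries) (j : ℕ) :
    GenSeries.comp h 1 0 ((GenSeries.comp f 1 lq)^[j] φ) =
      (GenSeries.comp (PowerSeries.C (Complex.exp lq) * PowerSeries.X) 1 lq)^[j]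
        (GenSeries.comp h 1 0 φ) := by
  induction j with
  | zero => rfl
  | succ j ih =>
    rw [Function.iterate_succ_apply', Function.iterate_succ_apply', ← ih,
      GenSeries.comp_comp hf hf1 h0 (by simpa using h1),
      GenSeries.comp_comp h0 (by simpa using h1) (by simp) (by simp), hconj, add_comm]

/-- Convergence of a solution of an equation with a univalent `f`. -/
theorem exists_nm_lt_top_of_carries {n : ℕ} {F : MvPowerSeries (Fin (n + 2)) ℂ} {f : PowerSeries ℂ}
    {lq : ℂ} (hf : PowerSeries.coeff 0 f = 0) (hf1 : PowerSeries.coeff 1 f = Complex.exp lq)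
    (hS : ‖Complex.exp lq‖ = 1 → SiegelCondition (Complex.exp lq)) {r : ℝ} (hr : 0 < r)
    (hpw : pw r f < ⊤) {R C : ℝ} (hR : 0 < R) (hFc : ConvergentAt F R C) {φ : GenSeries}
    (hF : IsFormalSolution n F f 1 lq φ) {A : Fin (n + 1) → ℂ} {ν : ℂ}
    (hA : ∀ j, HasLeadingTerm (partialAlong n F f 1 lq φ j) (A j) ν) (hA0 : ∃ j, A j ≠ 0)
    {τ : ℕ} {ρ : Fin τ → ℂ} (hρ : ∀ i, 0 < (ρ i).re)
    (hcar : Carries (semigroup ρ) φ (partialAlong n F f 1 lq φ) ν)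
    (hcond : ConvergenceCondition lq A ρ) : ∃ r > 0, nm (wt r) φ.toHahn < ⊤ := by
  have hν : 0 ≤ ν.re := by
    obtain ⟨j, hj⟩ := hA0
    exact re_nonneg_of_hasLeadingTerm (hA j) hj
  obtain ⟨h1, hφ, hfin, hA'⟩ := hcar
  obtain ⟨hdeg, hroots⟩ := hcond.exists_divisor hρ
  set Γ := semigroup ρ with hΓdef
  obtain ⟨ε, hε, hΓ⟩ := exists_le_re_semigroup hρ
  obtain ⟨κ, -, hnorm⟩ := exists_norm_le_semigroup hρ
  obtain ⟨g, g₂, N, K, hg, hgexp, hK, hdiv⟩ :=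
    exists_damping_of_roots hε hΓ (charPoly_ne_zero hA0) hdeg hroots ν
  obtain ⟨h, k, hh0, hh1, hk0, hk1, hhk, hconj, hhpw, hkpw⟩ := exists_linearization hf hf1 hS hr hpw
  set qX : PowerSeries ℂ := PowerSeries.C (Complex.exp lq) * PowerSeries.X with hqX
  have hhtail := exists_pw_unitTail_le (d := 1) (hh1.trans_ne one_ne_zero) hhpw
  have hktail := exists_pw_unitTail_le (d := 1) (hk1.trans_ne one_ne_zero) hkpw
  have hqtail : ∃ ρ > 0, ∀ r, 0 < r → r ≤ ρ → pw r (unitTail qX 1) ≤ 4⁻¹ :=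
    ⟨1, one_pos, fun r _ _ => by rw [hqX, unitTail_C_mul_X]; simp [pw]⟩
  -- Besides the low terms, the finitely many exponents outside ν + Γ are split off; this is where
  -- the finiteness clause of `Carries` enters.
  set φ₀ := φ.restrict fun l => l.re ≤ N ∨ l - ν ∉ Γ with hφ₀
  set χ := φ.restrict fun l => ¬ (l.re ≤ N ∨ l - ν ∉ Γ) with hχ
  have hφ₀Γ : φ₀.ExponentsIn Γ := fun l hl => hφ l (GenSeries.coeff_restrict_ne_zero.mp hl).2
  have hφ₀fin : ∀ r, nm (wt r) φ₀.toHahn < ⊤ := exists_nm_lt_top_of_finite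
    (((φ.finite_le N).union hfin).subset fun l hl => by
      obtain ⟨h2, h3⟩ := GenSeries.coeff_restrict_ne_zero.mp hl
      exact h2.imp (fun h => ⟨h3, h⟩) fun h => ⟨h3, h⟩)
  have hχ1 : ∀ l, χ.coeff l ≠ 0 → l ∈ shiftOne Γ ν ∧ N < l.re := fun l hl => by
    obtain ⟨h2, h3⟩ := GenSeries.coeff_restrict_ne_zero.mp hl
    push Not at h2
    exact ⟨⟨hφ l h3, h2.2⟩, h2.1⟩
  set T := GenSeries.comp h 1 0 with hT
  have hTΓ : ∀ ψ : GenSeries, ψ.ExponentsIn Γ → (T ψ).ExponentsIn Γ := by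
    intro ψ hψ μ hμ
    obtain ⟨-, i, l, hl, rfl⟩ := exists_of_compCoeff_ne_zero hμ
    rw [Nat.cast_one, one_mul]
    exact add_natCast_mem h1 (hψ l hl) i
  have hTχ : ∀ l, (T χ).coeff l ≠ 0 → l ∈ shiftOne Γ ν ∧ N < l.re := by
    intro μ hμ
    obtain ⟨-, i, l, hl, rfl⟩ := exists_of_compCoeff_ne_zero hμ
    refine ⟨natCast_mul_add_mem_shiftOne h1 (hχ1 l hl).1 le_rfl i, ?_⟩
    have h2 := (hχ1 l hl).2
    have h3 : (0 : ℝ) ≤ i := Nat.cast_nonneg i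
    simp only [Nat.cast_one, one_mul, Complex.add_re, Complex.natCast_re]
    linarith
  -- After the change of variable the argument x of F becomes h(x), so F itself is kept and only its
  -- zeroth argument changes.
  set v : Fin (n + 2) → HS := Fin.cons (psHom h)
    fun j : Fin (n + 1) => ((GenSeries.comp qX 1 lq)^[(j : ℕ)] (T φ₀)).toHahn with hv
  set w : Fin (n + 2) → HS := restArgs n qX 1 lq (T χ) with hw
  have hcompΓ := args_supp (n := n) (f := qX) le_rfl lq h1 (hTΓ φ₀ hφ₀Γ)
  have hvΓ : ∀ i μ, cf (v i) μ ≠ 0 → μ ∈ Γ := by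
    intro i μ hμ
    induction i using Fin.cases with
    | zero =>
      obtain ⟨k, hk, rfl⟩ := mem_posNat_of_cf_psHom_ne_zero hh0 hμ
      simpa using natCast_mul_mem h1 hk
    | succ j => exact hcompΓ j.succ μ hμ
  have hwΓ : ∀ i μ, cf (w i) μ ≠ 0 → μ ∈ Γ := by
    intro i μ hμ
    induction i using Fin.cases with
    | zero => exact absurd rfl hμ
    | succ j => exact args_supp le_rfl lq h1 (hTΓ χ fun l hl => (hχ1 l hl).1.1) j.succ μ hμ
  have hcomp : ∀ i, IsComp (unitTail h 1) (args n f 1 lq φ i) ((v + w) i) := by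
    intro i
    induction i using Fin.cases with
    | zero =>
      have h2 : (v + w) 0 = psHom h := add_zero _
      have h3 : args n f 1 lq φ 0 =
          (GenSeries.ofPowerSeries PowerSeries.X (by simp)).toHahn := by
        refine cf_ext fun μ => ?_
        have := congrArg (fun H => cf H μ) (toHahn_comp_ofPowerSeries_X
          (h := PowerSeries.X) (by simp) (by simp))
        rw [comp_X] at this
        refine Eq.trans ?_ this.symm
        change cf (HahnSeries.single (ReExp.of 1) 1) μ = _
        rw [cf_single]
        by_cases hμ : ∃ k : ℕ, μ = k
        · obtain ⟨k, rfl⟩ := hμ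
          rw [cf_psHom, PowerSeries.coeff_X]
          simp
        · rw [if_neg fun h => hμ ⟨1, by simpa using h⟩]
          by_contra hne
          obtain ⟨k, hk, -⟩ := exists_of_cf_psHom_ne_zero (Ne.symm hne)
          exact hμ ⟨k, hk⟩
      rw [h2, h3, ← toHahn_comp_ofPowerSeries_X hh0 hh1]
      exact GenSeries.isComp_comp h _
    | succ j =>
      have h2 : (v + w) j.succ = (T ((GenSeries.comp f 1 lq)^[(j : ℕ)] φ)).toHahn := by
        rw [hT, comp_iterate_comp_of_linearization hf hf1 hh0 hh1 hconj]
        exact cf_ext fun μ => (coeff_iterate_comp_add le_rfl lq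
          (coeff_comp_add le_rfl 0 (φ.coeff_restrict_add _)) j μ).symm
      rw [h2]
      exact GenSeries.isComp_comp h _
  have hge : ∀ i, ReGe ε (args n f 1 lq φ i) := fun i μ hμ =>
    hΓ μ (args_supp le_rfl lq h1 hφ i μ hμ)
  have hge' : ∀ i, ReGe ε ((v + w) i) := fun i =>
    ReGe.add (fun μ hμ => hΓ μ (hvΓ i μ hμ)) fun μ hμ => hΓ μ (hwΓ i μ hμ)
  have hsub := substCoeff_eq_of_isComp (coeff_zero_unitTail h 1) hcomp hε hge hge'
  obtain ⟨r', hr', hfin'⟩ := exists_nm_lt_top_of_linear (F := F) (v := v) (w := w) (χ := T χ) hε hΓ hν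
    hR hFc hvΓ
    (fun i => by
      induction i using Fin.cases with
      | zero =>
        obtain ⟨r, hr, h2⟩ := hhpw
        exact ⟨r, hr, by rwa [hv, Fin.cons_zero, nm_psHom hr.le]⟩
      | succ j =>
        obtain ⟨r, hr, h2⟩ := exists_nm_comp_lt_top le_rfl 0 (fun l hl => hnorm l (hφ₀Γ l hl))
          one_pos (hφ₀fin 1) hhtail
        exact exists_nm_args_lt_top (f := qX) le_rfl lq h1 hnorm (hTΓ φ₀ hφ₀Γ) ⟨r, hr, h2⟩ hqtail
          j.succ)
    (lq := lq) rfl (fun j l => coeff_iterate_comp_C_mul_X _ lq (T χ) j l) hTχ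
    (fun μ => by
      by_contra hne
      obtain ⟨k, hk⟩ := (hsub F μ).1 hne
      exact hk (hF _))
    (A := A)
    -- No term at ν - k with k ≥ 1 precedes the leading one, so A_j is unchanged.
    (fun j => by
      rw [(hsub _ ν).2 fun k hk => ?_]
      · exact (hA j).1
      · by_contra hne
        have hk0 : (0 : ℝ) < k := by exact_mod_cast Nat.pos_of_ne_zero hk
        have h2 := (hA j).2 (ν - k) (fun h => hk (by simpa using h)) hne
        rw [Complex.sub_re, Complex.natCast_re] at h2
        linarith)
    (fun j μ hμ hne => by
      obtain ⟨k, hk⟩ := (hsub _ μ).1 hne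
      by_cases h2 : μ - k = ν
      · have h3 : μ - ν = k * 1 := by linear_combination h2
        have hk0 : k ≠ 0 := by
          rintro rfl
          exact hμ (by simpa using h2)
        rw [h3]
        exact natCast_mul_mem h1 hk0
      · have h3 : μ - ν = (μ - k - ν) + k := by ring
        rw [h3]
        exact add_natCast_mem h1 (hA' j _ h2 hk) k)
    hg hgexp hK hdiv
  -- The convergent inverse k carries convergence of T χ back to χ.
  have hback : χ = GenSeries.comp k 1 0 (T χ) := by
    rw [hT, GenSeries.comp_comp hh0 (by simpa using hh1) hk0 (by simpa using hk1), hhk, add_zero,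
      comp_X]
  obtain ⟨r'', hr'', hfin''⟩ := exists_nm_comp_lt_top le_rfl 0
    (fun l hl => hnorm l (hTχ l hl).1.1) hr' hfin' hktail
  rw [← hback] at hfin''
  refine ⟨r'', hr'', ?_⟩
  have h2 : φ.toHahn = φ₀.toHahn + χ.toHahn := cf_ext (φ.coeff_restrict_add _)
  rw [h2]
  exact (nm_add_le _ _ _).trans_lt (ENNReal.add_lt_top.mpr ⟨hφ₀fin r'', hfin''⟩)

end ChangeOfVariable

end GenPower

end

/-! ### The two cases assembled. -/

theorem mainTheorem9 (n : ℕ)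
    (F : (Fin (n + 2) → ℂ) → ℂ) (Fs : MvPowerSeries (Fin (n + 2)) ℂ)
    (hF : GenPower.HasTaylorSeries F Fs)
    (f : ℂ → ℂ) (fs : PowerSeries ℂ) (hf : GenPower.HasTaylorSeries₁ f fs)
    (φ : GenPower.GenSeries) :
    -- univalent case: `f x = q x + o(x)`, `q = exp lq`
    (∀ lq : ℂ, PowerSeries.coeff 0 fs = 0 → PowerSeries.coeff 1 fs = Complex.exp lq →
      (‖Complex.exp lq‖ = 1 → GenPower.SiegelCondition (Complex.exp lq)) →
      GenPower.IsFormalSolution n Fs fs 1 lq φ →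
      ∀ (A : Fin (n + 1) → ℂ) (ν : ℂ),
      (∀ j, GenPower.HasLeadingTerm (GenPower.partialAlong n Fs fs 1 lq φ j) (A j) ν) →
      (∃ j, A j ≠ 0) →
      (∃ (τ : ℕ) (ρ : Fin τ → ℂ), GenPower.AdmissibleGenerators ρ ∧
        GenPower.Carries (GenPower.semigroup ρ) φ (GenPower.partialAlong n Fs fs 1 lq φ) ν) ∧
      (∀ (τ : ℕ) (ρ : Fin τ → ℂ), GenPower.AdmissibleGenerators ρ →
        GenPower.Carries (GenPower.semigroup ρ) φ (GenPower.partialAlong n Fs fs 1 lq φ) ν →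
        GenPower.ConvergenceCondition lq A ρ → GenPower.ConvergesInSectors φ)) ∧
    -- `d`-valent case: `f x = a x ^ d + o(x ^ d)`, `d ≥ 2`, `a = exp la`
    (∀ (d : ℕ) (la : ℂ), 2 ≤ d → (∀ k < d, PowerSeries.coeff k fs = 0) →
      PowerSeries.coeff d fs = Complex.exp la →
      GenPower.IsFormalSolution n Fs fs d la φ →
      ∀ A₀ ν : ℂ, GenPower.HasLeadingTerm (GenPower.partialAlong n Fs fs d la φ 0) A₀ ν →
      A₀ ≠ 0 →
      (∃ (τ : ℕ) (ρ : Fin τ → ℂ), GenPower.AdmissibleGenerators ρ ∧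
        φ.ExponentsIn (GenPower.semigroup ρ)) ∧
      GenPower.ConvergesInSectors φ) := by
  obtain ⟨R, hR, C, hFc⟩ := hF.convergentAt
  obtain ⟨r, hr, hpw⟩ := hf.exists_pw_lt_top
  refine ⟨fun lq h0 h1 hS hsol A ν hA hA0 => ⟨GenPower.exists_carries hS hsol hA hA0,
    fun τ ρ hρ hcar hcond => ?_⟩, fun d la hd _ hfd hsol A₀ ν hA hA0 => ?_⟩
  · obtain ⟨r', hr', hfin⟩ := GenPower.exists_nm_lt_top_of_carries h0 h1 hS hr hpw hR hFc hsol hA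
      hA0 hρ.2 hcar hcond
    obtain ⟨κ, -, hκ⟩ := GenPower.exists_norm_le_semigroup hρ.2
    exact GenPower.convergesInSectors_of_nm (fun l hl => hκ l (hcar.2.1 l hl)) hr' hfin
  · obtain ⟨τ, ρ, hρ, hφ, r', hr', hfin⟩ := GenPower.exists_nm_lt_top_of_two_le hd
      (GenPower.exists_pw_unitTail_le (hfd.trans_ne (Complex.exp_ne_zero la)) ⟨r, hr, hpw⟩) hR hFc
      hsol hA hA0
    obtain ⟨κ, -, hκ⟩ := GenPower.exists_norm_le_semigroup hρ.2
    exact ⟨⟨τ, ρ, hρ, hφ⟩, GenPower.convergesInSectors_of_nm (fun l hl => hκ l (hφ l hl)) hr' hfin⟩
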